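/- **Standing assumptions.** $(\mathcal D,\wedge,S^0)$ is a pointed closed symmetric monoidal model category (pushout-product axiom) whose smash product preserves weak equivalences in each variable, so that $Ho(\mathcal D)$ is symmetric monoidal; write $[A,B]$ for its morphism sets. $T\in\mathcal D$ is cofibrant, $T^n:=T^{\wedge n}$, and $T$ is a cogroup object in $Ho(\mathcal D)$. $T$ has a *sign*: an automorphism $(-1)_T$ of $T$ in $Ho(\mathcal D)$ with $(-1)_T^2=1$ such that every permutation $\tau\in\Sigma_n$ of the factors of $T^n$ equals $|\tau|_T\wedge T^{n-1}$ in $Ho(\mathcal D)$, where $|\tau|_T=(-1)_T$ for odd $\tau$ and $|\tau|_T=1$ for even $\tau$, and $(-1)_T\wedge T=T\wedge(-1)_T$. $N$ is a commutative monoid (written additively, with zero), $\mathbb S^r$ $(r\in N)$ are cofibrant objects with isomorphisms $\mathbb S^0\cong S^0$ and $s_{r,r'}:\mathbb S^{r+r'}\cong\mathbb S^r\wedge\mathbb S^{r'}$ which are associative and unital. $\mathcal B'$ is a class of cofibrant objects and $\mathcal B=\{\mathbb S^r\wedge U\mid r\in N,\ U\in\mathcal B'\}$. **Ring spectra.** A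 symmetric $T$-ring spectrum $R$ consists of objects $R_n$ with $\Sigma_n$-action, associative and unital $\Sigma_p\times\Sigma_q$-equivariant maps $\mu_{p,q}:R_p\wedge R_q\to R_{p+q}$ and unit maps $S^0\to R_0$, $\iota_1:T\to R_1$ with $\iota_1$ central. Here $f:A\to R_m$ is *central* if for all $n$ the map $\mu_{n,m}(1\wedge f):R_n\wedge A\to R_{n+m}$, followed by the block permutation $\chi_{n,m}$, equals $\mu_{m,n}(f\wedge 1)$ composed with the twist $R_n\wedge A\cong A\wedge R_n$. Put $\sigma_n=\mu_{n,1}(1\wedge\iota_1)$. For $V\in\mathcal B$ and $q\in\mathbb Z$ let $\pi_q^V(R)=\operatorname{colim}_m[V\wedge T^{q+m},R_m]$ along $f\mapsto\sigma_m(f\wedge T)$, with the group structure induced by the cogroup structure of $T$. The monoid of injective self-maps of $\mathbb N$ acts on it: for $f\in[V\wedge T^{q+m},R_m]$ with $q+m\ge2$ and an injection $\varphi$, choose $n\ge m$ and $\gamma\in\Sigma_n$ with $\gamma=\varphi$ on $\{1,\dots,m\}$; then $\varphi[f]$ is the class of the $(n-m)$-fold stabilization of $f$, composed with $\gamma$ on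 $R_n$ and with $V\wedge|\gamma|_T\wedge T^{q+n-1}$ on the source. $R$ is *semistable* if this action is trivial for all $V\in\mathcal B$, $q\in\mathbb Z$. **Graded rings.** Let $U\in\mathcal B'$ carry the structure of a commutative comonoid ($\mathrm{diag}:U\to U\wedge U$, $\omega:U\to S^0$) in $\mathcal D$, and set $\pi^U_{r,q}(R)=\pi_q^{\mathbb S^r\wedge U}(R)$, $\pi^U_{*,*}(R)=\bigoplus_{(r,q)\in N\times\mathbb Z}\pi^U_{r,q}(R)$. The product of $f\in[\mathbb S^r\wedge U\wedge T^{q+n},R_n]$ and $g\in[\mathbb S^{r'}\wedge U\wedge T^{q'+n'},R_{n'}]$ $(q+n,\,q'+n'\ge1)$ is represented by $\mathbb S^{r+r'}\wedge U\wedge T^{q+q'+n+n'}\to R_{n+n'}$, the composite of $s_{r,r'}\wedge\mathrm{diag}\wedge(-1)_T^{q'n}\wedge1$, the evident permutation of factors, $f\wedge g$ and $\mu_{n,n'}$. Let $c_k:\mathbb S^0\wedge U\wedge T^k\to T^k$ be given by $\mathbb S^0\cong S^0$ and $\omega$; the unit is $[\iota_1c_1]$. **Localization.** For a central map $x:T^l\to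 R_m$ let $R[1/x]_p=Hom(T^{lp},R_{(1+m)p})$, where $\gamma\in\Sigma_p$ acts by conjugation through the block permutations of $T^{lp}$ and $R_{(1+m)p}$; the multiplication is adjoint to $\mu_{(1+m)p,(1+m)q}\circ(ev\wedge ev)$ composed with the evident twist. Let $j_p:R_p\to R[1/x]_p$ be adjoint to $\xi_{m,p}\circ\mu_{p,mp}\circ(1\wedge x^p):R_p\wedge T^{lp}\to R_{(1+m)p}$, where $x^p:T^{lp}\to R_{mp}$ is the $p$-th power of $x$ and $\xi_{m,p}$ is the permutation with $\xi_{m,p}(k)=1+(1+m)(k-1)$ for $1\le k\le p$ and $\xi_{m,p}(p+m(i-1)+j)=1+j+(1+m)(i-1)$ for $1\le i\le p$, $1\le j\le m$. The unit maps of $R[1/x]$ are those of $R$ composed with $j$. **Theorem 4.11.** Let $R$ be a levelwise fibrant semistable symmetric $T$-ring spectrum and $x:T^l\to R_m$ a central map. Then $R[1/x]$ is a symmetric $T$-ring spectrum, $j:R\to R[1/x]$ is a map of symmetric ring spectra, and $R[1/x]$ is semistable. Moreover, for every $U\in\mathcal B'$ (with commutative comonoid structure as above), the group structures and products above make $\pi^U_{*,*}(R)$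 and $\pi^U_{*,*}(R[1/x])$ into $N\times\mathbb Z$-graded rings, and $j_*:\pi^U_{*,*}(R)\to\pi^U_{*,*}(R[1/x])$ is a ring homomorphism which is a localization at $[xc_l]\in\pi^U_{0,l-m}(R)$: it sends $[xc_l]$ to a unit and is universal among ring homomorphisms from $\pi^U_{*,*}(R)$ to (not necessarily commutative) rings with this property. -/

import Mathlib

open CategoryTheory CategoryTheory.Limits CategoryTheory.MonoidalCategory HomotopicalAlgebra

universe w

namespace SymSpec

noncomputable section

/-! ### Smash powers and the permutation of factors -/

section Powers

variable {C : Type*} [Category C] [MonoidalCategory C] (T : C)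

/-- `smashPow T V k` is `V ∧ T ∧ ⋯ ∧ T` with `k` factors `T`, bracketed from the left. -/
def smashPow (V : C) : ℕ → C
  | 0 => V
  | k + 1 => smashPow V k ⊗ T

/-- `T^k`, with `T^0` the monoidal unit. -/
abbrev tpow (k : ℕ) : C := smashPow T (𝟙_ C) k

variable {T}

/-- `g ∧ T^k : V ∧ T^k ⟶ W ∧ T^k`. -/
def smashMap {V W : C} (g : V ⟶ W) : ∀ k, smashPow T V k ⟶ smashPow T W k
  | 0 => g
  | k + 1 => smashMap g k ▷ T

/-- `V ∧ g ∧ T^k : V ∧ T^(k+1) ⟶ V ∧ W ∧ T^k`, the map `g : T ⟶ W` acting on the first factor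
`T`. -/
def headMap (V : C) {W : C} (g : T ⟶ W) : ∀ k, smashPow T V (k + 1) ⟶ smashPow T (V ⊗ W) k
  | 0 => V ◁ g
  | k + 1 => headMap V g k ▷ T

/-- `V ∧ a ∧ T^(k-1) : V ∧ T^k ⟶ V ∧ T^k`, the endomorphism `a` acting on the first factor `T`
(the identity if there is no such factor). -/
def headEnd (V : C) (a : T ⟶ T) : ∀ k, smashPow T V k ⟶ smashPow T V k
  | 0 => 𝟙 _
  | 1 => V ◁ a
  | k + 2 => headEnd V a (k + 1) ▷ T

/-- The canonical isomorphism `V ∧ T^k ≅ V ∧ (T^k)`. -/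
def smashIso (V : C) : ∀ k, smashPow T V k ≅ V ⊗ tpow T k
  | 0 => (ρ_ V).symm
  | k + 1 => whiskerRightIso (smashIso V k) T ≪≫ α_ _ _ _

/-- The canonical isomorphism `T^(a+b) ≅ T^a ∧ T^b`. -/
def tpowAdd (a : ℕ) : ∀ b, tpow T (a + b) ≅ tpow T a ⊗ tpow T b
  | 0 => (ρ_ _).symm
  | b + 1 => whiskerRightIso (tpowAdd a b) T ≪≫ α_ _ _ _

variable [SymmetricCategory C]

/-- The map of `V ∧ T^(n+1)` moving the last factor `T` to position `k` (positions counted from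
`0`) and keeping the order of the other factors. -/
def moveLast (V : C) : ∀ n : ℕ, ℕ → (smashPow T V (n + 1) ⟶ smashPow T V (n + 1))
  | 0, _ => 𝟙 _
  | n + 1, k =>
    if k = n + 1 then 𝟙 _
    else ((α_ (smashPow T V n) T T).hom ≫ smashPow T V n ◁ (β_ T T).hom ≫
      (α_ (smashPow T V n) T T).inv : smashPow T V (n + 2) ⟶ smashPow T V (n + 2)) ≫
        moveLast V n k ▷ T

/-- The permutation of `Fin n` obtained from a permutation `τ` of `Fin (n + 1)` by deleting the
last element of the source and its image from the target. -/
def dropLast {n : ℕ} (τ : Equiv.Perm (Fin (n + 1))) : Equiv.Perm (Fin n) :=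
  Equiv.removeNone (((finSuccEquiv' (Fin.last n)).symm.trans τ).trans
    (finSuccEquiv' (τ (Fin.last n))))

/-- The left action of the symmetric group on `V ∧ T^n` through permutation of the factors `T`:
the factor in position `i` is moved to position `τ i`. -/
def permSmash (V : C) : ∀ n, Equiv.Perm (Fin n) → (smashPow T V n ⟶ smashPow T V n)
  | 0, _ => 𝟙 _
  | n + 1, τ => permSmash V n (dropLast τ) ▷ T ≫ moveLast V n (τ (Fin.last n))

/-- For `d : W ⟶ V ∧ V'` the map `W ∧ T^(k+k') ⟶ (V ∧ T^k) ∧ (V' ∧ T^k')` given by `d` and the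
evident permutation of smash factors. -/
def smashSplit {W V V' : C} (d : W ⟶ V ⊗ V') (k k' : ℕ) :
    smashPow T W (k + k') ⟶ smashPow T V k ⊗ smashPow T V' k' :=
  (smashIso W (k + k')).hom ≫ (d ⊗ₘ (tpowAdd k k').hom) ≫
    tensorμ V V' (tpow T k) (tpow T k') ≫ ((smashIso V k).inv ⊗ₘ (smashIso V' k').inv)

end Powers

/-! ### Permutations -/

/-- The block sum `α + β` in the symmetric group on `p + q` letters. -/
def blockSum {p q : ℕ} (α : Equiv.Perm (Fin p)) (β : Equiv.Perm (Fin q)) :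
    Equiv.Perm (Fin (p + q)) :=
  finSumFinEquiv.permCongr (Equiv.Perm.sumCongr α β)

/-- `blockPerm s γ` permutes the `p` consecutive blocks of length `s` in `Fin (s * p)` according to
`γ`: it sends `i + s * j` to `i + s * γ j` for `i < s`, `j < p`. -/
def blockPerm (s : ℕ) {p : ℕ} (γ : Equiv.Perm (Fin p)) : Equiv.Perm (Fin (s * p)) :=
  ((finProdFinEquiv (m := p) (n := s)).trans (finCongr (Nat.mul_comm p s))).permCongr
    (Equiv.prodCongr γ (Equiv.refl _))

/-- The shuffle sending `k < p` to `(1 + m) * k`, and `p + (m * i + j)` to `(1 + m) * i + (1 + j)`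
for `i < p`, `j < m`. -/
def shuffle (m p : ℕ) : Fin (p + m * p) ≃ Fin ((1 + m) * p) :=
  calc
    Fin (p + m * p) ≃ Fin p ⊕ Fin (m * p) := finSumFinEquiv.symm
    _ ≃ (Fin p × Fin 1) ⊕ (Fin p × Fin m) :=
      Equiv.sumCongr (Equiv.prodUnique _ _).symm
        ((finCongr (Nat.mul_comm m p)).trans finProdFinEquiv.symm)
    _ ≃ Fin p × (Fin 1 ⊕ Fin m) := (Equiv.prodSumDistrib _ _ _).symm
    _ ≃ Fin p × Fin (1 + m) := Equiv.prodCongr (Equiv.refl _) finSumFinEquiv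
    _ ≃ Fin (p * (1 + m)) := finProdFinEquiv
    _ ≃ Fin ((1 + m) * p) := finCongr (Nat.mul_comm _ _)

/-! ### Symmetric ring spectra -/

section RingSpectra

variable {C : Type*} [Category C] [MonoidalCategory C]

/-- The data of a symmetric `T`-ring spectrum: levels, operation of the symmetric groups,
multiplication and unit maps. The axioms are in `SymRingData.IsSymRing`. -/
structure SymRingData (T : C) where
  X : ℕ → C
  perm : ∀ n, Equiv.Perm (Fin n) → (X n ⟶ X n)
  mul : ∀ p q, X p ⊗ X q ⟶ X (p + q)
  one₀ : 𝟙_ C ⟶ X 0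
  one₁ : T ⟶ X 1

namespace SymRingData

variable {T : C} (R : SymRingData T)

/-- The map `X a ⟶ X b` given by a bijection `Fin a ≃ Fin b`; here `a = b` necessarily, and the
map is the operation of the corresponding permutation. -/
def reindex {a b : ℕ} (e : Fin a ≃ Fin b) : R.X a ⟶ R.X b :=
  have h : a = b := by simpa using Fintype.card_congr e
  R.perm a (e.trans (finCongr h.symm)) ≫ eqToHom (congrArg R.X h)

/-- The structure map `σ_n : X n ∧ T ⟶ X (n+1)` of the underlying symmetric spectrum. -/
def σ (n : ℕ) : R.X n ⊗ T ⟶ R.X (n + 1) := R.X n ◁ R.one₁ ≫ R.mul n 1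

/-- The powers `x^p : T^(lp) ⟶ X (mp)` of a map `x : T^l ⟶ X m`. -/
def pow {l m : ℕ} (x : tpow T l ⟶ R.X m) : ∀ p, tpow T (l * p) ⟶ R.X (m * p)
  | 0 => R.one₀
  | p + 1 => (tpowAdd (l * p) l).hom ≫ (pow x p ⊗ₘ x) ≫ R.mul (m * p) m

/-- The ring spectrum data obtained by applying a monoidal functor levelwise. -/
def map {H : Type*} [Category H] [MonoidalCategory H] (F : C ⥤ H) [F.Monoidal] :
    SymRingData (F.obj T) where
  X n := F.obj (R.X n)
  perm n τ := F.map (R.perm n τ)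
  mul p q := Functor.LaxMonoidal.μ F _ _ ≫ F.map (R.mul p q)
  one₀ := Functor.LaxMonoidal.ε F ≫ F.map R.one₀
  one₁ := F.map R.one₁

/-- `f : A ⟶ X m` is central: for all `n` the product `X n ∧ A ⟶ X (n+m)`, followed by the block
permutation `χ_{n,m}`, agrees with the product in the other order. -/
def IsCentral [BraidedCategory C] {A : C} {m : ℕ} (f : A ⟶ R.X m) : Prop :=
  ∀ n, R.X n ◁ f ≫ R.mul n m ≫ R.reindex (finAddFlip : Fin (n + m) ≃ Fin (m + n)) =
    (β_ (R.X n) A).hom ≫ f ▷ R.X n ≫ R.mul m n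

/-- The axioms of a symmetric ring spectrum. -/
structure IsSymRing [BraidedCategory C] : Prop where
  perm_one : ∀ n, R.perm n 1 = 𝟙 _
  perm_mul : ∀ n (σ τ : Equiv.Perm (Fin n)), R.perm n (σ * τ) = R.perm n τ ≫ R.perm n σ
  mul_perm : ∀ p q (α : Equiv.Perm (Fin p)) (β : Equiv.Perm (Fin q)),
    (R.perm p α ⊗ₘ R.perm q β) ≫ R.mul p q = R.mul p q ≫ R.perm (p + q) (blockSum α β)
  assoc : ∀ p q r, (R.mul p q ▷ R.X r ≫ R.mul (p + q) r) ≫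
      R.reindex (finCongr (Nat.add_assoc p q r)) =
    (α_ _ _ _).hom ≫ R.X p ◁ R.mul q r ≫ R.mul p (q + r)
  mul_one : ∀ n, R.X n ◁ R.one₀ ≫ R.mul n 0 = (ρ_ (R.X n)).hom
  one_mul : ∀ n, R.one₀ ▷ R.X n ≫ R.mul 0 n ≫ R.reindex (finCongr (Nat.zero_add n)) =
    (λ_ (R.X n)).hom
  one₁_central : R.IsCentral R.one₁

/-- A levelwise family of maps is a map of symmetric ring spectra. -/
structure IsRingMap (R S : SymRingData T) (f : ∀ n, R.X n ⟶ S.X n) : Prop where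
  perm : ∀ n (τ : Equiv.Perm (Fin n)), R.perm n τ ≫ f n = f n ≫ S.perm n τ
  mul : ∀ p q, R.mul p q ≫ f (p + q) = (f p ⊗ₘ f q) ≫ S.mul p q
  one₀ : R.one₀ ≫ f 0 = S.one₀
  one₁ : R.one₁ ≫ f 1 = S.one₁

end SymRingData

/-- A symmetric `T`-ring spectrum. -/
structure SymRingSpectrum [BraidedCategory C] (T : C) extends SymRingData T where
  isSymRing : toSymRingData.IsSymRing

end RingSpectra

/-! ### The localization `R[1/x]` -/

section Localization

variable {C : Type*} [Category C] [MonoidalCategory C] [SymmetricCategory C] [MonoidalClosed C]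

/-- The evaluation `Hom(A, Y) ∧ A ⟶ Y`. -/
def homEv (A Y : C) : (ihom A).obj Y ⊗ A ⟶ Y :=
  (β_ _ _).hom ≫ (ihom.ev A).app Y

/-- The adjoint `Z ⟶ Hom(A, Y)` of a map `Z ∧ A ⟶ Y`. -/
def homAdj {Z A Y : C} (f : Z ⊗ A ⟶ Y) : Z ⟶ (ihom A).obj Y :=
  MonoidalClosed.curry ((β_ _ _).hom ≫ f)

variable {T : C} (R : SymRingData T) {l m : ℕ} (x : tpow T l ⟶ R.X m)

/-- The map `j_p : R_p ⟶ Hom(T^(lp), R_((1+m)p))`, adjoint to the multiplication by `x^p` followed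
by a shuffle. -/
def locMap (p : ℕ) : R.X p ⟶ (ihom (tpow T (l * p))).obj (R.X ((1 + m) * p)) :=
  homAdj (R.X p ◁ R.pow x p ≫ R.mul p (m * p) ≫ R.reindex (shuffle m p))

/-- The ring spectrum `R[1/x]`, with `R[1/x]_p = Hom(T^(lp), R_((1+m)p))`. -/
def loc : SymRingData T where
  X p := (ihom (tpow T (l * p))).obj (R.X ((1 + m) * p))
  perm p γ := homAdj (_ ◁ permSmash (𝟙_ C) (l * p) (blockPerm l γ⁻¹) ≫ homEv _ _ ≫
    R.perm _ (blockPerm (1 + m) γ))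
  mul p q := homAdj
    (_ ◁ (eqToHom (congrArg (tpow T) (Nat.mul_add l p q)) ≫ (tpowAdd (l * p) (l * q)).hom) ≫
      tensorμ _ _ _ _ ≫ (homEv _ _ ⊗ₘ homEv _ _) ≫ R.mul ((1 + m) * p) ((1 + m) * q) ≫
        R.reindex (finCongr (Nat.mul_add (1 + m) p q).symm))
  one₀ := R.one₀ ≫ locMap R x 0
  one₁ := R.one₁ ≫ locMap R x 1

end Localization

/-! ### Signs and cogroups

In this part `H` is a symmetric monoidal category; it is going to be the homotopy category. -/

section Sign

variable {H : Type*} [Category H]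

/-- A cogroup structure on `T`: a group structure on the sets `Hom(T, X)`, natural in `X`. -/
structure CogroupStructure (T : H) where
  group : ∀ X, Group (T ⟶ X)
  mul_comp : ∀ {X Y : H} (f g : T ⟶ X) (h : X ⟶ Y),
    (group X).mul f g ≫ h = (group Y).mul (f ≫ h) (g ≫ h)

variable [MonoidalCategory H]

/-- `h` is the sum of `f, g : V ∧ T ∧ T^k ⟶ X` with respect to the comultiplication
`V ∧ T ∧ T^k ⟶ V ∧ (T ∨ T) ∧ T^k` induced by the cogroup structure of `T`. Here `c.pt` is the
coproduct `T ∨ T`, the product of the two inclusions in the group `Hom(T, T ∨ T)` is the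
comultiplication of `T`, and `F` is the map on `V ∧ (T ∨ T) ∧ T^k` with components `f` and `g`. -/
def CogroupStructure.IsSum {T : H} (cg : CogroupStructure T) {V X : H} {k : ℕ}
    (f g h : smashPow T V (k + 1) ⟶ X) : Prop :=
  ∃ c : BinaryCofan T T, Nonempty (IsColimit c) ∧ ∃ F : smashPow T (V ⊗ c.pt) k ⟶ X,
    headMap V c.inl k ≫ F = f ∧ headMap V c.inr k ≫ F = g ∧
      headMap V ((cg.group c.pt).mul c.inl c.inr) k ≫ F = h

/-- `|τ|_T`: the automorphism `neg` of `T` for an odd permutation, the identity for an even one. -/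
def signAut {T : H} (neg : Aut T) {n : ℕ} (τ : Equiv.Perm (Fin n)) : Aut T :=
  if Equiv.Perm.sign τ = 1 then 1 else neg

/-- A sign of `T`: an automorphism `(-1)_T` with square the identity such that the permutation `τ`
of the factors of `T^n` is `|τ|_T ∧ T^(n-1)`, and such that `(-1)_T ∧ T = T ∧ (-1)_T`. -/
structure SignStructure [SymmetricCategory H] (T : H) where
  neg : Aut T
  neg_mul_neg : neg * neg = 1
  perm_eq : ∀ (n : ℕ) (τ : Equiv.Perm (Fin n)),
    permSmash (T := T) (𝟙_ H) n τ = headEnd (𝟙_ H) (signAut neg τ).hom n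
  whisker : neg.hom ▷ T = T ◁ neg.hom

end Sign

/-! ### Stable homotopy groups -/

section Homotopy

variable {H : Type*} [Category H] [MonoidalCategory H] {T : H}

/-- A representative `V ∧ T^k ⟶ R_m`, `k = q + m`, of an element of `π_q^V(R)`. -/
structure HRep (R : SymRingData T) (V : H) (q : ℤ) where
  k : ℕ
  m : ℕ
  deg : (k : ℤ) = q + m
  map : smashPow T V k ⟶ R.X m

namespace HRep

variable {R : SymRingData T} {V : H} {q : ℤ}

/-- The stabilization `σ ∘ (f ∧ T) : V ∧ T^(k+1) ⟶ R_(m+1)` of `f : V ∧ T^k ⟶ R_m`. -/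
def stab (a : HRep R V q) : HRep R V q where
  k := a.k + 1
  m := a.m + 1
  deg := by have := a.deg; push_cast; omega
  map := a.map ▷ T ≫ R.σ a.m

/-- The composite of `f : V ∧ T^k ⟶ R_m` with `γ : R_m ⟶ R_m` and with the sign of `γ` on the first
factor `T` of the source. -/
def permute (neg : Aut T) (a : HRep R V q) (γ : Equiv.Perm (Fin a.m)) : HRep R V q :=
  { a with map := headEnd V (signAut neg γ).hom a.k ≫ a.map ≫ R.perm a.m γ }

/-- `b` represents the image of the class of `a` under the injection `f` of the natural numbers:
the restriction of `f` to the first `m` numbers (`a` lives in level `m`) is extended to a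
permutation `γ` of the first `m + i` numbers, which operates on the `i`-fold stabilization
of `a`. -/
def RepresentsAction (neg : Aut T) (f : ℕ → ℕ) (a b : HRep R V q) : Prop :=
  ∃ (i : ℕ) (γ : Equiv.Perm (Fin (stab^[i] a).m)),
    (∀ j : Fin (stab^[i] a).m, (j : ℕ) < a.m → (γ j : ℕ) = f j) ∧ b = (stab^[i] a).permute neg γ

/-- The product of representatives, for a map `d : W ⟶ V ∧ V'`: the composite of
`W ∧ (-1)_T^(q'n) ∧ T^(k+k'-1)`, the map `W ∧ T^(k+k') ⟶ (V ∧ T^k) ∧ (V' ∧ T^k')` given by `d` and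
a permutation of factors, `f ∧ g`, and the multiplication. -/
def mul [SymmetricCategory H] (neg : Aut T) {V' W : H} {q' : ℤ} (d : W ⟶ V ⊗ V')
    (a : HRep R V q) (b : HRep R V' q') : HRep R W (q + q') where
  k := a.k + b.k
  m := a.m + b.m
  deg := by have := a.deg; have := b.deg; push_cast; omega
  map := headEnd W (neg ^ (q' * a.m)).hom (a.k + b.k) ≫ smashSplit d a.k b.k ≫
    (a.map ⊗ₘ b.map) ≫ R.mul a.m b.m

/-- For `e : V ⟶ S^0` and `x : T^k ⟶ R_m`, the representative `V ∧ T^k ⟶ T^k ⟶ R_m`. -/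
def ofMap (e : V ⟶ 𝟙_ H) {k m : ℕ} (x : tpow T k ⟶ R.X m) : HRep R V ((k : ℤ) - m) where
  k := k
  m := m
  deg := by omega
  map := smashMap e k ≫ x

/-- The representative `V ∧ T ⟶ T ⟶ R_1` of the unit. -/
def one (e : V ⟶ 𝟙_ H) : HRep R V 0 where
  k := 1
  m := 1
  deg := by norm_num
  map := smashMap e 1 ≫ (λ_ T).hom ≫ R.one₁

/-- The image of a representative under a levelwise family of maps. -/
def push {S : SymRingData T} (j : ∀ n, R.X n ⟶ S.X n) (a : HRep R V q) : HRep S V q where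
  k := a.k
  m := a.m
  deg := a.deg
  map := a.map ≫ j a.m

end HRep

/-- `π_q^V(R)`, the sequential colimit of the sets `[V ∧ T^(q+m), R_m]` along stabilization. (The
term with `q + m = 0`, if there is one, does not change the colimit.) -/
def Pi (R : SymRingData T) (V : H) (q : ℤ) :=
  Quot fun a b : HRep R V q => b = a.stab

/-- The class in `π_q^V(R)` of a representative. -/
def Pi.mk {R : SymRingData T} {V : H} {q : ℤ} (a : HRep R V q) : Pi R V q := Quot.mk _ a

/-- The injection monoid acts trivially on `π_q^V(R)`. -/
def TrivialAction (neg : Aut T) (R : SymRingData T) (V : H) (q : ℤ) : Prop :=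
  ∀ a : HRep R V q, 2 ≤ a.k → ∀ f : ℕ → ℕ, Function.Injective f →
    ∀ b, a.RepresentsAction neg f b → Pi.mk b = Pi.mk a

/-- The family of the groups `π_{r,q}(R) = π_q^{V r}(R)` for `(r, q)` in `N × ℤ`. -/
def PiFamily (R : SymRingData T) {N : Type*} (V : N → H) (i : N × ℤ) := Pi R (V i.1) i.2

/-- The class of a representative in the graded family. -/
def PiFamily.mk {R : SymRingData T} {N : Type*} {V : N → H} {i : N × ℤ}
    (a : HRep R (V i.1) i.2) : PiFamily R V i := Quot.mk _ a

/-- The `N × ℤ`-graded ring `π_{*,*}(R)` with `π_{r,q}(R) = π_q^{V r}(R)`, where the maps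
`d r r' : V (r + r') ⟶ V r ∧ V r'` and `e : V 0 ⟶ S^0` are used to form products and the unit.
All of the structure is determined: sums are induced by the cogroup structure of `T`, products
and the unit by the formulas for representatives. -/
structure HomotopyRing [SymmetricCategory H] (cg : CogroupStructure T) (neg : Aut T)
    (R : SymRingData T) {N : Type*} [AddCommMonoid N] (V : N → H)
    (d : ∀ r r', V (r + r') ⟶ V r ⊗ V r') (e : V 0 ⟶ 𝟙_ H) where
  addCommGroup : ∀ i : N × ℤ, AddCommGroup (PiFamily R V i)
  add_iff : ∀ (i : N × ℤ) (a b c : PiFamily R V i), a + b = c ↔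
    ∃ (k m : ℕ) (hk : ((k + 2 : ℕ) : ℤ) = i.2 + m) (f g h : smashPow T (V i.1) (k + 2) ⟶ R.X m),
      cg.IsSum f g h ∧ PiFamily.mk ⟨k + 2, m, hk, f⟩ = a ∧ PiFamily.mk ⟨k + 2, m, hk, g⟩ = b ∧
        PiFamily.mk ⟨k + 2, m, hk, h⟩ = c
  gring : DirectSum.GRing (PiFamily R V)
  mul_mk : ∀ (i j : N × ℤ) (a : HRep R (V i.1) i.2) (b : HRep R (V j.1) j.2),
    1 ≤ a.k → 1 ≤ b.k →
      gring.mul (PiFamily.mk a : PiFamily R V i) (PiFamily.mk b : PiFamily R V j) =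
        (PiFamily.mk (a.mul neg (d i.1 j.1) b) : PiFamily R V (i + j))
  one_mk : gring.one = (PiFamily.mk (HRep.one e) : PiFamily R V 0)

namespace HomotopyRing

variable [SymmetricCategory H] {cg : CogroupStructure T} {neg : Aut T} {R : SymRingData T}
  {N : Type*} [AddCommMonoid N] {V : N → H} {d : ∀ r r', V (r + r') ⟶ V r ⊗ V r'} {e : V 0 ⟶ 𝟙_ H}

/-- The underlying type of the graded ring, `⨁ π_{r,q}(R)` over all `(r, q)` in `N × ℤ`. -/
def Total (A : HomotopyRing cg neg R V d e) :=
  letI := A.addCommGroup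
  DirectSum (N × ℤ) (PiFamily R V)

instance [DecidableEq N] (A : HomotopyRing cg neg R V d e) : Ring A.Total :=
  letI := A.addCommGroup
  letI := A.gring
  (DirectSum.ring (PiFamily R V) : Ring (DirectSum (N × ℤ) (PiFamily R V)))

/-- The homogeneous element of degree `(r, q)` given by a representative. -/
def of [DecidableEq N] (A : HomotopyRing cg neg R V d e) (r : N) (q : ℤ)
    (a : HRep R (V r) q) : A.Total :=
  letI := A.addCommGroup
  DirectSum.of (PiFamily R V) (r, q) (PiFamily.mk a)

end HomotopyRing

end Homotopy

/-- The ring homomorphism `φ : A → B` is a localization at `a`: it is universal among the ring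
homomorphisms from `A` (to not necessarily commutative rings) sending `a` to a unit. -/
def IsRingLocalization {A B : Type*} [Ring A] [Ring B] (φ : A →+* B) (a : A) : Prop :=
  IsUnit (φ a) ∧ ∀ (C : Type w) [Ring C] (ψ : A →+* C), IsUnit (ψ a) →
    ∃! χ : B →+* C, χ.comp φ = ψ

/-! ### Monoidal model categories -/

section Model

variable (D : Type*) [Category D] [ModelCategory D] [MonoidalCategory D]

/-- The pushout-product axiom. -/
class PushoutProductAxiom : Prop where
  cofibration : ∀ {A B X Y : D} (f : A ⟶ B) (g : X ⟶ Y), Cofibration f → Cofibration g →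
    Cofibration ((Arrow.pushoutProduct.obj (Arrow.mk f)).obj (Arrow.mk g)).hom
  weakEquivalence : ∀ {A B X Y : D} (f : A ⟶ B) (g : X ⟶ Y), Cofibration f → Cofibration g →
    (WeakEquivalence f ∨ WeakEquivalence g) →
      WeakEquivalence ((Arrow.pushoutProduct.obj (Arrow.mk f)).obj (Arrow.mk g)).hom

/-- The homotopy category, with the smash product induced from `D`, in case the latter preserves
weak equivalences. -/
abbrev Ho [(weakEquivalences D).IsMonoidal] :=
  LocalizedMonoidal (weakEquivalences D).Q (weakEquivalences D)
    (Iso.refl ((weakEquivalences D).Q.obj (𝟙_ D)))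

/-- The localization functor from `D` to its homotopy category. -/
abbrev toHo [(weakEquivalences D).IsMonoidal] : D ⥤ Ho D :=
  Localization.Monoidal.toMonoidalCategory (weakEquivalences D).Q (weakEquivalences D)
    (Iso.refl ((weakEquivalences D).Q.obj (𝟙_ D)))

variable {D}

/-- The canonical isomorphism between the powers of `T` formed in `Ho(D)` and in `D`. -/
def mapTpow [(weakEquivalences D).IsMonoidal] (T : D) :
    ∀ k, tpow ((toHo D).obj T) k ≅ (toHo D).obj (tpow T k)
  | 0 => Functor.Monoidal.εIso (toHo D)
  | k + 1 => whiskerRightIso (mapTpow T k) _ ≪≫ Functor.Monoidal.μIso (toHo D) _ _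

/-- A symmetric ring spectrum is semistable (with respect to a class `B` of objects): the injection
monoid acts trivially on all `π_q^V(R)` with `V` in `B`. -/
def Semistable [SymmetricCategory D] [(weakEquivalences D).IsMonoidal] {T : D}
    (sgn : SignStructure ((toHo D).obj T)) (B : ObjectProperty D) (R : SymRingData T) : Prop :=
  ∀ V : D, B V → ∀ q : ℤ, TrivialAction sgn.neg (R.map (toHo D)) ((toHo D).obj V) q

end Model

/-! ### Spheres indexed by a monoid -/

/-- Objects `S^r` for `r` in `N` with isomorphisms `S^0 ≅ S^0` (the unit) and
`S^(r₁+r₂) ≅ S^r₁ ∧ S^r₂` which are associative and unital. -/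
structure SphereFamily (N : Type*) [AddCommMonoid N] (D : Type*) [Category D]
    [MonoidalCategory D] where
  obj : N → D
  unit : obj 0 ≅ 𝟙_ D
  s : ∀ r₁ r₂, obj (r₁ + r₂) ≅ obj r₁ ⊗ obj r₂
  assoc : ∀ r₁ r₂ r₃, (s (r₁ + r₂) r₃).hom ≫ (s r₁ r₂).hom ▷ obj r₃ ≫ (α_ _ _ _).hom =
    eqToHom (congrArg obj (add_assoc r₁ r₂ r₃)) ≫ (s r₁ (r₂ + r₃)).hom ≫ obj r₁ ◁ (s r₂ r₃).hom
  left_unit : ∀ r, (s 0 r).hom ≫ unit.hom ▷ obj r ≫ (λ_ _).hom =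
    eqToHom (congrArg obj (zero_add r))
  right_unit : ∀ r, (s r 0).hom ≫ obj r ◁ unit.hom ≫ (ρ_ _).hom =
    eqToHom (congrArg obj (add_zero r))

namespace SphereFamily

variable {N : Type*} [AddCommMonoid N] {D : Type*} [Category D] [MonoidalCategory D]
  (S : SphereFamily N D)

/-- The class of objects `S^r ∧ U` with `r` in `N` and `U` in a given class. -/
def smashClass (B' : ObjectProperty D) : ObjectProperty D :=
  fun V => ∃ (r : N) (U : D), B' U ∧ V = S.obj r ⊗ U

variable [SymmetricCategory D] (U : D) [ComonObj U]

/-- The map `S^(r+r') ∧ U ⟶ (S^r ∧ U) ∧ (S^r' ∧ U)` given by the diagonal of `U`. -/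
def diag (r r' : N) : S.obj (r + r') ⊗ U ⟶ (S.obj r ⊗ U) ⊗ (S.obj r' ⊗ U) :=
  ((S.s r r').hom ⊗ₘ ComonObj.comul) ≫ tensorμ _ _ _ _

/-- The map `S^0 ∧ U ⟶ S^0` to the unit given by the counit of `U`. -/
def aug : S.obj 0 ⊗ U ⟶ 𝟙_ D :=
  (S.unit.hom ⊗ₘ ComonObj.counit) ≫ (λ_ _).hom

end SphereFamily

section Rings

variable {D : Type*} [Category D] [ModelCategory D] [MonoidalCategory D] [SymmetricCategory D]
  [(weakEquivalences D).IsMonoidal] {T : D} {N : Type*} [AddCommMonoid N] (S : SphereFamily N D)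
  (U : D) [ComonObj U]

/-- The map `S^0 ∧ U ⟶ S^0` in the homotopy category. -/
def hoAug : (toHo D).obj (S.obj 0 ⊗ U) ⟶ 𝟙_ (Ho D) :=
  (toHo D).map (S.aug U) ≫ Functor.OplaxMonoidal.η (toHo D)

/-- The graded ring `π^U_{*,*}(R)`. -/
abbrev PiRing (cg : CogroupStructure ((toHo D).obj T)) (sgn : SignStructure ((toHo D).obj T))
    (R : SymRingData T) :=
  HomotopyRing cg sgn.neg (R.map (toHo D)) (fun r : N => (toHo D).obj (S.obj r ⊗ U))
    (fun r r' => (toHo D).map (S.diag U r r') ≫ Functor.OplaxMonoidal.δ (toHo D) _ _) (hoAug S U)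

/-- The representative `x ∘ c_l : S^0 ∧ U ∧ T^l ⟶ T^l ⟶ R_m` given by a map `x : T^l ⟶ R_m`. -/
def unitalRep (R : SymRingData T) {l m : ℕ} (x : tpow T l ⟶ R.X m) :
    HRep (R.map (toHo D)) ((toHo D).obj (S.obj 0 ⊗ U)) ((l : ℤ) - m) :=
  HRep.ofMap (hoAug S U) ((mapTpow T l).hom ≫ (toHo D).map x)

end Rings

end

end SymSpec

/-!
# The localization of a semistable symmetric ring spectrum at a central map

The spectrum `R[1/x]` is handled through the evaluation maps `R[1/x]_p ∧ T^(lp) ⟶ R_((1+m)p)`: a map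
`f : A ⟶ R[1/x]_p` is determined by its adjoint `L.hat f : A ∧ T^(lp) ⟶ R_((1+m)p)`, and the adjoints
of `f · γ`, of a product and of `f ≫ j` are explicit (`LocData`). Hence all identities for `R[1/x]`
follow from identities in `R` (`LocData.isSymRing`, `LocData.isRingMap`). Since `x` is central, its
powers are equivariant for block permutations (`SymRingData.IsSymRing.pow_perm`), and this is what
makes `j` equivariant and multiplicative. A symmetric monoidal functor preserves these data
(`LocData.map`), and in the homotopy category the adjunction persists because the powers of `T` are
cofibrant and the `R_n` fibrant (`IsFlat.bijective_hoEv`). From there on everything takes place in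
the homotopy category.

Homotopy classes are written as `cl h f` with `f : V ∧ (T^k) ⟶ R_m`. Semistability means that a
permutation of the target can be exchanged for a sign (`cl_perm`), so that a class is determined up
to sign by `f` up to permutations (`SymRingData.PermEq.cl_eq_act`). This gives the associativity,
unitality and distributivity of the products (`homotopyRing`); sums are computed in
`V ∧ (T ∨ T) ∧ T^k`, smash products with any object being left adjoints on the homotopy category.

Stabilization in `R[1/x]` corresponds under adjunction to multiplication by `ι₁` and by `x^1` in `R`,
up to permutations (`LocData.hatT_rmul_j`). Hence maps whose adjoints have the same class in `π_*(R)`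
have the same class in `π_*(R[1/x])` (`cl_eq_of_hatT`). A permutation `γ` of the target of a map
to `R[1/x]_p` permutes the blocks of `T^(lp)` and of `R_((1+m)p)`, hence multiplies the class of the
adjoint by `sign(γ)^l sign(γ)^(1+m)`; together with the sign on the source in the definition of the
action this is `sign(γ)^(l+m)`. If `l + m` is odd there seems to be a sign left over; but then the same
computation, applied to the exchange of the two factors `T` in a double stabilization, which does not
change the class, shows that signs act trivially on it. So `R[1/x]` is semistable
(`trivialAction_loc`).

For the universal property, `isRingLocalization_of` reduces the claim to three facts beside the Ore
condition, which holds because `[x]` commutes with homogeneous elements up to sign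
(`exists_map_mul_eq`). First, `j[x]` is a unit (`isUnit_gclass`): its inverse is represented by the
map adjoint to `ι₁^(l+m+2) x^(l+1)`. Secondly, `b · j[x]^p = ± j(a)` for `b` represented by a map to
`R[1/x]_p` and `a` represented by its adjoint (`exists_mul_gclass_pow_eq_gpush`). Thirdly, if `j(a) = 0`
then `a · [x]^p = 0` for some `p`, the adjoint of `f ≫ j` being `f · x^p` up to a shuffle
(`exists_mul_gclass_pow_eq`). The ambiguity of the signs is harmless throughout.
-/

namespace SymSpec

noncomputable section

/-! ### Bijections between the sets `Fin n` -/

/-- The block sum of two bijections. -/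
def sumE {a a' b b' : ℕ} (α : Fin a ≃ Fin a') (β : Fin b ≃ Fin b') :
    Fin (a + b) ≃ Fin (a' + b') :=
  finSumFinEquiv.symm.trans ((Equiv.sumCongr α β).trans finSumFinEquiv)

@[simp] lemma sumE_castAdd {a a' b b' : ℕ} (α : Fin a ≃ Fin a') (β : Fin b ≃ Fin b') (i : Fin a) :
    sumE α β (Fin.castAdd b i) = Fin.castAdd b' (α i) := by
  simp [sumE]

@[simp] lemma sumE_natAdd {a a' b b' : ℕ} (α : Fin a ≃ Fin a') (β : Fin b ≃ Fin b') (i : Fin b) :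
    sumE α β (Fin.natAdd a i) = Fin.natAdd a' (β i) := by
  simp [sumE]

lemma blockSum_eq_sumE {p q : ℕ} (α : Equiv.Perm (Fin p)) (β : Equiv.Perm (Fin q)) :
    blockSum α β = sumE α β := rfl

lemma equiv_add_ext {a b : ℕ} {X : Type*} {e e' : Fin (a + b) ≃ X}
    (h₁ : ∀ i, e (Fin.castAdd b i) = e' (Fin.castAdd b i))
    (h₂ : ∀ i, e (Fin.natAdd a i) = e' (Fin.natAdd a i)) : e = e' :=
  Equiv.ext fun k => Fin.addCases h₁ h₂ k

lemma sumE_trans {a a' a'' b b' b'' : ℕ} (α : Fin a ≃ Fin a') (α' : Fin a' ≃ Fin a'')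
    (β : Fin b ≃ Fin b') (β' : Fin b' ≃ Fin b'') :
    (sumE α β).trans (sumE α' β') = sumE (α.trans α') (β.trans β') :=
  equiv_add_ext (by simp) (by simp)

@[simp] lemma sumE_refl {a b : ℕ} :
    sumE (Equiv.refl (Fin a)) (Equiv.refl (Fin b)) = Equiv.refl _ :=
  equiv_add_ext (by simp) (by simp)

/-- Reassociation of the block sum. -/
abbrev assocE (p q r : ℕ) : Fin (p + q + r) ≃ Fin (p + (q + r)) := finCongr (Nat.add_assoc p q r)

@[simp] lemma assocE_castAdd_castAdd (p q r : ℕ) (i : Fin p) (h : p + q + r = p + (q + r)) :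
    Fin.cast h (Fin.castAdd r (Fin.castAdd q i)) = Fin.castAdd (q + r) i := rfl

@[simp] lemma assocE_castAdd_natAdd (p q r : ℕ) (i : Fin q) (h : p + q + r = p + (q + r)) :
    Fin.cast h (Fin.castAdd r (Fin.natAdd p i)) = Fin.natAdd p (Fin.castAdd r i) := rfl

@[simp] lemma assocE_symm_castAdd (p q r : ℕ) (i : Fin p) (h : p + (q + r) = p + q + r) :
    Fin.cast h (Fin.castAdd (q + r) i) = Fin.castAdd r (Fin.castAdd q i) := rfl

@[simp] lemma assocE_symm_natAdd_castAdd (p q r : ℕ) (i : Fin q) (h : p + (q + r) = p + q + r) :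
    Fin.cast h (Fin.natAdd p (Fin.castAdd r i)) = Fin.castAdd r (Fin.natAdd p i) := rfl

@[simp] lemma assocE_natAdd (p q r : ℕ) (i : Fin r) (h : p + q + r = p + (q + r)) :
    Fin.cast h (Fin.natAdd (p + q) i) = Fin.natAdd p (Fin.natAdd q i) :=
  Fin.ext (by simp [Nat.add_assoc])

@[simp] lemma assocE_symm_natAdd_natAdd (p q r : ℕ) (i : Fin r) (h : p + (q + r) = p + q + r) :
    Fin.cast h (Fin.natAdd p (Fin.natAdd q i)) = Fin.natAdd (p + q) i :=
  Fin.ext (by simp [Nat.add_assoc])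

lemma finCongr_trans' {a b c : ℕ} (h : a = b) (h' : b = c) :
    (finCongr h).trans (finCongr h') = finCongr (h.trans h') := by
  subst h h'; rfl

/-! ### The calculus of `reindex` -/

section Reindex

variable {C : Type*} [Category C] [MonoidalCategory C] {T : C}

namespace SymRingData

variable (R : SymRingData T)

lemma reindex_perm {a : ℕ} (e : Equiv.Perm (Fin a)) : R.reindex e = R.perm a e := by
  simp only [reindex, eqToHom_refl, Category.comp_id]
  rfl

/-- The product `f · g : A ∧ B ⟶ X (p + q)` of two maps `f : A ⟶ X p` and `g : B ⟶ X q`. -/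
def star {A B : C} {p q : ℕ} (f : A ⟶ R.X p) (g : B ⟶ R.X q) : A ⊗ B ⟶ R.X (p + q) :=
  (f ⊗ₘ g) ≫ R.mul p q

variable {R}

lemma star_comp {A A' B B' : C} {p q : ℕ} (u : A' ⟶ A) (v : B' ⟶ B) (f : A ⟶ R.X p)
    (g : B ⟶ R.X q) : R.star (u ≫ f) (v ≫ g) = (u ⊗ₘ v) ≫ R.star f g := by
  simp [star]

lemma star_comp_left {A A' B : C} {p q : ℕ} (u : A' ⟶ A) (f : A ⟶ R.X p)
    (g : B ⟶ R.X q) : R.star (u ≫ f) g = u ▷ B ≫ R.star f g := by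
  simpa using star_comp u (𝟙 _) f g

lemma star_comp_right {A B B' : C} {p q : ℕ} (v : B' ⟶ B) (f : A ⟶ R.X p)
    (g : B ⟶ R.X q) : R.star f (v ≫ g) = A ◁ v ≫ R.star f g := by
  simpa using star_comp (𝟙 _) v f g

lemma reindex_eqToHom {a b : ℕ} (h : a = b) (hR : ∀ n, R.perm n 1 = 𝟙 _) :
    R.reindex (finCongr h) = eqToHom (congrArg R.X h) := by
  subst h
  rw [eqToHom_refl, ← hR]
  exact R.reindex_perm _

lemma reindex_trans_of_perm_mul
    (h : ∀ n (σ τ : Equiv.Perm (Fin n)), R.perm n (σ * τ) = R.perm n τ ≫ R.perm n σ)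
    {a b c : ℕ} (e : Fin a ≃ Fin b) (e' : Fin b ≃ Fin c) :
    R.reindex (e.trans e') = R.reindex e ≫ R.reindex e' := by
  obtain rfl : a = b := by simpa using Fintype.card_congr e
  obtain rfl : a = c := by simpa using Fintype.card_congr e'
  simp only [reindex_perm]
  exact h a e' e

namespace IsSymRing

variable [BraidedCategory C] (hR : R.IsSymRing)
include hR

lemma reindex_refl (a : ℕ) : R.reindex (Equiv.refl (Fin a)) = 𝟙 _ := by
  rw [reindex_perm]; exact hR.perm_one a

lemma reindex_finCongr_self {a : ℕ} (h : a = a) : R.reindex (finCongr h) = 𝟙 _ :=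
  hR.reindex_refl a

lemma reindex_trans {a b c : ℕ} (e : Fin a ≃ Fin b) (e' : Fin b ≃ Fin c) :
    R.reindex (e.trans e') = R.reindex e ≫ R.reindex e' :=
  reindex_trans_of_perm_mul hR.perm_mul e e'

lemma reindex_trans_assoc {a b c : ℕ} (e : Fin a ≃ Fin b) (e' : Fin b ≃ Fin c) {Z : C}
    (h : R.X c ⟶ Z) :
    R.reindex e ≫ R.reindex e' ≫ h = R.reindex (e.trans e') ≫ h := by
  rw [hR.reindex_trans, Category.assoc]

lemma reindex_symm_comp {a b : ℕ} (e : Fin a ≃ Fin b) : R.reindex e.symm ≫ R.reindex e = 𝟙 _ := by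
  rw [← hR.reindex_trans, Equiv.symm_trans_self, hR.reindex_refl]

lemma reindex_comp_symm {a b : ℕ} (e : Fin a ≃ Fin b) : R.reindex e ≫ R.reindex e.symm = 𝟙 _ := by
  rw [← hR.reindex_trans, Equiv.self_trans_symm, hR.reindex_refl]

lemma isIso_reindex {a b : ℕ} (e : Fin a ≃ Fin b) : IsIso (R.reindex e) :=
  ⟨R.reindex e.symm, hR.reindex_comp_symm e, hR.reindex_symm_comp e⟩

lemma mul_reindex {p p' q q' : ℕ} (α : Fin p ≃ Fin p') (β : Fin q ≃ Fin q') :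
    (R.reindex α ⊗ₘ R.reindex β) ≫ R.mul p' q' = R.mul p q ≫ R.reindex (sumE α β) := by
  obtain rfl : p = p' := by simpa using Fintype.card_congr α
  obtain rfl : q = q' := by simpa using Fintype.card_congr β
  simp only [reindex_perm]
  exact hR.mul_perm p q α β

lemma star_reindex {A B : C} {p p' q q' : ℕ} (f : A ⟶ R.X p) (g : B ⟶ R.X q)
    (α : Fin p ≃ Fin p') (β : Fin q ≃ Fin q') :
    R.star (f ≫ R.reindex α) (g ≫ R.reindex β) = R.star f g ≫ R.reindex (sumE α β) := by
  simp only [star, Category.assoc, ← hR.mul_reindex, ← tensorHom_comp_tensorHom]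

lemma star_reindex_left {A B : C} {p p' q : ℕ} (f : A ⟶ R.X p) (g : B ⟶ R.X q)
    (α : Fin p ≃ Fin p') :
    R.star (f ≫ R.reindex α) g = R.star f g ≫ R.reindex (sumE α (Equiv.refl _)) := by
  rw [← hR.star_reindex, hR.reindex_refl, Category.comp_id]

lemma star_reindex_right {A B : C} {p q q' : ℕ} (f : A ⟶ R.X p) (g : B ⟶ R.X q)
    (β : Fin q ≃ Fin q') :
    R.star f (g ≫ R.reindex β) = R.star f g ≫ R.reindex (sumE (Equiv.refl _) β) := by
  rw [← hR.star_reindex, hR.reindex_refl, Category.comp_id]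

lemma star_assoc {A B D : C} {p q r : ℕ} (f : A ⟶ R.X p) (g : B ⟶ R.X q) (h : D ⟶ R.X r) :
    R.star (R.star f g) h ≫ R.reindex (assocE p q r) = (α_ A B D).hom ≫ R.star f (R.star g h) := by
  have := hR.assoc p q r
  simp only [Category.assoc] at this
  calc _ = ((f ⊗ₘ g) ⊗ₘ h) ≫ R.mul p q ▷ R.X r ≫ R.mul (p + q) r ≫ R.reindex (assocE p q r) := by
        simp only [star, Category.assoc]
        rw [← Category.comp_id h, ← tensorHom_comp_tensorHom, Category.comp_id]; simp
    _ = _ := by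
        rw [this, associator_naturality_assoc]
        simp only [star]
        rw [← Category.comp_id f, ← tensorHom_comp_tensorHom, Category.comp_id]; simp

lemma star_assoc' {A B D : C} {p q r : ℕ} (f : A ⟶ R.X p) (g : B ⟶ R.X q) (h : D ⟶ R.X r) :
    R.star f (R.star g h) = (α_ A B D).inv ≫ R.star (R.star f g) h ≫ R.reindex (assocE p q r) := by
  rw [hR.star_assoc, Iso.inv_hom_id_assoc]

lemma star_one {A : C} {p : ℕ} (f : A ⟶ R.X p) : R.star f R.one₀ = (ρ_ A).hom ≫ f := by
  rw [← rightUnitor_naturality, ← hR.mul_one]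
  simp [star, MonoidalCategory.tensorHom_def]

lemma one_star {A : C} {p : ℕ} (f : A ⟶ R.X p) :
    R.star R.one₀ f ≫ R.reindex (finCongr (Nat.zero_add p)) = (λ_ A).hom ≫ f := by
  rw [← leftUnitor_naturality, ← hR.one_mul]
  simp [star, tensorHom_def']

end IsSymRing

/-! ### Central maps -/

section Central

variable [BraidedCategory C]

lemma IsCentral.star_comm {A : C} {m : ℕ} {f : A ⟶ R.X m} (hf : R.IsCentral f) {B : C} {n : ℕ}
    (g : B ⟶ R.X n) :
    R.star g f ≫ R.reindex finAddFlip = (β_ B A).hom ≫ R.star f g := by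
  have := hf n
  calc _ = g ▷ A ≫ R.X n ◁ f ≫ R.mul n m ≫ R.reindex finAddFlip := by
        simp [star, MonoidalCategory.tensorHom_def]
    _ = _ := by rw [this]; simp [star, tensorHom_def']

lemma isCentral_of_star_comm {A : C} {m : ℕ} {f : A ⟶ R.X m}
    (h : ∀ n, R.star (𝟙 (R.X n)) f ≫ R.reindex finAddFlip = (β_ _ A).hom ≫ R.star f (𝟙 _)) :
    R.IsCentral f := by
  intro n
  simpa [star] using h n

lemma IsCentral.comp {A A' : C} {m : ℕ} {f : A ⟶ R.X m} (hf : R.IsCentral f) (u : A' ⟶ A) :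
    R.IsCentral (u ≫ f) := by
  refine isCentral_of_star_comm fun n => ?_
  rw [star_comp_right, Category.assoc, hf.star_comm, star_comp_left,
    BraidedCategory.braiding_naturality_right_assoc]

variable (hR : R.IsSymRing)
include hR

lemma IsSymRing.isCentral_reindex {A : C} {m m' : ℕ} {f : A ⟶ R.X m} (hf : R.IsCentral f)
    (e : Fin m ≃ Fin m') : R.IsCentral (f ≫ R.reindex e) := by
  refine isCentral_of_star_comm fun n => ?_
  rw [hR.star_reindex_right, hR.star_reindex_left, ← Category.assoc (β_ _ _).hom, ← hf.star_comm]
  simp only [Category.assoc, ← hR.reindex_trans]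
  congr 2
  exact equiv_add_ext (by simp) (by simp)

lemma IsSymRing.isCentral_one₀ : R.IsCentral R.one₀ := by
  refine isCentral_of_star_comm fun n => ?_
  have := hR.isIso_reindex (finCongr (Nat.zero_add n))
  rw [hR.star_one, ← cancel_mono (R.reindex (finCongr (Nat.zero_add n))), Category.assoc,
    Category.assoc, Category.assoc, hR.one_star, ← hR.reindex_trans]
  have : (finAddFlip.trans (finCongr (Nat.zero_add n)) : Fin (n + 0) ≃ Fin n) = Equiv.refl _ :=
    Equiv.ext fun i => Fin.ext (by
      change (finAddFlip (Fin.castAdd 0 i) : Fin (0 + n)).val = i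
      rw [finAddFlip_apply_castAdd]; simp)
  rw [this, hR.reindex_refl]
  simp [braiding_tensorUnit_right]

lemma IsSymRing.isCentral_star {A B : C} {p q : ℕ} {f : A ⟶ R.X p} {g : B ⟶ R.X q}
    (hf : R.IsCentral f) (hg : R.IsCentral g) : R.IsCentral (R.star f g) := by
  refine isCentral_of_star_comm fun n => ?_
  -- `h f g → f h g → f g h`
  have e : (finAddFlip : Fin (n + (p + q)) ≃ Fin (p + q + n)) =
      (assocE n p q).symm.trans ((sumE finAddFlip (Equiv.refl _)).trans ((assocE p n q).trans
        ((sumE (Equiv.refl _) finAddFlip).trans (assocE p q n).symm))) := by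
    refine equiv_add_ext (fun i => ?_) (fun k => ?_)
    · simp
    · refine Fin.addCases (fun j => ?_) (fun j => ?_) k
      · simp
      · simp
  have h1 := hf.star_comm (𝟙 (R.X n))
  have h2 := hg.star_comm (𝟙 (R.X n))
  rw [e, hR.reindex_trans, hR.star_assoc', Category.assoc, Category.assoc,
    hR.reindex_trans_assoc, Equiv.self_trans_symm, hR.reindex_refl, Category.id_comp,
    hR.reindex_trans, ← Category.assoc (R.star _ g), ← hR.star_reindex_left, h1,
    star_comp_left, hR.reindex_trans, Category.assoc, ← Category.assoc (R.star _ g),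
    hR.star_assoc, Category.assoc, hR.reindex_trans, ← Category.assoc (R.star _ _),
    ← hR.star_reindex_right, h2, star_comp_right, hR.star_assoc']
  simp only [Category.assoc, hR.reindex_comp_symm, Category.comp_id]
  rw [BraidedCategory.braiding_tensor_right_hom]
  simp only [Category.assoc]

end Central

end SymRingData

end Reindex

/-! ### The symmetric group action on smash powers -/

section SmashPerm

variable {C : Type*} [Category C] [MonoidalCategory C] {T : C}

/-- The identification of `(V ∧ T^n) ∧ T` with `V ∧ T^(n+1)`, which holds by definition. -/
def snoc (T V : C) (n : ℕ) : smashPow T V n ⊗ T ≅ smashPow T V (n + 1) := Iso.refl _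

/-- The map `f ∧ T` of `V ∧ T^(n+1)` given by a map `f` of `V ∧ T^n`. -/
def grow {V : C} {n : ℕ} (f : smashPow T V n ⟶ smashPow T V n) :
    smashPow T V (n + 1) ⟶ smashPow T V (n + 1) :=
  f ▷ T

lemma grow_eq {V : C} {n : ℕ} (f : smashPow T V n ⟶ smashPow T V n) :
    grow f = (snoc T V n).inv ≫ f ▷ T ≫ (snoc T V n).hom :=
  ((Category.id_comp _).trans (Category.comp_id _)).symm

lemma grow_comp {V : C} {n : ℕ} (f g : smashPow T V n ⟶ smashPow T V n) :
    grow (f ≫ g) = grow f ≫ grow g := comp_whiskerRight _ _ _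

lemma grow_id (V : C) (n : ℕ) : grow (𝟙 (smashPow T V n)) = 𝟙 _ := id_whiskerRight _ _

variable [SymmetricCategory C]

/-- The exchange of the last two factors of `Y ∧ T ∧ T`. -/
def swapLast (T Y : C) : (Y ⊗ T) ⊗ T ⟶ (Y ⊗ T) ⊗ T :=
  (α_ Y T T).hom ≫ Y ◁ (β_ T T).hom ≫ (α_ Y T T).inv

lemma swapLast_swapLast (Y : C) : swapLast T Y ≫ swapLast T Y = 𝟙 _ := by
  simp [swapLast, ← MonoidalCategory.whiskerLeft_comp_assoc]

lemma swapLast_natural {Y Z : C} (f : Y ⟶ Z) :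
    f ▷ T ▷ T ≫ swapLast T Z = swapLast T Y ≫ f ▷ T ▷ T := by
  simp only [swapLast, Category.assoc]
  rw [associator_naturality_left_assoc, ← whisker_exchange_assoc, associator_inv_naturality_left]

lemma swapLast_braid (Y : C) :
    swapLast T (Y ⊗ T) ≫ swapLast T Y ▷ T ≫ swapLast T (Y ⊗ T) =
      swapLast T Y ▷ T ≫ swapLast T (Y ⊗ T) ≫ swapLast T Y ▷ T := by
  have h := BraidedCategory.yang_baxter T T T
  calc _ = 𝟙 _ ⊗≫ Y ◁ (T ◁ (β_ T T).hom ≫ (α_ T T T).inv ≫ (β_ T T).hom ▷ T ≫ (α_ T T T).hom ≫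
        T ◁ (β_ T T).hom) ⊗≫ 𝟙 _ := by
        simp only [swapLast]; monoidal
    _ = _ := by
        rw [← h]
        simp only [swapLast]; monoidal

/-- The exchange of the last two factors of `V ∧ T^(n+2)`. -/
def topSwap (T V : C) (n : ℕ) : smashPow T V (n + 2) ⟶ smashPow T V (n + 2) :=
  swapLast T (smashPow T V n)

lemma topSwap_eq (V : C) (n : ℕ) : topSwap T V n = (snoc T V (n + 1)).inv ≫
    (snoc T V n).inv ▷ T ≫ swapLast T _ ≫ (snoc T V n).hom ▷ T ≫ (snoc T V (n + 1)).hom := by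
  have h (Y : C) : swapLast T Y = 𝟙 ((Y ⊗ T) ⊗ T) ≫ 𝟙 (Y ⊗ T) ▷ T ≫ swapLast T Y ≫
      𝟙 (Y ⊗ T) ▷ T ≫ 𝟙 ((Y ⊗ T) ⊗ T) := by simp
  exact h _

lemma topSwap_topSwap (V : C) (n : ℕ) : topSwap T V n ≫ topSwap T V n = 𝟙 _ :=
  swapLast_swapLast _

lemma topSwap_natural {V : C} {n : ℕ} (f : smashPow T V n ⟶ smashPow T V n) :
    grow (grow f) ≫ topSwap T V n = topSwap T V n ≫ grow (grow f) :=
  swapLast_natural f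

lemma topSwap_braid (V : C) (n : ℕ) :
    topSwap T V (n + 1) ≫ grow (topSwap T V n) ≫ topSwap T V (n + 1) =
      grow (topSwap T V n) ≫ topSwap T V (n + 1) ≫ grow (topSwap T V n) :=
  swapLast_braid _

/-- The exchange of the factors in positions `i` and `i + 1` of `V ∧ T^n`. -/
def adjSwap (T V : C) : ∀ n : ℕ, ℕ → (smashPow T V n ⟶ smashPow T V n)
  | 0, _ => 𝟙 _
  | 1, _ => 𝟙 _
  | n + 2, i => if i = n then topSwap T V n else grow (adjSwap T V (n + 1) i)

lemma adjSwap_last (V : C) (n : ℕ) : adjSwap T V (n + 2) n = topSwap T V n := by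
  simp [adjSwap]

lemma adjSwap_of_ne (V : C) {n i : ℕ} (h : i + 1 ≠ n) :
    adjSwap T V (n + 1) i = grow (adjSwap T V n i) := by
  obtain _ | n := n
  · exact (grow_id V 0).symm
  · have h : i ≠ n := by omega
    simp [adjSwap, h]

lemma moveLast_self (V : C) (n : ℕ) : moveLast (T := T) V n n = 𝟙 _ := by
  cases n <;> simp [moveLast]

lemma moveLast_succ (V : C) {n k : ℕ} (h : k ≠ n + 1) :
    moveLast (T := T) V (n + 1) k = topSwap T V n ≫ grow (moveLast V n k) := by
  simp only [moveLast, h, if_false]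
  rfl

lemma permSmash_succ (V : C) (n : ℕ) (τ : Equiv.Perm (Fin (n + 1))) :
    permSmash (T := T) V (n + 1) τ =
      grow (permSmash V n (dropLast τ)) ≫ moveLast V n (τ (Fin.last n)) := rfl

/-- Moving the last factor to position `k` and then exchanging the factors in positions `i` and
`i + 1`. -/
lemma moveLast_adjSwap (V : C) (n : ℕ) : ∀ k i, k ≤ n → i < n →
    (k = i → moveLast (T := T) V n k ≫ adjSwap T V (n + 1) i = moveLast V n (i + 1)) ∧
    (k = i + 1 → moveLast (T := T) V n k ≫ adjSwap T V (n + 1) i = moveLast V n i) ∧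
    (i + 1 < k → moveLast (T := T) V n k ≫ adjSwap T V (n + 1) i =
      grow (adjSwap T V n i) ≫ moveLast V n k) ∧
    (k < i → moveLast (T := T) V n k ≫ adjSwap T V (n + 1) i =
      grow (adjSwap T V n (i - 1)) ≫ moveLast V n k) := by
  induction n with
  | zero => intro k i _ h; omega
  | succ n ih =>
    intro k i hk hi
    by_cases hkn : k = n + 1
    · subst hkn
      rw [moveLast_self, Category.id_comp]
      refine ⟨by omega, fun h => ?_, fun h => ?_, by omega⟩
      · obtain rfl : n = i := by omega
        rw [adjSwap_last, moveLast_succ _ (by omega), moveLast_self, grow_id, Category.comp_id]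
      · rw [adjSwap_of_ne _ (by omega), Category.comp_id]
    · rw [moveLast_succ _ hkn]
      by_cases hin : i = n
      · subst hin
        rw [adjSwap_last]
        refine ⟨fun h => ?_, by omega, by omega, fun h => ?_⟩
        · subst h
          rw [moveLast_self, moveLast_self, grow_id, Category.comp_id, topSwap_topSwap]
        · obtain _ | m := i
          · omega
          · rw [moveLast_succ _ (by omega), Nat.add_sub_cancel, adjSwap_last, grow_comp,
              Category.assoc, Category.assoc, topSwap_natural]
            simp only [← Category.assoc]
            congr 1
            simpa only [Category.assoc] using topSwap_braid V m
      · have hin' : i < n := by omega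
        rw [adjSwap_of_ne _ (by omega), Category.assoc, ← grow_comp]
        obtain ⟨h1, h2, h3, h4⟩ := ih k i (by omega) hin'
        refine ⟨fun h => ?_, fun h => ?_, fun h => ?_, fun h => ?_⟩
        · rw [h1 h, moveLast_succ _ (by omega)]
        · rw [h2 h, moveLast_succ _ (by omega)]
        · rw [h3 h, grow_comp, adjSwap_of_ne _ (by omega), ← Category.assoc, ← topSwap_natural,
            Category.assoc]
        · rw [h4 h, grow_comp, adjSwap_of_ne _ (by omega), ← Category.assoc, ← topSwap_natural,
            Category.assoc]

lemma succAbove_dropLast {n : ℕ} (τ : Equiv.Perm (Fin (n + 1))) (j : Fin n) :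
    (τ (Fin.last n)).succAbove (dropLast τ j) = τ j.castSucc := by
  have h : τ j.castSucc ≠ τ (Fin.last n) := fun h =>
    (Fin.castSucc_lt_last j).ne (τ.injective h)
  obtain ⟨k, hk⟩ := Fin.exists_succAbove_eq h
  have h1 : (((finSuccEquiv' (Fin.last n)).symm.trans τ).trans
      (finSuccEquiv' (τ (Fin.last n)))) (some j) = some k := by
    simp [← hk, finSuccEquiv'_succAbove]
  have h2 := Equiv.some_removeNone_iff (e := ((finSuccEquiv' (Fin.last n)).symm.trans τ).trans
      (finSuccEquiv' (τ (Fin.last n)))) (x := j)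
  have h3 := Equiv.removeNone_some _ ⟨k, h1⟩
  rw [h1] at h3
  rw [dropLast, Option.some_injective _ h3, hk]

lemma dropLast_eq {n : ℕ} {τ : Equiv.Perm (Fin (n + 1))} {σ : Equiv.Perm (Fin n)}
    (h : ∀ j, (τ (Fin.last n)).succAbove (σ j) = τ j.castSucc) : dropLast τ = σ :=
  Equiv.ext fun j => Fin.succAbove_right_injective
    ((succAbove_dropLast τ j).trans (h j).symm)

lemma dropLast_one (n : ℕ) : dropLast (1 : Equiv.Perm (Fin (n + 1))) = 1 :=
  dropLast_eq fun j => by simp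

lemma permSmash_one (V : C) (n : ℕ) : permSmash (T := T) V n 1 = 𝟙 _ := by
  induction n with
  | zero => rfl
  | succ n ih =>
    rw [permSmash_succ, dropLast_one, ih, grow_id, Category.id_comp]
    exact moveLast_self V n

lemma adjSwap_perm (V : C) (n : ℕ) (i : Fin n) (τ : Equiv.Perm (Fin (n + 1))) :
    permSmash (T := T) V (n + 1) (Equiv.swap i.castSucc i.succ * τ) =
      permSmash V (n + 1) τ ≫ adjSwap T V (n + 1) i := by
  induction n with
  | zero => exact i.elim0
  | succ n ih =>
    have hk := (τ (Fin.last (n + 1))).is_le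
    have hin : (i : ℕ) < n + 1 := i.2
    obtain ⟨h1, h2, h3, h4⟩ := moveLast_adjSwap (T := T) V (n + 1) (τ (Fin.last (n + 1))) i hk hin
    have key := succAbove_dropLast τ
    rw [permSmash_succ V (n + 1) τ, permSmash_succ V (n + 1) (_ * τ), Category.assoc]
    set k := τ (Fin.last (n + 1)) with hkdef
    by_cases hki : k = i.castSucc
    · have e : dropLast (Equiv.swap i.castSucc i.succ * τ) = dropLast τ := by
        refine dropLast_eq fun j => ?_
        rw [Equiv.Perm.mul_apply, Equiv.Perm.mul_apply, ← key, ← hkdef, hki, Equiv.swap_apply_left]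
        have hne : i.castSucc.succAbove (dropLast τ j) ≠ i.castSucc := Fin.succAbove_ne _ _
        by_cases hj : i.castSucc.succAbove (dropLast τ j) = i.succ
        · rw [hj, Equiv.swap_apply_right]
          have : dropLast τ j = i := Fin.succAbove_right_injective (p := i.castSucc) (by simp [hj])
          simp [this]
        · rw [Equiv.swap_apply_of_ne_of_ne hne hj]
          have h' : dropLast τ j ≠ i := fun h => hj (by simp [h])
          rcases lt_or_gt_of_ne h' with h | h
          · rw [Fin.succAbove_of_castSucc_lt _ _ (by simpa using h.le),
              Fin.succAbove_of_castSucc_lt _ _ (Fin.lt_def.2 (by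
                have := Fin.lt_def.1 h; simp; omega))]
          · rw [Fin.succAbove_of_le_castSucc _ _ (by simpa using h),
              Fin.succAbove_of_le_castSucc _ _ (Fin.le_def.2 (by
                have := Fin.lt_def.1 h; simp; omega))]
      rw [e, h1 (by rw [hki]; simp), Equiv.Perm.mul_apply, ← hkdef, hki, Equiv.swap_apply_left]
      simp
    by_cases hki' : k = i.succ
    · have e : dropLast (Equiv.swap i.castSucc i.succ * τ) = dropLast τ := by
        refine dropLast_eq fun j => ?_
        rw [Equiv.Perm.mul_apply, Equiv.Perm.mul_apply, ← key, ← hkdef, hki',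
          Equiv.swap_apply_right]
        have hne : i.succ.succAbove (dropLast τ j) ≠ i.succ := Fin.succAbove_ne _ _
        by_cases hj : i.succ.succAbove (dropLast τ j) = i.castSucc
        · rw [hj, Equiv.swap_apply_left]
          have : dropLast τ j = i := Fin.succAbove_right_injective (p := i.succ) (by simp [hj])
          simp [this]
        · rw [Equiv.swap_apply_of_ne_of_ne hj hne]
          have h' : dropLast τ j ≠ i := fun h => hj (by simp [h])
          rcases lt_or_gt_of_ne h' with h | h
          · rw [Fin.succAbove_of_castSucc_lt _ _ (by simpa using h),
              Fin.succAbove_of_castSucc_lt _ _ (Fin.lt_def.2 (by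
                have := Fin.lt_def.1 h; simp; omega))]
          · rw [Fin.succAbove_of_le_castSucc _ _ (by simpa using h.le),
              Fin.succAbove_of_le_castSucc _ _ (Fin.le_def.2 (by
                have := Fin.lt_def.1 h; simp; omega))]
      rw [e, h2 (by rw [hki']; simp), Equiv.Perm.mul_apply, ← hkdef, hki', Equiv.swap_apply_right]
      simp
    have hv : (k : ℕ) ≠ i := fun h => hki (Fin.ext (by simpa using h))
    have hv' : (k : ℕ) ≠ i + 1 := fun h => hki' (Fin.ext (by simpa using h))
    have hfix : Equiv.swap i.castSucc i.succ k = k := Equiv.swap_apply_of_ne_of_ne hki hki'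
    rcases lt_or_gt_of_ne hv with hlt | hgt
    · -- the last letter goes below the two exchanged positions
      obtain ⟨i', hi'⟩ : ∃ i' : Fin n, (i' : ℕ) + 1 = i := ⟨⟨i - 1, by omega⟩, by simp; omega⟩
      have e : dropLast (Equiv.swap i.castSucc i.succ * τ) =
          Equiv.swap i'.castSucc i'.succ * dropLast τ := by
        refine dropLast_eq fun j => ?_
        rw [Equiv.Perm.mul_apply, Equiv.Perm.mul_apply, Equiv.Perm.mul_apply, ← key, ← hkdef, hfix,
          (Fin.succAbove_right_injective (p := k)).map_swap]
        congr 2 <;> refine Fin.ext ?_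
        · rw [Fin.succAbove_of_le_castSucc _ _ (Fin.le_def.2 (by simp; omega))]; simp [hi']
        · rw [Fin.succAbove_of_le_castSucc _ _ (Fin.le_def.2 (by simp; omega))]; simp [hi']
      rw [e, h4 hlt, ih, grow_comp, Category.assoc, Equiv.Perm.mul_apply, ← hkdef, hfix, ← hi',
        Nat.add_sub_cancel]
    · have hgt' : (i : ℕ) + 1 < k := by omega
      obtain ⟨i', hi'⟩ : ∃ i' : Fin n, (i' : ℕ) = i := ⟨⟨i, by omega⟩, rfl⟩
      have e : dropLast (Equiv.swap i.castSucc i.succ * τ) =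
          Equiv.swap i'.castSucc i'.succ * dropLast τ := by
        refine dropLast_eq fun j => ?_
        rw [Equiv.Perm.mul_apply, Equiv.Perm.mul_apply, Equiv.Perm.mul_apply, ← key, ← hkdef, hfix,
          (Fin.succAbove_right_injective (p := k)).map_swap]
        congr 2 <;> refine Fin.ext ?_
        · rw [Fin.succAbove_of_castSucc_lt _ _ (Fin.lt_def.2 (by simp; omega))]; simp [hi']
        · rw [Fin.succAbove_of_castSucc_lt _ _ (Fin.lt_def.2 (by simp; omega))]; simp [hi']
      rw [e, h3 hgt', ih, grow_comp, Category.assoc, Equiv.Perm.mul_apply, ← hkdef, hfix, ← hi']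

lemma permSmash_swap (V : C) (n : ℕ) (i : Fin n) :
    permSmash (T := T) V (n + 1) (Equiv.swap i.castSucc i.succ) = adjSwap T V (n + 1) i := by
  have := adjSwap_perm (T := T) V n i 1
  rwa [mul_one, permSmash_one, Category.id_comp] at this

lemma permSmash_mul (V : C) (n : ℕ) (σ τ : Equiv.Perm (Fin n)) :
    permSmash (T := T) V n (σ * τ) = permSmash V n τ ≫ permSmash V n σ := by
  obtain _ | n := n
  · rw [Subsingleton.elim σ 1, Subsingleton.elim τ 1, mul_one, permSmash_one, Category.comp_id]
  · have hσ : σ ∈ Submonoid.closure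
        (Set.range fun i : Fin n ↦ Equiv.swap i.castSucc i.succ) := by
      rw [Equiv.Perm.mclosure_swap_castSucc_succ]; trivial
    induction hσ using Submonoid.closure_induction generalizing τ with
    | mem σ h =>
      obtain ⟨i, rfl⟩ := h
      rw [adjSwap_perm, permSmash_swap]
    | one => rw [one_mul, permSmash_one, Category.comp_id]
    | mul σ σ' _ _ h h' => rw [mul_assoc, h, h', h, Category.assoc]

end SmashPerm

/-! ### The sphere spectrum -/

section Sphere0

variable {C : Type*} [Category C] [MonoidalCategory C] [SymmetricCategory C] (T : C)

/-- The sphere spectrum, with `n`-th level `T^n`: the symmetric groups permute the factors and the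
multiplication is the canonical isomorphism `T^p ∧ T^q ≅ T^(p+q)`. -/
def sphere : SymRingData T where
  X n := tpow T n
  perm n τ := permSmash (𝟙_ C) n τ
  mul p q := (tpowAdd p q).inv
  one₀ := 𝟙 _
  one₁ := (λ_ T).inv ≫ (snoc T (𝟙_ C) 0).hom

end Sphere0

section Sphere

variable {C : Type*} [Category C] [MonoidalCategory C] {T : C}

lemma tpowAdd_succ_inv (a b : ℕ) : (tpowAdd (T := T) a (b + 1)).inv =
    tpow T a ◁ (snoc T (𝟙_ C) b).inv ≫ (α_ _ _ _).inv ≫ (tpowAdd a b).inv ▷ T ≫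
      (snoc T (𝟙_ C) (a + b)).hom := by
  have h {X Y Z : C} (e : X ≅ Y ⊗ Z) : (whiskerRightIso e T ≪≫ α_ _ _ _).inv =
      Y ◁ 𝟙 (Z ⊗ T) ≫ (α_ _ _ _).inv ≫ e.inv ▷ T ≫ 𝟙 (X ⊗ T) := by simp
  exact h _

variable [SymmetricCategory C]

lemma permSmash_swap_succ (V : C) : ∀ (n : ℕ) (a b : Fin n), (b : ℕ) = a + 1 →
    permSmash (T := T) V n (Equiv.swap a b) = adjSwap T V n a
  | 0, a, _, _ => a.elim0
  | n + 1, a, b, h => by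
    have ha : (a : ℕ) < n := by have := b.2; omega
    have h1 : a = Fin.castSucc ⟨a, ha⟩ := Fin.ext rfl
    have h2 : b = Fin.succ ⟨a, ha⟩ := Fin.ext h
    have := permSmash_swap (T := T) V n ⟨a, ha⟩
    rwa [← h1, ← h2] at this

lemma adjSwap_tpowAdd_left (p q i : ℕ) (h : i + 1 < p) :
    adjSwap T (𝟙_ C) p i ▷ tpow T q ≫ (tpowAdd p q).inv =
      (tpowAdd p q).inv ≫ adjSwap T (𝟙_ C) (p + q) i := by
  induction q with
  | zero => exact rightUnitor_naturality _
  | succ q ih =>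
    have : adjSwap T (𝟙_ C) (p + (q + 1)) i = grow (adjSwap T (𝟙_ C) (p + q) i) :=
      adjSwap_of_ne (n := p + q) _ (by omega)
    rw [tpowAdd_succ_inv, this, grow_eq, ← whisker_exchange_assoc, associator_inv_naturality_left_assoc, ← comp_whiskerRight_assoc, ih]
    simp

lemma topSwap_tpowAdd (p q : ℕ) : tpow T p ◁ topSwap T (𝟙_ C) q ≫ (tpowAdd p (q + 2)).inv =
    (tpowAdd p (q + 2)).inv ≫ topSwap T (𝟙_ C) (p + q) := by
  have h (X Y Z : C) (e : Z ≅ X ⊗ Y) : X ◁ swapLast T Y ≫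
      (whiskerRightIso (whiskerRightIso e T ≪≫ α_ _ _ _) T ≪≫ α_ _ _ _).inv =
      (whiskerRightIso (whiskerRightIso e T ≪≫ α_ _ _ _) T ≪≫ α_ _ _ _).inv ≫ swapLast T Z := by
    simp only [Iso.trans_inv, whiskerRightIso_inv, comp_whiskerRight, Category.assoc]
    rw [swapLast_natural]
    simp only [swapLast]
    monoidal
  exact h _ _ _ (tpowAdd p q)

lemma adjSwap_tpowAdd_right (p q j : ℕ) (h : j + 1 < q) :
    tpow T p ◁ adjSwap T (𝟙_ C) q j ≫ (tpowAdd p q).inv =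
      (tpowAdd p q).inv ≫ adjSwap T (𝟙_ C) (p + q) (p + j) := by
  induction q with
  | zero => omega
  | succ q ih =>
    by_cases hj : j + 1 = q
    · subst hj
      rw [adjSwap_last, topSwap_tpowAdd]
      exact congrArg _ (adjSwap_last _ _).symm
    · rw [tpowAdd_succ_inv, adjSwap_of_ne _ hj]
      have : adjSwap T (𝟙_ C) (p + (q + 1)) (p + j) = grow (adjSwap T (𝟙_ C) (p + q) (p + j)) :=
        adjSwap_of_ne (n := p + q) _ (by omega)
      rw [this, grow_eq, grow_eq]
      simp only [MonoidalCategory.whiskerLeft_comp, Category.assoc,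
        whiskerLeft_hom_inv_assoc, Iso.hom_inv_id_assoc]
      rw [associator_inv_naturality_middle_assoc, ← comp_whiskerRight_assoc, ih (by omega)]
      simp

lemma perm_induction {n : ℕ} {P : Equiv.Perm (Fin n) → Prop} (one : P 1)
    (swap : ∀ a b : Fin n, (b : ℕ) = a + 1 → P (Equiv.swap a b))
    (mul : ∀ σ τ, P σ → P τ → P (σ * τ)) (σ : Equiv.Perm (Fin n)) : P σ := by
  obtain _ | n := n
  · rwa [Subsingleton.elim σ 1]
  · have hσ : σ ∈ Submonoid.closure
        (Set.range fun i : Fin n ↦ Equiv.swap i.castSucc i.succ) := by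
      rw [Equiv.Perm.mclosure_swap_castSucc_succ]; trivial
    induction hσ using Submonoid.closure_induction with
    | mem σ h =>
      obtain ⟨i, rfl⟩ := h
      exact swap _ _ (by simp)
    | one => exact one
    | mul σ σ' _ _ h h' => exact mul _ _ h h'

lemma sumE_mul {p q : ℕ} (α α' : Equiv.Perm (Fin p)) (β β' : Equiv.Perm (Fin q)) :
    sumE (α * α') (β * β') = sumE α β * sumE α' β' := (sumE_trans _ _ _ _).symm

lemma sumE_swap_left {p q : ℕ} (a b : Fin p) : sumE (Equiv.swap a b) (1 : Equiv.Perm (Fin q)) =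
    Equiv.swap (Fin.castAdd q a) (Fin.castAdd q b) := by
  refine equiv_add_ext (fun i => ?_) (fun i => ?_)
  · rw [sumE_castAdd, (Fin.castAdd_injective p q).map_swap]
  · rw [sumE_natAdd, Equiv.swap_apply_of_ne_of_ne]
    · rfl
    · intro h; have := congrArg Fin.val h; simp at this; omega
    · intro h; have := congrArg Fin.val h; simp at this; omega

lemma sumE_swap_right {p q : ℕ} (a b : Fin q) : sumE (1 : Equiv.Perm (Fin p)) (Equiv.swap a b) =
    Equiv.swap (Fin.natAdd p a) (Fin.natAdd p b) := by
  refine equiv_add_ext (fun i => ?_) (fun i => ?_)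
  · rw [sumE_castAdd, Equiv.swap_apply_of_ne_of_ne]
    · rfl
    · intro h; have := congrArg Fin.val h; simp at this; omega
    · intro h; have := congrArg Fin.val h; simp at this; omega
  · rw [sumE_natAdd, (Fin.natAdd_injective q p).map_swap]

lemma permSmash_sumE_left (p q : ℕ) (α : Equiv.Perm (Fin p)) :
    permSmash (T := T) (𝟙_ C) p α ▷ tpow T q ≫ (tpowAdd p q).inv =
      (tpowAdd p q).inv ≫ permSmash (𝟙_ C) (p + q) (sumE α (1 : Equiv.Perm (Fin q))) := by
  induction α using perm_induction with
  | one =>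
    have : sumE (1 : Equiv.Perm (Fin p)) (1 : Equiv.Perm (Fin q)) = 1 := sumE_refl
    rw [this, permSmash_one, permSmash_one]; simp
  | swap a b h =>
    rw [sumE_swap_left, permSmash_swap_succ _ _ _ _ h, permSmash_swap_succ _ _ _ _ (by simpa),
      Fin.val_castAdd]
    exact adjSwap_tpowAdd_left _ _ _ (by omega)
  | mul σ τ hσ hτ =>
    have := sumE_mul σ τ (1 : Equiv.Perm (Fin q)) 1
    rw [mul_one] at this
    rw [this, permSmash_mul, permSmash_mul, comp_whiskerRight, Category.assoc, hσ, ← Category.assoc,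
      hτ, Category.assoc]

lemma permSmash_sumE_right (p q : ℕ) (β : Equiv.Perm (Fin q)) :
    tpow T p ◁ permSmash (T := T) (𝟙_ C) q β ≫ (tpowAdd p q).inv =
      (tpowAdd p q).inv ≫ permSmash (𝟙_ C) (p + q) (sumE (1 : Equiv.Perm (Fin p)) β) := by
  induction β using perm_induction with
  | one =>
    have : sumE (1 : Equiv.Perm (Fin p)) (1 : Equiv.Perm (Fin q)) = 1 := sumE_refl
    rw [this, permSmash_one, permSmash_one]; simp
  | swap a b h =>
    rw [sumE_swap_right, permSmash_swap_succ _ _ _ _ h,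
      permSmash_swap_succ _ _ _ _ (by simp [h]; omega), Fin.val_natAdd]
    exact adjSwap_tpowAdd_right _ _ _ (by omega)
  | mul σ τ hσ hτ =>
    have := sumE_mul (1 : Equiv.Perm (Fin p)) 1 σ τ
    rw [mul_one] at this
    rw [this, permSmash_mul, permSmash_mul, MonoidalCategory.whiskerLeft_comp, Category.assoc, hσ,
      ← Category.assoc, hτ, Category.assoc]

lemma sphere_mul_perm (p q : ℕ) (α : Equiv.Perm (Fin p)) (β : Equiv.Perm (Fin q)) :
    (permSmash (T := T) (𝟙_ C) p α ⊗ₘ permSmash (T := T) (𝟙_ C) q β) ≫ (tpowAdd p q).inv =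
      (tpowAdd p q).inv ≫ permSmash (𝟙_ C) (p + q) (sumE α β) := by
  have := sumE_mul (1 : Equiv.Perm (Fin p)) α β 1
  rw [one_mul, mul_one] at this
  rw [MonoidalCategory.tensorHom_def, Category.assoc, permSmash_sumE_right, ← Category.assoc,
    permSmash_sumE_left, this, permSmash_mul, Category.assoc]

lemma sphere_reindex_finCongr {a b : ℕ} (h : a = b) :
    (sphere T).reindex (finCongr h) = eqToHom (congrArg (tpow T) h) :=
  SymRingData.reindex_eqToHom h fun n => permSmash_one _ n

end Sphere

section Sphere

variable {C : Type*} [Category C] [MonoidalCategory C] {T : C}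

lemma eqToHom_snoc {a b : ℕ} (h : a = b) :
    (snoc T (𝟙_ C) a).hom ≫ eqToHom (congrArg (tpow T) (congrArg (· + 1) h)) =
      eqToHom (congrArg (tpow T) h) ▷ T ≫ (snoc T (𝟙_ C) b).hom := by
  subst h
  simp

lemma sphere_assoc (p q r : ℕ) :
    (tpowAdd p q).inv ▷ tpow T r ≫ (tpowAdd (p + q) r).inv ≫
      eqToHom (congrArg (tpow T) (Nat.add_assoc p q r)) =
    (α_ _ _ _).hom ≫ tpow T p ◁ (tpowAdd q r).inv ≫ (tpowAdd p (q + r)).inv := by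
  induction r with
  | zero =>
    change (tpowAdd (T := T) p q).inv ▷ 𝟙_ C ≫ (ρ_ _).hom ≫ 𝟙 _ = (α_ _ _ (𝟙_ C)).hom ≫
      tpow T p ◁ (ρ_ _).hom ≫ (tpowAdd p q).inv
    simp
  | succ r ih =>
    rw [tpowAdd_succ_inv, tpowAdd_succ_inv]
    have e : (tpowAdd (T := T) p (q + (r + 1))).inv = tpow T p ◁ (snoc T (𝟙_ C) (q + r)).inv ≫
      (α_ _ _ _).inv ≫ (tpowAdd p (q + r)).inv ▷ T ≫ (snoc T (𝟙_ C) (p + (q + r))).hom :=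
        tpowAdd_succ_inv p (q + r)
    rw [e]
    simp only [Category.assoc, MonoidalCategory.whiskerLeft_comp, whiskerLeft_hom_inv_assoc]
    rw [associator_inv_naturality_middle_assoc, ← comp_whiskerRight_assoc]
    have ih' := congrArg (fun f => (α_ _ _ _).inv ≫ f) ih
    simp only [Iso.inv_hom_id_assoc] at ih'
    rw [← ih']
    have e2 := eqToHom_snoc (T := T) (Nat.add_assoc p q r)
    simp only [comp_whiskerRight, Category.assoc]
    rw [← e2, ← whisker_exchange_assoc]
    monoidal

/-- The identification of `T^0` with the unit, which holds by definition. -/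
def tzero (T : C) : tpow T 0 ≅ 𝟙_ C := Iso.refl _

lemma sphere_one_mul (n : ℕ) : (tpowAdd (T := T) 0 n).inv ≫
    eqToHom (congrArg (tpow T) (Nat.zero_add n)) =
      (tzero T).hom ▷ tpow T n ≫ (λ_ (tpow T n)).hom := by
  induction n with
  | zero =>
    have h : (ρ_ (𝟙_ C)).hom ≫ 𝟙 _ = 𝟙 _ ▷ 𝟙_ C ≫ (λ_ (𝟙_ C)).hom := by simp [unitors_equal]
    exact h
  | succ n ih =>
    have e2 : (snoc T (𝟙_ C) (0 + n)).hom ≫ eqToHom (congrArg (tpow T) (Nat.zero_add (n + 1))) = _ :=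
      eqToHom_snoc (T := T) (Nat.zero_add n)
    rw [tpowAdd_succ_inv]
    simp only [Category.assoc]
    rw [e2, ← comp_whiskerRight_assoc, ih, ← cancel_epi (tpow T 0 ◁ (snoc T (𝟙_ C) n).hom),
      whiskerLeft_hom_inv_assoc, ← Category.assoc (_ ◁ _) ((tzero T).hom ▷ _), whisker_exchange,
      Category.assoc, leftUnitor_naturality]
    monoidal

/-- The unit isomorphism `T ≅ T^1`. -/
def tone (T : C) : T ≅ tpow T 1 := (λ_ T).symm ≪≫ snoc T (𝟙_ C) 0

lemma tpowAdd_one_inv (n : ℕ) : tpow T n ◁ (tone T).hom ≫ (tpowAdd n 1).inv =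
    (snoc T (𝟙_ C) n).hom := by
  have h (Y : C) : Y ◁ ((λ_ T).inv ≫ 𝟙 (𝟙_ C ⊗ T)) ≫
      (whiskerRightIso (ρ_ Y).symm T ≪≫ α_ _ _ _).inv = 𝟙 (Y ⊗ T) := by
    simp
  exact h (tpow T n)

variable [SymmetricCategory C]

lemma dropLast_sumE {n : ℕ} (τ : Equiv.Perm (Fin n)) :
    dropLast (sumE τ (1 : Equiv.Perm (Fin 1))) = τ ∧
      sumE τ (1 : Equiv.Perm (Fin 1)) (Fin.last n) = Fin.last n := by
  have h : sumE τ (1 : Equiv.Perm (Fin 1)) (Fin.last n) = Fin.last n :=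
    sumE_natAdd τ (1 : Equiv.Perm (Fin 1)) 0
  refine ⟨dropLast_eq fun j => ?_, h⟩
  rw [h, Fin.succAbove_last]
  exact (sumE_castAdd τ (1 : Equiv.Perm (Fin 1)) j).symm

lemma sphere_reindex_sumE {a b : ℕ} (e : Fin a ≃ Fin b) :
    (sphere T).reindex (sumE e (Equiv.refl (Fin 1))) =
      (snoc T (𝟙_ C) a).inv ≫ (sphere T).reindex e ▷ T ≫ (snoc T (𝟙_ C) b).hom := by
  obtain rfl : a = b := by simpa using Fintype.card_congr e
  rw [SymRingData.reindex_perm, SymRingData.reindex_perm]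
  obtain ⟨h1, h2⟩ := dropLast_sumE e
  have := permSmash_succ (T := T) (𝟙_ C) a (sumE e (1 : Equiv.Perm (Fin 1)))
  rw [h1, h2, Fin.val_last, moveLast_self, Category.comp_id, grow_eq] at this
  exact this

/-- The map `T^(n+1) ⟶ T^(1+n)` moving the last factor to the front. -/
def lastToFront (T : C) (n : ℕ) : tpow T (n + 1) ⟶ tpow T (1 + n) :=
  (sphere T).reindex (finAddFlip : Fin (n + 1) ≃ Fin (1 + n))

lemma lastToFront_zero : lastToFront T 0 = 𝟙 _ := by
  have : (finAddFlip : Fin (0 + 1) ≃ Fin (1 + 0)) = Equiv.refl (Fin 1) :=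
    Equiv.ext fun i => @Subsingleton.elim (Fin 1) _ _ _
  unfold lastToFront
  rw [this]
  exact ((sphere T).reindex_perm (a := 1) (Equiv.refl _)).trans (permSmash_one _ 1)

lemma lastToFront_succ (n : ℕ) : lastToFront T (n + 1) = topSwap T (𝟙_ C) n ≫
    (snoc T (𝟙_ C) (n + 1)).inv ≫ lastToFront T n ▷ T ≫ (snoc T (𝟙_ C) (1 + n)).hom := by
  have e : (finAddFlip : Fin (n + 1 + 1) ≃ Fin (1 + (n + 1))) =
      (Equiv.swap (Fin.natAdd n (0 : Fin 2)) (Fin.natAdd n (1 : Fin 2)) :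
        Equiv.Perm (Fin (n + 1 + 1))).trans
        (sumE (finAddFlip : Fin (n + 1) ≃ Fin (1 + n)) (Equiv.refl (Fin 1))) := by
    refine Equiv.ext fun k => ?_
    have hk := k.2
    rcases lt_trichotomy (k : ℕ) n with h | h | h
    · have h1 : k = Fin.castAdd 1 (Fin.castAdd 1 ⟨k, h⟩) := rfl
      rw [Equiv.trans_apply, Equiv.swap_apply_of_ne_of_ne]
      · rw [h1, finAddFlip_apply_castAdd, sumE_castAdd, finAddFlip_apply_castAdd]
        rfl
      · intro h2; have := congrArg Fin.val h2; simp at this; omega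
      · intro h2; have := congrArg Fin.val h2; simp at this; omega
    · have h1 : k = Fin.natAdd n (0 : Fin 2) := Fin.ext (by simpa using h)
      have h2 : (Fin.natAdd n (0 : Fin 2)) = Fin.castAdd 1 (Fin.natAdd n (0 : Fin 1)) := rfl
      have h3 : (Fin.natAdd n (1 : Fin 2)) = Fin.natAdd (n + 1) (0 : Fin 1) := rfl
      have h4 : (Fin.natAdd n (0 : Fin 2)) = Fin.castAdd 1 (Fin.last n) := rfl
      rw [Equiv.trans_apply, h1, Equiv.swap_apply_left, h3, sumE_natAdd]
      refine (finAddFlip_apply_castAdd (Fin.last n) 1).trans ?_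
      refine Fin.ext ?_
      simp
    · have h1 : k = Fin.natAdd n (1 : Fin 2) := Fin.ext (by simp; omega)
      have h2 : (Fin.natAdd n (0 : Fin 2)) = Fin.castAdd 1 (Fin.natAdd n (0 : Fin 1)) := rfl
      have h3 : (Fin.natAdd n (1 : Fin 2)) = Fin.natAdd (n + 1) (0 : Fin 1) := rfl
      rw [Equiv.trans_apply, h1, Equiv.swap_apply_right, h2, sumE_castAdd, h3,
        finAddFlip_apply_natAdd, finAddFlip_apply_natAdd]
      rfl
  unfold lastToFront
  rw [e, SymRingData.reindex_trans_of_perm_mul fun n σ τ => permSmash_mul _ n σ τ,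
    sphere_reindex_sumE, SymRingData.reindex_perm]
  have h : (sphere T).perm (n + 1 + 1)
      (Equiv.swap (Fin.natAdd n (0 : Fin 2)) (Fin.natAdd n (1 : Fin 2))) =
      topSwap T (𝟙_ C) n :=
    (permSmash_swap_succ (𝟙_ C) (n + 2) (Fin.natAdd n (0 : Fin 2)) (Fin.natAdd n 1) rfl).trans
      (adjSwap_last _ _)
  rw [h]
  rfl

lemma snoc_lastToFront (n : ℕ) : (snoc T (𝟙_ C) n).hom ≫ lastToFront T n =
    (β_ _ _).hom ≫ (tone T).hom ▷ tpow T n ≫ (tpowAdd 1 n).inv := by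
  induction n with
  | zero =>
    rw [lastToFront_zero, Category.comp_id]
    have h : 𝟙 (𝟙_ C ⊗ T) = (β_ (𝟙_ C) T).hom ≫ ((λ_ T).inv ≫ 𝟙 (𝟙_ C ⊗ T)) ▷ 𝟙_ C ≫
        (ρ_ (𝟙_ C ⊗ T)).hom := by
      simp [braiding_tensorUnit_left]
    exact h
  | succ n ih =>
    have h1 : (snoc T (𝟙_ C) (n + 1)).hom ≫ lastToFront T (n + 1) =
        (snoc T (𝟙_ C) n).inv ▷ T ≫ swapLast T _ ≫
          ((snoc T (𝟙_ C) n).hom ≫ lastToFront T n) ▷ T ≫ (snoc T (𝟙_ C) (1 + n)).hom := by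
      rw [lastToFront_succ, topSwap_eq]
      simp
    rw [h1, ih, tpowAdd_succ_inv, ← whisker_exchange_assoc,
      ← BraidedCategory.braiding_naturality_left_assoc, BraidedCategory.braiding_tensor_left_hom]
    simp only [swapLast]
    monoidal

lemma isSymRing_sphere : (sphere T).IsSymRing where
  perm_one n := permSmash_one _ n
  perm_mul n σ τ := permSmash_mul _ n σ τ
  mul_perm p q α β := sphere_mul_perm p q α β
  assoc p q r := by
    have := sphere_assoc (T := T) p q r
    rw [← sphere_reindex_finCongr] at this
    rw [Category.assoc]
    exact this
  mul_one n := (congrArg (· ≫ _) (MonoidalCategory.whiskerLeft_id _ _)).trans (Category.id_comp _)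
  one_mul n := by
    have := sphere_one_mul (T := T) n
    rw [← sphere_reindex_finCongr] at this
    have h2 : (sphere T).one₀ = (tzero T).inv := rfl
    have h3 : (sphere T).mul 0 n = (tpowAdd 0 n).inv := rfl
    rw [h2, h3]
    refine (congrArg (fun f => (tzero T).inv ▷ tpow T n ≫ f) this).trans ?_
    exact inv_hom_whiskerRight_assoc _ _ _
  one₁_central n := by
    have h1 : (sphere T).X n ◁ (sphere T).one₁ ≫ (sphere T).mul n 1 = (snoc T (𝟙_ C) n).hom :=
      tpowAdd_one_inv n
    rw [← Category.assoc, h1]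
    exact snoc_lastToFront (T := T) n

end Sphere

/-! ### Permutations of the factors of `T^n` -/

section TPerm

variable {C : Type*} [Category C] [MonoidalCategory C] [SymmetricCategory C] {T : C}

/-- The map `T^a ⟶ T^b` permuting the factors according to a bijection `Fin a ≃ Fin b`. -/
def tperm {a b : ℕ} (e : Fin a ≃ Fin b) : tpow T a ⟶ tpow T b := (sphere T).reindex e

lemma tperm_perm {a : ℕ} (e : Equiv.Perm (Fin a)) :
    tperm (T := T) e = permSmash (𝟙_ C) a e := SymRingData.reindex_perm _ e

lemma tperm_trans {a b c : ℕ} (e : Fin a ≃ Fin b) (e' : Fin b ≃ Fin c) :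
    tperm (T := T) (e.trans e') = tperm e ≫ tperm e' := isSymRing_sphere.reindex_trans e e'

lemma tperm_refl (a : ℕ) : tperm (T := T) (Equiv.refl (Fin a)) = 𝟙 _ :=
  isSymRing_sphere.reindex_refl a

lemma tperm_finCongr {a b : ℕ} (h : a = b) :
    tperm (T := T) (finCongr h) = eqToHom (congrArg (tpow T) h) := sphere_reindex_finCongr h

lemma tperm_comp_symm {a b : ℕ} (e : Fin a ≃ Fin b) : tperm (T := T) e ≫ tperm e.symm = 𝟙 _ :=
  isSymRing_sphere.reindex_comp_symm e

lemma tperm_split {a a' b b' : ℕ} (α : Fin a ≃ Fin a') (β : Fin b ≃ Fin b') :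
    tperm (sumE α β) ≫ (tpowAdd (T := T) a' b').hom =
      (tpowAdd a b).hom ≫ (tperm α ⊗ₘ tperm β) := by
  rw [← cancel_epi (tpowAdd a b).inv, ← cancel_mono (tpowAdd a' b').inv]
  simp only [Category.assoc, Iso.hom_inv_id, Category.comp_id, Iso.inv_hom_id_assoc]
  exact (isSymRing_sphere.mul_reindex α β).symm

lemma tperm_assoc (p q r : ℕ) :
    tperm (T := T) (assocE p q r) ≫ (tpowAdd p (q + r)).hom ≫ tpow T p ◁ (tpowAdd q r).hom =
      (tpowAdd (p + q) r).hom ≫ (tpowAdd p q).hom ▷ tpow T r ≫ (α_ _ _ _).hom := by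
  have h := sphere_assoc (T := T) p q r
  rw [← tperm_finCongr (Nat.add_assoc p q r)] at h
  rw [← cancel_epi (tpowAdd (p + q) r).inv, ← cancel_epi ((tpowAdd p q).inv ▷ tpow T r)]
  have h2 := congrArg (fun f => f ≫ (tpowAdd p (q + r)).hom ≫ tpow T p ◁ (tpowAdd q r).hom) h
  simp only [Category.assoc, Iso.inv_hom_id_assoc, whiskerLeft_inv_hom, Category.comp_id] at h2
  rw [h2]
  simp

lemma tperm_zero_add (n : ℕ) : (tpowAdd (T := T) 0 n).hom ≫ (tzero T).hom ▷ tpow T n ≫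
    (λ_ _).hom = tperm (finCongr (Nat.zero_add n)) := by
  rw [← sphere_one_mul, Iso.hom_inv_id_assoc, tperm_finCongr]

lemma tperm_add_zero (n : ℕ) : (tpowAdd (T := T) n 0).hom ≫ tpow T n ◁ (tzero T).hom ≫
    (ρ_ _).hom = tperm (finCongr (Nat.add_zero n)) := by
  have h : (ρ_ (tpow T n)).inv ≫ tpow T n ◁ 𝟙 (𝟙_ C) ≫ (ρ_ (tpow T n)).hom = 𝟙 _ := by simp
  exact h.trans (tperm_refl n).symm

lemma tperm_trans_assoc {a b c : ℕ} (e : Fin a ≃ Fin b) (e' : Fin b ≃ Fin c) {Z : C}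
    (h : tpow T c ⟶ Z) : tperm (T := T) e ≫ tperm e' ≫ h = tperm (e.trans e') ≫ h := by
  rw [tperm_trans, Category.assoc]

lemma whiskerLeft_tperm_trans {a b c : ℕ} (A : C) (e : Fin a ≃ Fin b) (e' : Fin b ≃ Fin c) {Z : C}
    (h : A ⊗ tpow T c ⟶ Z) :
    A ◁ tperm (T := T) e ≫ A ◁ tperm e' ≫ h = A ◁ tperm (e.trans e') ≫ h := by
  rw [tperm_trans, MonoidalCategory.whiskerLeft_comp, Category.assoc]

lemma sphere_isCentral_id (b : ℕ) : (sphere T).IsCentral (𝟙 ((sphere T).X b)) := by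
  induction b with
  | zero => exact isSymRing_sphere.isCentral_one₀
  | succ b ih =>
    have h := isSymRing_sphere.isCentral_star ih (isSymRing_sphere (T := T)).one₁_central
    have h2 : (snoc T (𝟙_ C) b).inv ≫ (sphere T).star (𝟙 ((sphere T).X b)) (sphere T).one₁ =
        𝟙 (tpow T (b + 1)) := by
      have h3 : (sphere T).star (𝟙 ((sphere T).X b)) (sphere T).one₁ =
          tpow T b ◁ (tone T).hom ≫ (tpowAdd b 1).inv := by
        rw [SymRingData.star, id_tensorHom]; rfl
      exact (congrArg (fun f => (snoc T (𝟙_ C) b).inv ≫ f) (h3.trans (tpowAdd_one_inv b))).trans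
        (snoc T (𝟙_ C) b).inv_hom_id
    have := h.comp (snoc T (𝟙_ C) b).inv
    exact h2 ▸ this

lemma tperm_flip (a b : ℕ) : tperm finAddFlip ≫ (tpowAdd (T := T) b a).hom =
    (tpowAdd a b).hom ≫ (β_ _ _).hom := by
  have h := (sphere_isCentral_id (T := T) b).star_comm (𝟙 ((sphere T).X a))
  simp only [SymRingData.star, id_tensorHom_id] at h
  rw [← cancel_epi (tpowAdd a b).inv, ← cancel_mono (tpowAdd b a).inv]
  simp only [Category.assoc, Iso.hom_inv_id, Category.comp_id, Iso.inv_hom_id_assoc]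
  have h2 : 𝟙 ((sphere T).X a ⊗ (sphere T).X b) ≫ (tpowAdd a b).inv ≫ tperm finAddFlip =
    (β_ (tpow T a) (tpow T b)).hom ≫ 𝟙 ((sphere T).X b ⊗ (sphere T).X a) ≫ (tpowAdd b a).inv :=
      (Category.assoc _ _ _).symm.trans h
  exact ((Category.id_comp _).symm.trans h2).trans (congrArg _ (Category.id_comp _))

lemma sumE_finCongr_refl {a a' b : ℕ} (h : a = a') :
    sumE (finCongr h) (Equiv.refl (Fin b)) = finCongr (by rw [h]) := by
  subst h; exact sumE_refl

lemma sumE_refl_finCongr {a b b' : ℕ} (h : b = b') :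
    sumE (Equiv.refl (Fin a)) (finCongr h) = finCongr (by rw [h]) := by
  subst h; exact sumE_refl

/-- The bijection exchanging the two middle blocks. -/
def midSwap (m n p q : ℕ) : Fin (m + n + (p + q)) ≃ Fin (m + p + (n + q)) :=
  (assocE m n (p + q)).trans ((sumE (Equiv.refl _) ((assocE n p q).symm.trans
    ((sumE finAddFlip (Equiv.refl _)).trans (assocE p n q)))).trans (assocE m p (n + q)).symm)

lemma midSwap₁ (m n p q : ℕ) (i : Fin m) : midSwap m n p q (Fin.castAdd _ (Fin.castAdd _ i)) =
    Fin.castAdd _ (Fin.castAdd _ i) := by simp [midSwap]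

lemma midSwap₂ (m n p q : ℕ) (i : Fin n) : midSwap m n p q (Fin.castAdd _ (Fin.natAdd _ i)) =
    Fin.natAdd _ (Fin.castAdd _ i) := by simp [midSwap]

lemma midSwap₃ (m n p q : ℕ) (i : Fin p) : midSwap m n p q (Fin.natAdd _ (Fin.castAdd _ i)) =
    Fin.castAdd _ (Fin.natAdd _ i) := by simp [midSwap]

lemma midSwap₄ (m n p q : ℕ) (i : Fin q) : midSwap m n p q (Fin.natAdd _ (Fin.natAdd _ i)) =
    Fin.natAdd _ (Fin.natAdd _ i) := by simp [midSwap]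

end TPerm

/-! ### Products of maps with several factors -/

namespace SymRingData

section

variable {C : Type*} [Category C] [MonoidalCategory C] [BraidedCategory C] {T : C}
  {R : SymRingData T}

lemma IsSymRing.star_one' (hR : R.IsSymRing) {A : C} {p : ℕ} (f : A ⟶ R.X p) :
    R.star f R.one₀ ≫ R.reindex (finCongr (Nat.add_zero p)) = (ρ_ A).hom ≫ f := by
  rw [← hR.star_one]
  exact (congrArg (_ ≫ ·) (hR.reindex_refl p)).trans (Category.comp_id _)

end

variable {C : Type*} [Category C] [MonoidalCategory C] [SymmetricCategory C] {T : C}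
  {R : SymRingData T}

/-- The four-fold product with the two middle factors exchanged, the third one being central. -/
lemma IsSymRing.star_star_star (hR : R.IsSymRing) {A B Y Z : C} {m n p q : ℕ} (u : A ⟶ R.X m)
    (v : B ⟶ R.X n) {y : Y ⟶ R.X p} (hy : R.IsCentral y) (z : Z ⟶ R.X q) :
    R.star (R.star u v) (R.star y z) ≫ R.reindex (midSwap m n p q) =
      tensorμ A B Y Z ≫ R.star (R.star u y) (R.star v z) := by
  have h1 : R.star v (R.star y z) ≫ R.reindex ((assocE n p q).symm.trans
      ((sumE finAddFlip (Equiv.refl _)).trans (assocE p n q))) =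
      (α_ _ _ _).inv ≫ (β_ B Y).hom ▷ Z ≫ (α_ _ _ _).hom ≫ R.star y (R.star v z) := by
    rw [hR.reindex_trans, hR.star_assoc', Category.assoc, Category.assoc, hR.reindex_trans_assoc,
      Equiv.self_trans_symm, hR.reindex_refl, Category.id_comp, hR.reindex_trans,
      ← Category.assoc (R.star _ z), ← hR.star_reindex_left, hy.star_comm, star_comp_left,
      Category.assoc, hR.star_assoc]
  rw [midSwap, hR.reindex_trans, ← Category.assoc, hR.star_assoc, Category.assoc,
    hR.reindex_trans, ← Category.assoc (R.star u _), ← hR.star_reindex_right, h1]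
  simp only [star_comp_right, Category.assoc]
  rw [hR.star_assoc']
  simp only [Category.assoc, hR.reindex_comp_symm, Category.comp_id]
  simp only [tensorμ, Category.assoc]

end SymRingData

section TPermSum

variable {C : Type*} [Category C] [MonoidalCategory C] [SymmetricCategory C] {T : C}

lemma tperm_midSwap (m n p q : ℕ) : tperm (T := T) (midSwap m n p q) ≫
    (tpowAdd (m + p) (n + q)).hom ≫ ((tpowAdd m p).hom ⊗ₘ (tpowAdd n q).hom) =
      (tpowAdd (m + n) (p + q)).hom ≫ ((tpowAdd m n).hom ⊗ₘ (tpowAdd p q).hom) ≫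
        tensorμ _ _ _ _ := by
  have h := isSymRing_sphere.star_star_star (𝟙 ((sphere T).X m)) (𝟙 ((sphere T).X n))
    (sphere_isCentral_id p) (𝟙 ((sphere T).X q))
  have hs (p q : ℕ) : (sphere T).star (𝟙 ((sphere T).X p)) (𝟙 ((sphere T).X q)) =
      (tpowAdd p q).inv := by
    rw [SymRingData.star, id_tensorHom_id]
    exact Category.id_comp _
  rw [hs, hs, hs, hs] at h
  have h2 : (((tpowAdd m n).inv ⊗ₘ (tpowAdd p q).inv) ≫ (tpowAdd (m + n) (p + q)).inv) ≫
      tperm (T := T) (midSwap m n p q) = tensorμ _ _ _ _ ≫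
      ((tpowAdd m p).inv ⊗ₘ (tpowAdd n q).inv) ≫ (tpowAdd (m + p) (n + q)).inv := by
    exact h
  have h3 : tperm (T := T) (midSwap m n p q) = (tpowAdd (m + n) (p + q)).hom ≫
      ((tpowAdd m n).hom ⊗ₘ (tpowAdd p q).hom) ≫ tensorμ _ _ _ _ ≫
      ((tpowAdd m p).inv ⊗ₘ (tpowAdd n q).inv) ≫ (tpowAdd (m + p) (n + q)).inv := by
    rw [← h2]; simp
  rw [h3]
  simp

end TPermSum

/-- The middle interchange is compatible with the symmetry. -/
lemma tensorμ_braiding {C : Type*} [Category C] [MonoidalCategory C] [SymmetricCategory C]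
    (A B P Q : C) : tensorμ A B P Q ≫ (β_ _ _).hom =
      ((β_ A B).hom ⊗ₘ (β_ P Q).hom) ≫ tensorμ B A Q P := by
  rw [MonoidalCategory.tensorHom_def]
  simp only [tensorμ, BraidedCategory.braiding_tensor_left_hom,
    BraidedCategory.braiding_tensor_right_hom]
  trans (α_ A B (P ⊗ Q)).hom ≫ A ◁ (α_ B P Q).inv ≫ A ◁ ((β_ B P).hom ≫ (β_ P B).hom) ▷ Q ≫
    A ◁ (α_ B P Q).hom ≫ (α_ A B _).inv ≫ (β_ A B).hom ▷ (P ⊗ Q) ≫ (α_ B A (P ⊗ Q)).hom ≫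
    B ◁ A ◁ (β_ P Q).hom ≫ B ◁ (α_ A Q P).inv ≫ B ◁ (β_ A Q).hom ▷ P ≫ B ◁ (α_ Q A P).hom ≫
      (α_ B Q (A ⊗ P)).inv
  · monoidal
  · rw [SymmetricCategory.symmetry]
    monoidal

namespace SymRingData

variable {C : Type*} [Category C] [MonoidalCategory C] [SymmetricCategory C] {T : C}
  {R : SymRingData T}

/-- The product `(A ∧ B) ∧ T^(a+b) ⟶ X (m + n)` of maps `f : A ∧ T^a ⟶ X m` and
`g : B ∧ T^b ⟶ X n`. -/
def conv {A B : C} {a b m n : ℕ} (f : A ⊗ tpow T a ⟶ R.X m) (g : B ⊗ tpow T b ⟶ R.X n) :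
    (A ⊗ B) ⊗ tpow T (a + b) ⟶ R.X (m + n) :=
  (A ⊗ B) ◁ (tpowAdd a b).hom ≫ tensorμ A B _ _ ≫ R.star f g

lemma conv_comp {A A' B B' : C} {a b a' b' m n : ℕ} (u : A' ⟶ A) (v : B' ⟶ B)
    (α : Fin a' ≃ Fin a) (β : Fin b' ≃ Fin b)
    (f : A ⊗ tpow T a ⟶ R.X m) (g : B ⊗ tpow T b ⟶ R.X n) :
    conv ((u ⊗ₘ tperm α) ≫ f) ((v ⊗ₘ tperm β) ≫ g) =
      ((u ⊗ₘ v) ⊗ₘ tperm (sumE α β)) ≫ conv f g := by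
  simp only [conv]
  rw [star_comp, ← tensorμ_natural_assoc, ← id_tensorHom, ← id_tensorHom,
    tensorHom_comp_tensorHom_assoc, tensorHom_comp_tensorHom_assoc, tperm_split, Category.id_comp,
    Category.comp_id]

lemma conv_comp_left {A A' B : C} {a b a' m n : ℕ} (u : A' ⟶ A)
    (α : Fin a' ≃ Fin a) (f : A ⊗ tpow T a ⟶ R.X m) (g : B ⊗ tpow T b ⟶ R.X n) :
    conv ((u ⊗ₘ tperm α) ≫ f) g =
      ((u ▷ B) ⊗ₘ tperm (sumE α (Equiv.refl _))) ≫ conv f g := by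
  have := conv_comp u (𝟙 B) α (Equiv.refl _) f g
  rwa [tperm_refl, id_tensorHom_id, Category.id_comp, tensorHom_id] at this

lemma conv_comp_right {A B B' : C} {a b b' m n : ℕ} (v : B' ⟶ B)
    (β : Fin b' ≃ Fin b) (f : A ⊗ tpow T a ⟶ R.X m) (g : B ⊗ tpow T b ⟶ R.X n) :
    conv f ((v ⊗ₘ tperm β) ≫ g) =
      ((A ◁ v) ⊗ₘ tperm (sumE (Equiv.refl _) β)) ≫ conv f g := by
  have := conv_comp (𝟙 A) v (Equiv.refl _) β f g
  rwa [tperm_refl, id_tensorHom_id, Category.id_comp, id_tensorHom] at this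

lemma conv_whisker_left {A A' B : C} {a b m n : ℕ} (u : A' ⟶ A)
    (f : A ⊗ tpow T a ⟶ R.X m) (g : B ⊗ tpow T b ⟶ R.X n) :
    conv (u ▷ _ ≫ f) g = u ▷ B ▷ _ ≫ conv f g := by
  have := conv_comp_left u (Equiv.refl _) f g
  rwa [sumE_refl, tperm_refl, tensorHom_id, tperm_refl, tensorHom_id] at this

lemma conv_whisker_right {A B B' : C} {a b m n : ℕ} (v : B' ⟶ B)
    (f : A ⊗ tpow T a ⟶ R.X m) (g : B ⊗ tpow T b ⟶ R.X n) :
    conv f (v ▷ _ ≫ g) = (A ◁ v) ▷ _ ≫ conv f g := by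
  have := conv_comp_right v (Equiv.refl _) f g
  rwa [sumE_refl, tperm_refl, tensorHom_id, tperm_refl, tensorHom_id] at this

namespace IsSymRing

variable (hR : R.IsSymRing)
include hR

lemma conv_reindex {A B : C} {a b m n m' n' : ℕ} (f : A ⊗ tpow T a ⟶ R.X m)
    (g : B ⊗ tpow T b ⟶ R.X n) (γ : Fin m ≃ Fin m') (δ : Fin n ≃ Fin n') :
    conv (f ≫ R.reindex γ) (g ≫ R.reindex δ) = conv f g ≫ R.reindex (sumE γ δ) := by
  simp only [conv, hR.star_reindex, Category.assoc]

lemma conv_reindex_left {A B : C} {a b m n m' : ℕ} (f : A ⊗ tpow T a ⟶ R.X m)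
    (g : B ⊗ tpow T b ⟶ R.X n) (γ : Fin m ≃ Fin m') :
    conv (f ≫ R.reindex γ) g = conv f g ≫ R.reindex (sumE γ (Equiv.refl _)) := by
  simp only [conv, hR.star_reindex_left, Category.assoc]

lemma conv_reindex_right {A B : C} {a b m n n' : ℕ} (f : A ⊗ tpow T a ⟶ R.X m)
    (g : B ⊗ tpow T b ⟶ R.X n) (δ : Fin n ≃ Fin n') :
    conv f (g ≫ R.reindex δ) = conv f g ≫ R.reindex (sumE (Equiv.refl _) δ) := by
  simp only [conv, hR.star_reindex_right, Category.assoc]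

lemma conv_tperm_reindex_left {A B : C} {a b a' m n m' : ℕ} (f : A ⊗ tpow T a ⟶ R.X m)
    (g : B ⊗ tpow T b ⟶ R.X n) (α : Fin a' ≃ Fin a) (γ : Fin m ≃ Fin m') :
    conv (A ◁ tperm α ≫ f ≫ R.reindex γ) g = (A ⊗ B) ◁ tperm (sumE α (Equiv.refl _)) ≫
      conv f g ≫ R.reindex (sumE γ (Equiv.refl _)) := by
  have h := conv_comp_left (𝟙 A) α f g
  rw [id_whiskerRight, id_tensorHom, id_tensorHom] at h
  rw [← Category.assoc, hR.conv_reindex_left, h, Category.assoc]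

lemma conv_tperm_reindex_right {A B : C} {a b b' m n n' : ℕ} (f : A ⊗ tpow T a ⟶ R.X m)
    (g : B ⊗ tpow T b ⟶ R.X n) (β : Fin b' ≃ Fin b) (δ : Fin n ≃ Fin n') :
    conv f (B ◁ tperm β ≫ g ≫ R.reindex δ) = (A ⊗ B) ◁ tperm (sumE (Equiv.refl _) β) ≫
      conv f g ≫ R.reindex (sumE (Equiv.refl _) δ) := by
  have h := conv_comp_right (𝟙 B) β f g
  rw [MonoidalCategory.whiskerLeft_id, id_tensorHom, id_tensorHom] at h
  rw [← Category.assoc, hR.conv_reindex_right, h, Category.assoc]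

lemma conv_assoc {A B D : C} {a b d m n p : ℕ} (f : A ⊗ tpow T a ⟶ R.X m)
    (g : B ⊗ tpow T b ⟶ R.X n) (h : D ⊗ tpow T d ⟶ R.X p) :
    conv (conv f g) h ≫ R.reindex (assocE m n p) =
      ((α_ A B D).hom ⊗ₘ tperm (assocE a b d)) ≫ conv f (conv g h) := by
  have hm := associator_monoidal A B D (tpow T a) (tpow T b) (tpow T d)
  simp only [conv, star_comp_left, star_comp_right, Category.assoc, hR.star_assoc]
  have e1 := tensorμ_natural_right A (B ⊗ D) (𝟙 (tpow T a)) (tpowAdd (T := T) b d).hom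
  have e2 := tensorμ_natural_right (A ⊗ B) D (tpowAdd (T := T) a b).hom (𝟙 (tpow T d))
  simp only [MonoidalCategory.whiskerLeft_id, id_tensorHom, tensorHom_id] at e1 e2
  rw [← reassoc_of% e1, ← reassoc_of% e2, reassoc_of% hm, ← id_tensorHom, ← id_tensorHom,
    ← id_tensorHom (A ⊗ B ⊗ D), ← id_tensorHom (A ⊗ B ⊗ D)]
  simp only [tensorHom_comp_tensorHom_assoc, Category.id_comp, Category.comp_id]
  rw [tperm_assoc]

omit hR in
lemma conv_comm {A B : C} {a b m n : ℕ} (f : A ⊗ tpow T a ⟶ R.X m)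
    {y : B ⊗ tpow T b ⟶ R.X n} (hy : R.IsCentral y) :
    conv f y ≫ R.reindex finAddFlip =
      ((β_ A B).hom ⊗ₘ tperm finAddFlip) ≫ conv y f := by
  have h : tensorμ A B (tpow T a) (tpow T b) ≫ (β_ _ _).hom =
      ((β_ A B).hom ⊗ₘ (β_ (tpow T a) (tpow T b)).hom) ≫ tensorμ B A _ _ := by
    exact tensorμ_braiding _ _ _ _
  simp only [conv, Category.assoc]
  rw [hy.star_comm, reassoc_of% h, ← id_tensorHom, ← id_tensorHom]
  simp only [tensorHom_comp_tensorHom_assoc, Category.id_comp, Category.comp_id]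
  rw [tperm_flip]

lemma conv_one {A : C} {a m : ℕ} (f : A ⊗ tpow T a ⟶ R.X m) :
    conv f (𝟙_ C ◁ (tzero T).hom ≫ (λ_ _).hom ≫ R.one₀) ≫ R.reindex (finCongr (Nat.add_zero m)) =
      ((ρ_ A).hom ⊗ₘ tperm (finCongr (Nat.add_zero a))) ≫ f := by
  have e1 := tensorμ_natural_right A (𝟙_ C) (𝟙 (tpow T a)) (tzero T).hom
  simp only [MonoidalCategory.whiskerLeft_id, id_tensorHom] at e1
  have e2 := rightUnitor_monoidal A (tpow T a)
  have e3 : ((ρ_ A).hom ⊗ₘ (tpowAdd (T := T) a 0).hom ≫ tpow T a ◁ (tzero T).hom ≫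
      (ρ_ (tpow T a)).hom) = (A ⊗ 𝟙_ C) ◁ (tpowAdd a 0).hom ≫
      (A ⊗ 𝟙_ C) ◁ tpow T a ◁ (tzero T).hom ≫ ((ρ_ A).hom ⊗ₘ (ρ_ (tpow T a)).hom) := by
    rw [← id_tensorHom (A ⊗ 𝟙_ C), ← id_tensorHom (A ⊗ 𝟙_ C), tensorHom_comp_tensorHom,
      tensorHom_comp_tensorHom, Category.id_comp, Category.id_comp]
  rw [conv, star_comp_right, star_comp_right, Category.assoc, Category.assoc, Category.assoc,
    Category.assoc, hR.star_one', ← reassoc_of% e1, ← tperm_add_zero, e3, e2]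
  simp only [Category.assoc]

lemma one_conv {A : C} {a m : ℕ} (f : A ⊗ tpow T a ⟶ R.X m) :
    conv (𝟙_ C ◁ (tzero T).hom ≫ (λ_ _).hom ≫ R.one₀) f ≫ R.reindex (finCongr (Nat.zero_add m)) =
      ((λ_ A).hom ⊗ₘ tperm (finCongr (Nat.zero_add a))) ≫ f := by
  have e1 := tensorμ_natural_right (𝟙_ C) A (tzero T).hom (𝟙 (tpow T a))
  simp only [MonoidalCategory.whiskerLeft_id, tensorHom_id] at e1
  rw [conv, star_comp_left, star_comp_left, Category.assoc, Category.assoc, Category.assoc,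
    Category.assoc, hR.one_star, ← reassoc_of% e1, ← tperm_zero_add]
  have e2 := leftUnitor_monoidal A (tpow T a)
  have e3 : ((λ_ A).hom ⊗ₘ (tpowAdd (T := T) 0 a).hom ≫ (tzero T).hom ▷ tpow T a ≫
      (λ_ (tpow T a)).hom) = (𝟙_ C ⊗ A) ◁ (tpowAdd 0 a).hom ≫
      (𝟙_ C ⊗ A) ◁ (tzero T).hom ▷ tpow T a ≫ ((λ_ A).hom ⊗ₘ (λ_ (tpow T a)).hom) := by
    rw [← id_tensorHom, ← id_tensorHom, tensorHom_comp_tensorHom, tensorHom_comp_tensorHom,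
      Category.id_comp, Category.id_comp]
  rw [e3, e2]
  simp only [Category.assoc]

end IsSymRing

end SymRingData

/-! ### Block permutations -/

section Blocks

/-- The element `i` of the block `j` in `Fin (s * p)`, which consists of `p` blocks of length `s`. -/
def mkB {s p : ℕ} (j : Fin p) (i : Fin s) : Fin (s * p) :=
  finCongr (Nat.mul_comm p s) (finProdFinEquiv (j, i))

/-- The bijection permuting consecutive blocks of length `s`. -/
def blockE (s : ℕ) {p q : ℕ} (e : Fin p ≃ Fin q) : Fin (s * p) ≃ Fin (s * q) :=
  (((finProdFinEquiv (m := p) (n := s)).trans (finCongr (Nat.mul_comm p s))).symm.trans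
    (Equiv.prodCongr e (Equiv.refl _))).trans
    ((finProdFinEquiv (m := q) (n := s)).trans (finCongr (Nat.mul_comm q s)))

lemma blockPerm_eq_blockE (s : ℕ) {p : ℕ} (γ : Equiv.Perm (Fin p)) :
    blockPerm s γ = blockE s γ := rfl

@[simp] lemma blockE_mkB {s p q : ℕ} (e : Fin p ≃ Fin q) (j : Fin p) (i : Fin s) :
    blockE s e (mkB j i) = mkB (e j) i := by
  simp [blockE, mkB]

lemma exists_mkB {s p : ℕ} (k : Fin (s * p)) : ∃ (j : Fin p) (i : Fin s), k = mkB j i := by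
  refine ⟨(finProdFinEquiv.symm (finCongr (Nat.mul_comm s p) k)).1,
    (finProdFinEquiv.symm (finCongr (Nat.mul_comm s p) k)).2, ?_⟩
  simp only [mkB, Prod.mk.eta, Equiv.apply_symm_apply]
  rfl

lemma equiv_mul_ext {s p : ℕ} {X : Type*} {e e' : Fin (s * p) ≃ X}
    (h : ∀ (j : Fin p) (i : Fin s), e (mkB j i) = e' (mkB j i)) : e = e' := by
  ext k
  obtain ⟨j, i, rfl⟩ := exists_mkB k
  exact h j i

@[simp] lemma mkB_val {s p : ℕ} (j : Fin p) (i : Fin s) : (mkB j i : ℕ) = i + s * j := by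
  simp [mkB]

@[simp] lemma mkB_castAdd {s p q : ℕ} (j : Fin p) (i : Fin s) (h : s * (p + q) = s * p + s * q) :
    Fin.cast h (mkB (Fin.castAdd q j) i) = Fin.castAdd (s * q) (mkB j i) :=
  Fin.ext (by simp)

@[simp] lemma mkB_natAdd {s p q : ℕ} (j : Fin q) (i : Fin s) (h : s * (p + q) = s * p + s * q) :
    Fin.cast h (mkB (Fin.natAdd p j) i) = Fin.natAdd (s * p) (mkB j i) :=
  Fin.ext (by simp [Nat.mul_add]; omega)

@[simp] lemma castAdd_mkB {s p q : ℕ} (j : Fin p) (i : Fin s) (h : s * p + s * q = s * (p + q)) :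
    Fin.cast h (Fin.castAdd (s * q) (mkB j i)) = mkB (Fin.castAdd q j) i :=
  Fin.ext (by simp)

@[simp] lemma natAdd_mkB {s p q : ℕ} (j : Fin q) (i : Fin s) (h : s * p + s * q = s * (p + q)) :
    Fin.cast h (Fin.natAdd (s * p) (mkB j i)) = mkB (Fin.natAdd p j) i :=
  Fin.ext (by simp [Nat.mul_add]; omega)

lemma blockE_trans (s : ℕ) {p q r : ℕ} (e : Fin p ≃ Fin q) (e' : Fin q ≃ Fin r) :
    blockE s (e.trans e') = (blockE s e).trans (blockE s e') :=
  equiv_mul_ext fun j i => by simp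

@[simp] lemma blockE_refl (s p : ℕ) : blockE s (Equiv.refl (Fin p)) = Equiv.refl _ :=
  equiv_mul_ext fun j i => by simp

lemma blockE_finCongr (s : ℕ) {p q : ℕ} (h : p = q) :
    blockE s (finCongr h) = finCongr (by rw [h]) := by
  subst h; exact blockE_refl s p

lemma blockE_sumE (s : ℕ) {p p' q q' : ℕ} (α : Fin p ≃ Fin p') (β : Fin q ≃ Fin q') :
    (blockE s (sumE α β)).trans (finCongr (Nat.mul_add s p' q')) =
      (finCongr (Nat.mul_add s p q)).trans (sumE (blockE s α) (blockE s β)) := by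
  refine equiv_mul_ext fun j i => ?_
  refine Fin.addCases (fun j => ?_) (fun j => ?_) j <;> simp

lemma blockE_finAddFlip (s p q : ℕ) :
    (blockE s (finAddFlip : Fin (p + q) ≃ Fin (q + p))).trans (finCongr (Nat.mul_add s q p)) =
      (finCongr (Nat.mul_add s p q)).trans finAddFlip := by
  refine equiv_mul_ext fun j i => ?_
  refine Fin.addCases (fun j => ?_) (fun j => ?_) j <;> simp

@[simp] lemma shuffle_castAdd (m p : ℕ) (k : Fin p) :
    shuffle m p (Fin.castAdd (m * p) k) = mkB k (Fin.castAdd m 0) := by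
  apply Fin.ext
  simp [shuffle, Trans.trans]

@[simp] lemma shuffle_natAdd (m p : ℕ) (i : Fin p) (j : Fin m) :
    shuffle m p (Fin.natAdd p (mkB i j)) = mkB i (Fin.natAdd 1 j) := by
  apply Fin.ext
  simp [shuffle, Trans.trans, mkB]

lemma shuffle_blockE (m : ℕ) {p q : ℕ} (e : Fin p ≃ Fin q) :
    (shuffle m p).trans (blockE (1 + m) e) = (sumE e (blockE m e)).trans (shuffle m q) := by
  refine equiv_add_ext (fun i => ?_) (fun i => ?_)
  · simp
  · obtain ⟨j, i, rfl⟩ := exists_mkB i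
    simp

lemma midSwap_shuffle (m p q : ℕ) :
    (midSwap p q (m * p) (m * q)).trans ((sumE (shuffle m p) (shuffle m q)).trans
      (finCongr (Nat.mul_add (1 + m) p q).symm)) =
    (sumE (Equiv.refl _) (finCongr (Nat.mul_add m p q).symm)).trans (shuffle m (p + q)) := by
  refine equiv_add_ext (fun i => ?_) (fun i => ?_)
  · refine Fin.addCases (fun i => ?_) (fun i => ?_) i
    · simp [midSwap₁]
    · simp [midSwap₂]
  · refine Fin.addCases (fun i => ?_) (fun i => ?_) i
    · obtain ⟨j, i, rfl⟩ := exists_mkB i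
      simp [midSwap₃]
    · obtain ⟨j, i, rfl⟩ := exists_mkB i
      simp [midSwap₄]

end Blocks

/-! ### Powers of a central map -/

namespace SymRingData

variable {C : Type*} [Category C] [MonoidalCategory C] [SymmetricCategory C] {T : C}
  {R : SymRingData T} {l m : ℕ} (x : tpow T l ⟶ R.X m)

omit [SymmetricCategory C] in
lemma pow_succ (p : ℕ) :
    R.pow x (p + 1) = (tpowAdd (l * p) l).hom ≫ R.star (R.pow x p) x := rfl

namespace IsSymRing

variable (hR : R.IsSymRing)
include hR

lemma pow_zero : R.pow x 0 = tperm (finCongr (Nat.mul_zero l)) ≫ (tzero T).hom ≫ R.one₀ ≫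
    R.reindex (finCongr (Nat.mul_zero m).symm) := by
  have h (f : tpow T 0 ⟶ R.X 0) : f = tperm (Equiv.refl _) ≫ f ≫ R.reindex (Equiv.refl _) := by
    rw [tperm_refl, hR.reindex_refl, Category.id_comp, Category.comp_id]
  have h' : (tzero T).hom ≫ R.one₀ = R.one₀ := Category.id_comp _
  rw [← Category.assoc (tzero T).hom, h']
  exact h _

lemma isCentral_pow {x : tpow T l ⟶ R.X m} (hx : R.IsCentral x) (p : ℕ) :
    R.IsCentral (R.pow x p) := by
  induction p with
  | zero =>
    rw [hR.pow_zero]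
    exact ((hR.isCentral_reindex hR.isCentral_one₀ _).comp _).comp _
  | succ p ih => exact (hR.isCentral_star ih hx).comp _

lemma pow_add (p q : ℕ) : R.pow x (p + q) ≫ R.reindex (finCongr (Nat.mul_add m p q)) =
    tperm (finCongr (Nat.mul_add l p q)) ≫ (tpowAdd (l * p) (l * q)).hom ≫
      R.star (R.pow x p) (R.pow x q) := by
  induction q with
  | zero =>
    have h3 := tperm_split (T := T) (Equiv.refl (Fin (l * p))) (finCongr (Nat.mul_zero l))
    rw [tperm_refl, id_tensorHom] at h3
    have h4 : R.star (R.pow x p) R.one₀ = (ρ_ _).hom ≫ R.pow x p ≫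
        R.reindex (finCongr (Nat.add_zero (m * p)).symm) := by
      rw [← Category.assoc, ← hR.star_one', Category.assoc, ← hR.reindex_trans, finCongr_trans',
        hR.reindex_finCongr_self, Category.comp_id]
    rw [hR.pow_zero, star_comp_right, star_comp_right, hR.star_reindex_right, h4,
      ← reassoc_of% h3, ← Category.assoc (tpow T (l * p) ◁ _), ← Category.assoc (tpowAdd _ _).hom,
      Category.assoc, Category.assoc]
    have h5 := congrArg (· ≫ R.pow x p ≫ R.reindex (finCongr (Nat.add_zero (m * p)).symm) ≫
      R.reindex (sumE (Equiv.refl (Fin (m * p))) (finCongr (Nat.mul_zero m).symm)))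
      (tperm_add_zero (T := T) (l * p))
    simp only [Category.assoc] at h5 ⊢
    rw [h5, tperm_trans_assoc, tperm_trans_assoc, ← hR.reindex_trans]
    simp only [sumE_refl_finCongr, finCongr_trans']
    exact (congrArg (R.pow x p ≫ ·) rfl).trans ((Category.id_comp _).symm.trans
      (congrArg (· ≫ R.pow x p ≫ R.reindex (finCongr (Nat.mul_add m p 0)))
        (tperm_refl (l * p)).symm))
  | succ q ih =>
    have h1 : R.pow x (p + (q + 1)) =
      (tpowAdd (l * (p + q)) l).hom ≫ R.star (R.pow x (p + q)) x := rfl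
    have h2 := congrArg (fun f => (tpowAdd (l * (p + q)) l).hom ≫ R.star f x ≫
      R.reindex (assocE (m * p) (m * q) m)) ih
    simp only [hR.star_reindex_left, star_comp_left, Category.assoc, hR.star_assoc] at h2
    rw [← hR.reindex_trans] at h2
    have h3 := tperm_split (T := T) (finCongr (Nat.mul_add l p q)) (Equiv.refl (Fin l))
    rw [tperm_refl, tensorHom_id] at h3
    rw [← reassoc_of% h3, ← reassoc_of% (tperm_assoc (T := T) (l * p) (l * q) l),
      ← star_comp_right, ← pow_succ, ← Category.assoc (tperm _) (tperm _), ← tperm_trans] at h2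
    simp only [sumE_finCongr_refl, finCongr_trans'] at h2
    exact (Category.assoc _ _ _).trans h2

lemma pow_add' (p q : ℕ) : R.pow x (p + q) =
    tperm (finCongr (Nat.mul_add l p q)) ≫ (tpowAdd (l * p) (l * q)).hom ≫
      R.star (R.pow x p) (R.pow x q) ≫ R.reindex (finCongr (Nat.mul_add m p q).symm) := by
  have h := congrArg (· ≫ R.reindex (finCongr (Nat.mul_add m p q)).symm) (hR.pow_add x p q)
  simp only [Category.assoc, hR.reindex_comp_symm, Category.comp_id] at h
  exact h

lemma pow_sumE {p p' q q' : ℕ} {α : Fin p ≃ Fin p'} {β : Fin q ≃ Fin q'}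
    (hα : tperm (blockE l α) ≫ R.pow x p' = R.pow x p ≫ R.reindex (blockE m α))
    (hβ : tperm (blockE l β) ≫ R.pow x q' = R.pow x q ≫ R.reindex (blockE m β)) :
    tperm (blockE l (sumE α β)) ≫ R.pow x (p' + q') =
      R.pow x (p + q) ≫ R.reindex (blockE m (sumE α β)) := by
  have e1 : (finCongr (Nat.mul_add m p q).symm).trans (blockE m (sumE α β)) =
      (sumE (blockE m α) (blockE m β)).trans (finCongr (Nat.mul_add m p' q').symm) := by
    ext i
    have := congrArg (fun e => (e (finCongr (Nat.mul_add m p q).symm i)).val) (blockE_sumE m α β)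
    simpa using this
  rw [hR.pow_add' x p q, hR.pow_add' x p' q', tperm_trans_assoc, blockE_sumE, tperm_trans]
  simp only [Category.assoc]
  rw [← hR.reindex_trans, e1, hR.reindex_trans, ← Category.assoc (R.star _ _), ← hR.star_reindex,
    ← hα, ← hβ, star_comp, reassoc_of% (tperm_split (T := T) (blockE l α) (blockE l β)),
    Category.assoc]

lemma pow_finAddFlip {x : tpow T l ⟶ R.X m} (hx : R.IsCentral x) (p q : ℕ) :
    tperm (blockE l finAddFlip) ≫ R.pow x (q + p) =
      R.pow x (p + q) ≫ R.reindex (blockE m finAddFlip) := by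
  have e1 : (finCongr (Nat.mul_add m p q).symm).trans (blockE m finAddFlip) =
      finAddFlip.trans (finCongr (Nat.mul_add m q p).symm) := by
    ext i
    have := congrArg (fun e => (e (finCongr (Nat.mul_add m p q).symm i)).val)
      (blockE_finAddFlip m p q)
    simpa using this
  rw [hR.pow_add' x p q, hR.pow_add' x q p, tperm_trans_assoc, blockE_finAddFlip, tperm_trans]
  simp only [Category.assoc]
  rw [← hR.reindex_trans, e1, hR.reindex_trans, ← Category.assoc (R.star _ _),
    (hR.isCentral_pow hx q).star_comm, reassoc_of% (tperm_flip (T := T) (l * p) (l * q)),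
    Category.assoc]

/-- The powers of a central map are equivariant for block permutations. -/
lemma pow_perm {x : tpow T l ⟶ R.X m} (hx : R.IsCentral x) {p : ℕ} (τ : Equiv.Perm (Fin p)) :
    tperm (blockE l τ) ≫ R.pow x p = R.pow x p ≫ R.reindex (blockE m τ) := by
  have hrefl (q : ℕ) : tperm (blockE l (Equiv.refl (Fin q))) ≫ R.pow x q =
      R.pow x q ≫ R.reindex (blockE m (Equiv.refl (Fin q))) := by
    rw [blockE_refl, blockE_refl, tperm_refl, hR.reindex_refl, Category.id_comp, Category.comp_id]
  induction τ using perm_induction with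
  | one => exact hrefl p
  | swap a b h =>
    obtain ⟨a, ha⟩ := a
    obtain ⟨b, hb⟩ := b
    obtain rfl : b = a + 1 := h
    obtain ⟨r, rfl⟩ : ∃ r, p = a + (1 + 1) + r := ⟨p - (a + 2), by omega⟩
    have h1 := hR.pow_sumE x (hR.pow_sumE x (hrefl a) (hR.pow_finAddFlip hx 1 1)) (hrefl r)
    have e1 : (finAddFlip : Fin (1 + 1) ≃ Fin (1 + 1)) = Equiv.swap 0 1 := by decide
    have e2 := sumE_swap_right (p := (a : ℕ)) (0 : Fin (1 + 1)) 1
    have e3 := sumE_swap_left (q := r) (Fin.natAdd (a : ℕ) (0 : Fin (1 + 1))) (Fin.natAdd (a : ℕ) 1)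
    have e4 : Fin.castAdd r (Fin.natAdd (a : ℕ) (0 : Fin (1 + 1))) = ⟨a, ha⟩ := Fin.ext rfl
    have e5 : Fin.castAdd r (Fin.natAdd (a : ℕ) (1 : Fin (1 + 1))) = ⟨a + 1, hb⟩ := Fin.ext rfl
    rw [e4, e5, ← e2] at e3
    rw [← e3]
    rw [e1] at h1
    exact h1
  | mul σ τ hσ hτ =>
    have e (s : ℕ) : blockE s (σ * τ) = (blockE s τ).trans (blockE s σ) := blockE_trans s τ σ
    rw [e, e, tperm_trans, hR.reindex_trans, Category.assoc, hσ, reassoc_of% hτ]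

end IsSymRing

end SymRingData

/-! ### The localization through evaluation maps -/

section LocData

variable {C : Type*} [Category C] [MonoidalCategory C] [SymmetricCategory C] {T : C}

/-- A ring spectrum `R'` behaving as the localization `R[1/x]` with respect to evaluation maps
`R'_p ∧ T^(lp) ⟶ R_((1+m)p)` and maps `j_p : R_p ⟶ R'_p`. -/
structure LocData (R R' : SymRingData T) {l m : ℕ} (x : tpow T l ⟶ R.X m) where
  ev : ∀ p, R'.X p ⊗ tpow T (l * p) ⟶ R.X ((1 + m) * p)
  j : ∀ p, R.X p ⟶ R'.X p
  perm_ev : ∀ p (γ : Equiv.Perm (Fin p)), R'.perm p γ ▷ _ ≫ ev p =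
    _ ◁ tperm (blockE l γ.symm) ≫ ev p ≫ R.reindex (blockE (1 + m) γ)
  mul_ev : ∀ p q, R'.mul p q ▷ _ ≫ ev (p + q) = _ ◁ tperm (finCongr (Nat.mul_add l p q)) ≫
    SymRingData.conv (ev p) (ev q) ≫ R.reindex (finCongr (Nat.mul_add (1 + m) p q).symm)
  j_ev : ∀ p, j p ▷ _ ≫ ev p = R.star (𝟙 (R.X p)) (R.pow x p) ≫ R.reindex (shuffle m p)
  one₀_eq : R'.one₀ = R.one₀ ≫ j 0
  one₁_eq : R'.one₁ = R.one₁ ≫ j 1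

namespace LocData

variable {R R' : SymRingData T} {l m : ℕ} {x : tpow T l ⟶ R.X m} (L : LocData R R' x)

/-- The map `A ∧ T^(lp) ⟶ R_((1+m)p)` adjoint to a map `A ⟶ R'_p`. -/
def hat {A : C} {p : ℕ} (f : A ⟶ R'.X p) : A ⊗ tpow T (l * p) ⟶ R.X ((1 + m) * p) :=
  f ▷ _ ≫ L.ev p

lemma hat_comp {A B : C} {p : ℕ} (u : B ⟶ A) (f : A ⟶ R'.X p) :
    L.hat (u ≫ f) = u ▷ _ ≫ L.hat f := by
  simp [hat]

lemma hat_id (p : ℕ) : L.hat (𝟙 (R'.X p)) = L.ev p := by simp [hat]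

lemma hat_j {A : C} {p : ℕ} (f : A ⟶ R.X p) :
    L.hat (f ≫ L.j p) = R.star f (R.pow x p) ≫ R.reindex (shuffle m p) := by
  rw [hat_comp, hat, L.j_ev, ← Category.assoc, ← SymRingData.star_comp_left, Category.comp_id]

lemma hat_perm {A : C} {p : ℕ} (f : A ⟶ R'.X p) (γ : Equiv.Perm (Fin p)) :
    L.hat (f ≫ R'.perm p γ) =
      A ◁ tperm (blockE l γ.symm) ≫ L.hat f ≫ R.reindex (blockE (1 + m) γ) := by
  rw [hat, comp_whiskerRight, Category.assoc, L.perm_ev, ← whisker_exchange_assoc, hat,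
    Category.assoc]

lemma hat_star {A B : C} {p q : ℕ} (f : A ⟶ R'.X p) (g : B ⟶ R'.X q) :
    L.hat (R'.star f g) = (A ⊗ B) ◁ tperm (finCongr (Nat.mul_add l p q)) ≫
      SymRingData.conv (L.hat f) (L.hat g) ≫
        R.reindex (finCongr (Nat.mul_add (1 + m) p q).symm) := by
  rw [SymRingData.star, hat, comp_whiskerRight, Category.assoc, L.mul_ev, ← whisker_exchange_assoc,
    hat, hat, SymRingData.conv_whisker_left, SymRingData.conv_whisker_right, Category.assoc,
    MonoidalCategory.tensorHom_def, comp_whiskerRight]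
  simp only [Category.assoc]

section

variable (hR : R.IsSymRing)
include hR

omit hR in
lemma hat_reindex {A : C} {p q : ℕ} (f : A ⟶ R'.X p) (e : Fin p ≃ Fin q) :
    L.hat (f ≫ R'.reindex e) =
      A ◁ tperm (blockE l e.symm) ≫ L.hat f ≫ R.reindex (blockE (1 + m) e) := by
  obtain rfl : p = q := by simpa using Fintype.card_congr e
  rw [SymRingData.reindex_perm, hat_perm]

lemma hat_one₀ : L.hat R'.one₀ = 𝟙_ C ◁ tperm (finCongr (Nat.mul_zero l)) ≫
    (𝟙_ C ◁ (tzero T).hom ≫ (λ_ _).hom ≫ R.one₀) ≫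
      R.reindex (finCongr (Nat.mul_zero (1 + m)).symm) := by
  have h1 : R.star R.one₀ R.one₀ = (λ_ _).hom ≫ R.one₀ ≫
      R.reindex (finCongr (Nat.zero_add 0).symm) := by
    rw [← Category.assoc, ← hR.one_star, Category.assoc, ← hR.reindex_trans, finCongr_trans',
      hR.reindex_finCongr_self, Category.comp_id]
  have h2 : shuffle m 0 = finCongr (by omega) := Equiv.ext fun i => by
    exact (Fin.cast (by omega : 0 + m * 0 = 0) i).elim0
  rw [L.one₀_eq, hat_j, hR.pow_zero, SymRingData.star_comp_right, SymRingData.star_comp_right,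
    hR.star_reindex_right, h1, h2]
  simp only [Category.assoc, ← hR.reindex_trans, sumE_refl_finCongr, finCongr_trans']

/-- A criterion for centrality in terms of adjoint maps. -/
lemma isCentral_of_hat
    (hinj : ∀ (A : C) (p : ℕ) (f g : A ⟶ R'.X p), L.hat f = L.hat g → f = g) {A : C} {p : ℕ}
    {f : A ⟶ R'.X p} (hf : R.IsCentral (L.hat f)) : R'.IsCentral f := by
  refine SymRingData.isCentral_of_star_comm fun n => hinj _ _ _ _ ?_
  have h := SymRingData.IsSymRing.conv_comm (L.hat (𝟙 (R'.X n))) hf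
  have e1 := blockE_finAddFlip (1 + m) n p
  have e2 : (blockE l (finAddFlip : Fin (n + p) ≃ Fin (p + n)).symm).trans
      (finCongr (Nat.mul_add l n p)) = (finCongr (Nat.mul_add l p n)).trans finAddFlip :=
    blockE_finAddFlip l p n
  have e3 : (finCongr (Nat.mul_add (1 + m) n p).symm).trans (blockE (1 + m) finAddFlip) =
      finAddFlip.trans (finCongr (Nat.mul_add (1 + m) p n).symm) := by
    ext i
    have := congrArg (fun e => (e (finCongr (Nat.mul_add (1 + m) n p).symm i)).val) e1
    simpa using this
  rw [hat_reindex, hat_star, hat_comp, hat_star]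
  simp only [Category.assoc, ← hR.reindex_trans]
  rw [whiskerLeft_tperm_trans, e3, e2, hR.reindex_trans, reassoc_of% h, ← id_tensorHom,
    ← tensorHom_id, ← id_tensorHom, tensorHom_comp_tensorHom_assoc, tensorHom_comp_tensorHom_assoc,
    Category.id_comp, Category.comp_id, Category.id_comp, ← tperm_trans]
  have e4 (a b c : ℕ) (h : a = b + c) : ((finCongr h).trans finAddFlip).trans finAddFlip =
      finCongr h := by
    ext i
    refine congrArg Fin.val (?_ : finAddFlip (finAddFlip (finCongr h i)) = finCongr h i)
    exact finAddFlip.eq_symm_apply.1 rfl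
  rw [e4]

/-- If the adjunction is injective on maps, `R'` is a ring spectrum. -/
lemma isSymRing
    (hinj : ∀ (A : C) (p : ℕ) (f g : A ⟶ R'.X p), L.hat f = L.hat g → f = g)
    (hx : R.IsCentral x) : R'.IsSymRing where
  perm_one n := hinj _ _ _ _ (by
    rw [← Category.id_comp (R'.perm n 1), hat_perm]
    have h1 : blockE l (Equiv.symm (1 : Equiv.Perm (Fin n))) = Equiv.refl _ := blockE_refl l n
    have h2 : blockE (1 + m) (1 : Equiv.Perm (Fin n)) = Equiv.refl _ := blockE_refl _ n
    rw [h1, h2, tperm_refl, hR.reindex_refl, MonoidalCategory.whiskerLeft_id, Category.id_comp,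
      Category.comp_id])
  perm_mul n σ τ := hinj _ _ _ _ (by
    rw [← Category.id_comp (R'.perm n τ), ← Category.id_comp (R'.perm n (σ * τ)), hat_perm,
      hat_perm, hat_perm]
    have h1 : blockE l (σ * τ).symm = (blockE l σ.symm).trans (blockE l τ.symm) :=
      blockE_trans l _ _
    have h2 : blockE (1 + m) (σ * τ) = (blockE (1 + m) τ).trans (blockE (1 + m) σ) :=
      blockE_trans _ _ _
    simp only [Category.assoc]
    rw [h1, h2, whiskerLeft_tperm_trans, ← hR.reindex_trans])
  mul_perm p q α β := hinj _ _ _ _ (by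
    have h1 : (R'.perm p α ⊗ₘ R'.perm q β) ≫ R'.mul p q =
      R'.star (𝟙 _ ≫ R'.perm p α) (𝟙 _ ≫ R'.perm q β) := by simp [SymRingData.star]
    have h2 : R'.mul p q = R'.star (𝟙 _) (𝟙 _) := by simp [SymRingData.star]
    have e1 := blockE_sumE (1 + m) α β
    have e2 := blockE_sumE l α.symm β.symm
    have e3 : (finCongr (Nat.mul_add (1 + m) p q).symm).trans (blockE (1 + m) (sumE α β)) =
        (sumE (blockE (1 + m) α) (blockE (1 + m) β)).trans
          (finCongr (Nat.mul_add (1 + m) p q).symm) := by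
      ext i
      have := congrArg (fun e => (e (finCongr (Nat.mul_add (1 + m) p q).symm i)).val) e1
      simpa using this
    have e4 : blockE l (Equiv.symm (sumE α β)) = blockE l (sumE α.symm β.symm) := rfl
    have h3 := SymRingData.conv_comp (R := R) (𝟙 (R'.X p)) (𝟙 (R'.X q)) (blockE l α.symm)
      (blockE l β.symm) (L.ev p) (L.ev q)
    rw [id_tensorHom_id, id_tensorHom, id_tensorHom, id_tensorHom] at h3
    rw [h1, h2, blockSum_eq_sumE, hat_star, hat_perm, hat_perm, hat_perm, hat_star, hat_id, hat_id,
      ← Category.assoc (R'.X p ◁ _), ← Category.assoc (R'.X q ◁ _), hR.conv_reindex, h3]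
    simp only [Category.assoc, ← hR.reindex_trans, whiskerLeft_tperm_trans]
    rw [e3, e4, e2])
  assoc p q r := hinj _ _ _ _ (by
    have h1 : (R'.mul p q ▷ R'.X r ≫ R'.mul (p + q) r) =
        R'.star (R'.star (𝟙 _) (𝟙 _)) (𝟙 _) := by simp [SymRingData.star]
    have h2 : R'.X p ◁ R'.mul q r ≫ R'.mul p (q + r) =
        R'.star (𝟙 _) (R'.star (𝟙 _) (𝟙 _)) := by simp [SymRingData.star]
    have h5 := hR.conv_assoc (L.ev p) (L.ev q) (L.ev r)
    have h6 := congrArg (· ≫ R.reindex (assocE _ _ _).symm) h5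
    simp only [Category.assoc, hR.reindex_comp_symm, Category.comp_id] at h6
    rw [h1, h2, hat_reindex, hat_star, hat_star, hat_comp, hat_star, hat_star, hat_id, hat_id,
      hat_id, hR.conv_tperm_reindex_left, hR.conv_tperm_reindex_right, h6]
    simp only [Category.assoc, ← hR.reindex_trans, ← id_tensorHom,
      ← tensorHom_id, tensorHom_comp_tensorHom_assoc, ← tperm_trans, Category.id_comp,
      Category.comp_id]
    simp only [sumE_finCongr_refl, sumE_refl_finCongr, finCongr_trans', finCongr_symm,
      blockE_finCongr])
  mul_one n := hinj _ _ _ _ (by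
    have h1 : R'.X n ◁ R'.one₀ ≫ R'.mul n 0 = R'.star (𝟙 _) R'.one₀ := by simp [SymRingData.star]
    have h5 := hR.conv_one (L.ev n)
    have h6 := congrArg (· ≫ R.reindex (finCongr (Nat.add_zero _)).symm) h5
    simp only [Category.assoc, hR.reindex_comp_symm, Category.comp_id] at h6
    rw [← Category.comp_id (ρ_ (R'.X n)).hom, h1, hat_comp, hat_star, hat_one₀ L hR, hat_id,
      hR.conv_tperm_reindex_right, Category.assoc, Category.assoc]
    have h7 := congrArg (fun f => (R'.X n ⊗ 𝟙_ C) ◁ tperm (finCongr (Nat.mul_add l n 0)) ≫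
      (R'.X n ⊗ 𝟙_ C) ◁ tperm (sumE (Equiv.refl _) (finCongr (Nat.mul_zero l))) ≫ f ≫
      R.reindex (sumE (Equiv.refl _) (finCongr (Nat.mul_zero (1 + m)).symm)) ≫
      R.reindex (finCongr (Nat.mul_add (1 + m) n 0).symm)) h6
    refine h7.trans ?_
    simp only [Category.assoc, ← hR.reindex_trans, ← id_tensorHom,
      ← tensorHom_id, tensorHom_comp_tensorHom_assoc, ← tperm_trans, Category.id_comp]
    simp only [sumE_refl_finCongr, finCongr_trans', finCongr_symm]
    have h8 : ((ρ_ (R'.X n)).hom ⊗ₘ tperm (T := T) (Equiv.refl (Fin (l * n)))) ≫ L.ev n ≫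
      R.reindex (Equiv.refl _) = ((ρ_ (R'.X n)).hom ⊗ₘ 𝟙 _) ≫ L.ev n := by
        rw [tperm_refl, hR.reindex_refl, Category.comp_id]
    exact h8)
  one_mul n := hinj _ _ _ _ (by
    have h1 : R'.one₀ ▷ R'.X n ≫ R'.mul 0 n ≫ R'.reindex (finCongr (Nat.zero_add n)) =
      R'.star R'.one₀ (𝟙 _) ≫ R'.reindex (finCongr (Nat.zero_add n)) := by simp [SymRingData.star]
    have h5 := hR.one_conv (L.ev n)
    have h6 := congrArg (· ≫ R.reindex (finCongr (Nat.zero_add _)).symm) h5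
    simp only [Category.assoc, hR.reindex_comp_symm, Category.comp_id] at h6
    rw [← Category.comp_id (λ_ (R'.X n)).hom, h1, hat_reindex, hat_comp, hat_star, hat_one₀ L hR,
      hat_id, hR.conv_tperm_reindex_left, h6]
    simp only [Category.assoc, ← hR.reindex_trans, ← id_tensorHom,
      ← tensorHom_id, tensorHom_comp_tensorHom_assoc, ← tperm_trans, Category.id_comp]
    simp only [sumE_finCongr_refl, finCongr_trans', finCongr_symm, blockE_finCongr]
    rw [tperm_finCongr, hR.reindex_finCongr_self, eqToHom_refl, Category.comp_id])
  one₁_central := by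
    refine L.isCentral_of_hat hR hinj ?_
    rw [L.one₁_eq, hat_j]
    exact hR.isCentral_reindex (hR.isCentral_star hR.one₁_central (hR.isCentral_pow hx 1)) _

/-- If the adjunction is injective on maps, the maps `j_p` form a map of ring spectra. -/
lemma isRingMap
    (hinj : ∀ (A : C) (p : ℕ) (f g : A ⟶ R'.X p), L.hat f = L.hat g → f = g)
    (hx : R.IsCentral x) : R.IsRingMap R' L.j where
  perm n τ := hinj _ _ _ _ (by
    rw [hat_j, ← Category.id_comp (L.j n), hat_perm, hat_j, ← R.reindex_perm,
      ← Category.id_comp (R.reindex τ), hR.star_reindex_left]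
    have h1 := hR.pow_perm hx τ.symm
    simp only [Category.assoc, ← hR.reindex_trans]
    rw [← Category.assoc (R.X n ◁ _), ← SymRingData.star_comp_right, h1, hR.star_reindex_right,
      Category.assoc, ← hR.reindex_trans, shuffle_blockE, ← Equiv.trans_assoc, sumE_trans,
      ← blockE_trans]
    simp)
  mul p q := hinj _ _ _ _ (by
    have h1 : R.mul p q = R.star (𝟙 _) (𝟙 _) := by simp [SymRingData.star]
    have h2 : (L.j p ⊗ₘ L.j q) ≫ R'.mul p q = R'.star (𝟙 _ ≫ L.j p) (𝟙 _ ≫ L.j q) := by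
      simp [SymRingData.star]
    have h3 := hR.star_star_star (𝟙 (R.X p)) (𝟙 (R.X q)) (hR.isCentral_pow hx p) (R.pow x q)
    have h4 := hR.pow_add x p q
    have h5 := congrArg (· ≫ R.reindex (finCongr (Nat.mul_add m p q)).symm) h4
    simp only [Category.assoc, hR.reindex_comp_symm, Category.comp_id] at h5
    rw [h1, h2, hat_j, hat_star, hat_j, hat_j, SymRingData.conv, h5, SymRingData.star_comp_right,
      SymRingData.star_comp_right, hR.star_reindex_right, hR.star_reindex]
    simp only [Category.assoc]
    rw [← reassoc_of% h3]
    simp only [← hR.reindex_trans]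
    exact congrArg (fun e => _ ≫ _ ≫ _ ≫ R.reindex e) (midSwap_shuffle m p q).symm)
  one₀ := L.one₀_eq.symm
  one₁ := L.one₁_eq.symm

end

end LocData

end LocData

/-! ### The localization in a closed category -/

section Closed

variable {C : Type*} [Category C] [MonoidalCategory C] [SymmetricCategory C] [MonoidalClosed C]

lemma homAdj_homEv {Z A Y : C} (f : Z ⊗ A ⟶ Y) : homAdj f ▷ A ≫ homEv A Y = f := by
  have h := MonoidalClosed.uncurry_curry ((β_ A Z).hom ≫ f)
  rw [MonoidalClosed.uncurry_eq] at h
  rw [homAdj, homEv, BraidedCategory.braiding_naturality_left_assoc, h,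
    SymmetricCategory.symmetry_assoc]

lemma homEv_injective {Z A Y : C} {f g : Z ⟶ (ihom A).obj Y}
    (h : f ▷ A ≫ homEv A Y = g ▷ A ≫ homEv A Y) : f = g := by
  apply MonoidalClosed.uncurry_injective
  rw [MonoidalClosed.uncurry_eq, MonoidalClosed.uncurry_eq, ← cancel_epi (β_ Z A).hom,
    ← BraidedCategory.braiding_naturality_left_assoc,
    ← BraidedCategory.braiding_naturality_left_assoc]
  exact h

variable {T : C} (R : SymRingData T) {l m : ℕ} (x : tpow T l ⟶ R.X m)

/-- The evaluation maps of `R[1/x]`. -/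
def locData : LocData R (loc R x) x where
  ev p := homEv _ _
  j p := locMap R x p
  perm_ev p γ := by
    refine (homAdj_homEv _).trans ?_
    rw [tperm_perm, SymRingData.reindex_perm]
    rfl
  mul_ev p q := by
    refine (homAdj_homEv _).trans ?_
    rw [tperm_finCongr]
    simp only [SymRingData.conv, SymRingData.star, MonoidalCategory.whiskerLeft_comp, Category.assoc]
    rfl
  j_ev p := by
    refine (homAdj_homEv _).trans ?_
    rw [SymRingData.star, id_tensorHom, Category.assoc]
  one₀_eq := rfl
  one₁_eq := rfl

lemma locData_hat_injective (A : C) (p : ℕ) (f g : A ⟶ (loc R x).X p)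
    (h : (locData R x).hat f = (locData R x).hat g) : f = g := homEv_injective h

lemma isSymRing_loc (hR : R.IsSymRing) {x : tpow T l ⟶ R.X m} (hx : R.IsCentral x) :
    (loc R x).IsSymRing :=
  (locData R x).isSymRing hR (locData_hat_injective R x) hx

lemma isRingMap_loc (hR : R.IsSymRing) {x : tpow T l ⟶ R.X m} (hx : R.IsCentral x) :
    R.IsRingMap (loc R x) (locMap R x) :=
  (locData R x).isRingMap hR (locData_hat_injective R x) hx

end Closed

/-! ### Transport along a symmetric monoidal functor -/

section Transport

open Functor.LaxMonoidal Functor.Monoidal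

variable {C H : Type*} [Category C] [MonoidalCategory C] [SymmetricCategory C]
  [Category H] [MonoidalCategory H] [SymmetricCategory H] (F : C ⥤ H) [F.Braided] {T : C}

/-- The comparison of the powers of `F T` with the images of the powers of `T`. -/
def fTpow (T : C) : ∀ k, tpow (F.obj T) k ≅ F.obj (tpow T k)
  | 0 => εIso F
  | k + 1 => whiskerRightIso (fTpow T k) _ ≪≫ μIso F _ _

lemma fTpow_succ (k : ℕ) : (snoc (F.obj T) (𝟙_ H) k).hom ≫ (fTpow F T (k + 1)).hom =
    (fTpow F T k).hom ▷ F.obj T ≫ μ F _ _ ≫ F.map (snoc T (𝟙_ C) k).hom := by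
  have h {X : H} {Y : C} (e : X ≅ F.obj Y) : 𝟙 (X ⊗ F.obj T) ≫
      (whiskerRightIso e (F.obj T) ≪≫ μIso F _ _).hom =
        e.hom ▷ F.obj T ≫ μ F _ _ ≫ F.map (𝟙 (Y ⊗ T)) := by simp
  exact h _

lemma fTpow_grow {n : ℕ} {f : tpow T n ⟶ tpow T n} {g : tpow (F.obj T) n ⟶ tpow (F.obj T) n}
    (h : g ≫ (fTpow F T n).hom = (fTpow F T n).hom ≫ F.map f) :
    grow g ≫ (fTpow F T (n + 1)).hom = (fTpow F T (n + 1)).hom ≫ F.map (grow f) := by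
  rw [← cancel_epi (snoc (F.obj T) (𝟙_ H) n).hom, grow_eq, grow_eq]
  simp only [Category.assoc, Iso.hom_inv_id_assoc, fTpow_succ, reassoc_of% (fTpow_succ F (T := T)),
    ← F.map_comp, ← comp_whiskerRight_assoc, h]
  simp

lemma fTpow_topSwap (n : ℕ) : topSwap (F.obj T) (𝟙_ H) n ≫ (fTpow F T (n + 2)).hom =
    (fTpow F T (n + 2)).hom ≫ F.map (topSwap T (𝟙_ C) n) := by
  have h {X : H} {Y : C} (e : X ⟶ F.obj Y) : swapLast (F.obj T) X ≫ e ▷ F.obj T ▷ F.obj T ≫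
      μ F Y T ▷ F.obj T ≫ μ F _ _ =
      e ▷ F.obj T ▷ F.obj T ≫ μ F Y T ▷ F.obj T ≫ μ F _ _ ≫ F.map (swapLast T Y) := by
    rw [← reassoc_of% (swapLast_natural (T := F.obj T) e)]
    congr 1
    simp only [swapLast, F.map_comp, Category.assoc]
    rw [associativity_assoc, ← μ_natural_right_assoc,
      ← whiskerLeft_comp_assoc _ _ (F.map _), Functor.LaxBraided.braided, whiskerLeft_comp_assoc,
      associativity_inv]
  have h' {X : H} {Y : C} (e : X ≅ F.obj Y) : swapLast (F.obj T) X ≫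
      (whiskerRightIso (whiskerRightIso e (F.obj T) ≪≫ μIso F _ _) (F.obj T) ≪≫ μIso F _ _).hom =
      (whiskerRightIso (whiskerRightIso e (F.obj T) ≪≫ μIso F _ _) (F.obj T) ≪≫ μIso F _ _).hom ≫
        F.map (swapLast T Y) := by
    have := h e.hom
    simpa using this
  exact h' (fTpow F T n)

lemma fTpow_adjSwap (n i : ℕ) : adjSwap (F.obj T) (𝟙_ H) n i ≫ (fTpow F T n).hom =
    (fTpow F T n).hom ≫ F.map (adjSwap T (𝟙_ C) n i) := by
  have h0 {X : H} {Y : C} (f : X ⟶ F.obj Y) : 𝟙 _ ≫ f = f ≫ F.map (𝟙 _) := by simp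
  induction n with
  | zero => exact h0 _
  | succ n ih =>
    by_cases h : i + 1 = n
    · subst h
      rw [adjSwap_last, adjSwap_last]
      exact fTpow_topSwap F i
    · rw [adjSwap_of_ne _ h, adjSwap_of_ne _ h]
      exact fTpow_grow F ih

lemma fTpow_tperm {a b : ℕ} (e : Fin a ≃ Fin b) : tperm e ≫ (fTpow F T b).hom =
    (fTpow F T a).hom ≫ F.map (tperm e) := by
  obtain rfl : a = b := by simpa using Fintype.card_congr e
  rw [tperm_perm, tperm_perm]
  induction e using perm_induction with
  | one => rw [permSmash_one, permSmash_one]; simp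
  | swap a b h => rw [permSmash_swap_succ _ _ _ _ h, permSmash_swap_succ _ _ _ _ h, fTpow_adjSwap]
  | mul σ τ hσ hτ => rw [permSmash_mul, permSmash_mul, Category.assoc, hσ, reassoc_of% hτ,
      F.map_comp]

lemma fTpow_add (a b : ℕ) : (tpowAdd a b).inv ≫ (fTpow F T (a + b)).hom =
    ((fTpow F T a).hom ⊗ₘ (fTpow F T b).hom) ≫ μ F _ _ ≫ F.map (tpowAdd a b).inv := by
  induction b with
  | zero =>
    have h {X : H} {Y : C} (e : X ⟶ F.obj Y) : (ρ_ X).hom ≫ e =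
        (e ⊗ₘ ε F) ≫ μ F _ _ ≫ F.map (ρ_ Y).hom := by
      rw [MonoidalCategory.tensorHom_def, Category.assoc, ← right_unitality,
        rightUnitor_naturality]
    exact h _
  | succ b ih =>
    have h1 := fTpow_succ F (T := T) (a + b)
    have h2 := fTpow_succ F (T := T) b
    rw [← cancel_epi (tpow (F.obj T) a ◁ (snoc (F.obj T) (𝟙_ H) b).hom), tpowAdd_succ_inv,
      tpowAdd_succ_inv]
    simp only [Category.assoc, whiskerLeft_hom_inv_assoc]
    have h3 := (congrArg (fun f => (α_ _ _ _).inv ≫ (tpowAdd a b).inv ▷ F.obj T ≫ f) h1)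
    refine h3.trans ?_
    rw [← comp_whiskerRight_assoc, ih, ← id_tensorHom, tensorHom_comp_tensorHom_assoc, h2]
    have h4 : ((fTpow F T a).hom ⊗ₘ (fTpow F T b).hom ▷ F.obj T ≫ μ F (tpow T b) T ≫
        F.map (snoc T (𝟙_ C) b).hom) = ((fTpow F T a).hom ⊗ₘ (fTpow F T b).hom ▷ F.obj T) ≫
        F.obj _ ◁ μ F (tpow T b) T ≫ F.obj _ ◁ F.map (snoc T (𝟙_ C) b).hom := by
      rw [← MonoidalCategory.whiskerLeft_comp, ← id_tensorHom, tensorHom_comp_tensorHom,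
        Category.comp_id]
    rw [Category.id_comp, h4]
    simp only [Category.assoc, μ_natural_right_assoc, ← F.map_comp, whiskerLeft_hom_inv_assoc]
    simp only [F.map_comp, comp_whiskerRight, Category.assoc, μ_natural_left_assoc,
      associativity_inv_assoc]
    rw [← tensorHom_id (fTpow F T b).hom, associator_inv_naturality_assoc, tensorHom_id]

lemma fTpow_add_hom (a b : ℕ) : (fTpow F T (a + b)).hom ≫ F.map (tpowAdd a b).hom =
    (tpowAdd a b).hom ≫ ((fTpow F T a).hom ⊗ₘ (fTpow F T b).hom) ≫ μ F _ _ := by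
  rw [← cancel_epi (tpowAdd a b).inv, reassoc_of% fTpow_add F (T := T) a b]
  simp

variable {R : SymRingData T}

namespace SymRingData

/-- The map to a level of `R.map F` given by the image of a map to a level of `R`. -/
def fm {A : C} {p : ℕ} (f : A ⟶ R.X p) : F.obj A ⟶ (R.map F).X p := F.map f

lemma fm_comp {A B : C} {p : ℕ} (u : A ⟶ B) (f : B ⟶ R.X p) :
    fm F (u ≫ f) = F.map u ≫ fm F f := F.map_comp u f

lemma fm_id (p : ℕ) : fm F (𝟙 (R.X p)) = 𝟙 _ := F.map_id _

lemma fm_reindex {A : C} {a b : ℕ} (f : A ⟶ R.X a) (e : Fin a ≃ Fin b) :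
    fm F (f ≫ R.reindex e) = fm F f ≫ (R.map F).reindex e := by
  obtain rfl : a = b := by simpa using Fintype.card_congr e
  rw [reindex_perm, reindex_perm]
  exact F.map_comp _ _

lemma fm_map_reindex {A : C} {a b : ℕ} (f : A ⟶ R.X a) (e : Fin a ≃ Fin b) :
    F.map f ≫ fm F (R.reindex e) = fm F f ≫ (R.map F).reindex e := by
  rw [← fm_reindex, fm_comp]

lemma star_fm {A B : C} {p q : ℕ} (f : A ⟶ R.X p) (g : B ⟶ R.X q) :
    (R.map F).star (fm F f) (fm F g) = μ F A B ≫ fm F (R.star f g) := by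
  have h : (R.map F).star (fm F f) (fm F g) =
    (F.map f ⊗ₘ F.map g) ≫ μ F _ _ ≫ F.map (R.mul p q) := rfl
  rw [h, μ_natural_assoc, star, fm_comp]
  rfl

lemma isCentral_fm {A : C} {m : ℕ} {f : A ⟶ R.X m} (hf : R.IsCentral f) :
    (R.map F).IsCentral (fm F f) := by
  refine isCentral_of_star_comm fun n => ?_
  have h := hf.star_comm (𝟙 (R.X n))
  have h1 := congrArg (fun f => μ F _ _ ≫ fm F f) h
  simp only [fm_comp, fm_map_reindex] at h1
  rw [Functor.LaxBraided.braided_assoc, ← star_fm, ← Category.assoc, ← star_fm, fm_id] at h1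
  exact h1

lemma isSymRing_map (hR : R.IsSymRing) : (R.map F).IsSymRing where
  perm_one n := (congrArg F.map (hR.perm_one n)).trans (F.map_id _)
  perm_mul n σ τ := (congrArg F.map (hR.perm_mul n σ τ)).trans (F.map_comp _ _)
  mul_perm p q α β := by
    have h := congrArg (fun f => μ F _ _ ≫ F.map f) (hR.mul_perm p q α β)
    simp only [F.map_comp] at h
    rw [← μ_natural_assoc] at h
    exact h.trans (Category.assoc _ _ _).symm
  assoc p q r := by
    have h := congrArg (fun f => μ F _ _ ▷ F.obj (R.X r) ≫ μ F _ _ ≫ fm F f)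
      (hR.star_assoc (𝟙 (R.X p)) (𝟙 (R.X q)) (𝟙 (R.X r)))
    simp only [fm_comp, fm_map_reindex] at h
    rw [associativity_assoc, ← star_fm, ← star_comp_right, ← star_fm,
      ← Category.assoc (μ F _ _) (fm F _), ← star_fm, ← Category.assoc, ← star_comp_left,
      ← star_fm, fm_id, fm_id, fm_id] at h
    have h1 : (R.map F).mul p q ▷ (R.map F).X r ≫ (R.map F).mul (p + q) r =
        (R.map F).star ((R.map F).star (𝟙 _) (𝟙 _)) (𝟙 _) := by simp [star]
    have h2 : (R.map F).X p ◁ (R.map F).mul q r ≫ (R.map F).mul p (q + r) =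
        (R.map F).star (𝟙 _) ((R.map F).star (𝟙 _) (𝟙 _)) := by simp [star]
    rw [h1, h2]
    exact h
  mul_one n := by
    have h := congrArg (fun f => F.obj (R.X n) ◁ ε F ≫ μ F _ _ ≫ fm F f)
      (hR.star_one (𝟙 (R.X n)))
    simp only [fm_comp] at h
    rw [← right_unitality_assoc, ← star_fm, ← star_comp_right, fm_id] at h
    have h1 : (R.map F).X n ◁ (R.map F).one₀ ≫ (R.map F).mul n 0 =
        (R.map F).star (𝟙 _) (R.map F).one₀ := by simp [star]
    rw [h1]
    exact h.trans (Category.comp_id _)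
  one_mul n := by
    have h := congrArg (fun f => ε F ▷ F.obj (R.X n) ≫ μ F _ _ ≫ fm F f)
      (hR.one_star (𝟙 (R.X n)))
    simp only [fm_comp, fm_map_reindex] at h
    rw [← left_unitality_assoc, ← Category.assoc (μ F _ _), ← star_fm, ← Category.assoc,
      ← star_comp_left, fm_id] at h
    have h1 : (R.map F).one₀ ▷ (R.map F).X n ≫ (R.map F).mul 0 n ≫
        (R.map F).reindex (finCongr (Nat.zero_add n)) =
        (R.map F).star (R.map F).one₀ (𝟙 _) ≫ (R.map F).reindex (finCongr (Nat.zero_add n)) := by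
      simp [star]
    rw [h1]
    exact h.trans (Category.comp_id _)
  one₁_central := isCentral_fm F hR.one₁_central

lemma map_pow {l m : ℕ} (x : tpow T l ⟶ R.X m) (p : ℕ) :
    (R.map F).pow ((fTpow F T l).hom ≫ fm F x) p = (fTpow F T (l * p)).hom ≫ fm F (R.pow x p) := by
  induction p with
  | zero => exact rfl
  | succ p ih =>
    rw [pow_succ, pow_succ, ih, star_comp, star_fm, fm_comp]
    have h4 := congrArg (· ≫ fm F (R.star (R.pow x p) x)) (fTpow_add_hom F (T := T) (l * p) l)
    simp only [Category.assoc] at h4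
    exact h4.symm

lemma conv_fm {A B : C} {a b p q : ℕ} (f : A ⊗ tpow T a ⟶ R.X p) (g : B ⊗ tpow T b ⟶ R.X q) :
    conv (F.obj A ◁ (fTpow F T a).hom ≫ μ F _ _ ≫ fm F f)
      (F.obj B ◁ (fTpow F T b).hom ≫ μ F _ _ ≫ fm F g) =
    μ F A B ▷ _ ≫ F.obj (A ⊗ B) ◁ (fTpow F T (a + b)).hom ≫ μ F _ _ ≫ fm F (conv f g) := by
  rw [conv, star_comp, star_comp, star_fm, conv, fm_comp, fm_comp, ← μ_natural_right_assoc,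
    ← whiskerLeft_comp_assoc, fTpow_add_hom, ← id_tensorHom (F.obj A), ← id_tensorHom (F.obj B),
    ← tensorμ_natural_assoc, id_tensorHom_id, tensorμ_comp_μ_tensorHom_μ_comp_μ_assoc]
  simp only [MonoidalCategory.tensorHom_def, MonoidalCategory.whiskerLeft_comp, Category.assoc]
  simp only [id_whiskerRight, Category.id_comp, ← whisker_exchange_assoc]

end SymRingData

open SymRingData

/-- The image of localization data under a symmetric monoidal functor. -/
def LocData.map {R' : SymRingData T} {l m : ℕ} {x : tpow T l ⟶ R.X m} (L : LocData R R' x) :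
    LocData (R.map F) (R'.map F) ((fTpow F T l).hom ≫ fm F x) where
  ev p := F.obj (R'.X p) ◁ (fTpow F T (l * p)).hom ≫ μ F _ _ ≫ fm F (L.ev p)
  j p := F.map (L.j p)
  perm_ev p γ := by
    have h := congrArg (fun f => F.obj (R'.X p) ◁ (fTpow F T (l * p)).hom ≫ μ F _ _ ≫ fm F f)
      (L.perm_ev p γ)
    simp only [fm_comp, fm_map_reindex] at h
    rw [← μ_natural_left_assoc, ← μ_natural_right_assoc, ← whiskerLeft_comp_assoc,
      ← fTpow_tperm, whisker_exchange_assoc] at h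
    refine h.trans (?_ : _ = F.obj (R'.X p) ◁ tperm (blockE l γ.symm) ≫
      (F.obj (R'.X p) ◁ (fTpow F T (l * p)).hom ≫ μ F _ _ ≫ fm F (L.ev p)) ≫
        (R.map F).reindex (blockE (1 + m) γ))
    simp only [Category.assoc, MonoidalCategory.whiskerLeft_comp]
  mul_ev p q := by
    have h := congrArg (fun f => μ F _ _ ▷ _ ≫ F.obj (R'.X p ⊗ R'.X q) ◁
      (fTpow F T (l * (p + q))).hom ≫ μ F _ _ ≫ fm F f) (L.mul_ev p q)
    simp only [fm_comp, fm_map_reindex] at h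
    rw [← μ_natural_left_assoc, ← μ_natural_right_assoc, ← whiskerLeft_comp_assoc,
      ← fTpow_tperm, whisker_exchange_assoc, MonoidalCategory.whiskerLeft_comp_assoc,
      ← whisker_exchange_assoc (μ F (R'.X p) (R'.X q))] at h
    have h2 := congrArg (· ≫ (R.map F).reindex (finCongr (Nat.mul_add (1 + m) p q).symm))
      (conv_fm F (L.ev p) (L.ev q))
    simp only [Category.assoc] at h2
    rw [← h2, ← comp_whiskerRight_assoc] at h
    exact h
  j_ev p := by
    have h := congrArg (fun f => F.obj (R.X p) ◁ (fTpow F T (l * p)).hom ≫ μ F _ _ ≫ fm F f)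
      (L.j_ev p)
    simp only [fm_comp, fm_map_reindex] at h
    have k := star_comp_right (R := R.map F) (fTpow F T (l * p)).hom (fm F (𝟙 (R.X p)))
      (fm F (R.pow x p))
    rw [fm_id] at k
    rw [← μ_natural_left_assoc, whisker_exchange_assoc, ← Category.assoc (μ F _ _) (fm F _),
      ← star_fm, fm_id, ← Category.assoc (F.obj (R.X p) ◁ _)] at h
    rw [SymRingData.map_pow]
    refine Eq.trans ?_ (h.trans (congrArg (· ≫ (R.map F).reindex (shuffle m p)) k.symm))
    rfl
  one₀_eq := (congrArg (ε F ≫ F.map ·) L.one₀_eq).trans (by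
    rw [F.map_comp]; exact (Category.assoc _ _ _).symm)
  one₁_eq := (congrArg F.map L.one₁_eq).trans (F.map_comp _ _)

end Transport

/-! ### Smash products with cofibrant objects -/

section Quillen

variable {D : Type*} [Category D] [ModelCategory D] [MonoidalCategory D]

/-- The functor `A ∧ -` preserves cofibrations and trivial cofibrations. -/
structure IsFlat (A : D) : Prop where
  cofibration : ∀ {X Y : D} (i : X ⟶ Y), Cofibration i → Cofibration (A ◁ i)
  weakEquivalence : ∀ {X Y : D} (i : X ⟶ Y), Cofibration i → WeakEquivalence i →
    WeakEquivalence (A ◁ i)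

lemma isFlat_unit : IsFlat (𝟙_ D) where
  cofibration i hi := by
    have h : 𝟙_ D ◁ i = (λ_ _).hom ≫ i ≫ (λ_ _).inv := by simp
    rw [h]
    infer_instance
  weakEquivalence i hi hi' := by
    have h : 𝟙_ D ◁ i = (λ_ _).hom ≫ i ≫ (λ_ _).inv := by simp
    rw [h]
    infer_instance

lemma IsFlat.tensor {A B : D} (hA : IsFlat A) (hB : IsFlat B) : IsFlat (A ⊗ B) where
  cofibration i hi := by
    have h : (A ⊗ B) ◁ i = (α_ _ _ _).hom ≫ A ◁ B ◁ i ≫ (α_ _ _ _).inv := by simp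
    have := hA.cofibration _ (hB.cofibration i hi)
    rw [h]
    infer_instance
  weakEquivalence i hi hi' := by
    have h : (A ⊗ B) ◁ i = (α_ _ _ _).hom ≫ A ◁ B ◁ i ≫ (α_ _ _ _).inv := by simp
    have := hA.weakEquivalence _ (hB.cofibration i hi) (hB.weakEquivalence i hi hi')
    rw [h]
    infer_instance

lemma isFlat_tpow {T : D} (hT : IsFlat T) : ∀ k, IsFlat (tpow T k)
  | 0 => isFlat_unit
  | k + 1 => (isFlat_tpow hT k).tensor hT

variable [MonoidalClosed D]

lemma isFlat_of_isCofibrant [SymmetricCategory D] [PushoutProductAxiom D] (A : D) [hA : IsCofibrant A] :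
    IsFlat A := by
  -- the domain of the pushout product of `∅ ⟶ A` and `i : X ⟶ Y` is `A ∧ X`
  have h0 (X : D) : IsInitial ((⊥_ D) ⊗ X) :=
    (initialIsInitial.isInitialObj (tensorLeft X)).ofIso (β_ _ _)
  have key {X Y : D} (i : X ⟶ Y) : ∃ (Z : D) (e : A ⊗ X ⟶ Z) (p : Z ⟶ A ⊗ Y), IsIso e ∧
      A ◁ i = e ≫ p ∧ (Cofibration i → Cofibration p) ∧
        (Cofibration i → WeakEquivalence i → WeakEquivalence p) := by
    let f : (⊥_ D) ⟶ A := initial.to A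
    have : IsIso ((⊥_ D) ◁ i) := by
      have := (h0 X).uniqueUpToIso (h0 Y)
      have e : (⊥_ D) ◁ i = ((h0 X).uniqueUpToIso (h0 Y)).hom := (h0 X).hom_ext _ _
      rw [e]; infer_instance
    let sq := Functor.PushoutObjObj.ofHasPushout (curriedTensor D) f i
    refine ⟨sq.pt, sq.inl, sq.ι, sq.isPushout.isIso_inl_of_isIso ‹_›, sq.inl_ι.symm,
      fun hi => ?_, fun hi hi' => ?_⟩
    · exact PushoutProductAxiom.cofibration f i hA hi
    · exact PushoutProductAxiom.weakEquivalence f i hA hi (Or.inr hi')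
  constructor
  · intro X Y i hi
    obtain ⟨Z, e, p, he, h, h1, h2⟩ := key i
    have := h1 hi
    rw [h]; infer_instance
  · intro X Y i hi hi'
    obtain ⟨Z, e, p, he, h, h1, h2⟩ := key i
    have := h2 hi hi'
    rw [h]; infer_instance

lemma IsFlat.isCofibrant_tensor {A : D} (hA : IsFlat A) (Z : D) [hZ : IsCofibrant Z] :
    IsCofibrant (A ⊗ Z) := by
  have h0 : IsInitial (A ⊗ (⊥_ D)) := initialIsInitial.isInitialObj (tensorLeft A)
  rw [isCofibrant_iff_of_isInitial (A ◁ initial.to Z) h0]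
  exact hA.cofibration _ hZ

lemma IsFlat.fibration_ihom {A : D} (hA : IsFlat A) {X Y : D} (p : X ⟶ Y) [hp : Fibration p] :
    Fibration ((ihom A).map p) := by
  rw [fibration_iff, ← trivialCofibrations_rlp]
  intro X Y i hi
  rw [mem_trivialCofibrations_iff] at hi
  rw [← (ihom.adjunction A).hasLiftingProperty_iff]
  have := hA.cofibration i hi.1
  have := hA.weakEquivalence i hi.1 hi.2
  exact inferInstanceAs (HasLiftingProperty (A ◁ i) p)

lemma IsFlat.weakEquivalence_ihom {A : D} (hA : IsFlat A) {X Y : D} (p : X ⟶ Y) [hp : Fibration p]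
    [WeakEquivalence p] : WeakEquivalence ((ihom A).map p) := by
  have h : trivialFibrations D ((ihom A).map p) := by
    rw [← cofibrations_rlp]
    intro X Y i hi
    rw [← cofibration_iff] at hi
    rw [← (ihom.adjunction A).hasLiftingProperty_iff]
    have := hA.cofibration i hi
    exact inferInstanceAs (HasLiftingProperty (A ◁ i) p)
  exact ((mem_trivialFibrations_iff _).1 h).2

lemma IsFlat.isFibrant_ihom {A : D} (hA : IsFlat A) (Y : D) [hY : IsFibrant Y] :
    IsFibrant ((ihom A).obj Y) := by
  have h0 : IsTerminal ((ihom A).obj (⊤_ D)) :=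
    terminalIsTerminal.isTerminalObj (ihom A)
  rw [isFibrant_iff_of_isTerminal ((ihom A).map (terminal.from Y)) h0]
  exact hA.fibration_ihom _

end Quillen

/-! ### Maps in the homotopy category -/

section HoMaps

variable {D : Type*} [Category D] [ModelCategory D] [MonoidalCategory D]
  [(weakEquivalences D).IsMonoidal]

instance : (toHo D).IsLocalization (weakEquivalences D) :=
  inferInstanceAs ((Localization.Monoidal.toMonoidalCategory _ _ _).IsLocalization _)

lemma exists_cofibrant_iso (S : Ho D) : ∃ (Z : D) (_ : IsCofibrant Z), Nonempty ((toHo D).obj Z ≅ S) := by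
  have := Localization.essSurj (toHo D) (weakEquivalences D)
  obtain ⟨Z, _, p, _, _⟩ := CofibrantObject.HoCat.exists_resolution ((toHo D).objPreimage S)
  have := Localization.inverts (toHo D) (weakEquivalences _) p (by rwa [← weakEquivalence_iff])
  exact ⟨Z, ‹_›, ⟨asIso ((toHo D).map p) ≪≫ (toHo D).objObjPreimageIso S⟩⟩

lemma exists_fibrant_iso (S : Ho D) : ∃ (Z : D) (_ : IsFibrant Z), Nonempty ((toHo D).obj Z ≅ S) := by
  have := Localization.essSurj (toHo D) (weakEquivalences D)
  obtain ⟨Z, _, p, _, _⟩ := FibrantObject.HoCat.exists_resolution ((toHo D).objPreimage S)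
  have := Localization.inverts (toHo D) (weakEquivalences _) p (by rwa [← weakEquivalence_iff])
  exact ⟨Z, ‹_›, ⟨(asIso ((toHo D).map p)).symm ≪≫ (toHo D).objObjPreimageIso S⟩⟩

/-- For cofibrant `T` the coproduct of `T` with itself remains a coproduct in the homotopy
category. -/
lemma nonempty_isColimit_ho (T : D) [IsCofibrant T] :
    Nonempty (IsColimit (BinaryCofan.mk ((toHo D).map (coprod.inl : T ⟶ T ⨿ T))
      ((toHo D).map (coprod.inr : T ⟶ T ⨿ T)))) := by
  have hT : IsCofibrant (T ⨿ T) := isCofibrant_of_cofibration (coprod.inl : T ⟶ T ⨿ T)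
  have hex (X : Ho D) (f g : (toHo D).obj T ⟶ X) : ∃ h : (toHo D).obj (T ⨿ T) ⟶ X,
      (toHo D).map coprod.inl ≫ h = f ∧ (toHo D).map coprod.inr ≫ h = g := by
    obtain ⟨Y, _, ⟨e⟩⟩ := exists_fibrant_iso X
    obtain ⟨f', hf⟩ := map_surjective_of_isLocalization (toHo D) (X := T) (Y := Y) (f ≫ e.inv)
    obtain ⟨g', hg⟩ := map_surjective_of_isLocalization (toHo D) (X := T) (Y := Y) (g ≫ e.inv)
    refine ⟨(toHo D).map (coprod.desc f' g') ≫ e.hom, ?_, ?_⟩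
    · rw [← Functor.map_comp_assoc, coprod.inl_desc, hf]; simp
    · rw [← Functor.map_comp_assoc, coprod.inr_desc, hg]; simp
  have huniq (X : Ho D) (a b : (toHo D).obj (T ⨿ T) ⟶ X)
      (h1 : (toHo D).map coprod.inl ≫ a = (toHo D).map coprod.inl ≫ b)
      (h2 : (toHo D).map coprod.inr ≫ a = (toHo D).map coprod.inr ≫ b) : a = b := by
    obtain ⟨Y, _, ⟨e⟩⟩ := exists_fibrant_iso X
    obtain ⟨a', ha⟩ := map_surjective_of_isLocalization (toHo D) (X := T ⨿ T) (Y := Y) (a ≫ e.inv)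
    obtain ⟨b', hb⟩ := map_surjective_of_isLocalization (toHo D) (X := T ⨿ T) (Y := Y) (b ≫ e.inv)
    rw [← cancel_mono e.inv, ← ha, ← hb]
    have k1 : RightHomotopyRel (coprod.inl ≫ a') (coprod.inl ≫ b') := by
      rw [RightHomotopyRel.iff_map_eq (toHo D)]
      simp only [Functor.map_comp, ha, hb, reassoc_of% h1]
    have k2 : RightHomotopyRel (coprod.inr ≫ a') (coprod.inr ≫ b') := by
      rw [RightHomotopyRel.iff_map_eq (toHo D)]
      simp only [Functor.map_comp, ha, hb, reassoc_of% h2]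
    obtain ⟨P, hP⟩ := PathObject.exists_very_good Y
    have r1 := k1.rightHomotopy P
    have r2 := k2.rightHomotopy P
    rw [← RightHomotopyRel.iff_map_eq (toHo D)]
    exact ⟨P, ⟨{ h := coprod.desc r1.h r2.h
                 h₀ := by
                  apply coprod.hom_ext
                  · rw [coprod.inl_desc_assoc, r1.h₀]
                  · rw [coprod.inr_desc_assoc, r2.h₀]
                 h₁ := by
                  apply coprod.hom_ext
                  · rw [coprod.inl_desc_assoc, r1.h₁]
                  · rw [coprod.inr_desc_assoc, r2.h₁] }⟩⟩
  choose d hd1 hd2 using hex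
  exact ⟨BinaryCofan.IsColimit.mk _ (fun {X} f g => d X f g) (fun {X} f g => hd1 X f g)
    (fun {X} f g => hd2 X f g) (fun {X} f g m h1 h2 => huniq X _ _ (by rw [hd1]; exact h1)
      (by rw [hd2]; exact h2))⟩

variable [SymmetricCategory D] [MonoidalClosed D]

open Functor.LaxMonoidal Functor.Monoidal

/-- The evaluation map in the homotopy category. -/
def hoEv (A Y : D) : (toHo D).obj ((ihom A).obj Y) ⊗ (toHo D).obj A ⟶ (toHo D).obj Y :=
  μ (toHo D) _ _ ≫ (toHo D).map (homEv A Y)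

/-- For fibrant `Y` the internal homomorphism object represents maps in the homotopy category. -/
lemma IsFlat.bijective_hoEv {A : D} (hA : IsFlat A) (Y : D) [IsFibrant Y] (S : Ho D) :
    Function.Bijective fun f : S ⟶ (toHo D).obj ((ihom A).obj Y) =>
      f ▷ (toHo D).obj A ≫ hoEv A Y := by
  obtain ⟨Z, hZ, ⟨e⟩⟩ := exists_cofibrant_iso S
  have hY := hA.isFibrant_ihom Y
  have hZA : IsCofibrant (Z ⊗ A) := by
    have := hA.isCofibrant_tensor Z
    exact isCofibrant_of_cofibration (β_ A Z).hom
  have hcalc (φ : Z ⟶ (ihom A).obj Y) : (toHo D).map φ ▷ (toHo D).obj A ≫ hoEv A Y =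
      μ (toHo D) _ _ ≫ (toHo D).map (φ ▷ A ≫ homEv A Y) := by
    rw [hoEv, μ_natural_left_assoc, Functor.map_comp]
  constructor
  · intro f g hfg
    obtain ⟨f', hf⟩ := map_surjective_of_isLocalization (toHo D) (X := Z) (Y := (ihom A).obj Y)
      (e.hom ≫ f)
    obtain ⟨g', hg⟩ := map_surjective_of_isLocalization (toHo D) (X := Z) (Y := (ihom A).obj Y)
      (e.hom ≫ g)
    rw [← cancel_epi e.hom, ← hf, ← hg]
    have h1 : (toHo D).map (f' ▷ A ≫ homEv A Y) = (toHo D).map (g' ▷ A ≫ homEv A Y) := by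
      rw [← cancel_epi (μ (toHo D) Z A), ← hcalc, ← hcalc, hf, hg]
      have := congrArg (e.hom ▷ _ ≫ ·) hfg
      simpa using this
    rw [← RightHomotopyRel.iff_map_eq (toHo D)] at h1
    obtain ⟨P, hP⟩ := PathObject.exists_very_good Y
    have r := h1.rightHomotopy P
    have : WeakEquivalence ((ihom A).map P.p₀) := hA.weakEquivalence_ihom P.p₀
    have : IsIso ((toHo D).map ((ihom A).map P.p₀)) :=
      Localization.inverts (toHo D) (weakEquivalences _) _ (by rwa [← weakEquivalence_iff])
    have e0 : (toHo D).map ((ihom A).map P.ι) ≫ (toHo D).map ((ihom A).map P.p₀) = 𝟙 _ := by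
      rw [← Functor.map_comp, ← Functor.map_comp, P.ι_p₀]; simp
    have e1 : (toHo D).map ((ihom A).map P.ι) ≫ (toHo D).map ((ihom A).map P.p₁) = 𝟙 _ := by
      rw [← Functor.map_comp, ← Functor.map_comp, P.ι_p₁]; simp
    have e2 : (toHo D).map ((ihom A).map P.p₀) = (toHo D).map ((ihom A).map P.p₁) := by
      have : IsIso ((toHo D).map ((ihom A).map P.ι)) := by
        rw [← IsIso.eq_comp_inv] at e0
        rw [e0]; infer_instance
      rw [← cancel_epi ((toHo D).map ((ihom A).map P.ι)), e0, e1]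
    have e3 {P Y : D} (p : P ⟶ Y) (h : Z ⊗ A ⟶ P) : homAdj h ≫ (ihom A).map p = homAdj (h ≫ p) := by
      rw [homAdj, homAdj, ← MonoidalClosed.curry_natural_right, Category.assoc]
    have e4 (f : Z ⟶ (ihom A).obj Y) : homAdj (f ▷ A ≫ homEv A Y) = f :=
      homEv_injective (homAdj_homEv _)
    have k0 := e3 P.p₀ r.h
    have k1 := e3 P.p₁ r.h
    rw [r.h₀, e4] at k0
    rw [r.h₁, e4] at k1
    exact (congrArg (toHo D).map k0).symm.trans (((Functor.map_comp _ _ _).trans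
      ((congrArg _ e2).trans (Functor.map_comp _ _ _).symm)).trans (congrArg (toHo D).map k1))
  · intro g
    obtain ⟨g', hg⟩ := map_surjective_of_isLocalization (toHo D) (X := Z ⊗ A) (Y := Y)
      (inv (μ (toHo D) Z A) ≫ e.hom ▷ _ ≫ g)
    refine ⟨e.inv ≫ (toHo D).map (homAdj g'), ?_⟩
    dsimp only
    rw [comp_whiskerRight, Category.assoc, hcalc, homAdj_homEv, hg]
    simp

/-- Smashing with a flat object has a right adjoint on the homotopy category. -/
lemma IsFlat.isLeftAdjoint {A : D} (hA : IsFlat A) :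
    (tensorRight ((toHo D).obj A)).IsLeftAdjoint := by
  apply Functor.isLeftAdjoint_of_rightAdjointObjIsDefined_eq_top
  ext X
  simp only [Pi.top_apply, Prop.top_eq_true, iff_true]
  obtain ⟨Y, _, ⟨e⟩⟩ := exists_fibrant_iso X
  exact ⟨(toHo D).obj ((ihom A).obj Y),
    ⟨{ homEquiv := fun {S} => (Equiv.ofBijective _ (hA.bijective_hoEv Y S)).trans
          { toFun := fun f => f ≫ e.hom
            invFun := fun f => f ≫ e.inv
            left_inv := fun f => by simp
            right_inv := fun f => by simp }
       homEquiv_comp := fun f g => by simp [Functor.comp] }⟩⟩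

lemma IsFlat.isLeftAdjoint_tensorLeft {A : D} (hA : IsFlat A) :
    (tensorLeft ((toHo D).obj A)).IsLeftAdjoint := by
  have := hA.isLeftAdjoint
  exact Functor.isLeftAdjoint_of_iso (BraidedCategory.tensorLeftIsoTensorRight _).symm

end HoMaps

/-! ### Sums induced by the cogroup structure -/

namespace CogroupStructure

variable {H : Type*} [Category H] {T : H} (cg : CogroupStructure T)

/-- `h` is the sum of `f, g : Φ T ⟶ X`: for a map `F : Φ W ⟶ X` and maps `a, b : T ⟶ W` these are
the images of `a`, `b` and the product of `a` and `b` in the group `Hom(T, W)`. -/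
def IsSumF (Φ : H ⥤ H) {X : H} (f g h : Φ.obj T ⟶ X) : Prop :=
  ∃ (W : H) (a b : T ⟶ W) (F : Φ.obj W ⟶ X),
    Φ.map a ≫ F = f ∧ Φ.map b ≫ F = g ∧ Φ.map ((cg.group W).mul a b) ≫ F = h

variable {cg}

lemma IsSumF.comp {Φ : H ⥤ H} {X Y : H} {f g h : Φ.obj T ⟶ X} (hs : cg.IsSumF Φ f g h)
    (k : X ⟶ Y) : cg.IsSumF Φ (f ≫ k) (g ≫ k) (h ≫ k) := by
  obtain ⟨W, a, b, F, rfl, rfl, rfl⟩ := hs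
  exact ⟨W, a, b, F ≫ k, by simp, by simp, by simp⟩

lemma IsSumF.natTrans {Φ Φ' : H ⥤ H} (θ : Φ' ⟶ Φ) {X : H} {f g h : Φ.obj T ⟶ X}
    (hs : cg.IsSumF Φ f g h) : cg.IsSumF Φ' (θ.app T ≫ f) (θ.app T ≫ g) (θ.app T ≫ h) := by
  obtain ⟨W, a, b, F, rfl, rfl, rfl⟩ := hs
  exact ⟨W, a, b, θ.app _ ≫ F, by simp, by simp, by simp⟩

lemma IsSumF.functor {Φ : H ⥤ H} (Ψ : H ⥤ H) {X : H} {f g h : Φ.obj T ⟶ X}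
    (hs : cg.IsSumF Φ f g h) : cg.IsSumF (Φ ⋙ Ψ) (Ψ.map f) (Ψ.map g) (Ψ.map h) := by
  obtain ⟨W, a, b, F, rfl, rfl, rfl⟩ := hs
  exact ⟨W, a, b, Ψ.map F, by simp, by simp, by simp⟩

variable (cg)

/-- For a left adjoint functor `Φ` the group structure on `Hom(Φ T, X)` induced by the cogroup
structure of `T`. -/
@[reducible] def funGroup (Φ : H ⥤ H) [Φ.IsLeftAdjoint] (X : H) : Group (Φ.obj T ⟶ X) :=
  letI := cg.group (Φ.rightAdjoint.obj X)
  ((Adjunction.ofIsLeftAdjoint Φ).homEquiv T X).group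

lemma isSumF_mul (Φ : H ⥤ H) [Φ.IsLeftAdjoint] {X W : H} (a b : T ⟶ W) (F : Φ.obj W ⟶ X) :
    (cg.funGroup Φ X).mul (Φ.map a ≫ F) (Φ.map b ≫ F) = Φ.map ((cg.group W).mul a b) ≫ F := by
  let adj := Adjunction.ofIsLeftAdjoint Φ
  apply (adj.homEquiv T X).injective
  refine ((adj.homEquiv T X).apply_symm_apply _).trans ?_
  change (cg.group _).mul (adj.homEquiv T X _) (adj.homEquiv T X _) = _
  rw [adj.homEquiv_naturality_left, adj.homEquiv_naturality_left, adj.homEquiv_naturality_left,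
    ← cg.mul_comp]

omit cg in
lemma exists_components [HasBinaryCoproduct T T] (Φ : H ⥤ H) [Φ.IsLeftAdjoint] {X : H}
    (f g : Φ.obj T ⟶ X) :
    ∃ F : Φ.obj (T ⨿ T) ⟶ X, Φ.map coprod.inl ≫ F = f ∧ Φ.map coprod.inr ≫ F = g := by
  let adj := Adjunction.ofIsLeftAdjoint Φ
  refine ⟨(adj.homEquiv _ X).symm (coprod.desc (adj.homEquiv T X f) (adj.homEquiv T X g)), ?_, ?_⟩
  · rw [← adj.homEquiv_naturality_left_symm, coprod.inl_desc, Equiv.symm_apply_apply]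
  · rw [← adj.homEquiv_naturality_left_symm, coprod.inr_desc, Equiv.symm_apply_apply]

lemma isSumF_iff [HasBinaryCoproduct T T] (Φ : H ⥤ H) [Φ.IsLeftAdjoint] {X : H}
    {f g h : Φ.obj T ⟶ X} : cg.IsSumF Φ f g h ↔ (cg.funGroup Φ X).mul f g = h := by
  constructor
  · rintro ⟨W, a, b, F, rfl, rfl, rfl⟩
    exact cg.isSumF_mul Φ a b F
  · rintro rfl
    obtain ⟨F, h1, h2⟩ := exists_components Φ f g
    refine ⟨_, _, _, F, h1, h2, ?_⟩
    rw [← cg.isSumF_mul Φ, h1, h2]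

end CogroupStructure

namespace CogroupStructure

variable {H : Type*} [Category H] [MonoidalCategory H] [∀ S : H, (tensorLeft S).IsLeftAdjoint]
  {T : H} (cg : CogroupStructure T)

/-- The group structure on `Hom(A ∧ T, X)`. -/
@[reducible] def lastGroup (A X : H) : Group (A ⊗ T ⟶ X) := cg.funGroup (tensorLeft A) X

/-- The sum of two maps `A ∧ T ⟶ X`. -/
def sum {A X : H} (f g : A ⊗ T ⟶ X) : A ⊗ T ⟶ X := (cg.lastGroup A X).mul f g

variable [HasBinaryCoproduct T T]

lemma isSumF_iff_sum {A X : H} {f g h : A ⊗ T ⟶ X} :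
    cg.IsSumF (tensorLeft A) f g h ↔ cg.sum f g = h := cg.isSumF_iff _

lemma isSumF_sum {A X : H} (f g : A ⊗ T ⟶ X) : cg.IsSumF (tensorLeft A) f g (cg.sum f g) :=
  cg.isSumF_iff_sum.2 rfl

lemma sum_comp {A X Y : H} (f g : A ⊗ T ⟶ X) (k : X ⟶ Y) :
    cg.sum f g ≫ k = cg.sum (f ≫ k) (g ≫ k) :=
  (cg.isSumF_iff_sum.1 ((cg.isSumF_sum f g).comp k)).symm

lemma comp_sum {A A' X : H} (u : A' ⟶ A) (f g : A ⊗ T ⟶ X) :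
    u ▷ T ≫ cg.sum f g = cg.sum (u ▷ T ≫ f) (u ▷ T ≫ g) :=
  (cg.isSumF_iff_sum.1 ((cg.isSumF_sum f g).natTrans ((curriedTensor H).map u))).symm

lemma whiskerLeft_sum {A X : H} (P : H) (f g : A ⊗ T ⟶ X) :
    (α_ P A T).hom ≫ P ◁ cg.sum f g = cg.sum ((α_ P A T).hom ≫ P ◁ f) ((α_ P A T).hom ≫ P ◁ g) :=
  (cg.isSumF_iff_sum.1 (((cg.isSumF_sum f g).functor (tensorLeft P)).natTrans
    (tensorLeftTensor P A).hom)).symm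

/-- The group structures given by two factors `T` satisfy the interchange law. -/
lemma interchange (Ψ : H ⥤ H) [(Ψ ⋙ tensorRight T).IsLeftAdjoint] {X : H}
    (f g h k : (Ψ ⋙ tensorRight T).obj T ⟶ X) :
    cg.sum (A := Ψ.obj T) ((cg.funGroup (Ψ ⋙ tensorRight T) X).mul f g)
      ((cg.funGroup (Ψ ⋙ tensorRight T) X).mul h k) =
    (cg.funGroup (Ψ ⋙ tensorRight T) X).mul (cg.sum (A := Ψ.obj T) f h)
      (cg.sum (A := Ψ.obj T) g k) := by
  let Φ := Ψ ⋙ tensorRight T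
  obtain ⟨F₁, hf, hg⟩ := exists_components Φ f g
  obtain ⟨F₂, hh, hk⟩ := exists_components Φ h k
  obtain ⟨F, h1, h2⟩ := exists_components (tensorLeft (Ψ.obj (T ⨿ T))) F₁ F₂
  let i : T ⟶ T ⨿ T := coprod.inl
  let j : T ⟶ T ⨿ T := coprod.inr
  let μ : T ⟶ T ⨿ T := (cg.group (T ⨿ T)).mul i j
  have e1 : (cg.funGroup Φ X).mul f g = Φ.map μ ≫ F₁ := by
    rw [← hf, ← hg, cg.isSumF_mul]
  have e2 : (cg.funGroup Φ X).mul h k = Φ.map μ ≫ F₂ := by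
    rw [← hh, ← hk, cg.isSumF_mul]
  have s (A : H) (G : A ⊗ (T ⨿ T) ⟶ X) : cg.sum (A ◁ i ≫ G) (A ◁ j ≫ G) =
    A ◁ μ ≫ G := cg.isSumF_mul (tensorLeft A) _ _ G
  have l1 {Y Y' Z Z' : H} (a : Y ⟶ Y') (b : Z ⟶ Z') (G : Y' ⊗ Z' ⟶ X) :
      a ▷ Z ≫ Y' ◁ b ≫ G = Y ◁ b ≫ a ▷ Z' ≫ G := by
    rw [whisker_exchange_assoc]
  have e3 : cg.sum (A := Ψ.obj T) f h = Ψ.obj T ◁ μ ≫ Ψ.map i ▷ (T ⨿ T) ≫ F := by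
    rw [← s, ← l1, ← l1]
    exact congrArg₂ _ (hf.symm.trans (congrArg (Φ.map i ≫ ·) h1.symm))
      (hh.symm.trans (congrArg (Φ.map i ≫ ·) h2.symm))
  have e4 : cg.sum (A := Ψ.obj T) g k = Ψ.obj T ◁ μ ≫ Ψ.map j ▷ (T ⨿ T) ≫ F := by
    rw [← s, ← l1, ← l1]
    exact congrArg₂ _ (hg.symm.trans (congrArg (Φ.map j ≫ ·) h1.symm))
      (hk.symm.trans (congrArg (Φ.map j ≫ ·) h2.symm))
  rw [e3, e4, ← l1, ← l1]
  refine Eq.trans ?_ (cg.isSumF_mul Φ _ _ (Ψ.obj (T ⨿ T) ◁ μ ≫ F)).symm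
  change _ = Ψ.map μ ▷ T ≫ Ψ.obj (T ⨿ T) ◁ μ ≫ F
  rw [l1, ← s, ← l1, ← l1]
  exact congrArg₂ _ (e1.trans (congrArg (Φ.map μ ≫ ·) h1.symm))
    (e2.trans (congrArg (Φ.map μ ≫ ·) h2.symm))

lemma eckmannHilton (Ψ : H ⥤ H) [(Ψ ⋙ tensorRight T).IsLeftAdjoint] (X : H) :
    (cg.funGroup (Ψ ⋙ tensorRight T) X).mul = cg.sum (A := Ψ.obj T) ∧
      ∀ f g, cg.sum (A := Ψ.obj T) (X := X) f g = cg.sum g f := by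
  let G₁ := cg.funGroup (Ψ ⋙ tensorRight T) X
  let G₂ := cg.lastGroup (Ψ.obj T) X
  have u₁ : EckmannHilton.IsUnital G₁.mul G₁.one :=
    { left_id := G₁.one_mul, right_id := G₁.mul_one }
  have u₂ : EckmannHilton.IsUnital G₂.mul G₂.one :=
    { left_id := G₂.one_mul, right_id := G₂.mul_one }
  have hd := cg.interchange Ψ (X := X)
  have h : cg.sum (A := Ψ.obj T) = (cg.funGroup (Ψ ⋙ tensorRight T) X).mul :=
    EckmannHilton.mul u₂ u₁ (fun a b c d => hd a b c d)
  have hc := EckmannHilton.mul_comm u₂ u₁ (fun a b c d => hd a b c d)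
  exact ⟨h.symm, fun f g => (congrFun₂ h f g).trans
    ((hc.comm f g).trans (congrFun₂ h g f).symm)⟩

lemma sum_eq_of_isSumF (Ψ : H ⥤ H) [(Ψ ⋙ tensorRight T).IsLeftAdjoint] {X : H}
    {f g h : (Ψ ⋙ tensorRight T).obj T ⟶ X} (hs : cg.IsSumF (Ψ ⋙ tensorRight T) f g h) :
    cg.sum (A := Ψ.obj T) f g = h := by
  rw [← (cg.eckmannHilton Ψ X).1]
  exact (cg.isSumF_iff _).1 hs

variable [SymmetricCategory H]

instance (A : H) : (tensorRight A).IsLeftAdjoint :=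
  Functor.isLeftAdjoint_of_iso (BraidedCategory.tensorLeftIsoTensorRight A)

lemma sum_comm {B X : H} (f g : (B ⊗ T) ⊗ T ⟶ X) : cg.sum f g = cg.sum g f :=
  (cg.eckmannHilton (tensorLeft B) X).2 f g

lemma sum_whiskerRight {A X : H} (f g : A ⊗ T ⟶ X) :
    cg.sum f g ▷ T = cg.sum (f ▷ T) (g ▷ T) :=
  (cg.sum_eq_of_isSumF (tensorLeft A) ((cg.isSumF_sum f g).functor (tensorRight T))).symm

lemma sum_whiskerRight_tensor {A X : H} (Q : H) (f g : A ⊗ T ⟶ X) :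
    (α_ _ Q T).hom ≫ cg.sum f g ▷ (Q ⊗ T) =
      cg.sum ((α_ _ Q T).hom ≫ f ▷ (Q ⊗ T)) ((α_ _ Q T).hom ≫ g ▷ (Q ⊗ T)) :=
  (cg.sum_eq_of_isSumF (tensorLeft A ⋙ tensorRight Q)
    (((cg.isSumF_sum f g).functor (tensorRight (Q ⊗ T))).natTrans
      (Φ' := (tensorLeft A ⋙ tensorRight Q) ⋙ tensorRight T)
      (Functor.whiskerLeft (tensorLeft A) (tensorRightTensor Q T).inv))).symm

/-- The functor `V ↦ V ∧ T^k`. -/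
def smashFun (T : H) (k : ℕ) : H ⥤ H where
  obj V := smashPow T V k
  map g := smashMap g k
  map_id V := by
    induction k with
    | zero => rfl
    | succ k ih => exact (congrArg (· ▷ T) ih).trans (id_whiskerRight _ _)
  map_comp f g := by
    induction k with
    | zero => rfl
    | succ k ih => exact (congrArg (· ▷ T) ih).trans (comp_whiskerRight _ _ _)

omit [∀ S : H, (tensorLeft S).IsLeftAdjoint] [HasBinaryCoproduct T T] [SymmetricCategory H] in
lemma exists_headIso (V : H) (k : ℕ) : ∃ e : smashPow T V (k + 1) ≅ smashPow T (V ⊗ T) k,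
    ∀ {W : H} (g : T ⟶ W), headMap V g k = e.hom ≫ smashMap (V ◁ g) k := by
  induction k with
  | zero => exact ⟨Iso.refl _, fun g => (Category.id_comp _).symm⟩
  | succ k ih =>
    obtain ⟨e, he⟩ := ih
    exact ⟨whiskerRightIso e T, fun g =>
      (congrArg (· ▷ T) (he g)).trans (comp_whiskerRight _ _ _)⟩

instance (k : ℕ) : (smashFun T k).IsLeftAdjoint := by
  induction k with
  | zero => exact inferInstanceAs (𝟭 H).IsLeftAdjoint
  | succ k ih => exact inferInstanceAs (smashFun T k ⋙ tensorRight T).IsLeftAdjoint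

/-- The sum formed at the first factor `T` agrees with the sum formed at the last one. -/
lemma isSum_iff {V X : H} {k : ℕ} {f g h : smashPow T V (k + 1) ⟶ X} :
    cg.IsSum f g h ↔ cg.sum (A := smashPow T V k) f g = h := by
  have hs : ∀ {W X : H} (a b : T ⟶ W) (F : smashPow T (V ⊗ W) k ⟶ X),
      cg.sum (A := smashPow T V k) (headMap V a k ≫ F) (headMap V b k ≫ F) =
        headMap V ((cg.group W).mul a b) k ≫ F := by
    intro W X a b F
    cases k with
    | zero => exact cg.isSumF_mul (tensorLeft V) a b F
    | succ k =>
      obtain ⟨e, he⟩ := exists_headIso (T := T) V k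
      have he' (g : T ⟶ W) : headMap V g (k + 1) ≫ F =
          e.hom ▷ T ≫ ((tensorLeft V ⋙ smashFun T k) ⋙ tensorRight T).map g ≫ F :=
        (congrArg (· ▷ T ≫ F) (he g)).trans (comp_whiskerRight_assoc _ _ _ _)
      refine (congrArg₂ cg.sum (he' a) (he' b)).trans (Eq.trans ?_ (he' _).symm)
      refine Eq.trans (cg.comp_sum _ _ _).symm ?_
      exact congrArg _ (cg.sum_eq_of_isSumF (tensorLeft V ⋙ smashFun T k)
        ⟨_, _, _, F, rfl, rfl, rfl⟩)
  constructor
  · rintro ⟨c, hc, F, rfl, rfl, rfl⟩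
    exact hs _ _ F
  · rintro rfl
    have : ∃ F : smashPow T (V ⊗ (T ⨿ T)) k ⟶ X,
        headMap V coprod.inl k ≫ F = f ∧ headMap V coprod.inr k ≫ F = g := by
      obtain ⟨e, he⟩ := exists_headIso (T := T) V k
      obtain ⟨F, h1, h2⟩ := exists_components (tensorLeft V ⋙ smashFun T k) (e.inv ≫ f) (e.inv ≫ g)
      refine ⟨F, ?_, ?_⟩
      · exact (congrArg (· ≫ F) (he _)).trans ((Category.assoc _ _ _).trans
          ((congrArg (e.hom ≫ ·) h1).trans (e.hom_inv_id_assoc _)))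
      · exact (congrArg (· ≫ F) (he _)).trans ((Category.assoc _ _ _).trans
          ((congrArg (e.hom ≫ ·) h2).trans (e.hom_inv_id_assoc _)))
    obtain ⟨F, h1, h2⟩ := this
    refine ⟨BinaryCofan.mk coprod.inl coprod.inr, ⟨coprodIsCoprod T T⟩, F, h1, h2, ?_⟩
    refine (hs _ _ F).symm.trans ?_
    exact congrArg₂ _ h1 h2

end CogroupStructure

/-! ### Stable homotopy groups as sequential colimits -/

section Colimit

variable {H : Type*} [Category H] [MonoidalCategory H] {T : H} {R : SymRingData T} {V : H} {q : ℤ}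

namespace Pi

lemma mk_stab (a : HRep R V q) : Pi.mk a.stab = Pi.mk a :=
  (Quot.sound (r := fun a b : HRep R V q => b = a.stab) (rfl : a.stab = a.stab)).symm

lemma mk_stab_iterate (a : HRep R V q) (i : ℕ) : Pi.mk (HRep.stab^[i] a) = Pi.mk a := by
  induction i with
  | zero => rfl
  | succ i ih => rw [Function.iterate_succ_apply', mk_stab, ih]

lemma mk_eq_iff (a b : HRep R V q) :
    Pi.mk a = Pi.mk b ↔ ∃ i j, HRep.stab^[i] a = HRep.stab^[j] b := by
  constructor
  · intro h
    have h' := Quot.eqvGen_exact h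
    clear h
    induction h' with
    | rel a b h => exact ⟨1, 0, h.symm⟩
    | refl a => exact ⟨0, 0, rfl⟩
    | symm a b _ ih => obtain ⟨i, j, h⟩ := ih; exact ⟨j, i, h.symm⟩
    | trans a b c _ _ ih ih' =>
      obtain ⟨i, j, h⟩ := ih
      obtain ⟨i', j', h'⟩ := ih'
      refine ⟨i' + i, j + j', ?_⟩
      rw [Function.iterate_add_apply, h, ← Function.iterate_add_apply, Nat.add_comm i' j,
        Function.iterate_add_apply, h', ← Function.iterate_add_apply]
  · rintro ⟨i, j, h⟩
    rw [← mk_stab_iterate a i, h, mk_stab_iterate]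

lemma _root_.SymSpec.HRep.stab_iterate_m (a : HRep R V q) (i : ℕ) :
    (HRep.stab^[i] a).m = a.m + i := by
  induction i with
  | zero => rfl
  | succ i ih => rw [Function.iterate_succ_apply']; exact congrArg (· + 1) ih

/-- Every element has a representative in each sufficiently high level. -/
lemma exists_level (x : Pi R V q) : ∃ M : ℕ, ∀ (k m : ℕ) (hk : (k : ℤ) = q + m), M ≤ m →
    ∃ f : smashPow T V k ⟶ R.X m, Pi.mk ⟨k, m, hk, f⟩ = x := by
  obtain ⟨a, rfl⟩ := Quot.exists_rep x
  refine ⟨a.m, fun k m hk hm => ?_⟩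
  obtain ⟨i, rfl⟩ := Nat.exists_eq_add_of_le hm
  induction i generalizing k with
  | zero =>
    obtain ⟨k', m', h', f⟩ := a
    obtain rfl : k = k' := by simp only [add_zero] at hk; omega
    exact ⟨f, rfl⟩
  | succ i ih =>
    have := a.deg
    obtain ⟨k, rfl⟩ : ∃ k', k = k' + 1 := ⟨k - 1, by omega⟩
    obtain ⟨f, hf⟩ := ih k (by push_cast at hk ⊢; omega) (by omega)
    exact ⟨f ▷ T ≫ R.σ _, (mk_stab ⟨k, a.m + i, _, f⟩).trans hf⟩

/-- Finitely many elements have representatives in a common level. -/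
lemma exists_common (s : Finset (Pi R V q)) : ∃ (k m : ℕ) (hk : ((k + 2 : ℕ) : ℤ) = q + m),
    ∀ x ∈ s, ∃ f : smashPow T V (k + 2) ⟶ R.X m, Pi.mk ⟨k + 2, m, hk, f⟩ = x := by
  choose M hM using exists_level (R := R) (V := V) (q := q)
  let m := s.sup M + (q.natAbs + 2)
  refine ⟨(q + m - 2).toNat, m, by push_cast; omega, fun x hx => hM x _ _ _ ?_⟩
  exact (Finset.le_sup hx).trans (Nat.le_add_right _ _)

end Pi

end Colimit

section PiGroup

variable {H : Type*} [Category H] [MonoidalCategory H] [SymmetricCategory H]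
  [∀ S : H, (tensorLeft S).IsLeftAdjoint] {T : H} [HasBinaryCoproduct T T]
  (cg : CogroupStructure T) {R : SymRingData T} {V : H} {q : ℤ}

/-- The representative `c` is the sum of `a` and `b`, all of the same level. -/
def HRep.IsSum (a b c : HRep R V q) : Prop :=
  ∃ (k m : ℕ) (hk : ((k + 2 : ℕ) : ℤ) = q + m) (f g : smashPow T V (k + 2) ⟶ R.X m),
    a = ⟨k + 2, m, hk, f⟩ ∧ b = ⟨k + 2, m, hk, g⟩ ∧
      c = ⟨k + 2, m, hk, cg.sum (A := smashPow T V (k + 1)) f g⟩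

variable {cg}

lemma HRep.IsSum.stab {a b c : HRep R V q} (h : HRep.IsSum cg a b c) :
    HRep.IsSum cg a.stab b.stab c.stab := by
  obtain ⟨k, m, hk, f, g, rfl, rfl, rfl⟩ := h
  refine ⟨k + 1, m + 1, by push_cast at hk ⊢; omega, f ▷ T ≫ R.σ m, g ▷ T ≫ R.σ m, rfl, rfl, ?_⟩
  have h : cg.sum (A := smashPow T V (k + 1)) f g ▷ T ≫ R.σ m =
    cg.sum (A := smashPow T V (k + 1) ⊗ T) (f ▷ T ≫ R.σ m) (g ▷ T ≫ R.σ m) :=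
    (congrArg (· ≫ R.σ m) (cg.sum_whiskerRight (A := smashPow T V (k + 1)) f g)).trans
      (cg.sum_comp _ _ _)
  simp only [HRep.stab]
  congr 1

lemma HRep.IsSum.stab_iterate {a b c : HRep R V q} (h : HRep.IsSum cg a b c) (i : ℕ) :
    HRep.IsSum cg (HRep.stab^[i] a) (HRep.stab^[i] b) (HRep.stab^[i] c) := by
  induction i with
  | zero => exact h
  | succ i ih => simp only [Function.iterate_succ_apply']; exact ih.stab

omit [SymmetricCategory H] [HasBinaryCoproduct T T] in
lemma HRep.IsSum.unique {a b c c' : HRep R V q} (h : HRep.IsSum cg a b c)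
    (h' : HRep.IsSum cg a b c') : c = c' := by
  obtain ⟨k, m, hk, f, g, rfl, rfl, rfl⟩ := h
  obtain ⟨k', m', hk', f', g', h1, h2, rfl⟩ := h'
  cases h1
  cases h2
  rfl

omit [SymmetricCategory H] [HasBinaryCoproduct T T] in
lemma HRep.IsSum.m_eq {a b c : HRep R V q} (h : HRep.IsSum cg a b c) : a.m = b.m := by
  obtain ⟨k, m, hk, f, g, rfl, rfl, rfl⟩ := h
  rfl

variable (cg)

/-- The element `z` of the stable homotopy group is the sum of `x` and `y`. -/
def Pi.IsSum (x y z : Pi R V q) : Prop :=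
  ∃ a b c : HRep R V q, HRep.IsSum cg a b c ∧ Pi.mk a = x ∧ Pi.mk b = y ∧ Pi.mk c = z

variable {cg}

lemma Pi.IsSum.unique {x y z z' : Pi R V q} (h : Pi.IsSum cg x y z) (h' : Pi.IsSum cg x y z') :
    z = z' := by
  obtain ⟨a, b, c, hs, rfl, rfl, rfl⟩ := h
  obtain ⟨a', b', c', hs', h1, h2, rfl⟩ := h'
  obtain ⟨i, j, h1⟩ := (Pi.mk_eq_iff _ _).1 h1
  obtain ⟨i', j', h2⟩ := (Pi.mk_eq_iff _ _).1 h2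
  have e1 : HRep.stab^[i' + i] a' = HRep.stab^[i' + j] a := by
    rw [Function.iterate_add_apply, h1, ← Function.iterate_add_apply]
  have e2 : HRep.stab^[i' + i] b' = HRep.stab^[i + j'] b := by
    rw [Nat.add_comm, Function.iterate_add_apply, h2, ← Function.iterate_add_apply]
  have hij : i' + j = i + j' := by
    have h3 := congrArg HRep.m h1
    have h4 := congrArg HRep.m h2
    have := hs.m_eq
    have := hs'.m_eq
    simp only [HRep.stab_iterate_m] at h3 h4
    omega
  have s1 := hs'.stab_iterate (i' + i)
  have s2 := hs.stab_iterate (i' + j)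
  rw [e1, e2, ← hij] at s1
  rw [← Pi.mk_stab_iterate c (i' + j), s2.unique s1, Pi.mk_stab_iterate]

omit [SymmetricCategory H] [HasBinaryCoproduct T T] in
lemma Pi.exists_isSum (x y : Pi R V q) : ∃ z, Pi.IsSum cg x y z := by
  classical
  obtain ⟨k, m, hk, h⟩ := Pi.exists_common {x, y}
  obtain ⟨f, hf⟩ := h x (by simp)
  obtain ⟨g, hg⟩ := h y (by simp)
  exact ⟨_, _, _, _, ⟨k, m, hk, f, g, rfl, rfl, rfl⟩, hf, hg, rfl⟩

variable (cg)

/-- The sum of two elements of a stable homotopy group. -/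
def Pi.add (x y : Pi R V q) : Pi R V q := (Pi.exists_isSum (cg := cg) x y).choose

lemma Pi.add_mk {k m : ℕ} (hk : ((k + 2 : ℕ) : ℤ) = q + m) (f g : smashPow T V (k + 2) ⟶ R.X m) :
    Pi.add cg (Pi.mk ⟨k + 2, m, hk, f⟩) (Pi.mk ⟨k + 2, m, hk, g⟩) =
      Pi.mk ⟨k + 2, m, hk, cg.sum (A := smashPow T V (k + 1)) f g⟩ :=
  (Pi.exists_isSum (cg := cg) _ _).choose_spec.unique
    ⟨_, _, _, ⟨k, m, hk, f, g, rfl, rfl, rfl⟩, rfl, rfl, rfl⟩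

lemma Pi.add_assoc (x y z : Pi R V q) :
    Pi.add cg (Pi.add cg x y) z = Pi.add cg x (Pi.add cg y z) := by
  classical
  obtain ⟨k, m, hk, h⟩ := Pi.exists_common {x, y, z}
  obtain ⟨f, rfl⟩ := h x (by simp)
  obtain ⟨g, rfl⟩ := h y (by simp)
  obtain ⟨e, rfl⟩ := h z (by simp)
  rw [Pi.add_mk, Pi.add_mk]
  refine (Pi.add_mk cg hk _ e).trans (Eq.trans ?_ (Pi.add_mk cg hk f _).symm)
  exact congrArg (fun h => Pi.mk (⟨k + 2, m, hk, h⟩ : HRep R V q))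
    ((cg.lastGroup (smashPow T V (k + 1)) (R.X m)).mul_assoc f g e)

lemma Pi.add_comm (x y : Pi R V q) : Pi.add cg x y = Pi.add cg y x := by
  classical
  obtain ⟨k, m, hk, h⟩ := Pi.exists_common {x, y}
  obtain ⟨f, rfl⟩ := h x (by simp)
  obtain ⟨g, rfl⟩ := h y (by simp)
  simp only [Pi.add_mk]
  congr 2
  exact cg.sum_comm (B := smashPow T V k) f g

lemma Pi.exists_add_eq (x y : Pi R V q) : ∃ z, Pi.add cg z x = y := by
  classical
  obtain ⟨k, m, hk, h⟩ := Pi.exists_common {x, y}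
  obtain ⟨f, rfl⟩ := h x (by simp)
  obtain ⟨g, rfl⟩ := h y (by simp)
  let G := cg.lastGroup (smashPow T V (k + 1)) (R.X m)
  refine ⟨Pi.mk ⟨k + 2, m, hk, G.mul g (G.inv f)⟩, (Pi.add_mk cg hk _ f).trans ?_⟩
  congr 2
  exact (G.mul_assoc _ _ _).trans ((congrArg (G.mul g) (G.inv_mul_cancel f)).trans (G.mul_one g))

include cg in
omit [SymmetricCategory H] [HasBinaryCoproduct T T] in
lemma Pi.nonempty : Nonempty (Pi R V q) := by
  obtain ⟨k, m, hk, -⟩ := Pi.exists_common (∅ : Finset (Pi R V q))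
  exact ⟨Pi.mk ⟨k + 2, m, hk, (cg.lastGroup (smashPow T V (k + 1)) (R.X m)).one⟩⟩

lemma Pi.exists_zero : ∃ z : Pi R V q, ∀ x, Pi.add cg z x = x := by
  obtain ⟨a⟩ := Pi.nonempty (R := R) (V := V) (q := q) cg
  obtain ⟨z, hz⟩ := Pi.exists_add_eq cg a a
  refine ⟨z, fun x => ?_⟩
  obtain ⟨c, rfl⟩ := Pi.exists_add_eq cg a x
  rw [Pi.add_comm cg c a, ← Pi.add_assoc, hz]

/-- The abelian group structure of the stable homotopy groups. -/
@[reducible] def piAddCommGroup (R : SymRingData T) (V : H) (q : ℤ) : AddCommGroup (Pi R V q) :=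
  letI : Add (Pi R V q) := ⟨Pi.add cg⟩
  letI : Zero (Pi R V q) := ⟨(Pi.exists_zero cg).choose⟩
  letI : Neg (Pi R V q) := ⟨fun x => (Pi.exists_add_eq cg x 0).choose⟩
  { add_assoc := Pi.add_assoc cg
    zero_add := (Pi.exists_zero cg).choose_spec
    add_zero x := (Pi.add_comm cg _ _).trans ((Pi.exists_zero cg).choose_spec x)
    neg_add_cancel x := (Pi.exists_add_eq cg x _).choose_spec
    add_comm := Pi.add_comm cg
    nsmul := nsmulRec
    zsmul := zsmulRec }

end PiGroup

/-! ### Signs of bijections -/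

section Esign

/-- The sign of a bijection `Fin a ≃ Fin b`, where necessarily `a = b`. -/
def esign {a b : ℕ} (e : Fin a ≃ Fin b) : ℤˣ :=
  have h : a = b := by simpa using Fintype.card_congr e
  Equiv.Perm.sign (e.trans (finCongr h.symm))

lemma esign_perm {a : ℕ} (e : Equiv.Perm (Fin a)) : esign e = Equiv.Perm.sign e := by
  simp [esign]

lemma eq_of_equiv {a b : ℕ} (e : Fin a ≃ Fin b) : a = b := by simpa using Fintype.card_congr e

@[simp] lemma esign_trans {a b c : ℕ} (e : Fin a ≃ Fin b) (e' : Fin b ≃ Fin c) :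
    esign (e.trans e') = esign e * esign e' := by
  obtain rfl := eq_of_equiv e
  obtain rfl := eq_of_equiv e'
  simp only [esign_perm]
  exact (Equiv.Perm.sign_mul e' e).trans (mul_comm _ _)

@[simp] lemma esign_finCongr {a b : ℕ} (h : a = b) : esign (finCongr h) = 1 := by
  subst h
  exact (esign_perm _).trans Equiv.Perm.sign_one

@[simp] lemma esign_refl (a : ℕ) : esign (Equiv.refl (Fin a)) = 1 := esign_finCongr rfl

@[simp] lemma esign_symm {a b : ℕ} (e : Fin a ≃ Fin b) : esign e.symm = esign e := by
  obtain rfl := eq_of_equiv e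
  rw [esign_perm, esign_perm]
  exact Equiv.Perm.sign_inv e

@[simp] lemma esign_sumE {a a' b b' : ℕ} (α : Fin a ≃ Fin a') (β : Fin b ≃ Fin b') :
    esign (sumE α β) = esign α * esign β := by
  obtain rfl := eq_of_equiv α
  obtain rfl := eq_of_equiv β
  simp only [esign_perm]
  rw [← blockSum_eq_sumE, blockSum, Equiv.Perm.sign_permCongr, Equiv.Perm.sign_sumCongr]

lemma finAddFlip_succ (a b : ℕ) : (finAddFlip : Fin (a + (b + 1)) ≃ Fin ((b + 1) + a)) =
    (assocE a b 1).symm.trans ((sumE finAddFlip (Equiv.refl (Fin 1))).trans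
      ((assocE b a 1).trans ((sumE (Equiv.refl _) finAddFlip).trans (assocE b 1 a).symm))) := by
  have c1 (i : Fin a) : (assocE a b 1).symm (Fin.castAdd (b + 1) i) =
    Fin.castAdd 1 (Fin.castAdd b i) := rfl
  have c2 (i : Fin b) : (assocE a b 1).symm (Fin.natAdd a (Fin.castAdd 1 i)) =
    Fin.castAdd 1 (Fin.natAdd a i) := rfl
  have c3 (i : Fin 1) : (assocE a b 1).symm (Fin.natAdd a (Fin.natAdd b i)) =
    Fin.natAdd (a + b) i := Fin.ext (Nat.add_assoc a b i).symm
  have c4 (i : Fin b) : (assocE b a 1) (Fin.castAdd 1 (Fin.castAdd a i)) =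
    Fin.castAdd (a + 1) i := rfl
  have c5 (i : Fin a) : (assocE b a 1) (Fin.castAdd 1 (Fin.natAdd b i)) =
    Fin.natAdd b (Fin.castAdd 1 i) := rfl
  have c6 (i : Fin 1) : (assocE b a 1) (Fin.natAdd (b + a) i) =
    Fin.natAdd b (Fin.natAdd a i) := Fin.ext (by simp)
  have c7 (i : Fin b) : (assocE b 1 a).symm (Fin.castAdd (1 + a) i) =
    Fin.castAdd a (Fin.castAdd 1 i) := rfl
  have c8 (i : Fin 1) : (assocE b 1 a).symm (Fin.natAdd b (Fin.castAdd a i)) =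
    Fin.castAdd a (Fin.natAdd b i) := rfl
  have c9 (i : Fin a) : (assocE b 1 a).symm (Fin.natAdd b (Fin.natAdd 1 i)) =
    Fin.natAdd (b + 1) i := Fin.ext (by simp)
  apply equiv_add_ext
  · intro i
    rw [finAddFlip_apply_castAdd]
    simp only [Equiv.trans_apply, c1, sumE_castAdd, finAddFlip_apply_castAdd, c5, sumE_natAdd, c9]
  · intro i
    rw [finAddFlip_apply_natAdd]
    refine Fin.addCases (fun i => ?_) (fun i => ?_) i
    · simp only [Equiv.trans_apply, c2, sumE_castAdd, finAddFlip_apply_natAdd, c4, c7,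
        Equiv.refl_apply]
    · simp only [Equiv.trans_apply, c3, sumE_natAdd, finAddFlip_apply_natAdd, c6, c8,
        Equiv.refl_apply]

lemma finAddFlip_one (a : ℕ) : esign (finAddFlip : Fin (a + 1) ≃ Fin (1 + a)) = (-1) ^ a := by
  induction a with
  | zero =>
    have : (finAddFlip : Fin (0 + 1) ≃ Fin (1 + 0)) = finCongr (by omega) := by
      ext i; fin_cases i; rfl
    rw [this, esign_finCongr, pow_zero]
  | succ a ih =>
    have h := congrArg Equiv.symm (finAddFlip_succ 1 a)
    have h' : (finAddFlip : Fin (1 + (a + 1)) ≃ Fin (a + 1 + 1)).symm = finAddFlip := rfl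
    rw [h'] at h
    rw [h, esign_symm]
    simp only [esign_trans, esign_symm, esign_finCongr, esign_sumE, esign_refl, one_mul, mul_one]
    have h2 : (finAddFlip : Fin (1 + a) ≃ Fin (a + 1)) =
      (finAddFlip : Fin (a + 1) ≃ Fin (1 + a)).symm := rfl
    have h3 : (finAddFlip : Fin (1 + 1) ≃ Fin (1 + 1)) = Equiv.swap (0 : Fin 2) 1 := by
      ext i; fin_cases i <;> rfl
    rw [h2, esign_symm, ih, h3, esign_perm, Equiv.Perm.sign_swap (by decide), _root_.pow_succ]

@[simp] lemma esign_finAddFlip (a b : ℕ) :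
    esign (finAddFlip : Fin (a + b) ≃ Fin (b + a)) = (-1) ^ (a * b) := by
  induction b with
  | zero =>
    have : (finAddFlip : Fin (a + 0) ≃ Fin (0 + a)) = finCongr (by omega) := by
      apply equiv_add_ext
      · intro i; ext; rw [finAddFlip_apply_castAdd]; exact Nat.zero_add _
      · intro i; exact i.elim0
    rw [this, esign_finCongr, Nat.mul_zero, pow_zero]
  | succ b ih =>
    rw [finAddFlip_succ]
    simp only [esign_trans, esign_symm, esign_finCongr, esign_sumE, esign_refl, one_mul, mul_one]
    rw [ih, finAddFlip_one, ← pow_add, Nat.mul_succ]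

@[simp] lemma esign_blockE (s : ℕ) {p q : ℕ} (e : Fin p ≃ Fin q) :
    esign (blockE s e) = esign e ^ s := by
  obtain rfl := eq_of_equiv e
  rw [esign_perm, esign_perm, ← blockPerm_eq_blockE, blockPerm, Equiv.Perm.sign_permCongr,
    Equiv.prodCongr_refl_right, Equiv.Perm.sign_prodCongrLeft]
  simp

lemma exists_sign {k : ℕ} (hk : 2 ≤ k) (u : ℤˣ) :
    ∃ e : Equiv.Perm (Fin k), Equiv.Perm.sign e = u := by
  obtain rfl | rfl := Int.units_eq_one_or u
  · exact ⟨1, Equiv.Perm.sign_one⟩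
  · exact ⟨Equiv.swap ⟨0, by omega⟩ ⟨1, by omega⟩, Equiv.Perm.sign_swap (by simp)⟩

end Esign

/-! ### Multiplication with maps from powers of `T` -/

namespace SymRingData

section Rmul

variable {C : Type*} [Category C] [MonoidalCategory C] {T : C} {R : SymRingData T}

/-- The product `V ∧ T^(a+b) ⟶ X (m + n)` of `f : V ∧ T^a ⟶ X m` and `y : T^b ⟶ X n`. -/
def rmul {V : C} {a b m n : ℕ} (f : V ⊗ tpow T a ⟶ R.X m) (y : tpow T b ⟶ R.X n) :
    V ⊗ tpow T (a + b) ⟶ R.X (m + n) :=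
  V ◁ (tpowAdd a b).hom ≫ (α_ _ _ _).inv ≫ R.star f y

/-- The unit map `T ⟶ X 1` on the power `T^1`. -/
def unit₁ (R : SymRingData T) : tpow T 1 ⟶ R.X 1 := (tone T).inv ≫ R.one₁

lemma rmul_comp {V W : C} {a b m n : ℕ} (u : W ⟶ V) (f : V ⊗ tpow T a ⟶ R.X m)
    (y : tpow T b ⟶ R.X n) : rmul (u ▷ _ ≫ f) y = u ▷ _ ≫ rmul f y := by
  simp only [rmul, star_comp_left]
  rw [← whisker_exchange_assoc]
  simp

lemma smashIso_rmul {V : C} {a m : ℕ} (f : V ⊗ tpow T a ⟶ R.X m) :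
    (smashIso V (a + 1)).hom ≫ rmul f R.unit₁ =
      (snoc T V a).inv ≫ ((smashIso V a).hom ≫ f) ▷ T ≫ R.σ m := by
  have h1 : (smashIso (T := T) V (a + 1)).hom = (snoc T V a).inv ≫ (smashIso V a).hom ▷ T ≫
    (α_ _ _ _).hom ≫ V ◁ (snoc T (𝟙_ C) a).hom :=
      (congrArg ((smashIso V a).hom ▷ T ≫ ·) (by
        refine (Category.comp_id _).symm.trans ?_
        exact congrArg (_ ≫ ·) (MonoidalCategory.whiskerLeft_id _ _).symm)).trans
          (Category.id_comp _).symm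
  have h2 : (snoc T (𝟙_ C) a).hom ≫ (tpowAdd (T := T) a 1).hom = tpow T a ◁ (tone T).hom := by
    rw [← tpowAdd_one_inv, Category.assoc, Iso.inv_hom_id, Category.comp_id]
  have h3 : R.star f R.unit₁ = (V ⊗ tpow T a) ◁ (tone T).inv ≫ f ▷ T ≫ R.σ m := by
    rw [unit₁, star_comp_right]
    simp [star, σ, MonoidalCategory.tensorHom_def]
  rw [h1, rmul, h3]
  simp only [Category.assoc]
  rw [← MonoidalCategory.whiskerLeft_comp_assoc, h2]
  simp

variable {C : Type*} [Category C] [MonoidalCategory C] [SymmetricCategory C] {T : C}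
  {R : SymRingData T}

lemma rmul_tperm_reindex (hR : R.IsSymRing) {V : C} {a a' b m m' n : ℕ} (f : V ⊗ tpow T a ⟶ R.X m)
    (y : tpow T b ⟶ R.X n) (e : Fin a' ≃ Fin a) (γ : Fin m ≃ Fin m') :
    rmul (V ◁ tperm e ≫ f ≫ R.reindex γ) y =
      V ◁ tperm (sumE e (Equiv.refl _)) ≫ rmul f y ≫ R.reindex (sumE γ (Equiv.refl _)) := by
  have h := tperm_split (T := T) e (Equiv.refl (Fin b))
  rw [tperm_refl, tensorHom_id] at h
  rw [rmul, star_comp_left, hR.star_reindex_left, rmul]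
  simp only [Category.assoc]
  rw [← MonoidalCategory.whiskerLeft_comp_assoc, h]
  simp

lemma rmul_eq_conv {V : C} {a b m n : ℕ} (f : V ⊗ tpow T a ⟶ R.X m) (y : tpow T b ⟶ R.X n) :
    (ρ_ V).hom ▷ _ ≫ rmul f y = conv f ((λ_ _).hom ≫ y) := by
  rw [rmul, conv, star_comp_right, ← whisker_exchange_assoc]
  congr 1
  have h (P Q : C) : (ρ_ V).hom ▷ (P ⊗ Q) ≫ (α_ V P Q).inv =
      tensorμ V (𝟙_ C) P Q ≫ (V ⊗ P) ◁ (λ_ Q).hom := by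
    simp only [tensorμ, braiding_tensorUnit_left]
    monoidal
  rw [reassoc_of% h]

end Rmul

end SymRingData

/-! ### Representatives and their signs -/

section Classes

open SymRingData

variable {H : Type*} [Category H] [MonoidalCategory H] {T : H} {R : SymRingData T} {V : H} {q : ℤ}

/-- The class of a map `V ∧ (T^k) ⟶ X m`. -/
def cl {k m : ℕ} (h : (k : ℤ) = q + m) (f : V ⊗ tpow T k ⟶ R.X m) : Pi R V q :=
  Pi.mk ⟨k, m, h, (smashIso V k).hom ≫ f⟩

/-- A representative as a map on `V ∧ (T^k)`. -/
def HRep.til (a : HRep R V q) : V ⊗ tpow T a.k ⟶ R.X a.m := (smashIso V a.k).inv ≫ a.map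

lemma mk_eq_cl (a : HRep R V q) : Pi.mk a = cl a.deg a.til := by
  simp only [cl, HRep.til, Iso.hom_inv_id_assoc]

lemma exists_cl (x : Pi R V q) : ∃ (k m : ℕ) (h : (k : ℤ) = q + m) (f : V ⊗ tpow T k ⟶ R.X m),
    x = cl h f := by
  obtain ⟨a, rfl⟩ := Quot.exists_rep x
  exact ⟨_, _, _, _, mk_eq_cl a⟩

lemma til_stab (a : HRep R V q) : a.stab.til = rmul a.til R.unit₁ := by
  have h := smashIso_rmul a.til
  rw [HRep.til, Iso.hom_inv_id_assoc] at h
  exact (Iso.inv_comp_eq _).2 (h.trans (Category.id_comp _)).symm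

lemma cl_rmul_unit₁ {k m : ℕ} (h : (k : ℤ) = q + m) (f : V ⊗ tpow T k ⟶ R.X m)
    (h' : ((k + 1 : ℕ) : ℤ) = q + (m + 1 : ℕ)) : cl h' (rmul f R.unit₁) = cl h f := by
  refine Eq.trans ?_ (Pi.mk_stab _)
  rw [mk_eq_cl, til_stab]
  congr 2
  rw [HRep.til, Iso.inv_hom_id_assoc]

lemma exists_cl_two (x : Pi R V q) : ∃ (k m : ℕ) (h : (k : ℤ) = q + m)
    (f : V ⊗ tpow T k ⟶ R.X m), 2 ≤ k ∧ x = cl h f := by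
  obtain ⟨k, m, h, f, rfl⟩ := exists_cl x
  exact ⟨k + 1 + 1, m + 1 + 1, by push_cast; omega, rmul (rmul f R.unit₁) R.unit₁, by omega,
    by rw [cl_rmul_unit₁ (by push_cast; omega), cl_rmul_unit₁ h]⟩

/-- The endomorphism `(-1)_T` for `u = -1` and the identity for `u = 1`. -/
def sgnMap (neg : Aut T) (u : ℤˣ) : T ⟶ T := (if u = 1 then 1 else neg : Aut T).hom

omit [MonoidalCategory H] in
lemma sgnMap_sign (neg : Aut T) {n : ℕ} (τ : Equiv.Perm (Fin n)) :
    sgnMap neg (Equiv.Perm.sign τ) = (signAut neg τ).hom := rfl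

/-- The stabilization of a representative, composed with `(-1)_T` on the first factor `T` of the
source if `u = -1`. -/
def HRep.twist (neg : Aut T) (u : ℤˣ) (a : HRep R V q) : HRep R V q :=
  { a.stab with map := headEnd V (sgnMap neg u) (a.k + 1) ≫ a.stab.map }

/-- The involution of the stable homotopy groups given by `(-1)_T`, if `u = -1`. -/
def Pi.act (neg : Aut T) (u : ℤˣ) : Pi R V q → Pi R V q :=
  Quot.lift (fun a => Pi.mk (a.twist neg u)) (by
    rintro a _ rfl
    refine (Pi.mk_stab _).symm.trans (congrArg Pi.mk ?_)
    simp only [HRep.twist, HRep.stab]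
    congr 1
    exact (congrArg (· ≫ _) (comp_whiskerRight _ _ _)).trans (Category.assoc _ _ _))

lemma headEnd_eq (V : H) (g : T ⟶ T) (k : ℕ) :
    headEnd V g k ≫ (smashIso V k).hom = (smashIso V k).hom ≫ V ◁ headEnd (𝟙_ H) g k := by
  match k with
  | 0 =>
    refine (Category.id_comp _).trans ?_
    exact (Category.comp_id _).symm.trans
      (congrArg (_ ≫ ·) (MonoidalCategory.whiskerLeft_id _ _).symm)
  | 1 =>
    have h : V ◁ g ≫ (ρ_ V).inv ▷ T ≫ (α_ _ _ _).hom =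
      ((ρ_ V).inv ▷ T ≫ (α_ _ _ _).hom) ≫ V ◁ 𝟙_ H ◁ g := by simp
    exact h
  | k + 2 =>
    have ih := headEnd_eq V g (k + 1)
    have h {X Y Z : H} (a : X ⟶ X) (i : X ⟶ V ⊗ Z) (b : Z ⟶ Z) (h : a ≫ i = i ≫ V ◁ b) :
        a ▷ T ≫ i ▷ T ≫ (α_ _ _ _).hom = (i ▷ T ≫ (α_ _ _ _).hom) ≫ V ◁ b ▷ T := by
      rw [← comp_whiskerRight_assoc, h]; simp
    exact h (Y := V) _ _ _ ih

lemma act_cl (neg : Aut T) (u : ℤˣ) {k m : ℕ} (h : (k : ℤ) = q + m) (f : V ⊗ tpow T k ⟶ R.X m)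
    (h' : ((k + 1 : ℕ) : ℤ) = q + (m + 1 : ℕ)) : Pi.act neg u (cl h f) =
      cl h' (V ◁ headEnd (𝟙_ H) (sgnMap neg u) (k + 1) ≫ rmul f R.unit₁) := by
  refine congrArg Pi.mk ?_
  simp only [HRep.twist, HRep.stab]
  congr 1
  have h1 := headEnd_eq V (sgnMap neg u) (k + 1)
  rw [← reassoc_of% h1, smashIso_rmul]
  exact congrArg (headEnd V (sgnMap neg u) (k + 1) ≫ ·) (Category.id_comp _).symm

variable [SymmetricCategory H] (sgn : SignStructure T)

lemma tperm_eq_headEnd {k : ℕ} (e : Equiv.Perm (Fin k)) :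
    tperm (T := T) e = headEnd (𝟙_ H) (sgnMap sgn.neg (Equiv.Perm.sign e)) k := by
  rw [tperm_perm, sgn.perm_eq, sgnMap_sign]

variable (hR : R.IsSymRing)
include hR

lemma cl_tperm {k m : ℕ} (h : (k : ℤ) = q + m) (f : V ⊗ tpow T k ⟶ R.X m)
    (e : Equiv.Perm (Fin k)) :
    cl h (V ◁ tperm e ≫ f) = Pi.act sgn.neg (Equiv.Perm.sign e) (cl h f) := by
  have h' : ((k + 1 : ℕ) : ℤ) = q + (m + 1 : ℕ) := by push_cast; omega
  rw [act_cl _ _ _ _ h', ← cl_rmul_unit₁ h _ h']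
  have h1 := rmul_tperm_reindex hR f R.unit₁ e (Equiv.refl _)
  rw [hR.reindex_refl, sumE_refl, hR.reindex_refl, Category.comp_id, Category.comp_id] at h1
  have h2 := esign_sumE e (Equiv.refl (Fin 1))
  rw [esign_perm, esign_perm, esign_refl, mul_one] at h2
  rw [h1, tperm_eq_headEnd sgn, h2]

lemma act_one (x : Pi R V q) : Pi.act sgn.neg 1 x = x := by
  obtain ⟨k, m, h, f, rfl⟩ := exists_cl x
  have := cl_tperm sgn hR h f 1
  have h1 : tperm (T := T) (1 : Equiv.Perm (Fin k)) = 𝟙 _ := tperm_refl k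
  rw [h1, MonoidalCategory.whiskerLeft_id, Category.id_comp, Equiv.Perm.sign_one] at this
  exact this.symm

lemma act_act (u v : ℤˣ) (x : Pi R V q) :
    Pi.act sgn.neg u (Pi.act sgn.neg v x) = Pi.act sgn.neg (u * v) x := by
  obtain ⟨k, m, h, f, hk, rfl⟩ := exists_cl_two x
  obtain ⟨e, rfl⟩ := exists_sign hk u
  obtain ⟨e', rfl⟩ := exists_sign hk v
  rw [← cl_tperm sgn hR, ← cl_tperm sgn hR, ← Category.assoc, ← MonoidalCategory.whiskerLeft_comp,
    ← tperm_trans, cl_tperm sgn hR]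
  congr 1
  exact (Equiv.Perm.sign_mul e' e).trans (mul_comm _ _)

lemma act_injective (u : ℤˣ) {x y : Pi R V q} (h : Pi.act sgn.neg u x = Pi.act sgn.neg u y) :
    x = y := by
  have := congrArg (Pi.act sgn.neg u) h
  rwa [act_act sgn hR, act_act sgn hR, Int.units_mul_self, act_one sgn hR, act_one sgn hR] at this

variable (htr : TrivialAction sgn.neg R V q)
include htr

lemma cl_reindex {k m : ℕ} (h : (k : ℤ) = q + m) (f : V ⊗ tpow T k ⟶ R.X m)
    (γ : Equiv.Perm (Fin m)) :
    cl h (f ≫ R.reindex γ) = Pi.act sgn.neg (Equiv.Perm.sign γ) (cl h f) := by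
  -- first the case of a source with at least two factors `T`
  have key {k m : ℕ} (hk : 2 ≤ k) (h : (k : ℤ) = q + m) (f : V ⊗ tpow T k ⟶ R.X m)
      (γ : Equiv.Perm (Fin m)) :
      cl h (f ≫ R.reindex γ) = Pi.act sgn.neg (Equiv.Perm.sign γ) (cl h f) := by
    obtain ⟨e, he⟩ := exists_sign hk (Equiv.Perm.sign γ)
    let a : HRep R V q := ⟨k, m, h, (smashIso V k).hom ≫ f⟩
    let φ : ℕ → ℕ := fun j => if hj : j < m then γ ⟨j, hj⟩ else j
    have hφ : Function.Injective φ := by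
      intro i j hij
      simp only [φ] at hij
      split_ifs at hij with hi hj hj
      · simpa using γ.injective (Fin.ext hij)
      · have := (γ ⟨i, hi⟩).2; omega
      · have := (γ ⟨j, hj⟩).2; omega
      · exact hij
    have h1 : Pi.mk (a.permute sgn.neg γ) = Pi.mk a :=
      htr a hk φ hφ _ ⟨0, γ, fun j _ => by simp only [φ]; exact (dif_pos (c := (j : ℕ) < m)
        (t := fun hj => (γ ⟨j, hj⟩ : ℕ)) j.2).symm, rfl⟩
    have h2 : Pi.mk (a.permute sgn.neg γ) = cl h (V ◁ tperm e ≫ f ≫ R.reindex γ) := by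
      refine congrArg Pi.mk ?_
      simp only [HRep.permute, a]
      congr 1
      have h3 := headEnd_eq V (signAut sgn.neg γ).hom k
      rw [tperm_eq_headEnd sgn, he, sgnMap_sign, ← reassoc_of% h3, ← R.reindex_perm, Category.assoc]
    rw [h2, cl_tperm sgn hR, he] at h1
    apply act_injective sgn hR (Equiv.Perm.sign γ)
    rw [h1, act_act sgn hR, Int.units_mul_self, act_one sgn hR]
    rfl
  have h' : ((k + 1 : ℕ) : ℤ) = q + (m + 1 : ℕ) := by push_cast; omega
  have h'' : ((k + 1 + 1 : ℕ) : ℤ) = q + (m + 1 + 1 : ℕ) := by push_cast; omega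
  have e1 {k m : ℕ} (f : V ⊗ tpow T k ⟶ R.X m) (γ : Equiv.Perm (Fin m)) :
      rmul (f ≫ R.reindex γ) R.unit₁ = rmul f R.unit₁ ≫ R.reindex (sumE γ (Equiv.refl _)) := by
    have h1 := rmul_tperm_reindex hR f R.unit₁ (Equiv.refl _) γ
    rwa [sumE_refl, tperm_refl, tperm_refl, MonoidalCategory.whiskerLeft_id,
      MonoidalCategory.whiskerLeft_id, Category.id_comp, Category.id_comp] at h1
  rw [← cl_rmul_unit₁ h _ h', ← cl_rmul_unit₁ h' _ h'', e1, e1, key (by omega), cl_rmul_unit₁ h',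
    cl_rmul_unit₁ h]
  congr 1
  have h2 : esign (sumE (sumE γ (Equiv.refl (Fin 1))) (Equiv.refl (Fin 1))) = esign γ := by
    rw [esign_sumE, esign_sumE, esign_refl, mul_one, mul_one]
  rwa [esign_perm, esign_perm γ] at h2

/-- The effect of permutations of the source and the target on the class of a map. -/
lemma cl_perm {k k' m m' : ℕ} (h : (k : ℤ) = q + m) (f : V ⊗ tpow T k ⟶ R.X m)
    (e : Fin k' ≃ Fin k) (γ : Fin m ≃ Fin m') (h' : (k' : ℤ) = q + m') :
    cl h' (V ◁ tperm e ≫ f ≫ R.reindex γ) = Pi.act sgn.neg (esign e * esign γ) (cl h f) := by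
  obtain rfl := eq_of_equiv e
  obtain rfl := eq_of_equiv γ
  rw [cl_tperm sgn hR, cl_reindex sgn hR htr, act_act sgn hR, esign_perm, esign_perm]

end Classes

/-! ### Products of homotopy classes -/

lemma pow_eq_negOnePow (n : ℕ) : (-1 : ℤˣ) ^ n = (n : ℤ).negOnePow := (zpow_natCast _ _).symm

namespace SymRingData

section

variable {C : Type*} [Category C] [MonoidalCategory C] [SymmetricCategory C] {T : C}
  {R : SymRingData T} (hR : R.IsSymRing)
include hR

lemma IsSymRing.rmul_conv {V W : C} {k k' b m m' n : ℕ} (f : V ⊗ tpow T k ⟶ R.X m)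
    (g : W ⊗ tpow T k' ⟶ R.X m') (y : tpow T b ⟶ R.X n) :
    rmul (conv f g) y ≫ R.reindex (assocE m m' n) =
      (V ⊗ W) ◁ tperm (assocE k k' b) ≫ conv f (rmul g y) := by
  have h := hR.conv_assoc f g ((λ_ _).hom ≫ y)
  rw [← rmul_eq_conv g y, conv_whisker_right, ← rmul_eq_conv, Category.assoc] at h
  rw [← cancel_epi ((ρ_ (V ⊗ W)).hom ▷ tpow T (k + k' + b)), h, ← tensorHom_id,
    tensorHom_comp_tensorHom_assoc, Category.comp_id, rightUnitor_tensor_hom,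
    MonoidalCategory.tensorHom_def, Category.assoc]

omit hR in
lemma conv_unitor {W : C} {k' b m' n : ℕ} (g : W ⊗ tpow T k' ⟶ R.X m') {y : tpow T b ⟶ R.X n}
    (hy : R.IsCentral y) : conv ((λ_ _).hom ≫ y) g =
      ((λ_ W).hom ⊗ₘ tperm finAddFlip) ≫ rmul g y ≫ R.reindex finAddFlip := by
  have h := IsSymRing.conv_comm g (hy.comp (λ_ (tpow T b)).hom)
  rw [← rmul_eq_conv] at h
  have e : ((λ_ W).hom ⊗ₘ tperm (T := T) (finAddFlip : Fin (b + k') ≃ Fin (k' + b))) =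
      ((β_ (𝟙_ C) W).hom ⊗ₘ tperm finAddFlip) ≫ (ρ_ W).hom ▷ tpow T (k' + b) := by
    rw [← tensorHom_id, tensorHom_comp_tensorHom, Category.comp_id]
    congr 1
    simp
  have e2 : tperm (T := T) (finAddFlip : Fin (b + k') ≃ Fin (k' + b)) ≫ tperm finAddFlip = 𝟙 _ :=
    tperm_comp_symm finAddFlip
  rw [e, Category.assoc, ← Category.assoc (((ρ_ W).hom ▷ _)), h, tensorHom_comp_tensorHom_assoc, e2,
    SymmetricCategory.symmetry, id_tensorHom_id, Category.id_comp]

lemma IsSymRing.conv_rmul {V W : C} {k k' b m m' n : ℕ} (f : V ⊗ tpow T k ⟶ R.X m)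
    (g : W ⊗ tpow T k' ⟶ R.X m') {y : tpow T b ⟶ R.X n} (hy : R.IsCentral y) :
    conv (rmul f y) g ≫ R.reindex (assocE m n m') =
      (V ⊗ W) ◁ tperm ((assocE k b k').trans (sumE (Equiv.refl _) finAddFlip)) ≫
        conv f (rmul g y) ≫ R.reindex (sumE (Equiv.refl _) finAddFlip) := by
  have h := hR.conv_assoc f ((λ_ _).hom ≫ y) g
  rw [conv_unitor g hy, ← rmul_eq_conv f y, conv_whisker_left, ← Category.assoc (_ ⊗ₘ _),
    hR.conv_reindex_right, conv_comp_right, Category.assoc, Category.assoc] at h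
  rw [← cancel_epi ((ρ_ V).hom ▷ W ▷ tpow T (k + b + k')), h, tensorHom_comp_tensorHom_assoc,
    ← triangle, tperm_trans, MonoidalCategory.tensorHom_def, Category.assoc]

lemma IsSymRing.isCentral_unit₁ : R.IsCentral R.unit₁ := hR.one₁_central.comp _

end

end SymRingData

section Products

open SymRingData

variable {H : Type*} [Category H] [MonoidalCategory H] [SymmetricCategory H] {T : H}
  (sgn : SignStructure T) {R : SymRingData T} (hR : R.IsSymRing)

section

variable {V : H} {q : ℤ} (htr : TrivialAction sgn.neg R V q)
include hR htr

/-- Maps which agree up to permutations have the same class up to sign. -/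
lemma cl_eq {k k' m m' n : ℕ} (h : (k : ℤ) = q + m) (h' : (k' : ℤ) = q + m')
    {f : V ⊗ tpow T k ⟶ R.X m} {g : V ⊗ tpow T k' ⟶ R.X m'} {γ : Fin m ≃ Fin n}
    {e : Fin k ≃ Fin k'} {δ : Fin m' ≃ Fin n}
    (hfg : f ≫ R.reindex γ = V ◁ tperm e ≫ g ≫ R.reindex δ) :
    cl h f = Pi.act sgn.neg (esign γ * (esign e * esign δ)) (cl h' g) := by
  have hn : (k : ℤ) = q + n := by rw [← eq_of_equiv γ]; exact h
  have h1 := cl_perm sgn hR htr h f (Equiv.refl _) γ hn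
  rw [tperm_refl, MonoidalCategory.whiskerLeft_id, Category.id_comp, hfg, esign_refl, one_mul,
    cl_perm sgn hR htr h' g e δ hn] at h1
  rw [← act_act sgn hR, h1, act_act sgn hR, Int.units_mul_self, act_one sgn hR]

end

section

variable {V V' W : H} {q q' : ℤ} (d : W ⟶ V ⊗ V')

lemma deg_add {k k' m m' : ℕ} (h : (k : ℤ) = q + m) (h' : (k' : ℤ) = q' + m') :
    ((k + k' : ℕ) : ℤ) = q + q' + (m + m' : ℕ) := by push_cast; omega

/-- The product of representatives without sign. -/
def HRep.mul₀ (a : HRep R V q) (b : HRep R V' q') : HRep R W (q + q') where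
  k := a.k + b.k
  m := a.m + b.m
  deg := deg_add a.deg b.deg
  map := smashSplit d a.k b.k ≫ (a.map ⊗ₘ b.map) ≫ R.mul a.m b.m

lemma mk_mul₀ (a : HRep R V q) (b : HRep R V' q') : Pi.mk (a.mul₀ d b) =
    cl (deg_add a.deg b.deg) (d ▷ _ ≫ conv a.til b.til) := by
  refine congrArg Pi.mk ?_
  simp only [HRep.mul₀]
  congr 1
  simp only [smashSplit, HRep.til, conv, SymRingData.star, Category.assoc]
  rw [MonoidalCategory.tensorHom_def d]
  simp only [Category.assoc, tensorHom_comp_tensorHom_assoc]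

variable {Q : ℤ} (htr : TrivialAction sgn.neg R W Q)
include hR htr

lemma cl_conv_rmul {k k' b m m' n : ℕ} (f : V ⊗ tpow T k ⟶ R.X m) (g : V' ⊗ tpow T k' ⟶ R.X m')
    (y : tpow T b ⟶ R.X n) (h₁ : ((k + (k' + b) : ℕ) : ℤ) = Q + (m + (m' + n) : ℕ))
    (h₂ : ((k + k' + b : ℕ) : ℤ) = Q + (m + m' + n : ℕ)) :
    cl h₁ (d ▷ _ ≫ conv f (rmul g y)) = cl h₂ (rmul (d ▷ _ ≫ conv f g) y) := by
  have h := congrArg (d ▷ _ ≫ ·) (hR.rmul_conv f g y)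
  rw [← whisker_exchange_assoc, ← Category.assoc, ← rmul_comp] at h
  have h' := cl_eq sgn hR htr h₂ h₁ (e := assocE k k' b) (δ := Equiv.refl _)
    (h.trans (by rw [hR.reindex_refl, Category.comp_id]))
  rw [h']
  simp only [esign_finCongr, esign_refl, mul_one, act_one sgn hR]

lemma cl_rmul_conv {k k' b m m' n : ℕ} (f : V ⊗ tpow T k ⟶ R.X m) (g : V' ⊗ tpow T k' ⟶ R.X m')
    {y : tpow T b ⟶ R.X n} (hy : R.IsCentral y)
    (h₁ : ((k + b + k' : ℕ) : ℤ) = Q + (m + n + m' : ℕ))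
    (h₂ : ((k + k' + b : ℕ) : ℤ) = Q + (m + m' + n : ℕ)) :
    cl h₁ (d ▷ _ ≫ conv (rmul f y) g) = Pi.act sgn.neg ((-1) ^ (b * k') * (-1) ^ (n * m'))
      (cl h₂ (rmul (d ▷ _ ≫ conv f g) y)) := by
  have h₃ : ((k + (k' + b) : ℕ) : ℤ) = Q + (m + (m' + n) : ℕ) := by push_cast at h₂ ⊢; omega
  have h := congrArg (d ▷ _ ≫ ·) (hR.conv_rmul f g hy)
  rw [← whisker_exchange_assoc, ← Category.assoc] at h
  have h' := cl_eq sgn hR htr h₁ h₃ (h.trans (congrArg (_ ≫ ·) (Category.assoc _ _ _).symm))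
  rw [h', ← cl_conv_rmul sgn hR d htr f g y h₃]
  congr 1
  simp [mul_comm m' n]

end

section

variable {V V' W : H} {q q' : ℤ} (d : W ⟶ V ⊗ V') (htr : TrivialAction sgn.neg R W (q + q'))

/-- The product of homotopy classes given by a map `W ⟶ V ∧ V'`. -/
def Pi.mul (hR : R.IsSymRing) (htr : TrivialAction sgn.neg R W (q + q')) :
    Pi R V q → Pi R V' q' → Pi R W (q + q') :=
  Quot.lift₂ (fun a b => Pi.act sgn.neg (q' * a.m).negOnePow (Pi.mk (a.mul₀ d b)))
    (by
      rintro a b _ rfl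
      have h := deg_add (deg_add a.deg b.deg) (q' := 0) (k' := 1) (m' := 1) (by norm_num)
      rw [add_zero] at h
      have h' := deg_add a.deg b.stab.deg
      rw [mk_mul₀, mk_mul₀, til_stab]
      have h1 := cl_conv_rmul sgn hR d htr a.til b.til R.unit₁ h' h
      exact congrArg _ ((cl_rmul_unit₁ _ _ h).symm.trans h1.symm))
    (by
      rintro a _ b rfl
      have h := deg_add (deg_add a.deg b.deg) (q' := 0) (k' := 1) (m' := 1) (by norm_num)
      rw [add_zero] at h
      have h' := deg_add a.stab.deg b.deg
      rw [mk_mul₀, mk_mul₀, til_stab]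
      have h1 := cl_rmul_conv sgn hR d htr a.til b.til hR.isCentral_unit₁ h' h
      refine Eq.trans ?_ (congrArg _ h1).symm
      rw [cl_rmul_unit₁ (deg_add a.deg b.deg) _ h, act_act sgn hR]
      congr 1
      have := b.deg
      simp only [HRep.stab, pow_eq_negOnePow, ← Int.negOnePow_add]
      rw [Int.negOnePow_eq_iff]
      exact ⟨-(q' + b.m), by push_cast; rw [this]; ring⟩)

lemma mul_mk₀ (a : HRep R V q) (b : HRep R V' q') :
    Pi.mul sgn d hR htr (Pi.mk a) (Pi.mk b) =
      Pi.act sgn.neg (q' * a.m).negOnePow (Pi.mk (a.mul₀ d b)) := rfl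

lemma mul_cl {k k' m m' : ℕ} (h : (k : ℤ) = q + m) (h' : (k' : ℤ) = q' + m')
    (f : V ⊗ tpow T k ⟶ R.X m) (g : V' ⊗ tpow T k' ⟶ R.X m') :
    Pi.mul sgn d hR htr (cl h f) (cl h' g) =
      Pi.act sgn.neg (q' * m).negOnePow (cl (deg_add h h') (d ▷ _ ≫ conv f g)) := by
  refine (mul_mk₀ sgn hR d htr _ _).trans ?_
  rw [mk_mul₀]
  simp only [HRep.til, Iso.inv_hom_id_assoc]

include hR in
lemma act_mul (u : ℤˣ) (x : Pi R V q) (y : Pi R V' q') :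
    Pi.mul sgn d hR htr (Pi.act sgn.neg u x) y =
      Pi.act sgn.neg u (Pi.mul sgn d hR htr x y) := by
  obtain ⟨k, m, h, f, hk, rfl⟩ := exists_cl_two x
  obtain ⟨k', m', h', g, rfl⟩ := exists_cl y
  obtain ⟨e, rfl⟩ := exists_sign hk u
  rw [← cl_tperm sgn hR, mul_cl, mul_cl, act_act sgn hR,
    mul_comm (Equiv.Perm.sign e), ← act_act sgn hR]
  congr 1
  have h1 := hR.conv_tperm_reindex_left f g e (Equiv.refl _)
  rw [hR.reindex_refl, Category.comp_id] at h1
  rw [h1, ← whisker_exchange_assoc, ← Category.assoc (d ▷ _),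
    cl_perm sgn hR htr (deg_add h h') _ _ _ (deg_add h h')]
  rw [esign_sumE, esign_sumE, esign_refl, esign_refl, esign_refl, esign_perm]
  simp only [mul_one]

include hR in
lemma mul_act (u : ℤˣ) (x : Pi R V q) (y : Pi R V' q') :
    Pi.mul sgn d hR htr x (Pi.act sgn.neg u y) =
      Pi.act sgn.neg u (Pi.mul sgn d hR htr x y) := by
  obtain ⟨k, m, h, f, rfl⟩ := exists_cl x
  obtain ⟨k', m', h', g, hk', rfl⟩ := exists_cl_two y
  obtain ⟨e, rfl⟩ := exists_sign hk' u
  rw [← cl_tperm sgn hR, mul_cl, mul_cl, act_act sgn hR,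
    mul_comm (Equiv.Perm.sign e), ← act_act sgn hR]
  congr 1
  have h1 := hR.conv_tperm_reindex_right f g e (Equiv.refl _)
  rw [hR.reindex_refl, Category.comp_id] at h1
  rw [h1, ← whisker_exchange_assoc, ← Category.assoc (d ▷ _),
    cl_perm sgn hR htr (deg_add h h') _ _ _ (deg_add h h')]
  rw [esign_sumE, esign_sumE, esign_refl, esign_refl, esign_refl, esign_perm]
  simp only [mul_one, one_mul]

lemma sgnMap_negOnePow (n : ℤ) : sgnMap sgn.neg n.negOnePow = (sgn.neg ^ n).hom := by
  have h2 : sgn.neg ^ (2 : ℤ) = 1 := (zpow_two _).trans sgn.neg_mul_neg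
  obtain ⟨k, rfl⟩ | ⟨k, rfl⟩ := Int.even_or_odd n
  · rw [Int.negOnePow_even _ ⟨k, rfl⟩, ← two_mul, zpow_mul, h2, one_zpow]
    simp [sgnMap]
  · rw [Int.negOnePow_odd _ ⟨k, rfl⟩, zpow_add, zpow_mul, h2, one_zpow, one_mul, zpow_one]
    simp [sgnMap]

omit [SymmetricCategory H] in
lemma act_mk (neg : Aut T) (u : ℤˣ) (a : HRep R V q) (ha : 1 ≤ a.k) : Pi.act neg u (Pi.mk a) =
    Pi.mk { a with map := headEnd V (sgnMap neg u) a.k ≫ a.map } := by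
  refine Eq.trans ?_ (Pi.mk_stab _)
  refine congrArg Pi.mk ?_
  obtain ⟨k, m, hk, f⟩ := a
  obtain ⟨k, rfl⟩ : ∃ k', k = k' + 1 := ⟨k - 1, by simp only at ha; omega⟩
  simp only [HRep.twist, HRep.stab]
  congr 1
  exact ((congrArg (· ≫ R.σ m) (comp_whiskerRight _ _ _)).trans (Category.assoc _ _ _)).symm

lemma mul_mk (a : HRep R V q) (b : HRep R V' q') (ha : 1 ≤ a.k) :
    Pi.mul sgn d hR htr (Pi.mk a) (Pi.mk b) = Pi.mk (a.mul sgn.neg d b) := by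
  refine (act_mk sgn.neg _ (a.mul₀ d b) (ha.trans (Nat.le_add_right _ _))).trans ?_
  rw [sgnMap_negOnePow]
  rfl

end

/-! ### Distributivity -/

section Distrib

variable {V V' W : H} {q q' : ℤ} (d : W ⟶ V ⊗ V')

lemma smashSplit_succ (k k' : ℕ) : smashSplit (T := T) d k (k' + 1) =
    (snoc T W (k + k')).inv ≫ smashSplit d k k' ▷ T ≫ (α_ _ _ _).hom ≫
      smashPow T V k ◁ (snoc T V' k').hom := by
  have h₀ (P Q : H) : (α_ (V ⊗ V') (P ⊗ Q) T).hom ≫ (V ⊗ V') ◁ (α_ P Q T).hom ≫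
      tensorμ V V' P (Q ⊗ T) = tensorμ V V' P Q ▷ T ≫ (α_ (V ⊗ P) (V' ⊗ Q) T).hom ≫
        (V ⊗ P) ◁ (α_ V' Q T).hom := by
    simp only [tensorμ]
    monoidal
  have h (P Q X Y Z S : H) (i : X ⟶ W ⊗ Y) (j : Y ⟶ P ⊗ Q) (s : V ⊗ P ⟶ Z) (t : V' ⊗ Q ⟶ S) :
      (i ▷ T ≫ (α_ W Y T).hom) ≫ (d ⊗ₘ (j ▷ T ≫ (α_ P Q T).hom)) ≫ tensorμ V V' P (Q ⊗ T) ≫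
        (s ⊗ₘ ((α_ V' Q T).inv ≫ t ▷ T)) =
      (i ≫ (d ⊗ₘ j) ≫ tensorμ V V' P Q ≫ (s ⊗ₘ t)) ▷ T ≫ (α_ Z S T).hom := by
    have e1 : (α_ W Y T).hom ≫ (d ⊗ₘ (j ▷ T ≫ (α_ P Q T).hom)) =
        (d ⊗ₘ j) ▷ T ≫ (α_ (V ⊗ V') (P ⊗ Q) T).hom ≫ (V ⊗ V') ◁ (α_ P Q T).hom := by
      have e0 : (d ⊗ₘ (j ▷ T ≫ (α_ P Q T).hom)) = (d ⊗ₘ (j ⊗ₘ 𝟙 T)) ≫ (V ⊗ V') ◁ (α_ P Q T).hom := by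
        rw [← id_tensorHom, tensorHom_comp_tensorHom, Category.comp_id, tensorHom_id]
      rw [e0, ← associator_naturality_assoc, tensorHom_id]
    have e2 : (V ⊗ P) ◁ (α_ V' Q T).hom ≫ (s ⊗ₘ ((α_ V' Q T).inv ≫ t ▷ T)) = s ⊗ₘ (t ▷ T) := by
      rw [← id_tensorHom, tensorHom_comp_tensorHom, Iso.hom_inv_id_assoc, Category.id_comp]
    rw [Category.assoc, reassoc_of% e1, reassoc_of% (h₀ P Q), e2, ← tensorHom_id t T,
      ← associator_naturality, tensorHom_id]
    simp only [comp_whiskerRight, Category.assoc]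
  refine (h _ _ _ _ _ _ (smashIso W (k + k')).hom (tpowAdd k k').hom (smashIso V k).inv
    (smashIso V' k').inv).trans ?_
  refine (Category.id_comp _).symm.trans (congrArg (_ ≫ smashSplit d k k' ▷ T ≫ ·) ?_)
  exact (Category.comp_id _).symm.trans
    (congrArg (_ ≫ ·) (MonoidalCategory.whiskerLeft_id _ _).symm)

lemma mul₀_map_succ {k k' m m' : ℕ} (f : smashPow T V k ⟶ R.X m)
    (g : smashPow T V' (k' + 1) ⟶ R.X m') :
    smashSplit d k (k' + 1) ≫ (f ⊗ₘ g) ≫ R.mul m m' = (snoc T W (k + k')).inv ≫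
      smashSplit d k k' ▷ T ≫ (α_ _ _ _).hom ≫ (f ⊗ₘ ((snoc T V' k').hom ≫ g)) ≫ R.mul m m' := by
  rw [smashSplit_succ]
  simp only [Category.assoc, MonoidalCategory.tensorHom_def, MonoidalCategory.whiskerLeft_comp]
  rw [whisker_exchange_assoc]

variable [∀ S : H, (tensorLeft S).IsLeftAdjoint] [HasBinaryCoproduct T T]
  {cg : CogroupStructure T}

omit [SymmetricCategory H] in
lemma HRep.IsSum.comp_headEnd {a b c : HRep R V q} (h : HRep.IsSum cg a b c) (g : T ⟶ T) :
    HRep.IsSum cg { a with map := headEnd V g a.k ≫ a.map }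
      { b with map := headEnd V g b.k ≫ b.map } { c with map := headEnd V g c.k ≫ c.map } := by
  obtain ⟨k, m, hk, f, f', rfl, rfl, rfl⟩ := h
  refine ⟨k, m, hk, _, _, rfl, rfl, ?_⟩
  simp only
  congr 1
  exact cg.comp_sum (headEnd V g (k + 1)) f f'

lemma Pi.act_add (neg : Aut T) (u : ℤˣ) (x y : Pi R V q) :
    Pi.act neg u (Pi.add cg x y) = Pi.add cg (Pi.act neg u x) (Pi.act neg u y) := by
  obtain ⟨a, b, c, h, rfl, rfl, hc⟩ := (Pi.exists_isSum (cg := cg) x y).choose_spec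
  have hab : Pi.add cg (Pi.mk a) (Pi.mk b) = Pi.mk c := hc.symm
  rw [hab]
  exact ((Pi.exists_isSum (cg := cg) _ _).choose_spec.unique
    ⟨_, _, _, h.stab.comp_headEnd (sgnMap neg u), rfl, rfl, rfl⟩).symm

lemma HRep.IsSum.mul₀_right (a : HRep R V q) {b b' c : HRep R V' q'}
    (h : HRep.IsSum cg b b' c) :
    HRep.IsSum cg (a.mul₀ d b) (a.mul₀ d b') (a.mul₀ d c) := by
  obtain ⟨j, m, hj, f, f', rfl, rfl, rfl⟩ := h
  refine ⟨a.k + j, a.m + m, by have := a.deg; push_cast at hj ⊢; omega, _, _, rfl, rfl, ?_⟩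
  simp only [HRep.mul₀]
  congr 1
  have e (g : smashPow T V' (j + 2) ⟶ R.X m) :
      smashSplit d a.k (j + 2) ≫ (a.map ⊗ₘ g) ≫ R.mul a.m m =
        (smashSplit d a.k (j + 1) ≫ a.map ▷ _) ▷ T ≫ ((α_ _ _ T).hom ≫ R.X a.m ◁ g) ≫
          R.mul a.m m := by
    refine (mul₀_map_succ d (k' := j + 1) a.map g).trans ((Category.id_comp _).trans ?_)
    have h {X : H} (p : X ⟶ smashPow T V a.k ⊗ smashPow T V' (j + 1))
        (g : smashPow T V' (j + 1) ⊗ T ⟶ R.X m) : p ▷ T ≫ (α_ _ _ T).hom ≫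
        (a.map ⊗ₘ (𝟙 _ ≫ g)) ≫ R.mul a.m m = (p ≫ a.map ▷ _) ▷ T ≫ ((α_ _ _ T).hom ≫
          R.X a.m ◁ g) ≫ R.mul a.m m := by
      simp [MonoidalCategory.tensorHom_def]
    exact h _ g
  refine (e _).trans (Eq.trans ?_ (congrArg₂ _ (e f) (e f')).symm)
  refine Eq.trans (congrArg (fun z => _ ≫ z ≫ _) (cg.whiskerLeft_sum (R.X a.m) f f')) ?_
  exact (congrArg (_ ≫ ·) (cg.sum_comp _ _ _)).trans (cg.comp_sum _ _ _)

lemma HRep.IsSum.mul₀_left {a a' c : HRep R V q} (h : HRep.IsSum cg a a' c)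
    {j m' : ℕ} (hj : ((j + 2 : ℕ) : ℤ) = q' + m') (g : smashPow T V' (j + 2) ⟶ R.X m') :
    HRep.IsSum cg (a.mul₀ d ⟨j + 2, m', hj, g⟩) (a'.mul₀ d ⟨j + 2, m', hj, g⟩)
      (c.mul₀ d ⟨j + 2, m', hj, g⟩) := by
  obtain ⟨k, m, hk, f, f', rfl, rfl, rfl⟩ := h
  refine ⟨k + 2 + j, m + m', by push_cast at hk hj ⊢; omega, _, _, rfl, rfl, ?_⟩
  simp only [HRep.mul₀]
  congr 1
  have e (f : smashPow T V (k + 2) ⟶ R.X m) :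
      smashSplit d (k + 2) (j + 2) ≫ (f ⊗ₘ g) ≫ R.mul m m' =
        smashSplit d (k + 2) (j + 1) ▷ T ≫ ((α_ _ _ T).hom ≫
          f ▷ (smashPow T V' (j + 1) ⊗ T)) ≫ R.X m ◁ g ≫ R.mul m m' := by
    refine (mul₀_map_succ d (k' := j + 1) f g).trans ((Category.id_comp _).trans ?_)
    have h {X : H} (p : X ⟶ smashPow T V (k + 2) ⊗ smashPow T V' (j + 1))
        (g : smashPow T V' (j + 1) ⊗ T ⟶ R.X m') : p ▷ T ≫ (α_ _ _ T).hom ≫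
        (f ⊗ₘ (𝟙 _ ≫ g)) ≫ R.mul m m' = p ▷ T ≫ ((α_ _ _ T).hom ≫
          f ▷ (smashPow T V' (j + 1) ⊗ T)) ≫ R.X m ◁ g ≫ R.mul m m' := by
      simp [MonoidalCategory.tensorHom_def]
    exact h _ g
  refine (e _).trans (Eq.trans ?_ (congrArg₂ _ (e f) (e f')).symm)
  refine Eq.trans (congrArg (fun z => _ ≫ z ≫ _)
    (cg.sum_whiskerRight_tensor (A := smashPow T V (k + 1)) _ f f')) ?_
  exact (congrArg (_ ≫ ·) (cg.sum_comp _ _ _)).trans (cg.comp_sum _ _ _)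

variable (htr : TrivialAction sgn.neg R W (q + q'))

lemma Pi.mul_add (x : Pi R V q) (y z : Pi R V' q') :
    Pi.mul sgn d hR htr x (Pi.add cg y z) =
      Pi.add cg (Pi.mul sgn d hR htr x y) (Pi.mul sgn d hR htr x z) := by
  obtain ⟨a, rfl⟩ := Quot.exists_rep x
  obtain ⟨b, b', c, h, rfl, rfl, hc⟩ := (Pi.exists_isSum (cg := cg) y z).choose_spec
  have hb : Pi.add cg (Pi.mk b) (Pi.mk b') = Pi.mk c := hc.symm
  rw [hb]
  change Pi.mul sgn d hR htr (Pi.mk a) _ = Pi.add cg (Pi.mul sgn d hR htr (Pi.mk a) _) (Pi.mul sgn d hR htr (Pi.mk a) _)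
  rw [mul_mk₀, mul_mk₀, mul_mk₀, ← Pi.act_add]
  refine congrArg (Pi.act sgn.neg (q' * a.m).negOnePow) ?_
  exact ((Pi.exists_isSum (cg := cg) _ _).choose_spec.unique
    ⟨_, _, _, h.mul₀_right d a, rfl, rfl, rfl⟩).symm

lemma Pi.add_mul (x y : Pi R V q) (z : Pi R V' q') :
    Pi.mul sgn d hR htr (Pi.add cg x y) z =
      Pi.add cg (Pi.mul sgn d hR htr x z) (Pi.mul sgn d hR htr y z) := by
  classical
  obtain ⟨j, m', hj, hz⟩ := Pi.exists_common {z}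
  obtain ⟨g, rfl⟩ := hz z (by simp)
  obtain ⟨a, a', c, h, rfl, rfl, hc⟩ := (Pi.exists_isSum (cg := cg) x y).choose_spec
  have ha : Pi.add cg (Pi.mk a) (Pi.mk a') = Pi.mk c := hc.symm
  rw [ha]
  obtain ⟨k, m, hk, f, f', rfl, rfl, rfl⟩ := h
  rw [mul_mk₀, mul_mk₀, mul_mk₀, ← Pi.act_add]
  refine congrArg (Pi.act sgn.neg (q' * m).negOnePow) ?_
  exact ((Pi.exists_isSum (cg := cg) _ _).choose_spec.unique
    ⟨_, _, _, HRep.IsSum.mul₀_left d ⟨k, m, hk, f, f', rfl, rfl, rfl⟩ hj g, rfl, rfl, rfl⟩).symm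

end Distrib

end Products

/-! ### The graded ring of stable homotopy groups -/

section UnitMultiplication

open SymRingData

variable {H : Type*} [Category H] [MonoidalCategory H] {T : H}

lemma smashIso_unit (k : ℕ) : (smashIso (T := T) (𝟙_ H) k).hom = (λ_ _).inv := by
  induction k with
  | zero => exact unitors_inv_equal.symm
  | succ k ih =>
    have h (Z : H) (i : Z ⟶ 𝟙_ H ⊗ Z) (hi : i = (λ_ Z).inv) :
        i ▷ T ≫ (α_ _ _ _).hom = (λ_ (Z ⊗ T)).inv := by rw [hi]; simp
    exact h _ _ ih

lemma smashMap_smashIso {V W : H} (g : V ⟶ W) (k : ℕ) :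
    smashMap g k ≫ (smashIso W k).hom = (smashIso (T := T) V k).hom ≫ g ▷ _ := by
  induction k with
  | zero => exact rightUnitor_inv_naturality g
  | succ k ih =>
    have h {X Y Z : H} (s : X ⟶ Y) (i : Y ⟶ W ⊗ Z) (j : X ⟶ V ⊗ Z) (h : s ≫ i = j ≫ g ▷ Z) :
        s ▷ T ≫ i ▷ T ≫ (α_ _ _ _).hom = (j ▷ T ≫ (α_ _ _ _).hom) ≫ g ▷ (Z ⊗ T) := by
      rw [← comp_whiskerRight_assoc, h]; simp
    exact h _ _ _ ih

lemma smashMap_unit {V : H} (e : V ⟶ 𝟙_ H) (k : ℕ) :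
    smashMap e k = (smashIso (T := T) V k).hom ≫ e ▷ _ ≫ (λ_ _).hom := by
  have h := smashMap_smashIso (T := T) e k
  rw [smashIso_unit] at h
  rw [← reassoc_of% h]
  exact ((congrArg (smashMap e k ≫ ·) (Iso.inv_hom_id _)).trans (Category.comp_id _)).symm

variable {R : SymRingData T}

lemma mk_ofMap {V : H} (e : V ⟶ 𝟙_ H) {k m : ℕ} (x : tpow T k ⟶ R.X m) :
    Pi.mk (HRep.ofMap e x) = cl (HRep.ofMap e x).deg (e ▷ _ ≫ (λ_ _).hom ≫ x) := by
  refine congrArg Pi.mk ?_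
  simp only [HRep.ofMap]
  congr 1
  rw [smashMap_unit]
  simp only [Category.assoc]

lemma mk_one {V : H} (e : V ⟶ 𝟙_ H) :
    Pi.mk (HRep.one (R := R) e) =
      cl (k := 1) (m := 1) (by norm_num) (e ▷ _ ≫ (λ_ _).hom ≫ R.unit₁) := by
  refine congrArg Pi.mk ?_
  simp only [HRep.one]
  congr 1
  have h : (smashIso (T := T) V 1).hom ≫ e ▷ tpow T 1 ≫ (λ_ _).hom ≫ R.unit₁ =
    smashMap e 1 ≫ R.unit₁ := by
    rw [smashMap_unit]; simp only [Category.assoc]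
  refine Eq.trans ?_ h.symm
  refine congrArg (smashMap e 1 ≫ ·) ?_
  rw [unit₁, tone]
  have h2 (i : 𝟙_ H ⊗ T ⟶ 𝟙_ H ⊗ T) (hi : i = 𝟙 _) :
    (λ_ T).hom ≫ R.one₁ = (i ≫ (λ_ T).hom) ≫ R.one₁ := by rw [hi, Category.id_comp]
  exact h2 _ rfl

variable [SymmetricCategory H] (sgn : SignStructure T) (hR : R.IsSymRing)
  {V V₀ W : H} {q Q : ℤ}

/-- Multiplication from the right by the class given by a map `y` on a power of `T`. -/
lemma mul_cl_map (htr : TrivialAction sgn.neg R W (q + Q)) (d : W ⟶ V ⊗ V₀) (e : V₀ ⟶ 𝟙_ H)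
    {w : W ⟶ V} (hw : d ≫ V ◁ e ≫ (ρ_ V).hom = w) {k m b n : ℕ} (h : (k : ℤ) = q + m)
    (hb : (b : ℤ) = Q + n) (f : V ⊗ tpow T k ⟶ R.X m) (y : tpow T b ⟶ R.X n) :
    Pi.mul sgn d hR htr (cl h f) (cl hb (e ▷ _ ≫ (λ_ _).hom ≫ y)) =
      Pi.act sgn.neg (Q * m).negOnePow (cl (deg_add h hb) (rmul (w ▷ _ ≫ f) y)) := by
  rw [mul_cl, conv_whisker_right, ← rmul_eq_conv, ← comp_whiskerRight_assoc,
    ← comp_whiskerRight_assoc, Category.assoc, hw, ← rmul_comp]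

/-- Multiplication from the left by the class given by a central map `y` on a power of `T`. -/
lemma map_mul_cl (htr : TrivialAction sgn.neg R W (Q + q)) (d : W ⟶ V₀ ⊗ V) (e : V₀ ⟶ 𝟙_ H)
    {w : W ⟶ V} (hw : d ≫ e ▷ V ≫ (λ_ V).hom = w) {k m b n : ℕ} (h : (k : ℤ) = q + m)
    (hb : (b : ℤ) = Q + n) (f : V ⊗ tpow T k ⟶ R.X m) {y : tpow T b ⟶ R.X n}
    (hy : R.IsCentral y) (h' : ((k + b : ℕ) : ℤ) = Q + q + (m + n : ℕ)) :
    Pi.mul sgn d hR htr (cl hb (e ▷ _ ≫ (λ_ _).hom ≫ y)) (cl h f) =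
      Pi.act sgn.neg (Q * (q + m)).negOnePow (cl h' (rmul (w ▷ _ ≫ f) y)) := by
  rw [mul_cl, conv_whisker_left, conv_unitor f hy, MonoidalCategory.tensorHom_def,
    Category.assoc, ← comp_whiskerRight_assoc, ← comp_whiskerRight_assoc, Category.assoc, hw,
    ← whisker_exchange_assoc, ← Category.assoc (w ▷ _), ← rmul_comp,
    cl_perm sgn hR htr h' _ _ _ (deg_add hb h), act_act sgn hR]
  congr 1
  simp only [esign_finAddFlip, pow_eq_negOnePow, ← Int.negOnePow_add]
  rw [Int.negOnePow_eq_iff]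
  push_cast
  rw [h, hb]
  exact ⟨q * n + n * m, by ring⟩

end UnitMultiplication

section GradedRing

open SymRingData

variable {H : Type*} [Category H] [MonoidalCategory H] {T : H} {R : SymRingData T}
  {N : Type*} [AddCommMonoid N]

/-- The maps `V (r + r') ⟶ V r ∧ V r'` and `V 0 ⟶ S^0` are coassociative and counital. -/
structure IsGradedComonoid (V : N → H) (d : ∀ r r', V (r + r') ⟶ V r ⊗ V r')
    (e : V 0 ⟶ 𝟙_ H) : Prop where
  coassoc : ∀ r r' r'', d (r + r') r'' ≫ d r r' ▷ V r'' ≫ (α_ _ _ _).hom =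
    eqToHom (congrArg V (add_assoc r r' r'')) ≫ d r (r' + r'') ≫ V r ◁ d r' r''
  left_counit : ∀ r, d 0 r ≫ e ▷ V r ≫ (λ_ _).hom = eqToHom (congrArg V (zero_add r))
  right_counit : ∀ r, d r 0 ≫ V r ◁ e ≫ (ρ_ _).hom = eqToHom (congrArg V (add_zero r))

variable {V : N → H}

omit [AddCommMonoid N] in
lemma gradedMonoid_mk_eq (neg : Aut T) {i j : N × ℤ} (hij : i = j) {k m : ℕ}
    (h : (k : ℤ) = i.2 + m) (h' : (k : ℤ) = j.2 + m) (f : V j.1 ⊗ tpow T k ⟶ R.X m) (u : ℤˣ)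
    (hV : V i.1 = V j.1) {x : PiFamily R V i} {y : PiFamily R V j}
    (hx : x = Pi.act neg u (cl h (eqToHom hV ▷ _ ≫ f))) (hy : y = Pi.act neg u (cl h' f)) :
    GradedMonoid.mk i x = GradedMonoid.mk j y := by
  subst hij hx hy
  simp only [eqToHom_refl, id_whiskerRight, Category.id_comp]

variable [SymmetricCategory H] [∀ S : H, (tensorLeft S).IsLeftAdjoint] [HasBinaryCoproduct T T]
  (cg : CogroupStructure T) (sgn : SignStructure T) (hR : R.IsSymRing)
  {d : ∀ r r', V (r + r') ⟶ V r ⊗ V r'} {e : V 0 ⟶ 𝟙_ H} (hV : IsGradedComonoid V d e)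
  (htr : ∀ r q, TrivialAction sgn.neg R (V r) q)

/-- The group structure on the stable homotopy groups. -/
@[reducible] def piFamilyAddCommGroup (R : SymRingData T) (V : N → H) (i : N × ℤ) :
    AddCommGroup (PiFamily R V i) :=
  piAddCommGroup cg R (V i.1) i.2

include hV in
omit [∀ S : H, (tensorLeft S).IsLeftAdjoint] [HasBinaryCoproduct T T] in
lemma gmul_assoc (x y z : GradedMonoid (PiFamily R V)) :
    GradedMonoid.mk (A := PiFamily R V) (x.1 + y.1 + z.1) (Pi.mul sgn (d _ _) hR (htr _ _)
      (Pi.mul sgn (d _ _) hR (htr _ _) x.2 y.2) z.2) =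
    GradedMonoid.mk (A := PiFamily R V) (x.1 + (y.1 + z.1)) (Pi.mul sgn (d _ _) hR (htr _ _) x.2
      (Pi.mul sgn (d _ _) hR (htr _ _) y.2 z.2)) := by
  obtain ⟨⟨r, q⟩, x⟩ := x
  obtain ⟨⟨r', q'⟩, y⟩ := y
  obtain ⟨⟨r'', q''⟩, z⟩ := z
  obtain ⟨k, m, h, f, rfl⟩ := exists_cl (V := V r) (q := q) x
  obtain ⟨k', m', h', g, rfl⟩ := exists_cl (V := V r') (q := q') y
  obtain ⟨k'', m'', h'', g', rfl⟩ := exists_cl (V := V r'') (q := q'') z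
  have e0 := deg_add h (deg_add h' h'')
  have e1 := deg_add (deg_add h h') h''
  have e2 : ((k + (k' + k'') : ℕ) : ℤ) = q + q' + q'' + (m + (m' + m'') : ℕ) := by
    push_cast at e0 ⊢; omega
  have key : (d (r + r') r'' ▷ _ ≫ conv (d r r' ▷ _ ≫ conv f g) g') ≫
      R.reindex (assocE m m' m'') = V (r + r' + r'') ◁ tperm (assocE k k' k'') ≫
        (eqToHom (congrArg V (add_assoc r r' r'')) ▷ _ ≫ d r (r' + r'') ▷ _ ≫
          conv f (d r' r'' ▷ _ ≫ conv g g')) ≫ R.reindex (Equiv.refl _) := by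
    rw [hR.reindex_refl, Category.comp_id, conv_whisker_left, conv_whisker_right, Category.assoc,
      Category.assoc, hR.conv_assoc, MonoidalCategory.tensorHom_def, Category.assoc,
      ← comp_whiskerRight_assoc, ← comp_whiskerRight_assoc, Category.assoc, hV.coassoc,
      ← comp_whiskerRight_assoc (d r (r' + r'')), ← whisker_exchange_assoc,
      ← comp_whiskerRight_assoc]
  refine gradedMonoid_mk_eq sgn.neg (i := (r + r' + r'', q + q' + q''))
    (j := (r + (r' + r''), q + (q' + q''))) (by rw [add_assoc, add_assoc])
    e2 e0 (d r (r' + r'') ▷ _ ≫ conv f (d r' r'' ▷ _ ≫ conv g g'))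
    ((q'' * m').negOnePow * ((q' + q'') * m).negOnePow) (by rw [add_assoc]) ?_ ?_
  · have hl : Pi.mul sgn (d (r + r') r'') hR (htr _ (q + q' + q'')) (Pi.mul sgn (d r r') hR
        (htr _ (q + q')) (cl h f) (cl h' g)) (cl h'' g') =
        Pi.act sgn.neg ((q'' * m').negOnePow * ((q' + q'') * m).negOnePow)
          (cl e2 (eqToHom (congrArg V (add_assoc r r' r'')) ▷ _ ≫ d r (r' + r'') ▷ _ ≫
          conv f (d r' r'' ▷ _ ≫ conv g g'))) := by
      rw [mul_cl, act_mul sgn hR, mul_cl, cl_eq sgn hR (htr _ _) e1 e2 key, act_act sgn hR,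
        act_act sgn hR]
      congr 1
      simp only [esign_finCongr, esign_refl, mul_one, ← Int.negOnePow_add]
      congr 1
      push_cast
      ring
    exact hl
  · have hr : Pi.mul sgn (d r (r' + r'')) hR (htr _ (q + (q' + q''))) (cl h f)
        (Pi.mul sgn (d r' r'') hR (htr _ (q' + q'')) (cl h' g) (cl h'' g')) =
        Pi.act sgn.neg ((q'' * m').negOnePow * ((q' + q'') * m).negOnePow)
          (cl e0 (d r (r' + r'') ▷ _ ≫ conv f (d r' r'' ▷ _ ≫ conv g g'))) := by
      rw [mul_cl, mul_act sgn hR, mul_cl, act_act sgn hR]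
    exact hr

include hV in
omit [∀ S : H, (tensorLeft S).IsLeftAdjoint] [HasBinaryCoproduct T T] in
lemma gone_mul (x : GradedMonoid (PiFamily R V)) :
    GradedMonoid.mk (A := PiFamily R V) ((0 : N × ℤ) + x.1)
      (Pi.mul sgn (d _ _) hR (htr _ _) (Pi.mk (HRep.one e)) x.2) = x := by
  obtain ⟨⟨r, q⟩, x⟩ := x
  obtain ⟨k, m, h, f, rfl⟩ := exists_cl x
  have h' : ((k + 1 : ℕ) : ℤ) = 0 + q + (m + 1 : ℕ) := by push_cast; omega
  have h'' : ((k + 1 : ℕ) : ℤ) = q + (m + 1 : ℕ) := by push_cast; omega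
  refine gradedMonoid_mk_eq sgn.neg (i := ((0 : N × ℤ) + (r, q))) (j := (r, q)) (zero_add _)
    h' h'' (rmul f R.unit₁) 1 (congrArg V (zero_add r)) ?_ ?_
  · have h1 := map_mul_cl sgn hR (htr (0 + r) (0 + q)) (d 0 r) e (hV.left_counit r) h
      (b := 1) (n := 1) (Q := 0) (by norm_num) f hR.isCentral_unit₁ h'
    rw [zero_mul, Int.negOnePow_zero, rmul_comp, ← mk_one] at h1
    exact h1
  · rw [act_one sgn hR, cl_rmul_unit₁ h]

include hV in
omit [∀ S : H, (tensorLeft S).IsLeftAdjoint] [HasBinaryCoproduct T T] in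
lemma gmul_one (x : GradedMonoid (PiFamily R V)) :
    GradedMonoid.mk (A := PiFamily R V) (x.1 + (0 : N × ℤ))
      (Pi.mul sgn (d _ _) hR (htr _ _) x.2 (Pi.mk (HRep.one e))) = x := by
  obtain ⟨⟨r, q⟩, x⟩ := x
  obtain ⟨k, m, h, f, rfl⟩ := exists_cl x
  have h' : ((k + 1 : ℕ) : ℤ) = q + 0 + (m + 1 : ℕ) := by push_cast; omega
  have h'' : ((k + 1 : ℕ) : ℤ) = q + (m + 1 : ℕ) := by push_cast; omega
  refine gradedMonoid_mk_eq sgn.neg (i := ((r, q) + (0 : N × ℤ))) (j := (r, q)) (add_zero _)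
    h' h'' (rmul f R.unit₁) 1 (congrArg V (add_zero r)) ?_ ?_
  · have h1 := mul_cl_map sgn hR (htr (r + 0) (q + 0)) (d r 0) e (hV.right_counit r) h
      (b := 1) (n := 1) (Q := 0) (by norm_num) f R.unit₁
    rw [zero_mul, Int.negOnePow_zero, rmul_comp, ← mk_one] at h1
    exact h1
  · rw [act_one sgn hR, cl_rmul_unit₁ h]

/-- The unit and the products of the graded ring of stable homotopy groups. -/
@[reducible] def piGOne (R : SymRingData T) (e : V 0 ⟶ 𝟙_ H) : GradedMonoid.GOne (PiFamily R V) where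
  one := Pi.mk (HRep.one e)

/-- The products of the graded ring of stable homotopy groups. -/
@[reducible] def piGMul (d : ∀ r r', V (r + r') ⟶ V r ⊗ V r') : GradedMonoid.GMul (PiFamily R V) where
  mul {i j} x y := Pi.mul sgn (d i.1 j.1) hR (htr _ _) x y

/-- The graded ring structure on the stable homotopy groups. -/
@[reducible] def piGRing :
    letI := piFamilyAddCommGroup cg R V
    DirectSum.GRing (PiFamily R V) :=
  letI := piFamilyAddCommGroup cg R V
  letI : GradedMonoid.GOne (PiFamily R V) := piGOne R e
  letI : GradedMonoid.GMul (PiFamily R V) := piGMul sgn hR htr d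
  have hma {i j : N × ℤ} (x : PiFamily R V i) (y z : PiFamily R V j) :
      GradedMonoid.GMul.mul x (y + z) = GradedMonoid.GMul.mul x y + GradedMonoid.GMul.mul x z :=
    Pi.mul_add sgn hR (d i.1 j.1) (htr _ _) x y z
  have ham {i j : N × ℤ} (x y : PiFamily R V i) (z : PiFamily R V j) :
      GradedMonoid.GMul.mul (x + y) z = GradedMonoid.GMul.mul x z + GradedMonoid.GMul.mul y z :=
    Pi.add_mul sgn hR (d i.1 j.1) (htr _ _) x y z
  { mul := GradedMonoid.GMul.mul
    mul_zero := fun {i j} x => by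
      have h := hma x (0 : PiFamily R V j) 0
      rw [add_zero] at h
      exact left_eq_add.1 h
    zero_mul := fun {i j} y => by
      have h := ham (0 : PiFamily R V i) 0 y
      rw [add_zero] at h
      exact left_eq_add.1 h
    mul_add := hma
    add_mul := ham
    one := GradedMonoid.GOne.one
    one_mul := gone_mul sgn hR hV htr
    mul_one := gmul_one sgn hR hV htr
    mul_assoc := gmul_assoc sgn hR hV htr
    natCast n := n • (GradedMonoid.GOne.one : PiFamily R V 0)
    natCast_zero := zero_nsmul _
    natCast_succ n := succ_nsmul _ n
    intCast n := n • (GradedMonoid.GOne.one : PiFamily R V 0)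
    intCast_ofNat n := natCast_zsmul _ n
    intCast_negSucc_ofNat n := negSucc_zsmul _ n }

/-- The graded ring of stable homotopy groups. -/
def homotopyRing : HomotopyRing cg sgn.neg R V d e where
  addCommGroup := piFamilyAddCommGroup cg R V
  add_iff i a b c := by
    constructor
    · intro h
      classical
      obtain ⟨k, m, hk, hs⟩ := Pi.exists_common (R := R) (V := V i.1) (q := i.2) {a, b}
      obtain ⟨f, rfl⟩ := hs a (Finset.mem_insert_self _ _)
      obtain ⟨g, rfl⟩ := hs b (Finset.mem_insert_of_mem (Finset.mem_singleton_self _))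
      exact ⟨k, m, hk, f, g, _, cg.isSum_iff.2 rfl, rfl, rfl,
        (Pi.add_mk cg hk f g).symm.trans h⟩
    · rintro ⟨k, m, hk, f, g, h, hs, rfl, rfl, rfl⟩
      obtain rfl := cg.isSum_iff.1 hs
      exact Pi.add_mk cg hk f g
  gring := piGRing cg sgn hR hV htr
  mul_mk i j a b ha _ := mul_mk sgn hR _ _ a b ha
  one_mk := rfl

end GradedRing

/-! ### Iterated multiplication with maps from powers of `T` -/

/-- The bijection exchanging the last two of three blocks. -/
def swapE (a b c : ℕ) : Fin (a + b + c) ≃ Fin (a + c + b) :=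
  (assocE a b c).trans ((sumE (Equiv.refl _) finAddFlip).trans (assocE a c b).symm)

lemma esign_swapE (a b c : ℕ) : esign (swapE a b c) = (-1) ^ (b * c) := by
  simp [swapE]

namespace SymRingData

section

variable {C : Type*} [Category C] [MonoidalCategory C] {T : C} {R : SymRingData T}

/-- The product `T^(b+c) ⟶ X (n + p)` of maps `y : T^b ⟶ X n` and `z : T^c ⟶ X p`. -/
def rstar {b c n p : ℕ} (y : tpow T b ⟶ R.X n) (z : tpow T c ⟶ R.X p) :
    tpow T (b + c) ⟶ R.X (n + p) :=
  (tpowAdd b c).hom ≫ R.star y z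

lemma rmul_unitor {b c n p : ℕ} (y : tpow T b ⟶ R.X n) (z : tpow T c ⟶ R.X p) :
    rmul ((λ_ _).hom ≫ y) z = (λ_ _).hom ≫ rstar y z := by
  rw [rmul, rstar, star_comp_left, ← leftUnitor_naturality_assoc, leftUnitor_tensor_hom]
  simp only [Category.assoc]

end

variable {C : Type*} [Category C] [MonoidalCategory C] [SymmetricCategory C] {T : C}
  {R : SymRingData T}

namespace IsSymRing

variable (hR : R.IsSymRing)
include hR

lemma rmul_tperm_right {V : C} {a b b' m n n' : ℕ} (f : V ⊗ tpow T a ⟶ R.X m)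
    (y : tpow T b ⟶ R.X n) (e : Fin b' ≃ Fin b) (γ : Fin n ≃ Fin n') :
    rmul f (tperm e ≫ y ≫ R.reindex γ) = V ◁ tperm (sumE (Equiv.refl _) e) ≫ rmul f y ≫
      R.reindex (sumE (Equiv.refl _) γ) := by
  have h := hR.conv_tperm_reindex_right f ((λ_ _).hom ≫ y) e γ
  have h1 : 𝟙_ C ◁ tperm e ≫ ((λ_ _).hom ≫ y) ≫ R.reindex γ =
      (λ_ _).hom ≫ tperm e ≫ y ≫ R.reindex γ := by simp
  rw [h1, ← rmul_eq_conv, ← rmul_eq_conv] at h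
  rw [← cancel_epi ((ρ_ V).hom ▷ tpow T (a + b')), h, Category.assoc, whisker_exchange_assoc]

lemma rmul_rmul {V : C} {a b c m n p : ℕ} (f : V ⊗ tpow T a ⟶ R.X m)
    (y : tpow T b ⟶ R.X n) (z : tpow T c ⟶ R.X p) :
    rmul (rmul f y) z = V ◁ tperm (assocE a b c) ≫ rmul f (rstar y z) ≫
      R.reindex (assocE m n p).symm := by
  have h := hR.rmul_conv f ((λ_ _).hom ≫ y) z
  rw [← rmul_eq_conv, rmul_comp, rmul_unitor, ← rmul_eq_conv, whisker_exchange_assoc,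
    Category.assoc, cancel_epi] at h
  rw [← reassoc_of% h, ← hR.reindex_trans, Equiv.self_trans_symm, hR.reindex_refl,
    Category.comp_id]

lemma rmul_rstar {V : C} {a b c m n p : ℕ} (f : V ⊗ tpow T a ⟶ R.X m)
    (y : tpow T b ⟶ R.X n) (z : tpow T c ⟶ R.X p) :
    rmul f (rstar y z) = V ◁ tperm (assocE a b c).symm ≫ rmul (rmul f y) z ≫
      R.reindex (assocE m n p) := by
  rw [hR.rmul_rmul, Category.assoc, Category.assoc, ← hR.reindex_trans, whiskerLeft_tperm_trans,
    Equiv.symm_trans_self, Equiv.symm_trans_self, tperm_refl, hR.reindex_refl, Category.comp_id,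
    MonoidalCategory.whiskerLeft_id, Category.id_comp]

omit hR in
lemma rstar_comm {b c n p : ℕ} {y : tpow T b ⟶ R.X n} (hy : R.IsCentral y) (z : tpow T c ⟶ R.X p)
    (hR : R.IsSymRing) : rstar z y = tperm finAddFlip ≫ rstar y z ≫ R.reindex finAddFlip := by
  have h1 := hy.star_comm z
  have h2 := congrArg (· ≫ R.reindex finAddFlip) h1
  have e : (finAddFlip : Fin (p + n) ≃ Fin (n + p)).trans finAddFlip = Equiv.refl _ :=
    Equiv.self_trans_symm _
  simp only [Category.assoc] at h2
  rw [← hR.reindex_trans, e, hR.reindex_refl, Category.comp_id] at h2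
  rw [rstar, rstar, h2, ← Category.assoc, ← tperm_flip]
  simp only [Category.assoc]

lemma rmul_comm {V : C} {a b c m n p : ℕ} (f : V ⊗ tpow T a ⟶ R.X m)
    {y : tpow T b ⟶ R.X n} (hy : R.IsCentral y) (z : tpow T c ⟶ R.X p) :
    rmul (rmul f z) y = V ◁ tperm (swapE a c b) ≫ rmul (rmul f y) z ≫
      R.reindex (swapE m n p) := by
  rw [hR.rmul_rmul, rstar_comm hy z hR, hR.rmul_tperm_right, hR.rmul_rstar]
  simp only [Category.assoc, ← hR.reindex_trans, whiskerLeft_tperm_trans]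
  rfl

end IsSymRing

/-- The maps `f` and `g` agree up to permutations of the factors `T` and of the target. -/
def PermEq {V : C} {k k' m m' : ℕ} (f : V ⊗ tpow T k ⟶ R.X m) (g : V ⊗ tpow T k' ⟶ R.X m') : Prop :=
  ∃ (e : Fin k ≃ Fin k') (γ : Fin m' ≃ Fin m), f = V ◁ tperm e ≫ g ≫ R.reindex γ

namespace PermEq

variable (hR : R.IsSymRing) {V : C} {k k' k'' m m' m'' : ℕ} {f : V ⊗ tpow T k ⟶ R.X m}
  {g : V ⊗ tpow T k' ⟶ R.X m'} {h : V ⊗ tpow T k'' ⟶ R.X m''}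
include hR

lemma refl (f : V ⊗ tpow T k ⟶ R.X m) : PermEq f f :=
  ⟨Equiv.refl _, Equiv.refl _, by rw [tperm_refl, hR.reindex_refl, Category.comp_id,
    MonoidalCategory.whiskerLeft_id, Category.id_comp]⟩

lemma trans (h₁ : PermEq f g) (h₂ : PermEq g h) : PermEq f h := by
  obtain ⟨e, γ, rfl⟩ := h₁
  obtain ⟨e', γ', rfl⟩ := h₂
  exact ⟨e.trans e', γ'.trans γ, by
    simp only [Category.assoc, ← hR.reindex_trans, whiskerLeft_tperm_trans]⟩

lemma symm (h₁ : PermEq f g) : PermEq g f := by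
  obtain ⟨e, γ, rfl⟩ := h₁
  exact ⟨e.symm, γ.symm, by
    simp only [Category.assoc, ← hR.reindex_trans, whiskerLeft_tperm_trans,
      Equiv.symm_trans_self, Equiv.self_trans_symm, tperm_refl, hR.reindex_refl, Category.comp_id,
      MonoidalCategory.whiskerLeft_id, Category.id_comp]⟩

lemma rmul (h₁ : PermEq f g) {b n : ℕ} (y : tpow T b ⟶ R.X n) :
    PermEq (SymRingData.rmul f y) (SymRingData.rmul g y) := by
  obtain ⟨e, γ, rfl⟩ := h₁
  exact ⟨_, _, rmul_tperm_reindex hR g y e γ⟩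

lemma rmul_pow_add {l n : ℕ} (x : tpow T l ⟶ R.X n) (f : V ⊗ tpow T k ⟶ R.X m) (p q : ℕ) :
    PermEq (SymRingData.rmul f (R.pow x (p + q)))
      (SymRingData.rmul (SymRingData.rmul f (R.pow x p)) (R.pow x q)) := by
  have e : R.pow x (p + q) = tperm (finCongr (Nat.mul_add l p q)) ≫
      rstar (R.pow x p) (R.pow x q) ≫ R.reindex (finCongr (Nat.mul_add n p q).symm) := by
    rw [hR.pow_add', rstar, Category.assoc]
  rw [e, hR.rmul_tperm_right]
  exact trans hR ⟨_, _, rfl⟩ ⟨_, _, hR.rmul_rstar f _ _⟩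

lemma rmul_pow_zero {l n : ℕ} (x : tpow T l ⟶ R.X n) (f : V ⊗ tpow T k ⟶ R.X m) :
    PermEq (SymRingData.rmul f (R.pow x 0)) f := by
  have h1 := hR.conv_one f
  have h2 : 𝟙_ C ◁ (tzero T).hom ≫ (λ_ _).hom ≫ R.one₀ =
      (λ_ _).hom ≫ (tzero T).hom ≫ R.one₀ := by simp
  rw [h2, ← rmul_eq_conv, MonoidalCategory.tensorHom_def, Category.assoc, Category.assoc,
    cancel_epi] at h1
  have e : R.pow x 0 = tperm (finCongr (Nat.mul_zero l)) ≫
      ((tzero T).hom ≫ R.one₀) ≫ R.reindex (finCongr (Nat.mul_zero n).symm) := by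
    rw [hR.pow_zero, Category.assoc]
  rw [e, hR.rmul_tperm_right]
  refine trans hR ⟨_, _, rfl⟩ ⟨finCongr (Nat.add_zero k), (finCongr (Nat.add_zero m)).symm, ?_⟩
  rw [← reassoc_of% h1, ← hR.reindex_trans, Equiv.self_trans_symm, hR.reindex_refl,
    Category.comp_id]

lemma rmul_pow_one {l n : ℕ} (x : tpow T l ⟶ R.X n) (f : V ⊗ tpow T k ⟶ R.X m) :
    PermEq (SymRingData.rmul f (R.pow x 1)) (SymRingData.rmul f x) := by
  refine trans hR ⟨_, _, hR.rmul_rstar f (R.pow x 0) x⟩ ?_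
  exact (rmul_pow_zero hR x f).rmul hR x

omit hR in
lemma rmul_pow_congr {l n : ℕ} (x : tpow T l ⟶ R.X n) (f : V ⊗ tpow T k ⟶ R.X m) {p q : ℕ}
    (h : p = q) (hR : R.IsSymRing) :
    PermEq (SymRingData.rmul f (R.pow x p)) (SymRingData.rmul f (R.pow x q)) := by
  subst h; exact refl hR _

end PermEq

end SymRingData

/-! ### The adjoints of maps into the localization -/

namespace LocData

open SymRingData

variable {C : Type*} [Category C] [MonoidalCategory C] [SymmetricCategory C] {T : C}
  {R R' : SymRingData T} {l m : ℕ} {x : tpow T l ⟶ R.X m} (L : LocData R R' x)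

/-- The map `V ∧ T^(k+lp) ⟶ R_((1+m)p)` adjoint to a map `V ∧ T^k ⟶ R'_p`. -/
def hatT {V : C} {k p : ℕ} (f : V ⊗ tpow T k ⟶ R'.X p) :
    V ⊗ tpow T (k + l * p) ⟶ R.X ((1 + m) * p) :=
  V ◁ (tpowAdd k (l * p)).hom ≫ (α_ _ _ _).inv ≫ L.hat f

lemma hatT_injective (hinj : ∀ (A : C) (p : ℕ) (f g : A ⟶ R'.X p), L.hat f = L.hat g → f = g)
    {V : C} {k p : ℕ} {f g : V ⊗ tpow T k ⟶ R'.X p} (h : L.hatT f = L.hatT g) : f = g := by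
  rw [hatT, hatT, cancel_epi, cancel_epi] at h
  exact hinj _ _ _ _ h

lemma hatT_surjective (hsurj : ∀ (A : C) (p : ℕ) (g : A ⊗ tpow T (l * p) ⟶ R.X ((1 + m) * p)),
      ∃ f : A ⟶ R'.X p, L.hat f = g)
    {V : C} {k p : ℕ} (g : V ⊗ tpow T (k + l * p) ⟶ R.X ((1 + m) * p)) :
    ∃ f : V ⊗ tpow T k ⟶ R'.X p, L.hatT f = g := by
  obtain ⟨f, hf⟩ := hsurj _ p ((α_ V (tpow T k) (tpow T (l * p))).hom ≫
    V ◁ (tpowAdd k (l * p)).inv ≫ g)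
  exact ⟨f, by rw [hatT, hf]; simp⟩

lemma hatT_tperm_reindex {V : C} {k k' p p' : ℕ} (f : V ⊗ tpow T k ⟶ R'.X p) (e : Fin k' ≃ Fin k)
    (γ : Fin p ≃ Fin p') : L.hatT (V ◁ tperm e ≫ f ≫ R'.reindex γ) =
      V ◁ tperm (sumE e (blockE l γ.symm)) ≫ L.hatT f ≫ R.reindex (blockE (1 + m) γ) := by
  have h := tperm_split (T := T) e (blockE l γ.symm)
  rw [hatT, hat_comp, hat_reindex, hatT]
  simp only [Category.assoc]
  rw [← MonoidalCategory.whiskerLeft_comp_assoc, h, MonoidalCategory.tensorHom_def]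
  simp

lemma hatT_j {V : C} {k p : ℕ} (f : V ⊗ tpow T k ⟶ R.X p) :
    L.hatT (f ≫ L.j p) = rmul f (R.pow x p) ≫ R.reindex (shuffle m p) := by
  rw [hatT, hat_j, rmul]
  simp only [Category.assoc]

lemma tperm_hatT {k b p q c : ℕ} (h : c = p + q) :
    tperm (T := T) ((sumE (Equiv.refl _) (finCongr h)).trans
      ((midSwap k b p q).trans (assocE (k + p) b q).symm)) ≫ (tpowAdd (k + p + b) q).hom ≫
        (tpowAdd (k + p) b).hom ▷ _ ≫ (tpowAdd k p).hom ▷ _ ▷ _ =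
      (tpowAdd (k + b) c).hom ≫ ((tpowAdd k b).hom ⊗ₘ (tperm (finCongr h) ≫ (tpowAdd p q).hom)) ≫
        tensorμ _ _ _ _ ≫ (α_ _ _ _).inv := by
  have h1 := tperm_assoc (T := T) (k + p) b q
  have h2 : tperm (T := T) (assocE (k + p) b q).symm ≫ (tpowAdd (k + p + b) q).hom ≫
      (tpowAdd (k + p) b).hom ▷ _ = (tpowAdd (k + p) (b + q)).hom ≫
        tpow T (k + p) ◁ (tpowAdd b q).hom ≫ (α_ _ _ _).inv := by
    have h3 := congrArg (fun f => tperm (T := T) (assocE (k + p) b q).symm ≫ f ≫ (α_ _ _ _).inv) h1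
    simp only [Category.assoc, Iso.hom_inv_id, Category.comp_id] at h3
    rw [tperm_trans_assoc, Equiv.symm_trans_self, tperm_refl, Category.id_comp] at h3
    exact h3.symm
  have h4 := tperm_midSwap (T := T) k b p q
  have h5 := tperm_split (T := T) (Equiv.refl (Fin (k + b))) (finCongr h)
  rw [tperm_refl] at h5
  rw [tperm_trans, tperm_trans, Category.assoc, Category.assoc, reassoc_of% h2,
    ← associator_inv_naturality_left, ← MonoidalCategory.tensorHom_def'_assoc, reassoc_of% h4,
    reassoc_of% h5, tensorHom_comp_tensorHom_assoc, Category.id_comp]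

/-- The adjoint of the product of `f` with an element in the image of `j`. -/
lemma hatT_rmul_j (hR : R.IsSymRing) {V : C} {k b p n : ℕ} (f : V ⊗ tpow T k ⟶ R'.X p)
    (y : tpow T b ⟶ R.X n) : L.hatT (rmul f (y ≫ L.j n)) =
      V ◁ tperm ((sumE (Equiv.refl _) (finCongr (Nat.mul_add l p n))).trans
        ((midSwap k b (l * p) (l * n)).trans (assocE (k + l * p) b (l * n)).symm)) ≫
      rmul (rmul (L.hatT f) y) (R.pow x n) ≫ R.reindex ((assocE _ _ _).trans
        ((sumE (Equiv.refl _) (shuffle m n)).trans (finCongr (Nat.mul_add (1 + m) p n).symm))) := by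
  have hc (K B P Q : C) : (α_ V (K ⊗ B) (P ⊗ Q)).inv ≫ (α_ V K B).inv ▷ _ ≫ tensorμ (V ⊗ K) B P Q ≫
      (α_ _ _ _).inv = V ◁ (tensorμ K B P Q ≫ (α_ (K ⊗ P) B Q).inv) ≫ (α_ _ _ _).inv ≫
        (α_ _ _ _).inv ▷ _ ≫ (α_ _ _ _).inv ▷ _ ▷ _ := by
    simp only [tensorμ]
    monoidal
  have h1 := congrArg (V ◁ · ≫ (α_ _ _ _).inv ≫ (α_ _ _ _).inv ▷ _ ≫ (α_ _ _ _).inv ▷ _ ▷ _)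
    (tperm_hatT (T := T) (k := k) (b := b) (Nat.mul_add l p n))
  rw [← Category.assoc ((tpowAdd (k + b) _).hom), MonoidalCategory.whiskerLeft_comp V
    (_ ≫ (_ ⊗ₘ _)), Category.assoc, ← hc] at h1
  have e1 : rmul f (y ≫ L.j n) = (V ◁ (tpowAdd k b).hom ≫ (α_ _ _ _).inv) ≫
      R'.star f (y ≫ L.j n) := (Category.assoc _ _ _).symm
  rw [hatT, e1, hat_comp, hat_star, hat_j]
  simp only [hatT, rmul, conv, star_comp_left, hR.star_reindex_right, hR.star_assoc', Category.assoc, hR.reindex_trans]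
  simp only [← Category.assoc]
  congr 4
  rw [MonoidalCategory.tensorHom_def] at h1
  simp only [MonoidalCategory.whiskerLeft_comp, comp_whiskerRight, Category.assoc] at h1 ⊢
  rw [← associator_inv_naturality_middle_assoc, ← associator_inv_naturality_middle_assoc,
    ← comp_whiskerRight_assoc (α_ V (tpow T (k + l * p)) (tpow T b)).inv,
    ← associator_inv_naturality_middle, comp_whiskerRight_assoc,
    ← associator_inv_naturality_middle_assoc, h1, ← whisker_exchange_assoc,
    ← whisker_exchange_assoc, associator_inv_naturality_right_assoc,
    associator_inv_naturality_right_assoc]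

end LocData

/-! ### Homotopy classes of maps into the localization -/

section StabEq

open SymRingData

variable {H : Type*} [Category H] [MonoidalCategory H] {T : H} {R : SymRingData T} {V : H} {q : ℤ}

/-- The maps `f` and `g` become equal after `N` stabilizations. -/
def StabEq : ℕ → ∀ {k m : ℕ} (_ _ : V ⊗ tpow T k ⟶ R.X m), Prop
  | 0, _, _, f, g => f = g
  | N + 1, _, _, f, g => StabEq N (rmul f R.unit₁) (rmul g R.unit₁)

lemma stab_mk_til {k m : ℕ} (h : (k : ℤ) = q + m) (f : V ⊗ tpow T k ⟶ R.X m)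
    (h' : ((k + 1 : ℕ) : ℤ) = q + (m + 1 : ℕ)) :
    HRep.stab (⟨k, m, h, (smashIso V k).hom ≫ f⟩ : HRep R V q) =
      ⟨k + 1, m + 1, h', (smashIso V (k + 1)).hom ≫ rmul f R.unit₁⟩ := by
  simp only [HRep.stab]
  congr 1
  rw [smashIso_rmul]
  exact (Category.id_comp _).symm

lemma stabEq_of_stab_eq (N : ℕ) {k m : ℕ} (h : (k : ℤ) = q + m) (f g : V ⊗ tpow T k ⟶ R.X m)
    (hs : HRep.stab^[N] (⟨k, m, h, (smashIso V k).hom ≫ f⟩ : HRep R V q) =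
      HRep.stab^[N] ⟨k, m, h, (smashIso V k).hom ≫ g⟩) : StabEq N f g := by
  induction N generalizing k m with
  | zero =>
    simp only [Function.iterate_zero, id_eq, HRep.mk.injEq, heq_eq_eq, true_and, cancel_epi] at hs
    exact hs
  | succ N ih =>
    have h' : ((k + 1 : ℕ) : ℤ) = q + (m + 1 : ℕ) := by push_cast; omega
    simp only [Function.iterate_succ_apply] at hs
    rw [stab_mk_til h f h', stab_mk_til h g h'] at hs
    exact ih h' _ _ hs

lemma StabEq.cl_eq {N k m : ℕ} (h : (k : ℤ) = q + m) {f g : V ⊗ tpow T k ⟶ R.X m}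
    (hs : StabEq N f g) : cl h f = cl h g := by
  induction N generalizing k m with
  | zero => exact congrArg (cl h) hs
  | succ N ih =>
    have h' : ((k + 1 : ℕ) : ℤ) = q + (m + 1 : ℕ) := by push_cast; omega
    rw [← cl_rmul_unit₁ h f h', ← cl_rmul_unit₁ h g h']
    exact ih h' hs

lemma exists_stabEq {k m : ℕ} (h : (k : ℤ) = q + m) {f g : V ⊗ tpow T k ⟶ R.X m}
    (hs : cl h f = cl h g) : ∃ N, StabEq N f g := by
  obtain ⟨i, j, hij⟩ := (Pi.mk_eq_iff _ _).1 hs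
  have := congrArg HRep.m hij
  simp only [HRep.stab_iterate_m] at this
  obtain rfl : i = j := by omega
  exact ⟨i, stabEq_of_stab_eq i h f g hij⟩

lemma HRep.stab_iterate_k (a : HRep R V q) (i : ℕ) : (HRep.stab^[i] a).k = a.k + i := by
  induction i with
  | zero => rfl
  | succ i ih => rw [Function.iterate_succ_apply']; exact congrArg (· + 1) ih

end StabEq

section HatClasses

open SymRingData

variable {H : Type*} [Category H] [MonoidalCategory H] [SymmetricCategory H] {T : H}
  {R R' : SymRingData T} (hR : R.IsSymRing) {V : H}
include hR

lemma StabEq.tperm_rmul_reindex {N k k' b n m m' : ℕ} {f g : V ⊗ tpow T k ⟶ R.X m}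
    (h : StabEq N f g) (y : tpow T b ⟶ R.X n) (e : Fin k' ≃ Fin (k + b))
    (γ : Fin (m + n) ≃ Fin m') :
    StabEq N (V ◁ tperm e ≫ rmul f y ≫ R.reindex γ) (V ◁ tperm e ≫ rmul g y ≫ R.reindex γ) := by
  induction N generalizing k k' m m' with
  | zero => obtain rfl : f = g := h; rfl
  | succ N ih =>
    have h1 := ih h ((sumE e (Equiv.refl (Fin 1))).trans (swapE k b 1))
      ((swapE m 1 n).trans (sumE γ (Equiv.refl (Fin 1))))
    have h2 (f : V ⊗ tpow T k ⟶ R.X m) : rmul (V ◁ tperm e ≫ rmul f y ≫ R.reindex γ) R.unit₁ =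
        V ◁ tperm ((sumE e (Equiv.refl (Fin 1))).trans (swapE k b 1)) ≫
          rmul (rmul f R.unit₁) y ≫ R.reindex ((swapE m 1 n).trans (sumE γ (Equiv.refl (Fin 1)))) := by
      rw [rmul_tperm_reindex hR, hR.rmul_comm f hR.isCentral_unit₁ y, hR.reindex_trans,
        tperm_trans]
      simp
    rw [← h2, ← h2] at h1
    exact h1

variable {l m : ℕ} {x : tpow T l ⟶ R.X m} (L : LocData R R' x)
  (hinj : ∀ (A : H) (p : ℕ) (f g : A ⟶ R'.X p), L.hat f = L.hat g → f = g)

omit hR in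
lemma LocData.unit₁_eq : R'.unit₁ = R.unit₁ ≫ L.j 1 := by
  rw [unit₁, unit₁, L.one₁_eq, Category.assoc]

include hinj

lemma stabEq_of_hatT {N k p : ℕ} {f g : V ⊗ tpow T k ⟶ R'.X p}
    (h : StabEq N (L.hatT f) (L.hatT g)) : StabEq N f g := by
  induction N generalizing k p with
  | zero => exact L.hatT_injective hinj h
  | succ N ih =>
    refine ih (f := rmul f R'.unit₁) (g := rmul g R'.unit₁) ?_
    rw [L.unit₁_eq, L.hatT_rmul_j hR, L.hatT_rmul_j hR]
    exact StabEq.tperm_rmul_reindex hR (f := rmul (L.hatT f) R.unit₁)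
      (g := rmul (L.hatT g) R.unit₁) h _ _ _

variable {q : ℤ}

/-- Maps into the localization represent the same class if their adjoints do. -/
lemma cl_eq_of_hatT {Q : ℤ} {k p : ℕ} (h : (k : ℤ) = q + p) {f g : V ⊗ tpow T k ⟶ R'.X p}
    (h' : ((k + l * p : ℕ) : ℤ) = Q + ((1 + m) * p : ℕ)) (hs : cl h' (L.hatT f) = cl h' (L.hatT g)) :
    cl h f = cl h g := by
  obtain ⟨N, hN⟩ := exists_stabEq h' hs
  exact (stabEq_of_hatT hR L hinj hN).cl_eq h

omit hR hinj in
lemma hatT_deg {k p : ℕ} (h : (k : ℤ) = q + p) (l m : ℕ) :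
    ((k + l * p : ℕ) : ℤ) = q + (l - m) * p + ((1 + m) * p : ℕ) := by
  push_cast
  rw [h]
  ring

variable (sgn : SignStructure T)

omit hR hinj L in
lemma mk_permute (a : HRep R V q) (γ : Equiv.Perm (Fin a.m)) {e : Equiv.Perm (Fin a.k)}
    (he : Equiv.Perm.sign e = Equiv.Perm.sign γ) :
    Pi.mk (a.permute sgn.neg γ) = cl a.deg (V ◁ tperm e ≫ a.til ≫ R.reindex γ) := by
  refine congrArg Pi.mk ?_
  simp only [HRep.permute]
  congr 1
  have h3 := headEnd_eq V (signAut sgn.neg γ).hom a.k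
  rw [tperm_eq_headEnd sgn, he, sgnMap_sign, ← reassoc_of% h3, ← R.reindex_perm, HRep.til,
    Category.assoc, Iso.hom_inv_id_assoc]

/-- The localization of a semistable ring spectrum at a central map is semistable. -/
lemma trivialAction_loc (hR' : R'.IsSymRing) (htr : ∀ q, TrivialAction sgn.neg R V q) :
    TrivialAction sgn.neg R' V q := by
  rintro a ha φ - b ⟨i, γ, -, rfl⟩
  rw [← Pi.mk_stab_iterate a i]
  have hk : 2 ≤ (HRep.stab^[i] a).k := by rw [HRep.stab_iterate_k]; omega
  generalize HRep.stab^[i] a = c at γ hk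
  obtain ⟨e, he⟩ := exists_sign hk (Equiv.Perm.sign γ)
  rw [mk_permute sgn c γ he, mk_eq_cl]
  have h := c.deg
  have h' : ((c.k + 1 : ℕ) : ℤ) = q + (c.m + 1 : ℕ) := by push_cast; omega
  have h'' : ((c.k + 1 + 1 : ℕ) : ℤ) = q + (c.m + 1 + 1 : ℕ) := by push_cast; omega
  rw [← cl_rmul_unit₁ h _ h', ← cl_rmul_unit₁ h' _ h'', ← cl_rmul_unit₁ h c.til h',
    ← cl_rmul_unit₁ h' (rmul c.til R'.unit₁) h'', rmul_tperm_reindex hR', rmul_tperm_reindex hR']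
  refine cl_eq_of_hatT hR L hinj h'' (hatT_deg h'' l m) ?_
  -- exchanging the two factors `T` of the stabilizations does not change the map
  have hc := congrArg L.hatT (hR'.rmul_comm c.til hR'.isCentral_unit₁ R'.unit₁)
  rw [L.hatT_tperm_reindex] at hc
  have hc' := congrArg (cl (hatT_deg h'' l m)) hc
  rw [L.hatT_tperm_reindex, cl_perm sgn hR (htr _) (hatT_deg h'' l m) _ _ _ (hatT_deg h'' l m)]
  rw [cl_perm sgn hR (htr _) (hatT_deg h'' l m) _ _ _ (hatT_deg h'' l m)] at hc'
  have he' : esign e = esign γ := by rw [esign_perm, esign_perm, he]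
  simp only [esign_sumE, esign_refl, mul_one, esign_blockE, esign_symm, esign_swapE, he'] at hc' ⊢
  obtain hγ | hγ := Int.units_eq_one_or (esign γ)
  · rw [hγ]
    simp only [one_pow, mul_one, act_one sgn hR]
  · rw [hγ]
    simp only [_root_.pow_one] at hc'
    exact hc'.symm

omit hinj L in
lemma SymRingData.PermEq.cl_eq_act {k k' m m' : ℕ} (htr : TrivialAction sgn.neg R V q)
    {f : V ⊗ tpow T k ⟶ R.X m} {g : V ⊗ tpow T k' ⟶ R.X m'} (hfg : PermEq f g)
    (h : (k : ℤ) = q + m) (h' : (k' : ℤ) = q + m') :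
    ∃ u, cl h f = Pi.act sgn.neg u (cl h' g) := by
  obtain ⟨e, γ, rfl⟩ := hfg
  exact ⟨_, cl_perm sgn hR htr h' g e γ h⟩

/-- Maps into the localization represent the same class up to sign if their adjoints agree up to
permutations. -/
lemma exists_cl_eq_act_of_hatT (hR' : R'.IsSymRing) (htr : ∀ q, TrivialAction sgn.neg R V q)
    {k k' p p' : ℕ} (hk : 2 ≤ k) (h : (k : ℤ) = q + p) (h' : (k' : ℤ) = q + p')
    {f : V ⊗ tpow T k ⟶ R'.X p} {g : V ⊗ tpow T k' ⟶ R'.X p'}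
    (hfg : PermEq (L.hatT f) (L.hatT g)) : ∃ u, cl h f = Pi.act sgn.neg u (cl h' g) := by
  obtain rfl : p = p' := by
    obtain ⟨-, γ, -⟩ := hfg
    exact (Nat.eq_of_mul_eq_mul_left (by omega) (eq_of_equiv γ)).symm
  obtain rfl : k = k' := by omega
  obtain ⟨u, hu⟩ := hfg.cl_eq_act hR sgn (htr _) (hatT_deg h l m) (hatT_deg h l m)
  obtain ⟨e, rfl⟩ := exists_sign hk u
  refine ⟨_, Eq.trans ?_ (cl_tperm sgn hR' h g e)⟩
  refine cl_eq_of_hatT hR L hinj h (hatT_deg h l m) (hu.trans ?_)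
  have h1 := L.hatT_tperm_reindex g e (Equiv.refl _)
  rw [hR'.reindex_refl, Category.comp_id] at h1
  rw [h1, cl_perm sgn hR (htr _) (hatT_deg h l m) _ _ _ (hatT_deg h l m)]
  simp only [esign_sumE, esign_blockE, esign_symm, esign_refl, one_pow, mul_one, esign_perm e]

end HatClasses

/-! ### Localizations of graded rings -/

section Ore

/-- A criterion for a ring homomorphism to be a localization at an element `ξ` which satisfies an
Ore condition. -/
lemma isRingLocalization_of {A B : Type*} [Ring A] [Ring B] (φ : A →+* B) (ξ : A)
    (h₁ : IsUnit (φ ξ)) (h₂ : ∀ b, ∃ p a, b * φ ξ ^ p = φ a)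
    (h₃ : ∀ a, φ a = 0 → ∃ p, a * ξ ^ p = 0) (h₄ : ∀ a, ∃ a', a * ξ = ξ * a') :
    IsRingLocalization.{w} φ ξ := by
  refine ⟨h₁, fun C _ ψ hu => ?_⟩
  have hu' (p : ℕ) : IsUnit (ψ ξ ^ p) := hu.pow p
  have h₄' (p : ℕ) : ∀ a, ∃ a', a * ξ ^ p = ξ ^ p * a' := by
    induction p with
    | zero => exact fun a => ⟨a, by simp⟩
    | succ p ih =>
      intro a
      obtain ⟨a', ha'⟩ := ih a
      obtain ⟨a'', ha''⟩ := h₄ a'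
      exact ⟨a'', by rw [pow_succ, ← mul_assoc, ha', mul_assoc, ha'', mul_assoc]⟩
  choose p₀ a₀ h₀ using h₂
  obtain ⟨χ, hχ₀⟩ : ∃ χ : B → C, ∀ b, χ b * ψ ξ ^ p₀ b = ψ (a₀ b) :=
    ⟨fun b => ψ (a₀ b) * ↑(hu' (p₀ b)).unit⁻¹, fun b => by
      rw [mul_assoc, IsUnit.val_inv_mul, mul_one]⟩
  have hχ (b : B) (p : ℕ) (a : A) (h : b * φ ξ ^ p = φ a) : χ b * ψ ξ ^ p = ψ a := by
    have e : φ (a₀ b * ξ ^ p - a * ξ ^ p₀ b) = 0 := by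
      simp only [map_sub, map_mul, map_pow, ← h₀, ← h]
      rw [mul_assoc, mul_assoc, ← pow_add, ← pow_add, add_comm, sub_self]
    obtain ⟨s, hs⟩ := h₃ _ e
    have hs' : ψ (a₀ b) * ψ ξ ^ p * ψ ξ ^ s = ψ a * ψ ξ ^ p₀ b * ψ ξ ^ s := by
      rw [sub_mul, sub_eq_zero] at hs
      simpa only [map_mul, map_pow] using congrArg ψ hs
    refine (hu' (p₀ b)).mul_right_cancel ?_
    rw [← (hu' s).mul_right_cancel hs', ← hχ₀, mul_assoc, mul_assoc, ← pow_add, ← pow_add, add_comm]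
  have hone : χ 1 = 1 := by
    have := hχ 1 0 1 (by simp)
    simpa using this
  have hzero : χ 0 = 0 := by
    have := hχ 0 0 0 (by simp)
    simpa using this
  have hadd (b b' : B) : χ (b + b') = χ b + χ b' := by
    have e : (b + b') * φ ξ ^ (p₀ b + p₀ b') = φ (a₀ b * ξ ^ p₀ b' + a₀ b' * ξ ^ p₀ b) := by
      simp only [map_add, map_mul, map_pow, ← h₀, add_mul, mul_assoc, ← pow_add]
      rw [add_comm (p₀ b')]
    refine (hu' (p₀ b + p₀ b')).mul_right_cancel ?_
    rw [hχ _ _ _ e]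
    simp only [map_add, map_mul, map_pow, add_mul, ← hχ _ _ _ (h₀ b), ← hχ _ _ _ (h₀ b'),
      mul_assoc, ← pow_add]
    rw [add_comm (p₀ b')]
  have hmul (b b' : B) : χ (b * b') = χ b * χ b' := by
    obtain ⟨a, ha⟩ := h₄' (p₀ b) (a₀ b')
    have e : b * b' * φ ξ ^ (p₀ b' + p₀ b) = φ (a₀ b * a) := by
      rw [pow_add, mul_assoc, ← mul_assoc b', h₀, ← map_pow, ← map_mul, ha, map_mul, map_pow,
        ← mul_assoc, h₀, map_mul]
    refine (hu' (p₀ b' + p₀ b)).mul_right_cancel ?_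
    rw [hχ _ _ _ e, pow_add, mul_assoc, ← mul_assoc (χ b'), hχ _ _ _ (h₀ b'), ← map_pow, ← map_mul,
      ha, map_mul ψ (ξ ^ _), map_pow, ← mul_assoc, hχ₀, map_mul]
  let χ' : B →+* C :=
    { toFun := χ, map_one' := hone, map_mul' := hmul, map_zero' := hzero, map_add' := hadd }
  refine ⟨χ', ?_, fun χ₁ h => ?_⟩
  · ext a
    have := hχ (φ a) 0 a (by simp)
    rwa [pow_zero, mul_one] at this
  · ext b
    refine (hu' (p₀ b)).mul_right_cancel ?_
    refine Eq.trans ?_ (hχ b _ _ (h₀ b)).symm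
    rw [← h]
    simp only [RingHom.comp_apply, ← h₀ b, map_mul, map_pow]

end Ore

section Graded

open DirectSum

variable {ι : Type*} [AddMonoid ι] [DecidableEq ι] {𝒜 ℬ : ι → Type*}
  [∀ i, AddCommGroup (𝒜 i)] [∀ i, AddCommGroup (ℬ i)] [GRing 𝒜] [GRing ℬ]

/-- The inclusion of the homogeneous elements of a graded ring. -/
def homogeneousHom (𝒜 : ι → Type*) [∀ i, AddCommGroup (𝒜 i)] [GRing 𝒜] :
    GradedMonoid 𝒜 →* ⨁ i, 𝒜 i where
  toFun a := DirectSum.of 𝒜 a.1 a.2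
  map_one' := rfl
  map_mul' a b := (DirectSum.of_mul_of a.2 b.2).symm

variable (φ : ∀ i, 𝒜 i →+ ℬ i) (Φ : GradedMonoid 𝒜 →* GradedMonoid ℬ)
  (hΦ : ∀ i a, Φ (GradedMonoid.mk i a) = GradedMonoid.mk i (φ i a))

/-- The ring homomorphism given by a multiplicative family of additive maps. -/
def gradedRingHom : (⨁ i, 𝒜 i) →+* ⨁ i, ℬ i :=
  DirectSum.toSemiring (fun i => (DirectSum.of ℬ i).comp (φ i))
    (DirectSum.of_eq_of_gradedMonoid_eq ((hΦ 0 _).symm.trans Φ.map_one))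
    (fun {i j} a b => by
      have h := (hΦ (i + j) (GradedMonoid.GMul.mul a b)).symm.trans
        (Φ.map_mul (GradedMonoid.mk i a) (GradedMonoid.mk j b))
      rw [hΦ, hΦ] at h
      exact (DirectSum.of_eq_of_gradedMonoid_eq h).trans (DirectSum.of_mul_of _ _).symm)

lemma gradedRingHom_of (i : ι) (a : 𝒜 i) :
    gradedRingHom φ Φ hΦ (DirectSum.of 𝒜 i a) = DirectSum.of ℬ i (φ i a) :=
  DirectSum.toSemiring_of _ _ _ _ _

lemma gradedRingHom_homogeneousHom (a : GradedMonoid 𝒜) :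
    gradedRingHom φ Φ hΦ (homogeneousHom 𝒜 a) = homogeneousHom ℬ (Φ a) := by
  obtain ⟨i, a⟩ := a
  refine (gradedRingHom_of φ Φ hΦ i a).trans ?_
  exact (congrArg (homogeneousHom ℬ) (hΦ i a)).symm

lemma gradedRingHom_apply (a : ⨁ i, 𝒜 i) (i : ι) : gradedRingHom φ Φ hΦ a i = φ i (a i) := by
  induction a using DirectSum.induction_on with
  | zero => simp
  | of k a =>
    rw [gradedRingHom_of]
    obtain rfl | h := eq_or_ne k i
    · rw [DirectSum.of_eq_same, DirectSum.of_eq_same]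
    · rw [DirectSum.of_eq_of_ne _ _ _ h.symm, DirectSum.of_eq_of_ne _ _ _ h.symm, map_zero]
  | add a b ha hb => rw [map_add, DirectSum.add_apply, ha, hb, DirectSum.add_apply, map_add]

/-- A homogeneous version of `isRingLocalization_of`. -/
lemma isRingLocalization_gradedRingHom (ξ : GradedMonoid 𝒜) (h₁ : IsUnit (Φ ξ))
    (h₂ : ∀ b, ∃ p a, b * Φ ξ ^ p = Φ a)
    (h₃ : ∀ i (a : 𝒜 i), φ i a = 0 →
      ∃ p, GradedMonoid.mk i a * ξ ^ p = GradedMonoid.mk i 0 * ξ ^ p)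
    (h₄ : ∀ a, ∃ a', a * ξ = ξ * a') :
    IsRingLocalization.{w} (gradedRingHom φ Φ hΦ) (DirectSum.of 𝒜 ξ.1 ξ.2) := by
  change IsRingLocalization.{w} _ (homogeneousHom 𝒜 ξ)
  apply isRingLocalization_of
  · rw [gradedRingHom_homogeneousHom]
    exact h₁.map _
  · intro b
    rw [gradedRingHom_homogeneousHom]
    induction b using DirectSum.induction_on with
    | zero => exact ⟨0, 0, by simp⟩
    | of i b =>
      obtain ⟨p, a, h⟩ := h₂ (GradedMonoid.mk i b)
      refine ⟨p, homogeneousHom 𝒜 a, ?_⟩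
      rw [gradedRingHom_homogeneousHom, ← h, map_mul, map_pow]
      rfl
    | add b b' hb hb' =>
      obtain ⟨p, a, h⟩ := hb
      obtain ⟨p', a', h'⟩ := hb'
      refine ⟨p + p', a * homogeneousHom 𝒜 ξ ^ p' + a' * homogeneousHom 𝒜 ξ ^ p, ?_⟩
      simp only [map_add, map_mul, map_pow, ← h, ← h', gradedRingHom_homogeneousHom, add_mul,
        mul_assoc, ← pow_add]
      rw [add_comm p']
  · intro a ha
    have h (i : ι) : φ i (a i) = 0 := by
      rw [← gradedRingHom_apply φ Φ hΦ, ha, DirectSum.zero_apply]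
    choose p hp using fun i => h₃ i (a i) (h i)
    classical
    obtain ⟨P, hP⟩ : ∃ P, ∀ i ∈ DFinsupp.support a, p i ≤ P :=
      ⟨(DFinsupp.support a).sup p, fun i hi => Finset.le_sup hi⟩
    refine ⟨P, ?_⟩
    rw [← DirectSum.sum_support_of a, Finset.sum_mul]
    refine Finset.sum_eq_zero fun i hi => ?_
    obtain ⟨s, hs⟩ := Nat.exists_eq_add_of_le (hP i hi)
    have h1 := congrArg (homogeneousHom 𝒜) (hp i)
    have h0 : homogeneousHom 𝒜 (GradedMonoid.mk i (0 : 𝒜 i)) = 0 := map_zero (DirectSum.of 𝒜 i)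
    rw [map_mul, map_mul, h0, zero_mul, map_pow] at h1
    rw [hs, pow_add, ← mul_assoc]
    exact (congrArg (· * _) h1).trans (zero_mul _)
  · intro a
    induction a using DirectSum.induction_on with
    | zero => exact ⟨0, by simp⟩
    | of i a =>
      obtain ⟨a', h⟩ := h₄ (GradedMonoid.mk i a)
      refine ⟨homogeneousHom 𝒜 a', ?_⟩
      rw [← map_mul, ← h, map_mul]
      rfl
    | add a b ha hb =>
      obtain ⟨a', ha⟩ := ha
      obtain ⟨b', hb⟩ := hb
      exact ⟨a' + b', by rw [add_mul, ha, hb, mul_add]⟩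

end Graded

/-! ### Maps of ring spectra on homotopy classes -/

section Push

open SymRingData

variable {H : Type*} [Category H] [MonoidalCategory H] {T : H} {R R' : SymRingData T}
  {j : ∀ n, R.X n ⟶ R'.X n} (hj : R.IsRingMap R' j) {V : H} {q : ℤ}
include hj

lemma SymRingData.IsRingMap.star {A B : H} {p n : ℕ} (f : A ⟶ R.X p) (g : B ⟶ R.X n) :
    R.star f g ≫ j (p + n) = R'.star (f ≫ j p) (g ≫ j n) := by
  rw [SymRingData.star, SymRingData.star, Category.assoc, hj.mul, tensorHom_comp_tensorHom_assoc]

lemma SymRingData.IsRingMap.rmul {k b m n : ℕ} (f : V ⊗ tpow T k ⟶ R.X m) (y : tpow T b ⟶ R.X n) :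
    SymRingData.rmul f y ≫ j (m + n) = SymRingData.rmul (f ≫ j m) (y ≫ j n) := by
  simp only [SymRingData.rmul, Category.assoc, hj.star]

lemma SymRingData.IsRingMap.pow {l m : ℕ} (x : tpow T l ⟶ R.X m) (p : ℕ) :
    R.pow x p ≫ j (m * p) = R'.pow (x ≫ j m) p := by
  induction p with
  | zero => exact hj.one₀
  | succ p ih =>
    have h (f : tpow T (l * p) ⟶ R.X (m * p)) (g) (hf : f ≫ j (m * p) = g) :
        (tpowAdd (l * p) l).hom ≫ R.star f x ≫ j (m * p + m) =
          (tpowAdd (l * p) l).hom ≫ R'.star g (x ≫ j m) := by rw [hj.star, hf]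
    exact (Category.assoc _ _ _).trans (h _ _ ih)

lemma SymRingData.IsRingMap.unit₁ : R.unit₁ ≫ j 1 = R'.unit₁ := by
  rw [SymRingData.unit₁, SymRingData.unit₁, Category.assoc, hj.one₁]

lemma SymRingData.IsRingMap.conv [SymmetricCategory H] {V' : H} {k k' m m' : ℕ}
    (f : V ⊗ tpow T k ⟶ R.X m) (g : V' ⊗ tpow T k' ⟶ R.X m') :
    SymRingData.conv f g ≫ j (m + m') = SymRingData.conv (f ≫ j m) (g ≫ j m') := by
  simp only [SymRingData.conv, Category.assoc, hj.star]

lemma SymRingData.IsRingMap.σ {X : H} {m : ℕ} (f : X ⟶ R.X m) :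
    (f ▷ T ≫ R.σ m) ≫ j (m + 1) = (f ≫ j m) ▷ T ≫ R'.σ m := by
  have h1 : R.σ m = R.star (𝟙 _) R.one₁ := by
    simp [SymRingData.σ, SymRingData.star]
  have h2 : R'.σ m = R'.star (𝟙 _) R'.one₁ := by
    simp [SymRingData.σ, SymRingData.star]
  rw [h1, h2, Category.assoc, hj.star, hj.one₁, ← star_comp_left, ← star_comp_left,
    Category.id_comp, Category.comp_id]

lemma HRep.push_stab (a : HRep R V q) : a.stab.push j = (a.push j).stab := by
  simp only [HRep.push, HRep.stab]
  congr 1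
  exact hj.σ a.map

/-- The map on stable homotopy groups induced by a map of ring spectra. -/
def Pi.push : Pi R V q → Pi R' V q :=
  Quot.map (HRep.push j) (by rintro a _ rfl; exact HRep.push_stab hj a)

lemma push_cl {k m : ℕ} (h : (k : ℤ) = q + m) (f : V ⊗ tpow T k ⟶ R.X m) :
    Pi.push hj (cl h f) = cl h (f ≫ j m) := by
  refine congrArg Pi.mk ?_
  simp only [HRep.push, Category.assoc]

lemma push_act (neg : Aut T) (u : ℤˣ) (x : Pi R V q) :
    Pi.push hj (Pi.act neg u x) = Pi.act neg u (Pi.push hj x) := by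
  obtain ⟨a, rfl⟩ := Quot.exists_rep x
  refine congrArg Pi.mk ?_
  simp only [HRep.twist, HRep.push, HRep.stab]
  congr 1
  exact (Category.assoc _ _ _).trans (congrArg (headEnd V (sgnMap neg u) (a.k + 1) ≫ ·)
    (hj.σ a.map))

lemma push_mul [SymmetricCategory H] (sgn : SignStructure T) (hR : R.IsSymRing)
    (hR' : R'.IsSymRing) {V' W : H} {q' : ℤ} (d : W ⟶ V ⊗ V')
    (htr : TrivialAction sgn.neg R W (q + q')) (htr' : TrivialAction sgn.neg R' W (q + q'))
    (x : Pi R V q) (y : Pi R V' q') : Pi.push hj (Pi.mul sgn d hR htr x y) =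
      Pi.mul sgn d hR' htr' (Pi.push hj x) (Pi.push hj y) := by
  obtain ⟨k, m, h, f, rfl⟩ := exists_cl x
  obtain ⟨k', m', h', g, rfl⟩ := exists_cl y
  rw [mul_cl, push_act, push_cl, push_cl, push_cl, mul_cl, Category.assoc, hj.conv]

lemma push_add [SymmetricCategory H] [∀ S : H, (tensorLeft S).IsLeftAdjoint]
    [HasBinaryCoproduct T T] (cg : CogroupStructure T) (x y : Pi R V q) :
    Pi.push hj (Pi.add cg x y) = Pi.add cg (Pi.push hj x) (Pi.push hj y) := by
  classical
  obtain ⟨k, m, hk, h⟩ := Pi.exists_common {x, y}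
  obtain ⟨f, rfl⟩ := h x (by simp)
  obtain ⟨g, rfl⟩ := h y (by simp)
  rw [Pi.add_mk]
  refine Eq.trans ?_ (Pi.add_mk cg hk (f ≫ j m) (g ≫ j m)).symm
  exact congrArg (fun h => Pi.mk (⟨k + 2, m, hk, h⟩ : HRep R' V q))
    (cg.sum_comp (A := smashPow T V (k + 1)) f g (j m))

lemma push_one (e : V ⟶ 𝟙_ H) : Pi.push hj (Pi.mk (HRep.one (R := R) e)) = Pi.mk (HRep.one e) := by
  refine congrArg Pi.mk ?_
  simp only [HRep.push, HRep.one]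
  congr 1
  exact (Category.assoc _ _ _).trans (congrArg (smashMap e 1 ≫ ·)
    ((Category.assoc _ _ _).trans (congrArg ((λ_ T).hom ≫ ·) hj.one₁)))

end Push

/-! ### Homogeneous elements of the graded ring -/

section Homogeneous

open SymRingData

variable {H : Type*} [Category H] [MonoidalCategory H] {T : H} {R : SymRingData T}
  {N : Type*} [AddCommMonoid N] {V : N → H}

/-- The homogeneous element of degree `(r, q)` given by an element of the homotopy group. -/
abbrev gmk (R : SymRingData T) (V : N → H) (r : N) (q : ℤ) (x : Pi R (V r) q) :
    GradedMonoid (PiFamily R V) :=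
  GradedMonoid.mk (A := PiFamily R V) (r, q) x

/-- The sign involution on homogeneous elements. -/
def gact (neg : Aut T) (u : ℤˣ) (a : GradedMonoid (PiFamily R V)) : GradedMonoid (PiFamily R V) :=
  gmk R V a.1.1 a.1.2 (Pi.act neg u a.2)

variable [SymmetricCategory H] (sgn : SignStructure T) (hR : R.IsSymRing)
  {d : ∀ r r', V (r + r') ⟶ V r ⊗ V r'} {e : V 0 ⟶ 𝟙_ H} (hV : IsGradedComonoid V d e)
  (htr : ∀ r q, TrivialAction sgn.neg R (V r) q)

include hR in
omit [AddCommMonoid N] in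
lemma gact_gact (u v : ℤˣ) (a : GradedMonoid (PiFamily R V)) :
    gact sgn.neg u (gact sgn.neg v a) = gact sgn.neg (u * v) a :=
  congrArg (gmk R V a.1.1 a.1.2) (act_act sgn hR u v (V := V a.1.1) (q := a.1.2) a.2)

include hR in
omit [AddCommMonoid N] in
lemma gact_one (a : GradedMonoid (PiFamily R V)) : gact sgn.neg 1 a = a :=
  congrArg (gmk R V a.1.1 a.1.2) (act_one sgn hR (V := V a.1.1) (q := a.1.2) a.2)

variable [GradedMonoid.GMonoid (PiFamily R V)] (hmul : ∀ {i j : N × ℤ} (x : PiFamily R V i)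
  (y : PiFamily R V j), GradedMonoid.GMul.mul x y = Pi.mul sgn (d i.1 j.1) hR (htr _ _) x y)
include hmul

lemma gact_mul (u : ℤˣ) (a b : GradedMonoid (PiFamily R V)) :
    gact sgn.neg u a * b = gact sgn.neg u (a * b) := by
  refine congrArg (gmk R V (a.1.1 + b.1.1) (a.1.2 + b.1.2)) ?_
  have h1 := hmul (i := a.1) (j := b.1) (gact sgn.neg u a).2 b.2
  have h2 := hmul a.2 b.2
  refine h1.trans (Eq.trans ?_ (congrArg (Pi.act sgn.neg u) h2.symm))
  exact act_mul sgn hR _ _ _ _ _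

lemma mul_gact (u : ℤˣ) (a b : GradedMonoid (PiFamily R V)) :
    a * gact sgn.neg u b = gact sgn.neg u (a * b) := by
  refine congrArg (gmk R V (a.1.1 + b.1.1) (a.1.2 + b.1.2)) ?_
  have h1 := hmul (i := a.1) (j := b.1) a.2 (gact sgn.neg u b).2
  have h2 := hmul a.2 b.2
  refine h1.trans (Eq.trans ?_ (congrArg (Pi.act sgn.neg u) h2.symm))
  exact mul_act sgn hR _ _ _ _ _

include hV

lemma gmk_mul_map {r : N} {q Q : ℤ} {k m b n : ℕ} (h : (k : ℤ) = q + m) (hb : (b : ℤ) = Q + n)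
    (f : V r ⊗ tpow T k ⟶ R.X m) (y : tpow T b ⟶ R.X n) :
    gmk R V r q (cl h f) * gmk R V 0 Q (cl hb (e ▷ _ ≫ (λ_ _).hom ≫ y)) =
      gmk R V r (q + Q) (Pi.act sgn.neg (Q * m).negOnePow (cl (deg_add h hb) (rmul f y))) := by
  refine gradedMonoid_mk_eq sgn.neg (i := ((r, q) + ((0 : N), Q))) (j := (r, q + Q))
    (by rw [Prod.mk_add_mk, add_zero]) (deg_add h hb) (deg_add h hb) (rmul f y) _
    (congrArg V (add_zero r)) ((hmul (i := (r, q)) (j := (0, Q)) _ _).trans ?_) rfl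
  rw [← rmul_comp]
  exact mul_cl_map sgn hR (htr (r + 0) (q + Q)) (d r 0) e (hV.right_counit r) h hb f y

lemma map_mul_gmk {r : N} {q Q : ℤ} {k m b n : ℕ} (h : (k : ℤ) = q + m) (hb : (b : ℤ) = Q + n)
    (f : V r ⊗ tpow T k ⟶ R.X m) {y : tpow T b ⟶ R.X n} (hy : R.IsCentral y) :
    gmk R V 0 Q (cl hb (e ▷ _ ≫ (λ_ _).hom ≫ y)) * gmk R V r q (cl h f) = gmk R V r (q + Q)
      (Pi.act sgn.neg (Q * (q + m)).negOnePow (cl (deg_add h hb) (rmul f y))) := by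
  have h' : ((k + b : ℕ) : ℤ) = Q + q + (m + n : ℕ) := by push_cast; omega
  refine gradedMonoid_mk_eq sgn.neg (i := (((0 : N), Q) + (r, q))) (j := (r, q + Q))
    (by rw [Prod.mk_add_mk, zero_add, add_comm]) h' (deg_add h hb) (rmul f y) _
    (congrArg V (zero_add r)) ((hmul (i := (0, Q)) (j := (r, q)) _ _).trans ?_) rfl
  rw [← rmul_comp]
  exact map_mul_cl sgn hR (htr (0 + r) (Q + q)) (d 0 r) e (hV.left_counit r) h hb f hy h'

/-- The classes of central maps commute up to sign with homogeneous elements. -/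
lemma exists_map_mul_eq {Q : ℤ} {b n : ℕ} (hb : (b : ℤ) = Q + n) {y : tpow T b ⟶ R.X n}
    (hy : R.IsCentral y) (a : GradedMonoid (PiFamily R V)) :
    ∃ u, gmk R V 0 Q (cl hb (e ▷ _ ≫ (λ_ _).hom ≫ y)) * a =
      gact sgn.neg u (a * gmk R V 0 Q (cl hb (e ▷ _ ≫ (λ_ _).hom ≫ y))) := by
  obtain ⟨⟨r, q⟩, a⟩ := a
  obtain ⟨k, m, h, f, rfl⟩ := exists_cl (V := V r) (q := q) a
  refine ⟨(Q * (q + m)).negOnePow * (Q * m).negOnePow, ?_⟩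
  refine (map_mul_gmk sgn hR hV htr hmul h hb f hy).trans (Eq.trans ?_
    (congrArg (gact sgn.neg _) (gmk_mul_map sgn hR hV htr hmul h hb f y).symm))
  refine congrArg (gmk R V r (q + Q)) ?_
  have hu : ((Q * (q + m)).negOnePow * (Q * m).negOnePow) * (Q * m).negOnePow =
      (Q * (q + m)).negOnePow := by rw [mul_assoc, Int.units_mul_self, mul_one]
  have ha := act_act sgn hR ((Q * (q + m)).negOnePow * (Q * m).negOnePow) (Q * m).negOnePow
    (cl (deg_add h hb) (rmul f y))
  rw [hu] at ha
  exact ha.symm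

lemma gmk_mul_pow {r : N} {q Q : ℤ} {k m b n : ℕ} (h : (k : ℤ) = q + m) (hb : (b : ℤ) = Q + n)
    (f : V r ⊗ tpow T k ⟶ R.X m) (y : tpow T b ⟶ R.X n) (p : ℕ)
    (h' : ((k + b * p : ℕ) : ℤ) = q + Q * p + (m + n * p : ℕ)) :
    ∃ u, gmk R V r q (cl h f) * gmk R V 0 Q (cl hb (e ▷ _ ≫ (λ_ _).hom ≫ y)) ^ p =
      gmk R V r (q + Q * p) (Pi.act sgn.neg u (cl h' (rmul f (R.pow y p)))) := by
  induction p with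
  | zero =>
    have h1 : ((k + b * 0 : ℕ) : ℤ) = q + (m + n * 0 : ℕ) := by simpa using h
    obtain ⟨u, hu⟩ := (PermEq.rmul_pow_zero hR y f).symm hR |>.cl_eq_act hR sgn (htr r q) h h1
    refine ⟨u, ?_⟩
    rw [_root_.pow_zero, mul_one]
    refine (congrArg (gmk R V r q) hu).trans ?_
    refine gradedMonoid_mk_eq sgn.neg (i := (r, q)) (j := (r, q + Q * (0 : ℕ))) (by simp) h1 h'
      (rmul f (R.pow y 0)) u rfl ?_ rfl
    simp only [eqToHom_refl, id_whiskerRight, Category.id_comp]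
    rfl
  | succ p ih =>
    have h1 : ((k + b * p : ℕ) : ℤ) = q + Q * p + (m + n * p : ℕ) := by
      push_cast
      rw [h, hb]
      ring
    have h2 : ((k + b * (p + 1) : ℕ) : ℤ) = q + Q * p + Q + (m + n * (p + 1) : ℕ) := by
      rw [h']; push_cast; ring
    obtain ⟨u, hu⟩ := ih h1
    have hp : PermEq (rmul (rmul f (R.pow y p)) y) (rmul f (R.pow y (p + 1))) :=
      PermEq.symm hR ⟨_, _, hR.rmul_rstar f (R.pow y p) y⟩
    obtain ⟨v, hv⟩ := hp.cl_eq_act hR sgn (htr r _) (deg_add h1 hb) h2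
    refine ⟨u * ((Q * (m + n * p : ℕ)).negOnePow * v), ?_⟩
    rw [_root_.pow_succ, ← mul_assoc, hu]
    refine (gact_mul sgn hR htr hmul u (gmk R V r _ (cl h1 (rmul f (R.pow y p)))) _).trans ?_
    rw [gmk_mul_map sgn hR hV htr hmul h1 hb, hv]
    refine gradedMonoid_mk_eq sgn.neg (i := (r, q + Q * p + Q)) (j := (r, q + Q * (p + 1 : ℕ)))
      (by push_cast; rw [mul_add, mul_one, add_assoc]) h2 h' (rmul f (R.pow y (p + 1))) _ rfl ?_ rfl
    have ha : Pi.act sgn.neg u (Pi.act sgn.neg (Q * (m + n * p : ℕ)).negOnePow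
        (Pi.act sgn.neg v (cl h2 (rmul f (R.pow y (p + 1)))))) =
        Pi.act sgn.neg (u * ((Q * (m + n * p : ℕ)).negOnePow * v))
          (cl h2 (rmul f (R.pow y (p + 1)))) := by
      rw [act_act sgn hR, act_act sgn hR, mul_assoc]
    simp only [eqToHom_refl, id_whiskerRight, Category.id_comp]
    exact ha

end Homogeneous

/-! ### The homotopy ring of a localization -/

section Equalities

open SymRingData

variable {H : Type*} [Category H] [MonoidalCategory H] {T : H} {R R' : SymRingData T}
  {j : ∀ n, R.X n ⟶ R'.X n} (hj : R.IsRingMap R' j) {V : H}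

include hj in
/-- Maps with the same class become equal after stabilization, in such a way that the classes of
given lifts to another ring spectrum do not change. -/
lemma exists_comp_eq_of_stabEq (N : ℕ) {k m : ℕ} (f g : V ⊗ tpow T k ⟶ R.X m)
    (h : StabEq N (f ≫ j m) (g ≫ j m)) :
    ∃ (k' m' : ℕ) (f' g' : V ⊗ tpow T k' ⟶ R.X m'), f' ≫ j m' = g' ≫ j m' ∧
      ∀ q (h : (k : ℤ) = q + m), ∃ h' : (k' : ℤ) = q + m',
        (cl h' f' : Pi R V q) = cl h f ∧ (cl h' g' : Pi R V q) = cl h g := by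
  induction N generalizing k m with
  | zero => exact ⟨k, m, f, g, h, fun q hq => ⟨hq, rfl, rfl⟩⟩
  | succ N ih =>
    have h1 : StabEq N (rmul f R.unit₁ ≫ j (m + 1)) (rmul g R.unit₁ ≫ j (m + 1)) := by
      rw [hj.rmul, hj.rmul, hj.unit₁]
      exact h
    obtain ⟨k', m', f', g', hfg, hc⟩ := ih _ _ h1
    refine ⟨k', m', f', g', hfg, fun q hq => ?_⟩
    have h2 : ((k + 1 : ℕ) : ℤ) = q + (m + 1 : ℕ) := by push_cast; omega
    obtain ⟨h', e1, e2⟩ := hc q h2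
    exact ⟨h', e1.trans (cl_rmul_unit₁ hq f h2), e2.trans (cl_rmul_unit₁ hq g h2)⟩

lemma exists_cl_cl {q : ℤ} (a b : Pi R V q) : ∃ (k m : ℕ) (h : (k : ℤ) = q + m)
    (f g : V ⊗ tpow T k ⟶ R.X m), a = cl h f ∧ b = cl h g := by
  classical
  obtain ⟨k, m, hk, h⟩ := Pi.exists_common {a, b}
  obtain ⟨f, hf⟩ := h a (by simp)
  obtain ⟨g, hg⟩ := h b (by simp)
  exact ⟨_, _, hk, _, _, hf.symm.trans (mk_eq_cl _), hg.symm.trans (mk_eq_cl _)⟩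

variable [SymmetricCategory H]

lemma cl_rmul_pow_unit₁ (sgn : SignStructure T) (hR : R.IsSymRing) {q : ℤ}
    (htr : TrivialAction sgn.neg R V q) {k m : ℕ} (h : (k : ℤ) = q + m)
    (f : V ⊗ tpow T k ⟶ R.X m) (c : ℕ) (h' : ((k + 1 * c : ℕ) : ℤ) = q + (m + 1 * c : ℕ)) :
    ∃ u, cl h' (rmul f (R.pow R.unit₁ c)) = Pi.act sgn.neg u (cl h f) := by
  induction c with
  | zero => exact (PermEq.rmul_pow_zero hR R.unit₁ f).cl_eq_act hR sgn htr h' h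
  | succ c ih =>
    have h1 : ((k + 1 * c : ℕ) : ℤ) = q + (m + 1 * c : ℕ) := by push_cast at h' ⊢; omega
    have h2 : ((k + 1 * c + 1 : ℕ) : ℤ) = q + (m + 1 * c + 1 : ℕ) := by push_cast at h' ⊢; omega
    obtain ⟨u, hu⟩ := ih h1
    have hp : PermEq (rmul f (R.pow R.unit₁ (c + 1))) (rmul (rmul f (R.pow R.unit₁ c)) R.unit₁) :=
      ⟨_, _, hR.rmul_rstar f (R.pow R.unit₁ c) R.unit₁⟩
    obtain ⟨v, hv⟩ := hp.cl_eq_act hR sgn htr h' h2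
    exact ⟨v * u, by rw [hv, cl_rmul_unit₁ h1 _ h2, hu, act_act sgn hR]⟩

lemma SymRingData.PermEq.comp {W : H} (u : W ⟶ V) {k k' m m' : ℕ} {f : V ⊗ tpow T k ⟶ R.X m}
    {g : V ⊗ tpow T k' ⟶ R.X m'} (h : PermEq f g) : PermEq (u ▷ _ ≫ f) (u ▷ _ ≫ g) := by
  obtain ⟨e, γ, rfl⟩ := h
  exact ⟨e, γ, by rw [← whisker_exchange_assoc, Category.assoc]⟩

variable {l m : ℕ} {x : tpow T l ⟶ R.X m} (L : LocData R R' x)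

lemma LocData.hatT_comp {W : H} (u : W ⟶ V) {k p : ℕ} (f : V ⊗ tpow T k ⟶ R'.X p) :
    L.hatT (u ▷ _ ≫ f) = u ▷ _ ≫ L.hatT f := by
  rw [LocData.hatT, LocData.hatT, L.hat_comp, ← whisker_exchange_assoc]
  simp

lemma LocData.permEq_hatT_j {k p : ℕ} (f : V ⊗ tpow T k ⟶ R.X p) :
    PermEq (L.hatT (f ≫ L.j p)) (rmul f (R.pow x p)) :=
  ⟨Equiv.refl _, shuffle m p, by
    rw [L.hatT_j, tperm_refl, MonoidalCategory.whiskerLeft_id, Category.id_comp]⟩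

lemma LocData.permEq_hatT_rmul_j (hR : R.IsSymRing) {k b p n : ℕ} (f : V ⊗ tpow T k ⟶ R'.X p)
    (y : tpow T b ⟶ R.X n) :
    PermEq (L.hatT (rmul f (y ≫ L.j n))) (rmul (rmul (L.hatT f) y) (R.pow x n)) :=
  ⟨_, _, L.hatT_rmul_j hR f y⟩

lemma LocData.rmul_pow_eq_of_comp_j_eq (hR : R.IsSymRing) {k p : ℕ} {f g : V ⊗ tpow T k ⟶ R.X p}
    (h : f ≫ L.j p = g ≫ L.j p) : rmul f (R.pow x p) = rmul g (R.pow x p) := by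
  have := congrArg L.hatT h
  rw [L.hatT_j, L.hatT_j] at this
  have h2 := congrArg (· ≫ R.reindex (shuffle m p).symm) this
  simpa only [Category.assoc, ← hR.reindex_trans, Equiv.self_trans_symm, hR.reindex_refl,
    Category.comp_id] using h2

/-- The image of a central map `x` in the localization at `x` is central. -/
lemma LocData.isCentral_comp_j (hR : R.IsSymRing) (hx : R.IsCentral x)
    (hinj : ∀ (A : H) (p : ℕ) (f g : A ⟶ R'.X p), L.hat f = L.hat g → f = g) :
    R'.IsCentral (x ≫ L.j m) := by
  refine L.isCentral_of_hat hR hinj ?_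
  rw [L.hat_j]
  exact hR.isCentral_reindex (hR.isCentral_star hx (hR.isCentral_pow hx m)) _

end Equalities

section LocalizedRing

open SymRingData

variable {H : Type*} [Category H] [MonoidalCategory H] [SymmetricCategory H] {T : H}
  {R R' : SymRingData T} {l m : ℕ} {x : tpow T l ⟶ R.X m} (L : LocData R R' x)
  (hj : R.IsRingMap R' L.j) {N : Type*} [AddCommMonoid N] {V : N → H}

/-- The class of the map `x : T^l ⟶ R_m`. -/
def gclass (e : V 0 ⟶ 𝟙_ H) {l m : ℕ} (x : tpow T l ⟶ R.X m) : GradedMonoid (PiFamily R V) :=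
  gmk R V 0 ((l : ℤ) - m) (cl (by omega) (e ▷ _ ≫ (λ_ _).hom ≫ x))

/-- The map of homogeneous elements induced by the localization map. -/
def gpush (a : GradedMonoid (PiFamily R V)) : GradedMonoid (PiFamily R' V) :=
  gmk R' V a.1.1 a.1.2 (Pi.push hj a.2)

variable (sgn : SignStructure T) (hR : R.IsSymRing) (hR' : R'.IsSymRing)
  {d : ∀ r r', V (r + r') ⟶ V r ⊗ V r'} {e : V 0 ⟶ 𝟙_ H} (hV : IsGradedComonoid V d e)
  (htr : ∀ r q, TrivialAction sgn.neg R (V r) q) (htr' : ∀ r q, TrivialAction sgn.neg R' (V r) q)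
  [GradedMonoid.GMonoid (PiFamily R V)] [GradedMonoid.GMonoid (PiFamily R' V)]
  (hmul : ∀ {i j : N × ℤ} (x : PiFamily R V i)
    (y : PiFamily R V j), GradedMonoid.GMul.mul x y = Pi.mul sgn (d i.1 j.1) hR (htr _ _) x y)
  (hmul' : ∀ {i j : N × ℤ} (x : PiFamily R' V i)
    (y : PiFamily R' V j), GradedMonoid.GMul.mul x y = Pi.mul sgn (d i.1 j.1) hR' (htr' _ _) x y)

omit [GradedMonoid.GMonoid (PiFamily R V)] [GradedMonoid.GMonoid (PiFamily R' V)] in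
lemma gpush_gclass : gpush L hj (gclass e x : GradedMonoid (PiFamily R V)) = gclass e (x ≫ L.j m) := by
  refine congrArg (gmk R' V 0 ((l : ℤ) - m)) ?_
  exact (push_cl hj (V := V 0) _ _).trans (congrArg (cl _)
    ((Category.assoc _ _ _).trans (congrArg _ (Category.assoc _ _ _))))

include hV hmul in
lemma exists_mul_gclass_eq (hx : R.IsCentral x) (a : GradedMonoid (PiFamily R V)) :
    ∃ a', a * gclass e x = gclass e x * a' := by
  obtain ⟨u, hu⟩ := exists_map_mul_eq sgn hR hV htr hmul (Q := (l : ℤ) - m) (by omega) hx a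
  refine ⟨gact sgn.neg u a, ?_⟩
  rw [mul_gact sgn hR htr hmul]
  refine Eq.trans ?_ (congrArg (gact sgn.neg u) hu).symm
  rw [gact_gact sgn hR, Int.units_mul_self, gact_one sgn hR]
  rfl

include hV hmul in
omit [GradedMonoid.GMonoid (PiFamily R' V)] in
lemma exists_mul_gclass_pow_eq {r : N} {q : ℤ} {a z : Pi R (V r) q}
    (hz : ∀ u, Pi.act sgn.neg u z = z) (haz : Pi.push hj a = Pi.push hj z) :
    ∃ p, gmk R V r q a * gclass e x ^ p = gmk R V r q z * gclass e x ^ p := by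
  obtain ⟨k, p, h, f, g, rfl, rfl⟩ := exists_cl_cl a z
  rw [push_cl, push_cl] at haz
  obtain ⟨N, hN⟩ := exists_stabEq h haz
  obtain ⟨k, p, f, g, hfg, hc⟩ := exists_comp_eq_of_stabEq hj N f g hN
  obtain ⟨h, ef, eg⟩ := hc q h
  rw [← eg] at hz
  rw [← ef, ← eg]
  have hp := L.rmul_pow_eq_of_comp_j_eq hR hfg
  have h' : ((k + l * p : ℕ) : ℤ) = q + (l - m) * p + (p + m * p : ℕ) := by
    push_cast; rw [h]; ring
  obtain ⟨u, hu⟩ := gmk_mul_pow sgn hR hV htr hmul (Q := (l : ℤ) - m) h (by omega) f x p h'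
  obtain ⟨v, hv⟩ := gmk_mul_pow sgn hR hV htr hmul (Q := (l : ℤ) - m) h (by omega) g x p h'
  have hg : gmk R V r q (cl h g) * gclass e x ^ p = gact sgn.neg (u * v)
      (gmk R V r (q + (l - m) * p) (Pi.act sgn.neg v (cl h' (rmul g (R.pow x p))))) :=
    (congrArg (gmk R V r q · * gclass e x ^ p) (hz (u * v))).symm.trans <|
      (gact_mul sgn hR htr hmul (u * v) (gmk R V r q (cl h g)) _).trans
        (congrArg (gact sgn.neg (u * v)) hv)
  refine ⟨p, hu.trans (Eq.trans ?_ hg.symm)⟩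
  rw [hp]
  refine congrArg (gmk R V r (q + (l - m) * p)) ?_
  refine Eq.trans ?_ (act_act sgn hR (u * v) v (cl h' (rmul g (R.pow x p)))).symm
  rw [mul_assoc, Int.units_mul_self, mul_one]

include hV hmul' hR hj in
omit [GradedMonoid.GMonoid (PiFamily R V)] in
/-- Every element of the homotopy ring of the localization has the form `j(a) j(x)^(-p)`. -/
lemma exists_mul_gclass_pow_eq_gpush
    (hinj : ∀ (A : H) (p : ℕ) (f g : A ⟶ R'.X p), L.hat f = L.hat g → f = g)
    (htr : ∀ r q, TrivialAction sgn.neg R (V r) q) (b : GradedMonoid (PiFamily R' V)) :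
    ∃ p a, b * gclass e (x ≫ L.j m) ^ p = gpush L hj a := by
  obtain ⟨⟨r, q⟩, b⟩ := b
  obtain ⟨k, p, h, f, hk, rfl⟩ := exists_cl_two (V := V r) (q := q) b
  have h' : ((k + l * p : ℕ) : ℤ) = q + (l - m) * p + (p + m * p : ℕ) := by
    push_cast; rw [h]; ring
  obtain ⟨u, hu⟩ := gmk_mul_pow sgn hR' hV htr' hmul' (Q := (l : ℤ) - m) h (by omega) f
    (x ≫ L.j m) p h'
  have hp : PermEq (L.hatT (rmul f (R'.pow (x ≫ L.j m) p)))
      (L.hatT (L.hatT f ≫ L.j ((1 + m) * p))) := by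
    rw [← hj.pow]
    refine (L.permEq_hatT_rmul_j hR f (R.pow x p)).trans hR ?_
    refine PermEq.symm hR ((L.permEq_hatT_j _).trans hR ?_)
    exact (PermEq.rmul_pow_congr x _ (by ring) hR).trans hR (PermEq.rmul_pow_add hR x _ p (m * p))
  obtain ⟨v, hv⟩ := exists_cl_eq_act_of_hatT hR L hinj sgn hR' (htr r) (by omega) h'
    (hatT_deg h l m) hp
  refine ⟨p, gmk R V r (q + (l - m) * p) (Pi.act sgn.neg (u * v) (cl (hatT_deg h l m)
    (L.hatT f))), hu.trans (congrArg (gmk R' V r (q + (l - m) * p)) ?_)⟩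
  rw [hv]
  refine (act_act sgn hR' u v _).trans (Eq.symm ?_)
  exact (push_act hj sgn.neg _ _).trans (congrArg _ (push_cl hj _ _))

include hV hmul' hR hj in
omit [GradedMonoid.GMonoid (PiFamily R V)] in
/-- The class of `x` becomes a unit in the homotopy ring of the localization. -/
lemma isUnit_gclass (hx : R.IsCentral x)
    (hinj : ∀ (A : H) (p : ℕ) (f g : A ⟶ R'.X p), L.hat f = L.hat g → f = g)
    (hsurj : ∀ (A : H) (p : ℕ) (g : A ⊗ tpow T (l * p) ⟶ R.X ((1 + m) * p)),
      ∃ f : A ⟶ R'.X p, L.hat f = g)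
    (htr : ∀ r q, TrivialAction sgn.neg R (V r) q)
    (hone : (1 : GradedMonoid (PiFamily R' V)) = gmk R' V 0 0 (Pi.mk (HRep.one e))) :
    IsUnit (gclass e (x ≫ L.j m) : GradedMonoid (PiFamily R' V)) := by
  have hy := L.isCentral_comp_j hR hx hinj
  -- the inverse is represented by the map adjoint to a product of units and a power of `x`
  let B : 𝟙_ H ⊗ tpow T (1 + 1 * (l + m + 1)) ⟶ R.X (1 + 1 * (l + m + 1)) :=
    rmul ((λ_ _).hom ≫ R.unit₁) (R.pow R.unit₁ (l + m + 1))
  obtain ⟨F, hF⟩ := L.hatT_surjective hsurj (k := m + 2) (p := l + 2)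
    (𝟙_ H ◁ tperm (finCongr (by ring)) ≫ rmul B (R.pow x (l + 1)) ≫
      R.reindex (finCongr (by ring)))
  have hp : PermEq (L.hatT (rmul F (x ≫ L.j m))) (L.hatT (B ≫ L.j _)) := by
    have h1 : PermEq (L.hatT F) (rmul B (R.pow x (l + 1))) := ⟨_, _, hF⟩
    have h2 : PermEq (rmul (L.hatT F) x) (rmul B (R.pow x (l + 1 + 1))) :=
      (h1.rmul hR x).trans hR <| PermEq.symm hR <| (PermEq.rmul_pow_add hR x B (l + 1) 1).trans hR <|
        PermEq.rmul_pow_one hR x _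
    have h3 := (L.permEq_hatT_rmul_j hR F x).trans hR <| (h2.rmul hR (R.pow x m)).trans hR <|
      PermEq.symm hR <| PermEq.rmul_pow_add hR x B (l + 1 + 1) m
    exact h3.trans hR <| (PermEq.rmul_pow_congr x B (by ring) hR).trans hR <|
      PermEq.symm hR <| L.permEq_hatT_j B
  have hp' : PermEq (L.hatT (rmul (e ▷ _ ≫ F) (x ≫ L.j m))) (L.hatT (e ▷ _ ≫ B ≫ L.j _)) := by
    rw [rmul_comp, L.hatT_comp, L.hatT_comp]
    exact hp.comp e
  set Q : ℤ := (l : ℤ) - m with hQ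
  have hb : ((m + 2 : ℕ) : ℤ) = -Q + (l + 2 : ℕ) := by push_cast; omega
  have hl : (l : ℤ) = Q + m := by omega
  have hB : ((1 + 1 * (l + m + 1) : ℕ) : ℤ) = -Q + Q + (1 + 1 * (l + m + 1) : ℕ) := by
    push_cast; omega
  have h1 : ((1 : ℕ) : ℤ) = -Q + Q + (1 : ℕ) := by push_cast; omega
  obtain ⟨u, hu⟩ := exists_cl_eq_act_of_hatT hR L hinj sgn hR' (htr 0) (by omega)
    (deg_add hb hl) hB hp'
  have hB' : e ▷ _ ≫ B ≫ L.j _ = rmul (e ▷ _ ≫ (λ_ _).hom ≫ R'.unit₁)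
      (R'.pow R'.unit₁ (l + m + 1)) := by
    rw [rmul_comp, hj.rmul, hj.pow, Category.assoc, hj.unit₁]
  obtain ⟨v, hv⟩ := cl_rmul_pow_unit₁ sgn hR' (htr' 0 (-Q + Q)) h1
    (e ▷ _ ≫ (λ_ _).hom ≫ R'.unit₁) (l + m + 1) hB
  have hone' (q : ℤ) (hq : q = 0) (h : ((1 : ℕ) : ℤ) = q + (1 : ℕ)) :
      gmk R' V 0 q (cl h (e ▷ _ ≫ (λ_ _).hom ≫ R'.unit₁)) = 1 := by
    subst hq
    rw [hone]
    exact congrArg (gmk R' V 0 0) (mk_one e).symm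
  have h2 := gmk_mul_map sgn hR' hV htr' hmul' hb hl (e ▷ _ ≫ F) (x ≫ L.j m)
  have hinv : ∃ w, gmk R' V 0 (-Q) (cl hb (e ▷ _ ≫ F)) * gclass e (x ≫ L.j m) =
      gact sgn.neg w 1 := by
    refine ⟨(Q * (l + 2 : ℕ)).negOnePow * (u * v), h2.trans ?_⟩
    rw [← hone' _ (neg_add_cancel Q) h1]
    refine congrArg (gmk R' V 0 (-Q + Q)) ?_
    rw [hu, hB', hv]
    exact (congrArg _ (act_act sgn hR' u v _)).trans (act_act sgn hR' _ (u * v) _)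
  obtain ⟨w, hw⟩ := hinv
  have hleft : gact sgn.neg w (gmk R' V 0 (-Q) (cl hb (e ▷ _ ≫ F))) *
      gclass e (x ≫ L.j m) = 1 := by
    rw [gact_mul sgn hR' htr' hmul', hw, gact_gact sgn hR', Int.units_mul_self, gact_one sgn hR']
  generalize gact sgn.neg w (gmk R' V 0 (-Q) (cl hb (e ▷ _ ≫ F))) = y at hleft
  obtain ⟨t, ht⟩ := exists_map_mul_eq sgn hR' hV htr' hmul' hl hy y
  refine isUnit_iff_exists_and_exists.2 ⟨⟨gact sgn.neg t y, ?_⟩, ⟨y, hleft⟩⟩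
  rw [mul_gact sgn hR' htr' hmul']
  refine (congrArg (gact sgn.neg t) (ht.trans (congrArg (gact sgn.neg t) hleft))).trans ?_
  rw [gact_gact sgn hR', Int.units_mul_self, gact_one sgn hR']

end LocalizedRing

section LocalizationTheorem

open SymRingData

variable {H : Type*} [Category H] [MonoidalCategory H] [SymmetricCategory H] {T : H}
  [∀ S : H, (tensorLeft S).IsLeftAdjoint] [HasBinaryCoproduct T T]
  {R R' : SymRingData T} {l m : ℕ} {x : tpow T l ⟶ R.X m} (L : LocData R R' x)
  {N : Type*} [AddCommMonoid N] [DecidableEq N] {V : N → H}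
  (cg : CogroupStructure T) (sgn : SignStructure T) (hR : R.IsSymRing) (hR' : R'.IsSymRing)
  {d : ∀ r r', V (r + r') ⟶ V r ⊗ V r'} {e : V 0 ⟶ 𝟙_ H} (hV : IsGradedComonoid V d e)
  (htr : ∀ r q, TrivialAction sgn.neg R (V r) q) (htr' : ∀ r q, TrivialAction sgn.neg R' (V r) q)

omit [AddCommMonoid N] [DecidableEq N] in
lemma act_eq_self_of_add_self (r : N) (q : ℤ) {z : Pi R (V r) q} (hz : Pi.add cg z z = z)
    (u : ℤˣ) : Pi.act sgn.neg u z = z := by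
  let _ := piAddCommGroup cg R (V r) q
  have h0 : ∀ y : Pi R (V r) q, Pi.add cg y y = y → y = 0 := fun y hy => left_eq_add.1 (Eq.symm hy)
  rw [h0 z hz]
  exact h0 _ ((Pi.act_add (cg := cg) sgn.neg u 0 0).symm.trans (congrArg _ (add_zero 0)))

/-- The map of homotopy rings induced by the localization map of ring spectra is a localization. -/
theorem exists_isRingLocalization (hx : R.IsCentral x)
    (hinj : ∀ (A : H) (p : ℕ) (f g : A ⟶ R'.X p), L.hat f = L.hat g → f = g)
    (hsurj : ∀ (A : H) (p : ℕ) (g : A ⊗ tpow T (l * p) ⟶ R.X ((1 + m) * p)),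
      ∃ f : A ⟶ R'.X p, L.hat f = g) :
    ∃ j : (homotopyRing cg sgn hR hV htr).Total →+* (homotopyRing cg sgn hR' hV htr').Total,
      (∀ r q (a : HRep R (V r) q), j ((homotopyRing cg sgn hR hV htr).of r q a) =
        (homotopyRing cg sgn hR' hV htr').of r q (a.push L.j)) ∧
      IsRingLocalization.{w} j
        ((homotopyRing cg sgn hR hV htr).of 0 ((l : ℤ) - m) (HRep.ofMap e x)) := by
  have hj : R.IsRingMap R' L.j := L.isRingMap hR hinj hx
  let _ := piFamilyAddCommGroup cg R V
  let _ := piFamilyAddCommGroup cg R' V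
  let _ : DirectSum.GRing (PiFamily R V) := piGRing cg sgn hR hV htr
  let _ : DirectSum.GRing (PiFamily R' V) := piGRing cg sgn hR' hV htr'
  let φ (i : N × ℤ) : PiFamily R V i →+ PiFamily R' V i :=
    AddMonoidHom.mk' (Pi.push hj) (fun a b => push_add hj cg a b)
  let Φ : GradedMonoid (PiFamily R V) →* GradedMonoid (PiFamily R' V) :=
    { toFun := gpush L hj
      map_one' := congrArg (gmk R' V 0 0) (push_one hj e)
      map_mul' := fun a b => congrArg (gmk R' V (a.1.1 + b.1.1) (a.1.2 + b.1.2))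
        (push_mul hj sgn hR hR' (d a.1.1 b.1.1) (htr _ _) (htr' _ _) a.2 b.2) }
  have hξ : (homotopyRing cg sgn hR hV htr).of 0 ((l : ℤ) - m) (HRep.ofMap e x) =
      DirectSum.of (PiFamily R V) (gclass e x : GradedMonoid (PiFamily R V)).1
        (gclass e x : GradedMonoid (PiFamily R V)).2 :=
    congrArg (DirectSum.of (PiFamily R V) ((0 : N), (l : ℤ) - m)) (mk_ofMap e x)
  have hΦ : Φ (gclass e x) = gclass e (x ≫ L.j m) := gpush_gclass L hj
  refine ⟨gradedRingHom φ Φ (fun i a => rfl), fun r q a => gradedRingHom_of φ Φ _ (r, q) _, ?_⟩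
  rw [hξ]
  refine isRingLocalization_gradedRingHom.{w} φ Φ (fun i a => rfl) (gclass e x) ?_ ?_ ?_ ?_
  · rw [hΦ]
    exact isUnit_gclass L hj sgn hR hR' hV htr' (fun _ _ => rfl) hx hinj hsurj htr rfl
  · rw [hΦ]
    exact exists_mul_gclass_pow_eq_gpush L hj sgn hR hR' hV htr' (fun _ _ => rfl) hinj htr
  · rintro ⟨r, q⟩ a ha
    refine exists_mul_gclass_pow_eq L hj sgn hR hV htr (fun _ _ => rfl)
      (act_eq_self_of_add_self cg sgn r q (add_zero (0 : PiFamily R V (r, q)))) ?_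
    exact ha.trans (map_zero (φ (r, q))).symm
  · exact exists_mul_gclass_eq sgn hR hV htr (fun _ _ => rfl) hx

end LocalizationTheorem

/-! ### The graded comonoid of the objects `S^r ∧ U` -/

section Comonoids

variable {C : Type*} [Category C] [MonoidalCategory C] [SymmetricCategory C]

lemma tensorδ_eq_tensorμ (X₁ X₂ Y₁ Y₂ : C) : tensorδ X₁ X₂ Y₁ Y₂ = tensorμ X₁ Y₁ X₂ Y₂ := by
  have h : (β_ X₂ Y₁).inv = (β_ Y₁ X₂).hom  :=
    Iso.inv_ext (SymmetricCategory.symmetry _ _)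
  simp only [tensorδ, tensorμ, h]

lemma tensorμ_associativity (X₁ X₂ Y₁ Y₂ Z₁ Z₂ : C) :
    tensorμ (X₁ ⊗ Y₁) Z₁ (X₂ ⊗ Y₂) Z₂ ≫ tensorμ X₁ Y₁ X₂ Y₂ ▷ (Z₁ ⊗ Z₂) ≫ (α_ _ _ _).hom =
      ((α_ X₁ Y₁ Z₁).hom ⊗ₘ (α_ X₂ Y₂ Z₂).hom) ≫ tensorμ X₁ (Y₁ ⊗ Z₁) X₂ (Y₂ ⊗ Z₂) ≫
        (X₁ ⊗ X₂) ◁ tensorμ Y₁ Z₁ Y₂ Z₂ := by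
  have h := tensor_associativity X₁ X₂ Y₁ Y₂ Z₁ Z₂
  have h1 := congrArg (· ≫ tensorδ X₁ X₂ (Y₁ ⊗ Z₁) (Y₂ ⊗ Z₂) ≫
    (X₁ ⊗ X₂) ◁ tensorδ Y₁ Y₂ Z₁ Z₂) h
  simp only [Category.assoc, tensorμ_tensorδ_assoc, ← MonoidalCategory.whiskerLeft_comp,
    tensorμ_tensorδ, MonoidalCategory.whiskerLeft_id, Category.comp_id] at h1
  have h2 := congrArg (tensorδ (X₁ ⊗ Y₁) (X₂ ⊗ Y₂) Z₁ Z₂ ≫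
    tensorδ X₁ X₂ Y₁ Y₂ ▷ (Z₁ ⊗ Z₂) ≫ ·) h1
  rw [← comp_whiskerRight_assoc, tensorδ_tensorμ, id_whiskerRight, Category.id_comp,
    tensorδ_tensorμ_assoc] at h2
  rw [← tensorδ_eq_tensorμ, ← tensorδ_eq_tensorμ, ← tensorδ_eq_tensorμ, ← tensorδ_eq_tensorμ]
  exact h2.symm

lemma tensorμ_left_unitality (X₁ X₂ : C) : tensorμ (𝟙_ C) X₁ (𝟙_ C) X₂ ≫
    (λ_ (𝟙_ C)).hom ▷ (X₁ ⊗ X₂) ≫ (λ_ _).hom = ((λ_ X₁).hom ⊗ₘ (λ_ X₂).hom) := by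
  rw [tensor_left_unitality, ← comp_whiskerRight_assoc, Iso.hom_inv_id, id_whiskerRight,
    Category.id_comp, ← tensorδ_eq_tensorμ, tensorδ_tensorμ_assoc]

lemma tensorμ_right_unitality (X₁ X₂ : C) : tensorμ X₁ (𝟙_ C) X₂ (𝟙_ C) ≫
    (X₁ ⊗ X₂) ◁ (λ_ (𝟙_ C)).hom ≫ (ρ_ _).hom = ((ρ_ X₁).hom ⊗ₘ (ρ_ X₂).hom) := by
  rw [tensor_right_unitality, ← MonoidalCategory.whiskerLeft_comp_assoc, Iso.hom_inv_id,
    MonoidalCategory.whiskerLeft_id, Category.id_comp, ← tensorδ_eq_tensorμ,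
    tensorδ_tensorμ_assoc]

variable {N : Type*} [AddCommMonoid N] (S : SphereFamily N C) (U : C) [ComonObj U]

lemma isGradedComonoid_sphere :
    IsGradedComonoid (fun r => S.obj r ⊗ U) (S.diag U) (S.aug U) where
  coassoc r r' r'' := by
    have h1 := S.assoc r r' r''
    have h2 := ComonObj.comul_assoc U
    have e : eqToHom (congrArg (fun r => S.obj r ⊗ U) (add_assoc r r' r'')) =
        eqToHom (congrArg S.obj (add_assoc r r' r'')) ▷ U := by
      rw [eqToHom_whiskerRight]
    have k1 := tensorμ_natural (S.s r r').hom (𝟙 (S.obj r'')) (ComonObj.comul (X := U)) (𝟙 U)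
    have k2 := tensorμ_natural (𝟙 (S.obj r)) (S.s r' r'').hom (𝟙 U) (ComonObj.comul (X := U))
    rw [id_tensorHom_id] at k1 k2
    simp only [tensorHom_id, id_tensorHom] at k1 k2
    simp only [SphereFamily.diag]
    rw [e, comp_whiskerRight, Category.assoc, Category.assoc, ← reassoc_of% k1,
      tensorμ_associativity, MonoidalCategory.whiskerLeft_comp, Category.assoc, ← reassoc_of% k2]
    simp only [tensorHom_comp_tensorHom_assoc, h1, ← h2]
    rw [← tensorHom_id (eqToHom _), tensorHom_comp_tensorHom_assoc, Category.id_comp]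
  left_counit r := by
    have h1 := S.left_unit r
    have e : eqToHom (congrArg (fun r => S.obj r ⊗ U) (zero_add r)) =
        eqToHom (congrArg S.obj (zero_add r)) ▷ U := by
      rw [eqToHom_whiskerRight]
    have k1 := tensorμ_natural S.unit.hom (𝟙 (S.obj r)) (ComonObj.counit (X := U)) (𝟙 U)
    rw [id_tensorHom_id] at k1
    simp only [tensorHom_id] at k1
    have k2 : ComonObj.comul ≫ ComonObj.counit ▷ U ≫ (λ_ U).hom = 𝟙 U := by simp
    simp only [SphereFamily.diag, SphereFamily.aug]
    rw [e, comp_whiskerRight, Category.assoc, Category.assoc, ← reassoc_of% k1,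
      tensorμ_left_unitality, tensorHom_comp_tensorHom, tensorHom_comp_tensorHom, h1, k2,
      tensorHom_id]
  right_counit r := by
    have h1 := S.right_unit r
    have e : eqToHom (congrArg (fun r => S.obj r ⊗ U) (add_zero r)) =
        eqToHom (congrArg S.obj (add_zero r)) ▷ U := by
      rw [eqToHom_whiskerRight]
    have k1 := tensorμ_natural (𝟙 (S.obj r)) S.unit.hom (𝟙 U) (ComonObj.counit (X := U))
    rw [id_tensorHom_id] at k1
    simp only [id_tensorHom] at k1
    have k2 : ComonObj.comul ≫ U ◁ ComonObj.counit ≫ (ρ_ U).hom = 𝟙 U := by simp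
    simp only [SphereFamily.diag, SphereFamily.aug]
    rw [e, MonoidalCategory.whiskerLeft_comp, Category.assoc, Category.assoc, ← reassoc_of% k1,
      tensorμ_right_unitality, tensorHom_comp_tensorHom, tensorHom_comp_tensorHom, h1, k2,
      tensorHom_id]

omit [SymmetricCategory C] in
/-- A monoidal functor preserves graded comonoids. -/
lemma IsGradedComonoid.map {H : Type*} [Category H] [MonoidalCategory H] (F : C ⥤ H) [F.OplaxMonoidal]
    {V : N → C} {d : ∀ r r', V (r + r') ⟶ V r ⊗ V r'} {e : V 0 ⟶ 𝟙_ C}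
    (hV : IsGradedComonoid V d e) : IsGradedComonoid (fun r => F.obj (V r))
      (fun r r' => F.map (d r r') ≫ Functor.OplaxMonoidal.δ F _ _)
      (F.map e ≫ Functor.OplaxMonoidal.η F) where
  coassoc r r' r'' := by
    have h := congrArg (fun f => F.map f ≫ Functor.OplaxMonoidal.δ F _ _ ≫
      F.obj (V r) ◁ Functor.OplaxMonoidal.δ F _ _) (hV.coassoc r r' r'')
    simp only [F.map_comp, Category.assoc, eqToHom_map] at h
    rw [← Functor.OplaxMonoidal.associativity, ← Functor.OplaxMonoidal.δ_natural_left_assoc,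
      ← Functor.OplaxMonoidal.δ_natural_right_assoc, ← MonoidalCategory.whiskerLeft_comp,
      ← comp_whiskerRight_assoc] at h
    simpa only [Category.assoc] using h
  left_counit r := by
    have h := congrArg (fun f => F.map f) (hV.left_counit r)
    simp only [F.map_comp, eqToHom_map] at h
    rw [← Functor.OplaxMonoidal.left_unitality_hom,
      ← Functor.OplaxMonoidal.δ_natural_left_assoc, ← comp_whiskerRight_assoc] at h
    simpa only [Category.assoc] using h
  right_counit r := by
    have h := congrArg (fun f => F.map f) (hV.right_counit r)
    simp only [F.map_comp, eqToHom_map] at h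
    rw [← Functor.OplaxMonoidal.right_unitality_hom,
      ← Functor.OplaxMonoidal.δ_natural_right_assoc, ← MonoidalCategory.whiskerLeft_comp_assoc] at h
    simpa only [Category.assoc] using h

end Comonoids

/-! ### The homotopy category -/

section HomotopyCategory

open Functor.LaxMonoidal Functor.Monoidal SymRingData

variable {D : Type*} [Category D] [ModelCategory D] [MonoidalCategory D] [SymmetricCategory D]
  [(weakEquivalences D).IsMonoidal]

lemma bijective_whiskerRight_comp {H : Type*} [Category H] [MonoidalCategory H] {A Z P Q W : H}
    (i : Q ≅ P) (E : Z ⊗ P ⟶ W) (h : Function.Bijective fun f : A ⟶ Z => f ▷ P ≫ E) :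
    Function.Bijective fun f : A ⟶ Z => f ▷ Q ≫ Z ◁ i.hom ≫ E := by
  simp only [← whisker_exchange_assoc]
  refine ⟨fun f g hfg => h.1 ((cancel_epi (A ◁ i.hom)).1 hfg), fun g => ?_⟩
  obtain ⟨f, hf⟩ := h.2 (A ◁ i.inv ≫ g)
  exact ⟨f, (congrArg _ hf).trans (by simp)⟩

lemma mapTpow_eq_fTpow (T : D) (k : ℕ) : mapTpow T k = fTpow (toHo D) T k := by
  induction k with
  | zero => rfl
  | succ k ih =>
    exact congrArg (fun e => whiskerRightIso e _ ≪≫ μIso (toHo D) _ _) ih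

variable [MonoidalClosed D]

lemma isLeftAdjoint_tensorLeft_ho [PushoutProductAxiom D] (S : Ho D) :
    (tensorLeft S).IsLeftAdjoint := by
  obtain ⟨Z, hZ, ⟨e⟩⟩ := exists_cofibrant_iso S
  have := (isFlat_of_isCofibrant Z).isLeftAdjoint_tensorLeft
  exact Functor.isLeftAdjoint_of_iso ((curriedTensor (Ho D)).mapIso e)

variable {T : D} (R : SymRingData T) {l m : ℕ} (x : tpow T l ⟶ R.X m)

/-- The localization `R[1/x]` in the homotopy category. -/
def hoLocData : LocData (R.map (toHo D)) ((loc R x).map (toHo D))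
    ((fTpow (toHo D) T l).hom ≫ fm (toHo D) x) :=
  (locData R x).map (toHo D)

lemma hoLocData_hat_bijective (hT : IsFlat T) (hR : ∀ n, IsFibrant (R.X n)) (A : Ho D) (p : ℕ) :
    Function.Bijective fun f : A ⟶ ((loc R x).map (toHo D)).X p => (hoLocData R x).hat f := by
  have := hR ((1 + m) * p)
  exact bijective_whiskerRight_comp (fTpow (toHo D) T (l * p)) _
    ((isFlat_tpow hT (l * p)).bijective_hoEv (R.X ((1 + m) * p)) A)

end HomotopyCategory

end

end SymSpec

theorem theorem4p11
    {D : Type*} [Category D] [ModelCategory D] [HasZeroObject D]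
    [MonoidalCategory D] [SymmetricCategory D] [MonoidalClosed D]
    [SymSpec.PushoutProductAxiom D] [(weakEquivalences D).IsMonoidal]
    (T : D) [IsCofibrant T]
    (cg : SymSpec.CogroupStructure ((SymSpec.toHo D).obj T))
    (sgn : SymSpec.SignStructure ((SymSpec.toHo D).obj T))
    {N : Type*} [AddCommMonoid N] [DecidableEq N]
    (S : SymSpec.SphereFamily N D) (hS : ∀ r, IsCofibrant (S.obj r))
    (B' : ObjectProperty D) (hB' : ∀ U, B' U → IsCofibrant U)
    (R : SymSpec.SymRingSpectrum T) (hfib : ∀ n, IsFibrant (R.X n))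
    (hR : SymSpec.Semistable sgn (S.smashClass B') R.toSymRingData)
    {l m : ℕ} (x : SymSpec.tpow T l ⟶ R.X m) (hx : R.IsCentral x) :
    (SymSpec.loc R.toSymRingData x).IsSymRing ∧
    R.IsRingMap (SymSpec.loc R.toSymRingData x) (SymSpec.locMap R.toSymRingData x) ∧
    SymSpec.Semistable sgn (S.smashClass B') (SymSpec.loc R.toSymRingData x) ∧
    ∀ (U : D) [ComonObj U] [IsCommComonObj U], B' U →
      ∃ (A : SymSpec.PiRing S U cg sgn R.toSymRingData)
        (A' : SymSpec.PiRing S U cg sgn (SymSpec.loc R.toSymRingData x))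
        (j : A.Total →+* A'.Total),
        (∀ (r : N) (q : ℤ)
          (a : SymSpec.HRep (R.map (SymSpec.toHo D)) ((SymSpec.toHo D).obj (S.obj r ⊗ U)) q),
          j (A.of r q a) =
            A'.of r q
              (a.push fun n => (SymSpec.toHo D).map (SymSpec.locMap R.toSymRingData x n))) ∧
        SymSpec.IsRingLocalization.{w} j
          (A.of 0 ((l : ℤ) - m) (SymSpec.unitalRep S U R.toSymRingData x)) := by
  have hR₀ := R.isSymRing
  have hloc := SymSpec.isSymRing_loc R.toSymRingData hR₀ hx
  have hHo := SymSpec.SymRingData.isSymRing_map (SymSpec.toHo D) hR₀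
  have hHo' := SymSpec.SymRingData.isSymRing_map (SymSpec.toHo D) hloc
  have hbij := SymSpec.hoLocData_hat_bijective R.toSymRingData x
    (SymSpec.isFlat_of_isCofibrant T) hfib
  have hinj (A : SymSpec.Ho D) (p : ℕ)
      (f g : A ⟶ ((SymSpec.loc R.toSymRingData x).map (SymSpec.toHo D)).X p)
      (h : (SymSpec.hoLocData R.toSymRingData x).hat f =
        (SymSpec.hoLocData R.toSymRingData x).hat g) : f = g := (hbij A p).1 h
  have hss : SymSpec.Semistable sgn (S.smashClass B') (SymSpec.loc R.toSymRingData x) :=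
    fun V hV q => SymSpec.trivialAction_loc hHo (SymSpec.hoLocData R.toSymRingData x) hinj sgn hHo'
      (hR V hV)
  refine ⟨hloc, SymSpec.isRingMap_loc R.toSymRingData hR₀ hx, hss, fun U _ _ hU => ?_⟩
  have htr (r : N) (q : ℤ) := hR _ ⟨r, U, hU, rfl⟩ q
  have htr' (r : N) (q : ℤ) := hss _ ⟨r, U, hU, rfl⟩ q
  have := SymSpec.isLeftAdjoint_tensorLeft_ho (D := D)
  have : HasBinaryCoproduct ((SymSpec.toHo D).obj T) ((SymSpec.toHo D).obj T) :=
    ⟨⟨⟨_, (SymSpec.nonempty_isColimit_ho T).some⟩⟩⟩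
  have hV := (SymSpec.isGradedComonoid_sphere S U).map (SymSpec.toHo D)
  obtain ⟨j, h1, h2⟩ := SymSpec.exists_isRingLocalization.{w}
    (SymSpec.hoLocData R.toSymRingData x) cg sgn hHo hHo' hV htr htr'
    ((SymSpec.SymRingData.isCentral_fm (SymSpec.toHo D) hx).comp _) hinj (fun A p => (hbij A p).2)
  refine ⟨_, _, j, h1, ?_⟩
  have e : SymSpec.unitalRep S U R.toSymRingData x = SymSpec.HRep.ofMap (SymSpec.hoAug S U)
      ((SymSpec.fTpow (SymSpec.toHo D) T l).hom ≫ SymSpec.SymRingData.fm (SymSpec.toHo D) x) := by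
    rw [SymSpec.unitalRep, SymSpec.mapTpow_eq_fTpow]
    rfl
  rw [e]
  exact h2
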